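/- **Setting.** Let $\operatorname{sgn}(x)=-1$ for $x<0$, $\operatorname{sgn}(x)=1$ for $x\ge 0$, $\Phi'(x)=x-\operatorname{sgn}(x)$, and $(\Delta p)_j=p_{j+1}-2p_j+p_{j-1}$. For $k\in\mathbb Z$ let $X_k$ be the set of $u\in\ell^\infty(\mathbb Z)$ with $0<\inf_{j<k}u_j$ and $-2<\inf_{j\ge k}u_j\le\sup_{j\ge k}u_j<0$. A *single-interface solution* starting in $X_1$ is a continuous $u:[0,\infty)\to\ell^\infty(\mathbb Z)$ together with times $t_0^*=0$, $t^*_k\in(0,\infty]$ ($k\ge1$), such that for all $k\ge 1$: $t^*_{k-1}=\infty$ or $t^*_{k-1}<t^*_k$; $\dot u_j=\Delta\Phi'(u_j)$ for all $j$ and all $t\ge 0$ that are not transition times; $u_k(t_k^*)=0$ and $\lim_{t\searrow t_k^*}\dot u_k(t)>0$ if $t_k^*<\infty$; $u(t)\in X_k$ for $t^*_{k-1}<t<t^*_k$. Put $p_j=\Phi'(u_j)$. Let $g$ be the discrete heat kernel ($\dot g_j=\Delta g_j$, $g_j(0)=\delta_j^0$), $q$ the bounded solution of $\dot q=\Delta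 q$ with $q(0)=p(0)$, and $r_j(t)=-2\sum_{k\ge1,\,t_k^*\le t}g_{j-k}(t-t_k^*)$. For $\varepsilon>0$ set $P_\varepsilon(\tau,\xi)=p_j(\tau/\varepsilon^2)$ for $\xi\in[\varepsilon j-\varepsilon/2,\varepsilon j+\varepsilon/2)$, similarly $Q_\varepsilon$ (from $q$), $R_\varepsilon$ (from $r$) and $G_\varepsilon$ (from $g$), and $\xi_\varepsilon^*(\tau)=\varepsilon\sum_{k\ge1}k\,\chi_{[t_k^*,t_{k+1}^*)}(\tau/\varepsilon^2)$. Fix $0<\tau_{\rm fin}<\infty$, $I=[0,\tau_{\rm fin}]$, $\Omega=I\times\mathbb R$. Given $d_*>0$ let $H_\varepsilon(\tau,\xi)$ be $0$ for $\tau\le0$, $\frac{\tau}{d_*\varepsilon}G_\varepsilon(d_*\varepsilon,\xi)$ for $0\le\tau\le d_*\varepsilon$, and $G_\varepsilon(\tau,\xi)$ for $\tau\ge d_*\varepsilon$; put $R_{1,\varepsilon}(\tau,\xi)=-2\sum_{k\ge1,\ \varepsilon^2t_k^*<\tau_{\rm fin}}H_\varepsilon(\tau-\varepsilon^2t^*_k,\xi-\varepsilon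 k)$ and $R_{2,\varepsilon}=R_\varepsilon-R_{1,\varepsilon}$. *Macroscopic single-interface initial data* with constants $\alpha,\beta$ means: $u(0)\in X_1$, $|\Delta p_0(0)|\le\beta\varepsilon$, $\sup_j|p_{j+1}(0)-p_j(0)|\le\alpha\varepsilon$, $\sup_{j\ne0}|\Delta p_j(0)|\le\alpha\varepsilon^2$. **Theorem (limit dynamics along subsequences).** For all $\alpha,\beta$ and $\tau_{\rm fin}>0$ there are $d_*>0$ and $0<\varepsilon_*\le1$ such that for every $0<\varepsilon\le\varepsilon_*$ and every single-interface solution with macroscopic single-interface initial data the number $K_\varepsilon$ of $k\ge1$ with $\varepsilon^2t_k^*<\tau_{\rm fin}$ satisfies $K_\varepsilon\le\tau_{\rm fin}/(2d_*\varepsilon)$, and $\varepsilon^2(t_{k+1}^*-t_k^*)\ge2d_*\varepsilon$ for $1\le k\le K_\varepsilon$; moreover the following holds for this $d_*$. Let $\varepsilon_n>0$, $\varepsilon_n\to0$, and for each $n$ let a single-interface solution with macroscopic single-interface initial data for $\varepsilon=\varepsilon_n$ and the fixed $\alpha,\beta$ be given. All limits below are along $\varepsilon=\varepsilon_n$. Then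 $P_{\varepsilon}=Q_{\varepsilon}+R_{\varepsilon}$ on $\Omega$ for every $\varepsilon=\varepsilon_n$, and: (A) Along a subsequence, $\xi^*_\varepsilon\to\xi^*$ uniformly on $I$, $Q_\varepsilon\to Q$ locally uniformly on $\Omega$, and $R_{1,\varepsilon}\to R$ uniformly on $\Omega$. (B) Suppose that the initial data are uniformly bounded, $\sup_{n,j}|p_j(0)|<\infty$ (which holds automatically if $Q_\varepsilon\to Q$ uniformly on $\Omega$). Let $\xi^*,Q,R$ be any limits in the sense of (A) along the given sequence and $P=Q+R$. Then $Q_\varepsilon\to Q$ uniformly on $\Omega$ if and only if $P_\varepsilon(0,\cdot)\to P(0,\cdot)$ uniformly on $\mathbb R$; for every $1\le s<\infty$, $R_{2,\varepsilon}\to0$ in $L^s(\Omega)$ and $P_\varepsilon\to P$ in $L^s_{\rm loc}(\Omega)$; and: 1. $\xi^*$ is Lipschitz on $I$; $Q$, $R$ and $P$ are bounded and locally Hölder continuous on $\Omega$; $R\in L^\infty(I;L^1(\mathbb R))$ and $\partial_\xi R\in L^\infty(I;L^2(\mathbb R))$ (weak derivative). 2. $Q$ is continuous on $\Omega$, is a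 classical solution of $\partial_\tau Q=\partial_\xi^2Q$ in $(0,\tau_{\rm fin})\times\mathbb R$, and $Q(0,\cdot)=P(0,\cdot)$. 3. $(P,\xi^*)$ is a distributional solution of $\partial_\tau P=\partial_\xi^2P$ off the curve $\xi=\xi^*(\tau)$, with $[P]=0$ and $2\dot\xi^*=[\partial_\xi P]$ on that curve; that is, with $\mu(\tau,\xi)=\operatorname{sgn}(\xi^*(\tau)-\xi)$, $$-\int_0^{\tau_{\rm fin}}\!\!\int_{\mathbb R}(P+\mu)\,\partial_\tau\psi\,d\xi\,d\tau=\int_0^{\tau_{\rm fin}}\!\!\int_{\mathbb R}P\,\partial_\xi^2\psi\,d\xi\,d\tau\qquad\text{for all }\psi\in C_c^\infty((0,\tau_{\rm fin})\times\mathbb R).$$ The initial data are attained: $P(\tau,\cdot)\to P(0,\cdot)$ uniformly on $\mathbb R$ and $\xi^*(\tau)\to\xi^*(0)$ as $\tau\searrow0$. Moreover $P\ge-1$ on $\Omega$; $P(\tau,\xi)\le1$ if $\xi\ge\xi^*(\tau)$; in particular $P(\tau,\xi^*(\tau))\in[-1,1]$ for all $\tau\in I$. Finally $\xi^*$ is nondecreasing,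 $\dot\xi^*$ exists and is $\ge0$ for almost every $\tau\in I$, and for every $\tau\in I$ with $P(\tau,\xi^*(\tau))\ne1$ the derivative $\dot\xi^*(\tau)$ exists (one-sided at the end points of $I$) and equals $0$. -/

import Mathlib

open Set Filter Topology MeasureTheory
open scoped ENNReal NNReal ContDiff

namespace DiffusionLattice

noncomputable section

/-! ### The lattice and its single-interface solutions -/

/-- The sign function with the convention `sgn 0 = 1`. -/
def sgn (x : ℝ) : ℝ := if x < 0 then -1 else 1

/-- The derivative `Φ'(x) = x - sgn x` of the piecewise quadratic double-well potential. -/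
def dPhi (x : ℝ) : ℝ := x - sgn x

/-- The discrete Laplacian `p_{j+1} - 2 p_j + p_{j-1}`. -/
def lap (p : ℤ → ℝ) (j : ℤ) : ℝ := p (j + 1) - 2 * p j + p (j - 1)

/-- The Banach space of bounded real sequences indexed by the integers. -/
abbrev LInf : Type := lp (fun _ : ℤ => ℝ) ∞

/-- The states with a single phase interface at `k`:
`0 < inf_{j<k} u_j` and `-2 < inf_{j≥k} u_j ≤ sup_{j≥k} u_j < 0`
(`sup_{j<k} u_j < ∞` holds because `u` is a bounded sequence). -/
def stateSpace (k : ℤ) : Set LInf :=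
  {u | (∃ δ > 0, ∀ j < k, δ ≤ u j) ∧ ∃ δ > 0, ∀ j ≥ k, -2 + δ ≤ u j ∧ u j ≤ -δ}

/-- `u` is a single-interface solution, on `[0,∞)`, of `u_j' = (lap Φ'(u))_j`, with first phase
transition index `k₁` and phase transition times `T k ∈ (0,∞]`, `k ≥ k₁` (and `T (k₁ - 1) = 0`;
the other values of `T` are irrelevant). -/
structure IsSingleInterfaceSolution (k₁ : ℤ) (u : ℝ → LInf) (T : ℤ → EReal) : Prop where
  continuousOn : ContinuousOn u (Ici 0)
  start : T (k₁ - 1) = 0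
  pos : ∀ k ≥ k₁, 0 < T k
  increasing : ∀ k ≥ k₁, T (k - 1) = ⊤ ∨ T (k - 1) < T k
  solves : ∀ t : ℝ, 0 ≤ t → (∀ k ≥ k₁, T k ≠ (t : EReal)) → ∀ j : ℤ,
    HasDerivWithinAt (fun s => u s j) (lap (fun i => dPhi (u t i)) j) (Ici 0) t
  transition : ∀ k ≥ k₁, ∀ t : ℝ, T k = (t : EReal) →
    u t k = 0 ∧ ∃ v > 0, Tendsto (fun s => deriv (fun r => u r k) s) (𝓝[>] t) (𝓝 v)
  mem_stateSpace : ∀ k ≥ k₁, ∀ t : ℝ, T (k - 1) < (t : EReal) → (t : EReal) < T k →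
    u t ∈ stateSpace k

/-- Macroscopic single-interface initial data, with the interface at the origin. -/
structure IsMacroscopicData (α β ε : ℝ) (u₀ : LInf) : Prop where
  mem_stateSpace : u₀ ∈ stateSpace 1
  lap_zero : |lap (fun i => dPhi (u₀ i)) 0| ≤ β * ε
  grad : ∀ j : ℤ, |dPhi (u₀ (j + 1)) - dPhi (u₀ j)| ≤ α * ε
  lap_ne_zero : ∀ j : ℤ, j ≠ 0 → |lap (fun i => dPhi (u₀ i)) j| ≤ α * ε ^ 2

/-! ### Regular and singular part -/

/-- The discrete heat kernel, that is the solution of `g_j' = (lap g)_j`, `g_j(0) = δ_j^0`,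
in its Fourier representation. -/
def heatKernel (j : ℤ) (t : ℝ) : ℝ :=
  1 / (2 * Real.pi) *
    ∫ k in (-Real.pi)..Real.pi, Real.exp (-(2 * (1 - Real.cos k)) * t) * Real.cos (j * k)

/-- The regular part `q` of `p = Φ'(u)`: the (bounded) solution of the discrete heat equation
with initial data `p(0)`. -/
def regularPart (u : ℝ → LInf) (t : ℝ) (j : ℤ) : ℝ :=
  ∑' k : ℤ, heatKernel (j - k) t * dPhi (u 0 k)

/-- The singular part `r` of `p`: the sum of the shifted and delayed heat kernels
`-2 g_{j-k}(t - T k)` over the phase transitions `k ≥ 1` with `T k ≤ t`. -/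
def singularPart (T : ℤ → EReal) (t : ℝ) (j : ℤ) : ℝ :=
  -2 * ∑ᶠ k ∈ {k : ℤ | 1 ≤ k ∧ T k ≤ (t : EReal)}, heatKernel (j - k) (t - (T k).toReal)

/-! ### Rescaled data, as functions of the macroscopic variables `(τ, ξ)` -/

/-- The index `j` with `ξ ∈ [ε j - ε/2, ε j + ε/2)`. -/
def cell (ε ξ : ℝ) : ℤ := ⌊ξ / ε + 1 / 2⌋

def macroP (ε : ℝ) (u : ℝ → LInf) (z : ℝ × ℝ) : ℝ := dPhi (u (z.1 / ε ^ 2) (cell ε z.2))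

def macroQ (ε : ℝ) (u : ℝ → LInf) (z : ℝ × ℝ) : ℝ :=
  regularPart u (z.1 / ε ^ 2) (cell ε z.2)

def macroR (ε : ℝ) (T : ℤ → EReal) (z : ℝ × ℝ) : ℝ :=
  singularPart T (z.1 / ε ^ 2) (cell ε z.2)

/-- The macroscopic interface position `ε ∑_{k≥1} k χ_{[T k, T (k+1))}(τ/ε²)`. -/
def interface (ε : ℝ) (T : ℤ → EReal) (τ : ℝ) : ℝ :=
  ε * ∑ᶠ k ∈ {k : ℤ | 1 ≤ k ∧ T k ≤ ((τ / ε ^ 2 : ℝ) : EReal) ∧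
    ((τ / ε ^ 2 : ℝ) : EReal) < T (k + 1)}, (k : ℝ)

/-- The indices `1, …, K` of the phase transitions at macroscopic times `ε² T k < τfin`. -/
def transitions (τfin ε : ℝ) (T : ℤ → EReal) : Set ℤ :=
  {k | 1 ≤ k ∧ T k < ((τfin / ε ^ 2 : ℝ) : EReal)}

/-- The heat kernel on lattice site `j` at macroscopic time `τ`, regularized in time: it vanishes
for `τ ≤ 0`, is linear in `τ` on `[0, d ε]`, and is the heat kernel for `τ ≥ d ε`. -/
def regKernel (d ε τ : ℝ) (j : ℤ) : ℝ :=
  if τ ≤ 0 then 0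
  else if τ ≤ d * ε then τ / (d * ε) * heatKernel j (d * ε / ε ^ 2)
  else heatKernel j (τ / ε ^ 2)

/-- The temporally regularized singular part. -/
def macroR₁ (τfin d ε : ℝ) (T : ℤ → EReal) (z : ℝ × ℝ) : ℝ :=
  -2 * ∑ᶠ k ∈ transitions τfin ε T,
    regKernel d ε (z.1 - ε ^ 2 * (T k).toReal) (cell ε z.2 - k)

/-- The remainder of the singular part. -/
def macroR₂ (τfin d ε : ℝ) (T : ℤ → EReal) (z : ℝ × ℝ) : ℝ :=
  macroR ε T z - macroR₁ τfin d ε T z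

/-- The time-space domain `[0, τfin] × ℝ`. -/
def domain (τfin : ℝ) : Set (ℝ × ℝ) := Icc 0 τfin ×ˢ univ

/-- `(Q, R, ξ)` is the limit of the rescaled data along the sequence. -/
structure IsLimit (τfin d : ℝ) (ε : ℕ → ℝ) (u : ℕ → ℝ → LInf) (T : ℕ → ℤ → EReal)
    (Q R : ℝ × ℝ → ℝ) (ξ : ℝ → ℝ) : Prop where
  interface : TendstoUniformlyOn (fun n => interface (ε n) (T n)) ξ atTop (Icc 0 τfin)
  regular : TendstoLocallyUniformlyOn (fun n => macroQ (ε n) (u n)) Q atTop (domain τfin)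
  singular : TendstoUniformlyOn (fun n => macroR₁ τfin d (ε n) (T n)) R atTop (domain τfin)

/-! ### Notions for the limit problem -/

def IsBoundedOn (F : ℝ × ℝ → ℝ) (s : Set (ℝ × ℝ)) : Prop := ∃ M : ℝ, ∀ z ∈ s, |F z| ≤ M

def IsLocallyHolderOn (F : ℝ × ℝ → ℝ) (s : Set (ℝ × ℝ)) : Prop :=
  ∃ γ : ℝ≥0, 0 < γ ∧ γ ≤ 1 ∧ ∀ K ⊆ s, IsCompact K → ∃ C : ℝ≥0, HolderOnWith C γ F K

/-- Test functions: smooth with compact support in `(0, τfin) × ℝ`. -/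
structure IsTestFunction (τfin : ℝ) (ψ : ℝ × ℝ → ℝ) : Prop where
  smooth : ContDiff ℝ ∞ ψ
  compact : HasCompactSupport ψ
  supp : tsupport ψ ⊆ Ioo 0 τfin ×ˢ univ

/-- The weak derivative `∂_ξ R` exists on `(0, τfin) × ℝ` and belongs to `L^∞(I; L²(ℝ))`. -/
def HasGradientInLInfLTwo (τfin : ℝ) (R : ℝ × ℝ → ℝ) : Prop :=
  ∃ D : ℝ × ℝ → ℝ, AEStronglyMeasurable D (volume.restrict (domain τfin)) ∧
    (∃ C : ℝ≥0, ∀ᵐ τ ∂(volume.restrict (Icc 0 τfin)),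
      MemLp (fun x => D (τ, x)) 2 volume ∧ eLpNorm (fun x => D (τ, x)) 2 volume ≤ C) ∧
    ∀ ψ, IsTestFunction τfin ψ →
      ∫ z in domain τfin, R z * deriv (fun x => ψ (z.1, x)) z.2 =
        -∫ z in domain τfin, D z * ψ z

/-- `Q` is continuous on `[0, τfin] × ℝ`, has initial data `f`, and is a classical solution of
`∂_τ Q = ∂_ξ² Q` in `(0, τfin) × ℝ`. -/
def IsHeatSolution (τfin : ℝ) (f : ℝ → ℝ) (Q : ℝ × ℝ → ℝ) : Prop :=
  ContinuousOn Q (domain τfin) ∧ (∀ x, Q (0, x) = f x) ∧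
    ∃ Qx Qxx : ℝ × ℝ → ℝ,
      ContinuousOn Qx (Ioo 0 τfin ×ˢ univ) ∧ ContinuousOn Qxx (Ioo 0 τfin ×ˢ univ) ∧
      ∀ τ ∈ Ioo 0 τfin, ∀ x : ℝ,
        HasDerivAt (fun y => Q (τ, y)) (Qx (τ, x)) x ∧
        HasDerivAt (fun y => Qx (τ, y)) (Qxx (τ, x)) x ∧
        HasDerivAt (fun s => Q (s, x)) (Qxx (τ, x)) τ

/-- `(P, ξ)` is a distributional solution of the free boundary problem
`∂_τ P = ∂_ξ² P` off the interface, `[P] = 0` and `2 ξ' = [∂_ξ P]` on the interface, that is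
`∂_τ (P + μ) = ∂_ξ² P` in the sense of distributions on `(0, τfin) × ℝ`, where
`μ(τ, x) = sgn (ξ(τ) - x)`. -/
def IsDistributionalSolution (τfin : ℝ) (P : ℝ × ℝ → ℝ) (ξ : ℝ → ℝ) : Prop :=
  ∀ ψ, IsTestFunction τfin ψ →
    -∫ z in domain τfin, (P z + sgn (ξ z.1 - z.2)) * deriv (fun s => ψ (s, z.2)) z.1 =
      ∫ z in domain τfin, P z * iteratedDeriv 2 (fun x => ψ (z.1, x)) z.2

/-- Regularity of the limits; `P = Q + R`. -/
structure LimitRegularity (τfin : ℝ) (P Q R : ℝ × ℝ → ℝ) (ξ : ℝ → ℝ) : Prop where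
  lipschitz : ∃ C : ℝ≥0, LipschitzOnWith C ξ (Icc 0 τfin)
  bounded_Q : IsBoundedOn Q (domain τfin)
  bounded_R : IsBoundedOn R (domain τfin)
  bounded_P : IsBoundedOn P (domain τfin)
  holder_Q : IsLocallyHolderOn Q (domain τfin)
  holder_R : IsLocallyHolderOn R (domain τfin)
  holder_P : IsLocallyHolderOn P (domain τfin)
  integrable_R : ∃ C : ℝ≥0, ∀ τ ∈ Icc 0 τfin,
    MemLp (fun x => R (τ, x)) 1 volume ∧ eLpNorm (fun x => R (τ, x)) 1 volume ≤ C
  gradient_R : HasGradientInLInfLTwo τfin R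

/-- The limit free boundary problem with its initial data and the hysteretic flow rule. -/
structure LimitDynamics (τfin : ℝ) (P : ℝ × ℝ → ℝ) (ξ : ℝ → ℝ) : Prop where
  equation : IsDistributionalSolution τfin P ξ
  initial_P : TendstoUniformly (fun τ x => P (τ, x)) (fun x => P (0, x)) (𝓝[>] (0 : ℝ))
  initial_ξ : Tendsto ξ (𝓝[>] 0) (𝓝 (ξ 0))
  lower : ∀ τ ∈ Icc 0 τfin, ∀ x : ℝ, -1 ≤ P (τ, x)
  upper : ∀ τ ∈ Icc 0 τfin, ∀ x : ℝ, ξ τ ≤ x → P (τ, x) ≤ 1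
  on_interface : ∀ τ ∈ Icc 0 τfin, P (τ, ξ τ) ∈ Icc (-1) 1
  monotone : MonotoneOn ξ (Icc 0 τfin)
  speed_nonneg : ∀ᵐ τ ∂(volume.restrict (Icc 0 τfin)), ∃ v ≥ 0, HasDerivAt ξ v τ
  speed_zero : ∀ τ ∈ Icc 0 τfin, P (τ, ξ τ) ≠ 1 → HasDerivWithinAt ξ 0 (Icc 0 τfin) τ

end

end DiffusionLattice

open DiffusionLattice

namespace DiffusionLattice

/-! On each side of the interface the lattice equation is linear. Between two transitions the field
p = Φ'(u), written as `branch k`, solves the discrete heat equation. When site k changes phase, p_k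
drops from 1 to -1. Duhamel's principle then gives p = q + r, where q is the heat flow of the
initial data and r is a sum of -2 times delayed heat kernels (`branch_eq`, `dPhi_eq_add`). The proof
is driven by comparison arguments (`min_principle`) and by explicit bounds on the heat kernel.

The decisive point is that consecutive transitions are separated by a microscopic time of order 1/ε
(`separation`). Behind the interface p stays below the ramp 1 + αε(k-j)₊ (`branch_le`). Just after
site k has flipped, p lies below the solution of the heat equation that starts from this ramp minus
2 at site k, and that solution is explicit: the kink of the ramp feeds αε∫g, the drop contributes
-2g. Site k+1 can flip only when the influx αε∫₀ˢg₁ has compensated 2g₁(s). The size of g₁ then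
forces αεs ≥ 1/40 (`le_mul_of_heatKernel_one_le`). It follows that the transition times do not
accumulate and that the interface has bounded macroscopic speed.

Compactness of the regular part follows from the Lipschitz bound on the data. The kernels in the
singular part are rough at age zero, so each of them is switched on linearly during a time dε. A
regularized kernel is 1/4-Hölder in time with constant ε·age^(-3/4). Since the ages are spaced by at
least 4dε, the sum of these constants over all transitions is bounded independently of ε
(`sum_kernelWeight_le`). The same weights and the Cauchy–Schwarz inequality bound the discrete
gradient in ℓ² (`sum_sq_grad_kernelSum_le`), which gives 1/2-Hölder continuity in space. Every
transition except the latest is older than dε, so only the latest one contributes to the remainder.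
Hence the remainder is bounded and of order ε in L¹ (`macroR₂_eq`, `lintegral_macroR₂_le`).

The limits are identified as follows. The rescaled kernel converges to the Gaussian in L¹, by a
local limit theorem and Scheffé's argument, so Q is the Gaussian convolution of its initial values
(`Q_eq_gaussian`). The gradient of R is obtained from Riesz's criterion for square integrable
derivatives, which survives the passage to the limit (`hasSquareVariation_of_limit`). The free
boundary equation is the limit of the weak lattice equation for u = p + sgn u
(`integral_macroP_add_sgn`), because the phase function converges off the limit curve, which is a
null set.

Convergence of P_ε in L^s alone would not transfer pointwise bounds. However, within 2dε before any
time there is a time at which the remainder vanishes identically (`exists_regular_time`), and the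
bounds are passed to the limit there. The flow rule rests on an exact identity: when site k flips,
the value of Q_ε + R_{1,ε} at that site is 1 (`macroQ_add_macroR₁_at_transition`). If P differs from
1 at the interface at time τ, there are no transitions near τ for small ε, and the limit interface
is constant there. -/

/-! ### The minimum principle. -/

theorem lap_sub (p q : ℤ → ℝ) (j : ℤ) : lap (fun i => p i - q i) j = lap p j - lap q j := by
  unfold lap; ring

theorem lap_comp_sub (f : ℤ → ℝ) (j k : ℤ) : lap (fun i => f (i - k)) j = lap f (j - k) := by
  simp only [lap, show j + 1 - k = j - k + 1 by ring, show j - 1 - k = j - k - 1 by ring]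

/-- Minimum principle for the discrete heat equation on a subset `A` of the lattice. -/
theorem min_principle {a b M : ℝ} (A : Set ℤ) (v v' : ℝ → ℤ → ℝ)
    (hcont : ∀ j, ContinuousOn (fun t => v t j) (Icc a b))
    (hderiv : ∀ j ∈ A, ∀ t ∈ Ioo a b, HasDerivAt (fun s => v s j) (v' t j) t)
    (hsuper : ∀ j ∈ A, ∀ t ∈ Ioo a b, lap (v t) j ≤ v' t j)
    (hbd : ∀ t ∈ Icc a b, ∀ j ∈ A, -M ≤ v t j)
    (hout : ∀ t ∈ Icc a b, ∀ j ∉ A, 0 ≤ v t j)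
    (hinit : ∀ j, 0 ≤ v a j) :
    ∀ t ∈ Icc a b, ∀ j, 0 ≤ v t j := by
  -- it suffices to treat times before `b`
  have key : ∀ t ∈ Ico a b, ∀ j, 0 ≤ v t j := by
    intro c hc j₀
    by_contra! hneg
    have hj₀A : j₀ ∈ A := by
      by_contra h
      exact absurd (hout c ⟨hc.1, hc.2.le⟩ j₀ h) (not_le.2 hneg)
    have hsub : Icc a c ⊆ Icc a b := Icc_subset_Icc_right hc.2.le
    -- This size makes the perturbation at the bad point equal to half of the negative value there,
    -- so negativity is preserved.
    set η : ℝ := -(v c j₀) / (2 * (1 + (j₀ : ℝ) ^ 2 + 3 * (c - a))) with hη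
    have hden : 0 < 1 + (j₀ : ℝ) ^ 2 + 3 * (c - a) := by nlinarith [hc.1, sq_nonneg (j₀ : ℝ)]
    have hηpos : 0 < η := by rw [hη]; apply div_pos <;> linarith
    -- The quadratic growth in j confines negative values to finitely many sites. The slope 3 in
    -- time exceeds the Laplacian 2 of j², so w is a strict supersolution.
    set w : ℝ → ℤ → ℝ := fun t j => v t j + η * (1 + (j : ℝ) ^ 2 + 3 * (t - a)) with hw
    have hwneg : w c j₀ < 0 := by
      have : η * (1 + (j₀ : ℝ) ^ 2 + 3 * (c - a)) = -(v c j₀) / 2 := by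
        rw [hη]; field_simp
      simp only [hw, this]; linarith
    obtain ⟨N, hN⟩ := exists_nat_gt (|M| / η + |(j₀ : ℝ)|)
    have hMN : |M| < η * N := by
      have : |M| / η < N := by linarith [abs_nonneg (j₀ : ℝ)]
      rwa [div_lt_iff₀ hηpos, mul_comm] at this
    classical
    set F : Finset ℤ := (Finset.Icc (-(N : ℤ)) N).filter (· ∈ A) with hF
    have hout' : ∀ t ∈ Icc a c, ∀ j ∉ F, 0 ≤ w t j := by
      intro t ht j hj
      have h3 : 0 ≤ 3 * (t - a) := by linarith [ht.1]
      by_cases hjA : j ∈ A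
      · have hjN : (N : ℝ) < |(j : ℝ)| := by
          by_contra! h
          apply hj
          simp only [hF, Finset.mem_filter, Finset.mem_Icc]
          rw [abs_le] at h
          exact ⟨⟨by exact_mod_cast h.1, by exact_mod_cast h.2⟩, hjA⟩
        have h1 := hbd t (hsub ht) j hjA
        have h2 : |(j : ℝ)| ≤ 1 + (j : ℝ) ^ 2 := by nlinarith [sq_abs (j : ℝ), sq_nonneg (|(j : ℝ)| - 1)]
        have h4 : η * N ≤ η * (1 + (j : ℝ) ^ 2 + 3 * (t - a)) := by
          apply mul_le_mul_of_nonneg_left _ hηpos.le; linarith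
        simp only [hw]; linarith [le_abs_self M]
      · have := hout t (hsub ht) j hjA
        simp only [hw]; positivity
    have hj₀F : j₀ ∈ F := by
      by_contra h
      exact absurd (hout' c ⟨hc.1, le_rfl⟩ j₀ h) (not_le.2 hwneg)
    have hwcont : ∀ j, ContinuousOn (fun t => w t j) (Icc a c) := fun j =>
      ((hcont j).mono hsub).add (by fun_prop)
    -- space-time minimum
    have hmin : ∀ j ∈ F, ∃ t ∈ Icc a c, ∀ s ∈ Icc a c, w t j ≤ w s j := fun j _ =>
      isCompact_Icc.exists_isMinOn ⟨a, le_rfl, hc.1⟩ (hwcont j)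
    choose! τ hτ hτmin using hmin
    obtain ⟨j₁, hj₁F, hj₁⟩ := F.exists_min_image (fun j => w (τ j) j) ⟨j₀, hj₀F⟩
    set t₁ := τ j₁ with ht₁
    have ht₁c : t₁ ∈ Icc a c := hτ j₁ hj₁F
    have hw1neg : w t₁ j₁ < 0 :=
      (hj₁ j₀ hj₀F).trans_lt ((hτmin j₀ hj₀F c ⟨hc.1, le_rfl⟩).trans_lt hwneg)
    have hglob : ∀ s ∈ Icc a c, ∀ j, w t₁ j₁ ≤ w s j := by
      intro s hs j
      by_cases hj : j ∈ F
      · exact (hj₁ j hj).trans (hτmin j hj s hs)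
      · exact hw1neg.le.trans (hout' s hs j hj)
    have hj₁A : j₁ ∈ A := (Finset.mem_filter.1 hj₁F).2
    have hat : a < t₁ := by
      rcases ht₁c.1.lt_or_eq with h | h
      · exact h
      · exfalso
        have h0 : 0 ≤ w a j₁ := by
          have := hinit j₁
          simp only [hw, sub_self, mul_zero, add_zero]; positivity
        rw [h] at h0; linarith
    have htI : t₁ ∈ Ioo a b := ⟨hat, ht₁c.2.trans_lt hc.2⟩
    have hd : HasDerivAt (fun s => w s j₁) (v' t₁ j₁ + η * (3 * 1)) t₁ := by
      apply (hderiv j₁ hj₁A t₁ htI).add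
      apply HasDerivAt.const_mul
      have := ((hasDerivAt_id t₁).sub_const a).const_mul (3 : ℝ)
      exact this.const_add _
    -- The minimum is taken over times up to c only, so it is compared with earlier times, which
    -- suffices for the sign of the derivative. At the same point the Laplacian of w is nonnegative,
    -- contradicting the strict supersolution property.
    have hle : v' t₁ j₁ + η * (3 * 1) ≤ 0 := by
      have h1 := hd.hasDerivWithinAt (s := Iic t₁)
      have h2 := h1.Iio_of_Iic
      rw [hasDerivWithinAt_iff_tendsto_slope' (by simp)] at h2
      refine le_of_tendsto h2 ?_
      filter_upwards [Ioo_mem_nhdsLT hat] with s hs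
      rw [slope_def_field]
      apply div_nonpos_of_nonneg_of_nonpos
      · have := hglob s ⟨hs.1.le, hs.2.le.trans ht₁c.2⟩ j₁
        linarith
      · linarith [hs.2]
    have h1 := hsuper j₁ hj₁A t₁ htI
    have h2 := hglob t₁ ht₁c (j₁ + 1)
    have h3 := hglob t₁ ht₁c (j₁ - 1)
    simp only [hw, lap] at h1 h2 h3
    push_cast at h2 h3
    nlinarith
  intro t ht j
  rcases ht.2.lt_or_eq with h | h
  · exact key t ⟨ht.1, h⟩ j
  · rcases ht.1.lt_or_eq with h' | h'
    · have hc : ContinuousWithinAt (fun t => v t j) (Icc a b) b := hcont j b ⟨(h'.trans_le h.le).le, le_rfl⟩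
      have hab : a < b := h'.trans_le h.le
      have hc' : Tendsto (fun t => v t j) (𝓝[<] b) (𝓝 (v b j)) :=
        hc.tendsto.mono_left (by
          rw [← nhdsWithin_Ioo_eq_nhdsLT hab]
          exact nhdsWithin_mono _ Ioo_subset_Icc_self)
      rw [h]
      refine ge_of_tendsto hc' ?_
      filter_upwards [Ioo_mem_nhdsLT hab] with s hs
      exact key s ⟨hs.1.le, hs.2⟩ j
    · rw [← h']; exact hinit j

/-! ### The discrete heat kernel -/

theorem heatKernel_neg (j : ℤ) (t : ℝ) : heatKernel (-j) t = heatKernel j t := by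
  unfold heatKernel
  congr 2
  ext k
  push_cast
  rw [show -(j : ℝ) * k = -(j * k) by ring, Real.cos_neg]

theorem heatKernel_zero (j : ℤ) : heatKernel j 0 = if j = 0 then 1 else 0 := by
  unfold heatKernel
  have hpi := Real.pi_pos
  split_ifs with h
  · subst h
    simp
    field_simp
    norm_num
  · have hj : (j : ℝ) ≠ 0 := by exact_mod_cast h
    simp only [mul_zero, Real.exp_zero, one_mul]
    rw [intervalIntegral.integral_comp_mul_left (f := Real.cos) hj, integral_cos]
    simp [Real.sin_int_mul_pi]

theorem lap_heatKernel (j : ℤ) (t : ℝ) : lap (fun i => heatKernel i t) j = 1 / (2 * Real.pi) *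
    ∫ k in (-Real.pi)..Real.pi,
      -(2 * (1 - Real.cos k)) * Real.exp (-(2 * (1 - Real.cos k)) * t) * Real.cos (j * k) := by
  unfold lap heatKernel
  have e : ∀ a b c : ℝ, 1 / (2 * Real.pi) * a - 2 * (1 / (2 * Real.pi) * b) + 1 / (2 * Real.pi) * c
      = 1 / (2 * Real.pi) * (a - 2 * b + c) := fun a b c => by ring
  rw [e]
  congr 1
  rw [← intervalIntegral.integral_const_mul, ← intervalIntegral.integral_sub, ← intervalIntegral.integral_add]
  · congr 1
    ext k
    push_cast
    have e1 : ((j : ℝ) + 1) * k = j * k + k := by ring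
    have e2 : ((j : ℝ) - 1) * k = j * k - k := by ring
    rw [e1, e2, Real.cos_add, Real.cos_sub]
    ring
  all_goals exact Continuous.intervalIntegrable (by fun_prop) _ _

theorem hasDerivAt_heatKernel (j : ℤ) (t : ℝ) :
    HasDerivAt (heatKernel j) (lap (fun i => heatKernel i t) j) t := by
  have h := intervalIntegral.hasDerivAt_integral_of_dominated_loc_of_deriv_le
    (μ := volume) (a := -Real.pi) (b := Real.pi) (x₀ := t) (s := Metric.ball t 1)
    (F := fun t k => Real.exp (-(2 * (1 - Real.cos k)) * t) * Real.cos (j * k))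
    (F' := fun t k => (-(2 * (1 - Real.cos k))) * Real.exp (-(2 * (1 - Real.cos k)) * t) * Real.cos (j * k))
    (bound := fun _ => 4 * Real.exp (4 * (|t| + 1)))
    (Metric.ball_mem_nhds t one_pos)
    (Eventually.of_forall fun x => (Continuous.aestronglyMeasurable (by fun_prop)))
    (Continuous.intervalIntegrable (by fun_prop) _ _)
    (Continuous.aestronglyMeasurable (by fun_prop))
    (Eventually.of_forall fun k _ x hx => by
      have hx' : |x| ≤ |t| + 1 := by
        have h1 : |x - t| < 1 := by simpa [Real.dist_eq] using hx
        have h2 := abs_add_le (x - t) t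
        rw [sub_add_cancel] at h2; linarith
      have hc1 := Real.cos_le_one k
      have hc2 := Real.neg_one_le_cos k
      rw [Real.norm_eq_abs, abs_mul, abs_mul, Real.abs_exp, abs_neg, abs_of_nonneg (by linarith : (0:ℝ) ≤ 2 * (1 - Real.cos k))]
      have h1 : Real.exp (-(2 * (1 - Real.cos k)) * x) ≤ Real.exp (4 * (|t| + 1)) := by
        apply Real.exp_le_exp.2
        have : -(2 * (1 - Real.cos k)) * x ≤ 2 * (1 - Real.cos k) * |x| := by
          nlinarith [neg_abs_le x]
        nlinarith [abs_nonneg x]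
      have h2 := Real.abs_cos_le_one (j * k)
      calc _ ≤ 2 * (1 - Real.cos k) * Real.exp (-(2 * (1 - Real.cos k)) * x) * 1 := by gcongr
        _ ≤ 4 * Real.exp (4 * (|t| + 1)) * 1 := by gcongr; linarith
        _ = _ := by ring)
    (by simp)
    (Eventually.of_forall fun k _ x _ => by
      apply HasDerivAt.mul_const
      have := ((hasDerivAt_id x).const_mul (-(2 * (1 - Real.cos k)))).exp
      simpa [mul_comm] using this)
  rw [lap_heatKernel]
  exact h.2.const_mul (1 / (2 * Real.pi))

theorem continuous_heatKernel (j : ℤ) : Continuous (heatKernel j) :=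
  continuous_iff_continuousAt.2 fun t => (hasDerivAt_heatKernel j t).continuousAt

theorem abs_heatKernel_le_one (j : ℤ) {t : ℝ} (ht : 0 ≤ t) : |heatKernel j t| ≤ 1 := by
  have hpi := Real.pi_pos
  unfold heatKernel
  rw [abs_mul, abs_of_pos (by positivity)]
  have h : ‖∫ k in (-Real.pi)..Real.pi, Real.exp (-(2 * (1 - Real.cos k)) * t) * Real.cos (j * k)‖
      ≤ 1 * |Real.pi - -Real.pi| := by
    apply intervalIntegral.norm_integral_le_of_norm_le_const
    intro k _
    rw [Real.norm_eq_abs, abs_mul, Real.abs_exp]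
    have h1 : Real.exp (-(2 * (1 - Real.cos k)) * t) ≤ 1 := by
      apply Real.exp_le_one_iff.2
      nlinarith [Real.cos_le_one k]
    have h2 := Real.abs_cos_le_one (j * k)
    nlinarith [Real.exp_pos (-(2 * (1 - Real.cos k)) * t), abs_nonneg (Real.cos (j * k))]
  rw [Real.norm_eq_abs, sub_neg_eq_add, abs_of_pos (by positivity : (0:ℝ) < Real.pi + Real.pi)] at h
  calc _ ≤ 1 / (2 * Real.pi) * (1 * (Real.pi + Real.pi)) := by gcongr
    _ = 1 := by field_simp; norm_num

theorem hasDerivAt_heatKernel_shift (j k : ℤ) (s t : ℝ) :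
    HasDerivAt (fun r => heatKernel (j - k) (r - s)) (lap (fun i => heatKernel (i - k) (t - s)) j) t := by
  have h := (hasDerivAt_heatKernel (j - k) (t - s)).comp t ((hasDerivAt_id t).sub_const s)
  rw [lap_comp_sub (fun i => heatKernel i (t - s))]
  simpa [Function.comp_def] using h

/-- The Fourier integrand changes sign, so positivity is taken from the minimum principle; the
Fourier formula only supplies the bound that this principle needs. -/
theorem heatKernel_nonneg (j : ℤ) {t : ℝ} (ht : 0 ≤ t) : 0 ≤ heatKernel j t :=
  min_principle (a := 0) (b := t) (M := 1) univ (fun t j => heatKernel j t)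
    (fun t j => lap (fun i => heatKernel i t) j)
    (fun j => (continuous_heatKernel j).continuousOn)
    (fun j _ t _ => hasDerivAt_heatKernel j t)
    (fun _ _ _ _ => le_rfl)
    (fun s hs j _ => (abs_le.1 (abs_heatKernel_le_one j hs.1)).1)
    (fun _ _ j hj => absurd (mem_univ j) hj)
    (fun j => by simp only [heatKernel_zero]; split_ifs <;> norm_num)
    t ⟨ht, le_rfl⟩ j


theorem hasDerivAt_sum_heatKernel (F : Finset ℤ) (c : ℤ → ℝ) (j : ℤ) (t : ℝ) :
    HasDerivAt (fun s => ∑ k ∈ F, heatKernel (j - k) s * c k)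
      (lap (fun i => ∑ k ∈ F, heatKernel (i - k) t * c k) j) t := by
  have h := HasDerivAt.fun_sum (u := F) (A := fun k s => heatKernel (j - k) s * c k)
    (A' := fun k => lap (fun i => heatKernel (i - k) t) j * c k) (x := t)
    (fun k _ => by simpa using (hasDerivAt_heatKernel_shift j k 0 t).mul_const (c k))
  refine h.congr_deriv ?_
  simp only [lap, Finset.mul_sum, ← Finset.sum_add_distrib, ← Finset.sum_sub_distrib]
  exact Finset.sum_congr rfl fun k _ => by ring

theorem abs_sum_heatKernel_le (F : Finset ℤ) (c : ℤ → ℝ) (j : ℤ) {t : ℝ} (ht : 0 ≤ t) :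
    |∑ k ∈ F, heatKernel (j - k) t * c k| ≤ ∑ k ∈ F, |c k| := by
  refine (Finset.abs_sum_le_sum_abs _ _).trans (Finset.sum_le_sum fun k _ => ?_)
  rw [abs_mul]
  exact mul_le_of_le_one_left (abs_nonneg _) (abs_heatKernel_le_one _ ht)

theorem sum_heatKernel_zero (F : Finset ℤ) (c : ℤ → ℝ) (j : ℤ) :
    ∑ k ∈ F, heatKernel (j - k) 0 * c k = if j ∈ F then c j else 0 := by
  simp only [heatKernel_zero, sub_eq_zero, ite_mul, one_mul, zero_mul]
  rw [Finset.sum_ite_eq F j c]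

/-- Finite superpositions of heat kernels lie below every supersolution that is bounded below. -/
theorem sum_heatKernel_le (F : Finset ℤ) (c : ℤ → ℝ) (B B' : ℝ → ℤ → ℝ) (M : ℝ)
    (hB : ∀ j t, HasDerivAt (fun s => B s j) (B' t j) t)
    (hsuper : ∀ j, ∀ t > 0, lap (B t) j ≤ B' t j) (hbd : ∀ t, 0 ≤ t → ∀ j, -M ≤ B t j)
    (hinit : ∀ j ∈ F, c j ≤ B 0 j) (hinit' : ∀ j ∉ F, 0 ≤ B 0 j) {t : ℝ} (ht : 0 ≤ t) (j : ℤ) :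
    ∑ k ∈ F, heatKernel (j - k) t * c k ≤ B t j := by
  have := min_principle (a := 0) (b := t) (M := M + ∑ k ∈ F, |c k|) univ
    (fun t j => B t j - ∑ k ∈ F, heatKernel (j - k) t * c k)
    (fun t j => B' t j - lap (fun i => ∑ k ∈ F, heatKernel (i - k) t * c k) j)
    (fun j s _ => ((hB j s).sub (hasDerivAt_sum_heatKernel F c j s)).continuousAt.continuousWithinAt)
    (fun j _ s _ => (hB j s).sub (hasDerivAt_sum_heatKernel F c j s))
    (fun j _ s hs => by rw [lap_sub]; linarith [hsuper j s hs.1])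
    (fun s hs j _ => by
      have h1 := (abs_le.1 (abs_sum_heatKernel_le F c j hs.1)).2
      have h2 := hbd s hs.1 j
      linarith)
    (fun _ _ j hj => absurd (mem_univ j) hj)
    (fun j => by
      rw [sum_heatKernel_zero]
      split_ifs with h
      · linarith [hinit j h]
      · linarith [hinit' j h])
    t ⟨ht, le_rfl⟩ j
  linarith

theorem sum_heatKernel_le_one (F : Finset ℤ) (j : ℤ) {t : ℝ} (ht : 0 ≤ t) :
    ∑ k ∈ F, heatKernel (j - k) t ≤ 1 := by
  simpa using sum_heatKernel_le F (fun _ => 1) (fun _ _ => 1) (fun _ _ => 0) 0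
    (fun j t => hasDerivAt_const _ _) (fun _ _ _ => by norm_num [lap]) (fun _ _ _ => by norm_num)
    (fun _ _ => le_rfl) (fun _ _ => zero_le_one) ht j

theorem summable_heatKernel {t : ℝ} (ht : 0 ≤ t) : Summable (fun j => heatKernel j t) :=
  summable_of_sum_le (c := 1) (fun j => heatKernel_nonneg j ht) fun F => by
    have := sum_heatKernel_le_one F 0 ht
    simpa only [zero_sub, heatKernel_neg] using this

/-- Chebyshev's inequality for a kernel of variance 2t. The barrier -1 + (j² + 2t)/N² solves the
heat equation, starts above minus the indicator of the window, and is read off at j = 0. -/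
theorem one_sub_le_sum_heatKernel (N : ℕ) (hN : 0 < N) {t : ℝ} (ht : 0 ≤ t) :
    1 - 2 * t / (N : ℝ) ^ 2 ≤ ∑ k ∈ Finset.Icc (-(N : ℤ)) N, heatKernel k t := by
  have hN' : (0 : ℝ) < N := by exact_mod_cast hN
  have := sum_heatKernel_le (Finset.Icc (-(N : ℤ)) N) (fun _ => -1)
    (fun t j => -1 + ((N : ℝ) ^ 2)⁻¹ * (((j : ℝ) - (0 : ℤ)) ^ 2 + 2 * t)) (fun _ _ => ((N : ℝ) ^ 2)⁻¹ * 2) 1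
    (fun j t => by
      have := (((hasDerivAt_id t).const_mul 2).const_add (((j : ℝ) - (0 : ℤ)) ^ 2)).const_mul ((N : ℝ) ^ 2)⁻¹
      simpa using this.const_add (-1))
    (fun j t _ => by simp only [lap]; push_cast; nlinarith)
    (fun t ht j => by
      have : 0 ≤ ((N : ℝ) ^ 2)⁻¹ * (((j : ℝ) - (0 : ℤ)) ^ 2 + 2 * t) := by positivity
      linarith)
    (fun j _ => by
      have : 0 ≤ ((N : ℝ) ^ 2)⁻¹ * (((j : ℝ) - (0 : ℤ)) ^ 2 + 2 * 0) := by positivity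
      linarith)
    (fun j hj => by
      have hj' : (N : ℝ) ≤ |(j : ℝ)| := by
        by_contra! h
        rw [abs_lt] at h
        apply hj
        rw [Finset.mem_Icc]
        exact ⟨by exact_mod_cast h.1.le, by exact_mod_cast h.2.le⟩
      have h2 : (N : ℝ) ^ 2 ≤ (j : ℝ) ^ 2 := by rw [← sq_abs (j : ℝ)]; gcongr
      have : 1 ≤ ((N : ℝ) ^ 2)⁻¹ * (((j : ℝ) - (0 : ℤ)) ^ 2 + 2 * 0) := by
        rw [inv_mul_eq_div, le_div_iff₀ (by positivity)]; simpa using h2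
      linarith) ht 0
  simp only [zero_sub, heatKernel_neg, mul_neg, mul_one, Finset.sum_neg_distrib] at this
  simp only [Int.cast_zero, sub_zero] at this
  have e : ((N : ℝ) ^ 2)⁻¹ * (0 ^ 2 + 2 * t) = 2 * t / (N : ℝ) ^ 2 := by field_simp; ring
  rw [e] at this; linarith

theorem hasSum_heatKernel {t : ℝ} (ht : 0 ≤ t) : HasSum (fun j => heatKernel j t) 1 := by
  have hs := summable_heatKernel ht
  convert hs.hasSum using 1
  apply le_antisymm
  · have h : Tendsto (fun N : ℕ => 1 - 2 * t / (N : ℝ) ^ 2) atTop (𝓝 (1 - 0)) := by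
      apply Tendsto.const_sub
      apply Tendsto.const_div_atTop
      exact (tendsto_pow_atTop two_ne_zero).comp tendsto_natCast_atTop_atTop
    rw [sub_zero] at h
    refine le_of_tendsto h ?_
    filter_upwards [eventually_gt_atTop 0] with N hN
    exact (one_sub_le_sum_heatKernel N hN ht).trans
      (hs.sum_le_tsum _ fun j _ => heatKernel_nonneg j ht)
  · refine hs.tsum_le_of_sum_le fun F => ?_
    have := sum_heatKernel_le_one F 0 ht
    simpa only [zero_sub, heatKernel_neg] using this

theorem hasSum_heatKernel_shift (j : ℤ) {t : ℝ} (ht : 0 ≤ t) :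
    HasSum (fun k => heatKernel (j - k) t) 1 :=
  (Equiv.subLeft j).hasSum_iff.2 (hasSum_heatKernel ht)

theorem hasSum_heatKernel_shift' (k : ℤ) {t : ℝ} (ht : 0 ≤ t) :
    HasSum (fun j => heatKernel (j - k) t) 1 :=
  (Equiv.subRight k).hasSum_iff.2 (hasSum_heatKernel ht)

/-- The function e^(t/2)·2^(-|j|) is a supersolution: the Laplacian of 2^(-|j|) is half of it away
from 0 and negative at 0. The bound serves as the summable majorant for termwise operations on heat
flows. -/
theorem heatKernel_le_geometric (j : ℤ) {t : ℝ} (ht : 0 ≤ t) :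
    heatKernel j t ≤ Real.exp (t / 2) * (1 / 2 : ℝ) ^ j.natAbs := by
  have := sum_heatKernel_le {0} (fun _ => 1) (fun t j => Real.exp (t / 2) * (1 / 2 : ℝ) ^ j.natAbs)
    (fun t j => (Real.exp (t / 2) * (1 / 2)) * (1 / 2 : ℝ) ^ j.natAbs) 0
    (fun j t => (((hasDerivAt_id t).div_const 2).exp).mul_const _)
    (fun j t _ => by
      simp only [lap]
      have he := Real.exp_pos (t / 2)
      have hpow : lap (fun j : ℤ => (1 / 2 : ℝ) ^ j.natAbs) j ≤ 1 / 2 * (1 / 2 : ℝ) ^ j.natAbs := by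
        simp only [lap]
        rcases lt_trichotomy j 0 with h | h | h
        · obtain ⟨n, rfl⟩ : ∃ n : ℕ, j = -((n : ℤ) + 1) := ⟨(-j - 1).toNat, by omega⟩
          rw [show (-((n : ℤ) + 1) + 1).natAbs = n by omega, show (-((n : ℤ) + 1) - 1).natAbs = n + 2 by omega,
            show (-((n : ℤ) + 1)).natAbs = n + 1 by omega]
          apply le_of_eq; ring
        · subst h; norm_num
        · obtain ⟨n, rfl⟩ : ∃ n : ℕ, j = (n : ℤ) + 1 := ⟨(j - 1).toNat, by omega⟩
          rw [show ((n : ℤ) + 1 + 1).natAbs = n + 2 by omega, show ((n : ℤ) + 1 - 1).natAbs = n by omega,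
            show ((n : ℤ) + 1).natAbs = n + 1 by omega]
          apply le_of_eq; ring
      simp only [lap] at hpow
      nlinarith)
    (fun t _ j => by rw [neg_zero]; positivity) (fun j hj => by simp at hj; subst hj; simp)
    (fun j _ => by positivity) ht j
  simpa using this

/-! ### Decay estimates from the Fourier representation -/

/-- The bound cos k ≤ 1 - 2k²/π² on [-π, π] turns the integrand into a Gaussian, whose integral over
the whole line is at most π/√t because π ≤ 4. -/
theorem integral_exp_cos_le {t : ℝ} (ht : 0 < t) :
    1 / (2 * Real.pi) * ∫ k in (-Real.pi)..Real.pi, Real.exp (-(2 * (1 - Real.cos k)) * t)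
      ≤ 1 / (2 * √t) := by
  have hpi := Real.pi_pos
  have hb : 0 < 4 * t / Real.pi ^ 2 := by positivity
  have h1 : ∫ k in (-Real.pi)..Real.pi, Real.exp (-(2 * (1 - Real.cos k)) * t)
      ≤ ∫ k in (-Real.pi)..Real.pi, Real.exp (-(4 * t / Real.pi ^ 2) * k ^ 2) := by
    apply intervalIntegral.integral_mono_on (by linarith)
      (Continuous.intervalIntegrable (by fun_prop) _ _) (Continuous.intervalIntegrable (by fun_prop) _ _)
    intro k hk
    apply Real.exp_le_exp.2
    have := Real.cos_le_one_sub_mul_cos_sq (abs_le.2 hk)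
    have e : -(4 * t / Real.pi ^ 2) * k ^ 2 = -(2 * (2 / Real.pi ^ 2 * k ^ 2)) * t := by ring
    rw [e]
    nlinarith
  have h2 : ∫ k in (-Real.pi)..Real.pi, Real.exp (-(4 * t / Real.pi ^ 2) * k ^ 2)
      ≤ √(Real.pi / (4 * t / Real.pi ^ 2)) := by
    rw [← integral_gaussian, intervalIntegral.integral_of_le (by linarith)]
    exact setIntegral_le_integral (integrable_exp_neg_mul_sq hb) (Eventually.of_forall fun k => (Real.exp_pos _).le)
  have h3 : √(Real.pi / (4 * t / Real.pi ^ 2)) ≤ Real.pi / √t := by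
    rw [show Real.pi / (4 * t / Real.pi ^ 2) = Real.pi / 4 * (Real.pi ^ 2 / t) by field_simp]
    rw [Real.sqrt_mul (by positivity), Real.sqrt_div (by positivity) t, Real.sqrt_sq hpi.le]
    apply mul_le_of_le_one_left (by positivity)
    rw [Real.sqrt_le_one]
    linarith [Real.pi_lt_four]
  calc _ ≤ 1 / (2 * Real.pi) * (Real.pi / √t) := by
        gcongr; exact h1.trans (h2.trans h3)
    _ = _ := by field_simp

/-- Bound for Fourier integrals with a symbol dominated by a Gaussian-type factor. -/
theorem abs_fourier_le {t A : ℝ} (ht : 0 < t) (f : ℝ → ℝ) (hA : 0 ≤ A)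
    (hf : ∀ k, |f k| ≤ A * Real.exp (-(2 * (1 - Real.cos k)) * t)) :
    |1 / (2 * Real.pi) * ∫ k in (-Real.pi)..Real.pi, f k| ≤ A / (2 * √t) := by
  have hpi := Real.pi_pos
  rw [abs_mul, abs_of_pos (by positivity)]
  have h := intervalIntegral.norm_integral_le_of_norm_le (f := f) (μ := volume) (a := -Real.pi) (b := Real.pi)
    (g := fun k => A * Real.exp (-(2 * (1 - Real.cos k)) * t)) (by linarith)
    (Eventually.of_forall fun k _ => hf k) (Continuous.intervalIntegrable (by fun_prop) _ _)
  rw [intervalIntegral.integral_const_mul, Real.norm_eq_abs] at h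
  calc _ ≤ 1 / (2 * Real.pi) * (A * ∫ k in (-Real.pi)..Real.pi, Real.exp (-(2 * (1 - Real.cos k)) * t)) := by
        gcongr
    _ = A * (1 / (2 * Real.pi) * ∫ k in (-Real.pi)..Real.pi, Real.exp (-(2 * (1 - Real.cos k)) * t)) := by ring
    _ ≤ A * (1 / (2 * √t)) := by gcongr; exact integral_exp_cos_le ht
    _ = _ := by ring

theorem heatKernel_le (j : ℤ) {t : ℝ} (ht : 0 < t) : heatKernel j t ≤ 1 / (2 * √t) := by
  refine (le_abs_self _).trans (abs_fourier_le ht _ zero_le_one fun k => ?_)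
  rw [abs_mul, Real.abs_exp, one_mul]
  exact mul_le_of_le_one_right (Real.exp_pos _).le (Real.abs_cos_le_one _)

/-- With symbol y = 2(1 - cos k), half of the exponential absorbs the factor y, since
(yt/2)·e^(-yt/2) ≤ 1. The other half is integrated. -/
theorem abs_lap_heatKernel_le (j : ℤ) {t : ℝ} (ht : 0 < t) :
    |lap (fun i => heatKernel i t) j| ≤ 2 / (t * √t) := by
  rw [lap_heatKernel]
  have h := abs_fourier_le (half_pos ht)
    (fun k => -(2 * (1 - Real.cos k)) * Real.exp (-(2 * (1 - Real.cos k)) * t) * Real.cos (j * k))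
    (by positivity : 0 ≤ 2 / t) fun k => by
    have hy : 0 ≤ 2 * (1 - Real.cos k) := by linarith [Real.cos_le_one k]
    set y := 2 * (1 - Real.cos k)
    rw [abs_mul, abs_mul, Real.abs_exp, abs_neg, abs_of_nonneg hy]
    have h1 : y * t / 2 ≤ Real.exp (y * (t / 2)) := by linarith [Real.add_one_le_exp (y * (t / 2))]
    have e : Real.exp (-y * (t / 2)) = Real.exp (-y * t) * Real.exp (y * (t / 2)) := by
      rw [← Real.exp_add]; ring_nf
    calc y * Real.exp (-y * t) * |Real.cos (j * k)| ≤ y * Real.exp (-y * t) * 1 := by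
          gcongr; exact Real.abs_cos_le_one _
      _ = 2 / t * ((y * t / 2) * Real.exp (-y * t)) := by field_simp
      _ ≤ 2 / t * (Real.exp (y * (t / 2)) * Real.exp (-y * t)) := by gcongr
      _ = _ := by rw [e]; ring
  refine h.trans ?_
  have hs : √t ≤ 2 * √(t / 2) := by
    rw [Real.sqrt_le_left (by positivity), mul_pow, Real.sq_sqrt (by positivity)]; linarith
  rw [div_div, show t * (2 * √(t / 2)) = t * (2 * √(t / 2)) from rfl]
  gcongr

/-- Integration by parts in the Fourier variable; the boundary terms vanish because sin(jπ) = 0. -/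
theorem mul_heatKernel (j : ℤ) (t : ℝ) : (j : ℝ) * heatKernel j t = 1 / (2 * Real.pi) *
    ∫ k in (-Real.pi)..Real.pi,
      2 * t * Real.sin k * Real.exp (-(2 * (1 - Real.cos k)) * t) * Real.sin (j * k) := by
  have h := intervalIntegral.integral_mul_deriv_eq_deriv_mul (a := -Real.pi) (b := Real.pi)
    (u := fun k => Real.exp (-(2 * (1 - Real.cos k)) * t)) (v := fun k => Real.sin (j * k))
    (u' := fun k => Real.exp (-(2 * (1 - Real.cos k)) * t) * (-(2 * Real.sin k) * t))
    (v' := fun k => Real.cos (j * k) * j)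
    (fun k _ => by
      have h1 := (((((Real.hasDerivAt_cos k).const_sub 1).const_mul 2).neg).mul_const t).exp
      simpa using h1)
    (fun k _ => by
      have h1 := ((hasDerivAt_id k).const_mul (j : ℝ)).sin
      simpa using h1)
    (Continuous.intervalIntegrable (by fun_prop) _ _) (Continuous.intervalIntegrable (by fun_prop) _ _)
  simp only [mul_neg, Real.sin_neg, Real.sin_int_mul_pi, mul_zero, neg_zero, sub_zero, zero_sub] at h
  unfold heatKernel
  rw [mul_left_comm]
  congr 1
  rw [← intervalIntegral.integral_const_mul, ← intervalIntegral.integral_neg] at *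
  calc _ = ∫ k in (-Real.pi)..Real.pi, Real.exp (-(2 * (1 - Real.cos k)) * t) * (Real.cos (j * k) * j) := by
        congr 1; ext k; ring
    _ = _ := by
        rw [show (fun k => Real.exp (-(2 * (1 - Real.cos k)) * t) * (Real.cos (j * k) * j)) = fun k =>
          Real.exp (-(2 * (1 - Real.cos k)) * t) * (Real.cos (j * k) * j) from rfl]
        simp only [neg_mul] at h ⊢
        rw [h]; congr 1; ext k; ring

/-- Since sin²k ≤ 2(1 - cos k), the factor √t·|sin k| is absorbed by half of the exponential, and
the remaining √t cancels the decay of the integral. Uniformity in time makes this the source of the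
spatial decay of the singular part. -/
theorem abs_mul_heatKernel_le (j : ℤ) {t : ℝ} (ht : 0 ≤ t) : |(j : ℝ)| * heatKernel j t ≤ 2 := by
  rcases ht.eq_or_lt with rfl | ht
  · rw [heatKernel_zero]; split_ifs with h <;> simp [h]
  have e : |(j : ℝ)| * heatKernel j t = |(j : ℝ) * heatKernel j t| := by
    rw [abs_mul, abs_of_nonneg (heatKernel_nonneg j ht.le)]
  rw [e, mul_heatKernel]
  have h := abs_fourier_le (half_pos ht)
    (fun k => 2 * t * Real.sin k * Real.exp (-(2 * (1 - Real.cos k)) * t) * Real.sin (j * k))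
    (by positivity : 0 ≤ 2 * √t) fun k => by
    have hy : Real.sin k ^ 2 ≤ 2 * (1 - Real.cos k) := by
      nlinarith [Real.sin_sq_add_cos_sq k, sq_nonneg (1 - Real.cos k)]
    have hy0 : 0 ≤ 2 * (1 - Real.cos k) := by linarith [Real.cos_le_one k]
    set y := 2 * (1 - Real.cos k)
    have h1 : √t * |Real.sin k| ≤ Real.exp (y * (t / 2)) := by
      have h2 := Real.add_one_le_exp (y * (t / 2))
      have h3 : √t * |Real.sin k| ≤ 1 + y * (t / 2) := by
        have h4 : (√t * |Real.sin k|) ^ 2 ≤ y * t := by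
          rw [mul_pow, Real.sq_sqrt ht.le, sq_abs]; nlinarith
        nlinarith [sq_nonneg (√t * |Real.sin k| - 1)]
      linarith
    have e : Real.exp (-y * (t / 2)) = Real.exp (-y * t) * Real.exp (y * (t / 2)) := by
      rw [← Real.exp_add]; ring_nf
    rw [abs_mul, abs_mul, abs_mul, Real.abs_exp, abs_of_pos (by positivity : 0 < 2 * t)]
    calc 2 * t * |Real.sin k| * Real.exp (-y * t) * |Real.sin (j * k)|
        ≤ 2 * t * |Real.sin k| * Real.exp (-y * t) * 1 := by
          gcongr; exact Real.abs_sin_le_one _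
      _ = 2 * √t * (√t * |Real.sin k|) * Real.exp (-y * t) := by
          nth_rw 1 [← Real.mul_self_sqrt ht.le]; ring
      _ ≤ 2 * √t * Real.exp (y * (t / 2)) * Real.exp (-y * t) := by gcongr
      _ = _ := by rw [e]; ring
  refine h.trans ?_
  have hs : √t ≤ 2 * √(t / 2) := by
    rw [Real.sqrt_le_left (by positivity), mul_pow, Real.sq_sqrt (by positivity)]; linarith
  rw [div_le_iff₀ (by positivity)]
  linarith


/-! ### Gradient and time-increment bounds for the kernel. -/

theorem summable_heatKernel_mul {t : ℝ} (ht : 0 ≤ t) {f : ℤ → ℝ} {M : ℝ} (hf : ∀ j, |f j| ≤ M) :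
    Summable fun j => heatKernel j t * f j := by
  refine Summable.of_norm_bounded ((summable_heatKernel ht).mul_right M) fun j => ?_
  rw [Real.norm_eq_abs, abs_mul, abs_of_nonneg (heatKernel_nonneg j ht)]
  exact mul_le_mul_of_nonneg_left (hf j) (heatKernel_nonneg j ht)

theorem hasSum_telescope_int {b : ℤ → ℝ} (hb : Summable b) : HasSum (fun j => b (j + 1) - b j) 0 := by
  have h1 : HasSum (fun j => b (j + 1)) (∑' j, b j) := (Equiv.addRight (1 : ℤ)).hasSum_iff.2 hb.hasSum
  simpa using h1.sub hb.hasSum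

/-- The `ℓ²`-norm of the discrete gradient of the heat kernel. -/
theorem sum_sq_grad_heatKernel_le {t : ℝ} (ht : 0 < t) :
    Summable (fun j => (heatKernel (j + 1) t - heatKernel j t) ^ 2) ∧
    ∑' j, (heatKernel (j + 1) t - heatKernel j t) ^ 2 ≤ 2 / (t * √t) := by
  set g := fun j => heatKernel j t with hg
  have hg1 : ∀ j, |g j| ≤ 1 := fun j => abs_heatKernel_le_one j ht.le
  set b : ℤ → ℝ := fun j => g j * (g j - g (j - 1)) with hb
  have hbs : Summable b := summable_heatKernel_mul ht.le (M := 2) fun j => by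
    have h1 := abs_le.1 (hg1 j); have h2 := abs_le.1 (hg1 (j - 1))
    exact abs_le.2 ⟨by linarith, by linarith⟩
  have hls : Summable fun j => g j * lap g j :=
    summable_heatKernel_mul ht.le fun j => abs_lap_heatKernel_le j ht
  -- Summation by parts: up to a telescoping term, the squared gradient is -g·Δg, and it remains to
  -- use the decay of Δg together with total mass 1.
  have hid : (fun j => (g (j + 1) - g j) ^ 2) = fun j => (b (j + 1) - b j) - g j * lap g j := by
    ext j; simp only [hb, lap, add_sub_cancel_right]; ring
  have hsum := (hasSum_telescope_int hbs).sub hls.hasSum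
  rw [← hid, zero_sub] at hsum
  refine ⟨hsum.summable, ?_⟩
  have hsum' : HasSum (fun j => (g (j + 1) - g j) ^ 2) (∑' j, g j * (-lap g j)) := by
    simpa only [mul_neg, tsum_neg] using hsum
  rw [show ∑' j, (heatKernel (j + 1) t - heatKernel j t) ^ 2 = ∑' j, g j * (-lap g j) from hsum'.tsum_eq]
  have h2 : HasSum (fun j => g j * (2 / (t * √t))) (1 * (2 / (t * √t))) := (hasSum_heatKernel ht.le).mul_right _
  rw [one_mul] at h2
  refine hasSum_le (fun j => ?_) (by simpa only [mul_neg, tsum_neg] using hls.hasSum.neg) h2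
  have h3 := (abs_le.1 (abs_lap_heatKernel_le j ht)).1
  have h4 := heatKernel_nonneg j ht.le
  have : -(2 / (t * √t)) ≤ lap g j := h3
  show -(g j * lap g j) ≤ _
  nlinarith

/-- Interpolation in the ratio (b - a)/a. If it is at most 1, the mean value theorem with the bound
on Δg is used and the ratio is weakened to its power 1/4. Otherwise both values are at most of order
a^(-1/2). The resulting exponent -3/4 exceeds -1, which later keeps the rescaled sums over
transitions bounded. -/
theorem abs_heatKernel_sub_le (j : ℤ) {a b : ℝ} (ha : 0 < a) (hab : a ≤ b) :
    |heatKernel j b - heatKernel j a| ≤ 2 * (b - a) ^ (1 / 4 : ℝ) * a ^ (-(3 / 4) : ℝ) := by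
  have hx : 0 ≤ (b - a) / a := div_nonneg (by linarith) ha.le
  have key : |heatKernel j b - heatKernel j a| ≤ 2 / √a * ((b - a) / a) ^ (1 / 4 : ℝ) := by
    rcases le_total ((b - a) / a) 1 with h | h
    · have h1 : |heatKernel j b - heatKernel j a| ≤ 2 / (a * √a) * (b - a) := by
        have := Convex.norm_image_sub_le_of_norm_hasDerivWithin_le (f := heatKernel j)
          (f' := fun t => lap (fun i => heatKernel i t) j) (C := 2 / (a * √a)) (s := Icc a b)
          (x := a) (y := b)
          (fun t _ => (hasDerivAt_heatKernel j t).hasDerivWithinAt)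
          (fun t ht => by
            rw [Real.norm_eq_abs]
            refine (abs_lap_heatKernel_le j (ha.trans_le ht.1)).trans ?_
            have := ht.1
            have := ha.trans_le this
            gcongr)
          (convex_Icc a b) ⟨le_rfl, hab⟩ ⟨hab, le_rfl⟩
        simpa [Real.norm_eq_abs, abs_of_nonneg (sub_nonneg.2 hab)] using this
      calc _ ≤ 2 / (a * √a) * (b - a) := h1
        _ = 2 / √a * ((b - a) / a) ^ (1 : ℝ) := by rw [Real.rpow_one]; field_simp
        _ ≤ _ := by
          gcongr 2 / √a * ?_
          exact Real.rpow_le_rpow_of_exponent_ge_of_imp hx h (by norm_num) (fun _ h => by norm_num at h)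
    · have h1 : (1 : ℝ) ≤ ((b - a) / a) ^ (1 / 4 : ℝ) := Real.one_le_rpow h (by norm_num)
      have h2 := heatKernel_le j ha
      have h3 := heatKernel_le j (ha.trans_le hab)
      have h4 : 1 / (2 * √b) ≤ 1 / (2 * √a) := by gcongr
      have h5 := heatKernel_nonneg j ha.le
      have h6 := heatKernel_nonneg j (ha.trans_le hab).le
      have h7 : 1 / (2 * √a) ≤ 2 / √a := by
        rw [div_le_div_iff₀ (by positivity) (by positivity)]; nlinarith [Real.sqrt_nonneg a]
      have h8 : 2 / √a ≤ 2 / √a * ((b - a) / a) ^ (1 / 4 : ℝ) := le_mul_of_one_le_right (by positivity) h1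
      exact abs_le.2 ⟨by linarith, by linarith⟩
  refine key.trans (le_of_eq ?_)
  rw [Real.div_rpow (by linarith) ha.le, Real.sqrt_eq_rpow, show (-(3 / 4) : ℝ) = -(1 / 2) + -(1 / 4) by norm_num,
    Real.rpow_add ha, Real.rpow_neg ha.le, Real.rpow_neg ha.le]
  field_simp

/-! ### The kernel at the nearest neighbour -/

theorem heatKernel_one_eq (t : ℝ) : heatKernel 1 t = 1 / (2 * Real.pi) *
    ∫ k in (-Real.pi)..Real.pi, 2 * t * Real.sin k ^ 2 * Real.exp (-(2 * (1 - Real.cos k)) * t) := by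
  have := mul_heatKernel 1 t
  simp only [Int.cast_one, one_mul] at this
  rw [this]
  congr 2; ext k; ring

theorem heatKernel_one_le {t : ℝ} (ht : 0 ≤ t) : heatKernel 1 t ≤ 2 * t := by
  have hpi := Real.pi_pos
  rw [heatKernel_one_eq]
  have h := intervalIntegral.integral_mono_on (μ := volume) (a := -Real.pi) (b := Real.pi)
    (f := fun k => 2 * t * Real.sin k ^ 2 * Real.exp (-(2 * (1 - Real.cos k)) * t)) (g := fun _ => 2 * t)
    (by linarith) (Continuous.intervalIntegrable (by fun_prop) _ _)
    (Continuous.intervalIntegrable (by fun_prop) _ _) fun k _ => by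
      have h1 : Real.exp (-(2 * (1 - Real.cos k)) * t) ≤ 1 := by
        apply Real.exp_le_one_iff.2; nlinarith [Real.cos_le_one k]
      have h2 : Real.sin k ^ 2 ≤ 1 := Real.sin_sq_le_one k
      calc _ ≤ 2 * t * 1 * 1 := by gcongr
        _ = _ := by ring
  rw [intervalIntegral.integral_const, smul_eq_mul] at h
  calc _ ≤ 1 / (2 * Real.pi) * ((Real.pi - -Real.pi) * (2 * t)) := by gcongr
    _ = _ := by field_simp; ring

/-- Only the frequencies in [0, a] are kept. There sin k ≥ 2k/π, and the exponential is at least 1/e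
because k²t ≤ a²t ≤ 1. It is applied with a = 1 for short times and a = 1/√t for long ones. -/
theorem le_heatKernel_one {t a : ℝ} (ht : 0 ≤ t) (ha : 0 ≤ a) (ha1 : a ≤ 1) (hat : a ^ 2 * t ≤ 1) :
    t * a ^ 3 / 80 ≤ heatKernel 1 t := by
  have hpi := Real.pi_pos
  have hpi3 := Real.pi_gt_three
  have hpi4 := Real.pi_lt_d2
  rw [heatKernel_one_eq]
  set f := fun k => 2 * t * Real.sin k ^ 2 * Real.exp (-(2 * (1 - Real.cos k)) * t) with hf
  have hf0 : ∀ k, 0 ≤ f k := fun k => by positivity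
  have hfc : ∀ a b, IntervalIntegrable f volume a b := fun a b =>
    Continuous.intervalIntegrable (by fun_prop) _ _
  have h1 : ∫ k in (0:ℝ)..a, f k ≤ ∫ k in (-Real.pi)..Real.pi, f k :=
    intervalIntegral.integral_mono_interval (by linarith) ha (by linarith)
      (Eventually.of_forall hf0) (hfc _ _)
  have h2 : ∫ k in (0:ℝ)..a, 2 * t * (4 / 3.15 ^ 2 / 2.7182818286) * k ^ 2 ≤ ∫ k in (0:ℝ)..a, f k := by
    apply intervalIntegral.integral_mono_on ha (Continuous.intervalIntegrable (by fun_prop) _ _) (hfc _ _)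
    intro k hk
    have hs : 2 / Real.pi * k ≤ Real.sin k := Real.mul_le_sin hk.1 (by linarith [hk.2])
    have hs' : 2 / 3.15 * k ≤ Real.sin k := by
      refine le_trans ?_ hs
      have := hk.1
      gcongr
    have hs2 : (2 / 3.15 * k) ^ 2 ≤ Real.sin k ^ 2 := by
      have := hk.1
      gcongr
    have he : Real.exp (-1) ≤ Real.exp (-(2 * (1 - Real.cos k)) * t) := by
      apply Real.exp_le_exp.2
      have := Real.one_sub_sq_div_two_le_cos (x := k)
      have h5 : k ^ 2 ≤ a ^ 2 := by have := hk.1; have := hk.2; gcongr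
      nlinarith
    have he' : 1 / 2.7182818286 ≤ Real.exp (-1) := by
      rw [Real.exp_neg, one_div]
      exact inv_anti₀ (Real.exp_pos 1) Real.exp_one_lt_d9.le
    calc _ = 2 * t * (2 / 3.15 * k) ^ 2 * (1 / 2.7182818286) := by ring
      _ ≤ f k := by simp only [hf]; gcongr; exact he'.trans he
  rw [intervalIntegral.integral_const_mul, integral_pow] at h2
  norm_num at h2
  have h3 : 1 / 6.3 ≤ 1 / (2 * Real.pi) := by
    apply one_div_le_one_div_of_le (by positivity); linarith
  have h4 : 0 ≤ ∫ k in (-Real.pi)..Real.pi, f k :=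
    intervalIntegral.integral_nonneg (by linarith) fun k _ => hf0 k
  have h5 : 1 / 6.3 * (∫ k in (-Real.pi)..Real.pi, f k) ≤ 1 / (2 * Real.pi) * ∫ k in (-Real.pi)..Real.pi, f k := by
    gcongr
  refine le_trans ?_ h5
  have h6 := h2.trans h1
  have h7 : 0 ≤ t * a ^ 3 := by positivity
  nlinarith

theorem integral_heatKernel_one_le {s : ℝ} (hs : 0 ≤ s) : ∫ t in (0:ℝ)..s, heatKernel 1 t ≤ √s := by
  -- the derivative of the square root dominates the kernel
  have h : ∫ t in (0:ℝ)..s, heatKernel 1 t ≤ ∫ t in (0:ℝ)..s, 1 / 2 * t ^ (-(1 / 2) : ℝ) := by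
    apply intervalIntegral.integral_mono_on_of_le_Ioo hs
      ((continuous_heatKernel 1).intervalIntegrable _ _)
    · apply IntervalIntegrable.const_mul
      exact intervalIntegral.intervalIntegrable_rpow' (by norm_num)
    · intro t ht
      refine (heatKernel_le 1 ht.1).trans (le_of_eq ?_)
      rw [Real.rpow_neg ht.1.le, ← Real.sqrt_eq_rpow]
      field_simp
  refine h.trans (le_of_eq ?_)
  rw [intervalIntegral.integral_const_mul, integral_rpow (Or.inl (by norm_num)), Real.sqrt_eq_rpow]
  norm_num
  ring

/-- If the accumulated influx balances the kernel, then a definite amount of time has passed. -/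
theorem le_mul_of_heatKernel_one_le {s A : ℝ} (hs : 0 < s) (hA : 0 ≤ A)
    (h : 2 * heatKernel 1 s ≤ A * ∫ t in (0:ℝ)..s, heatKernel 1 t) : 1 / 40 ≤ A * s := by
  -- For s ≤ 1 the kernel at the neighbour is comparable to s and its integral to s². For s ≥ 1 the
  -- bounds are of order 1/√s from below and √s from above. In both regimes the quotient of kernel
  -- and integral is at least of order 1/s.
  rcases le_total s 1 with h1 | h1
  · have h2 := le_heatKernel_one hs.le zero_le_one le_rfl (by simpa using h1)
    have h3 : ∫ t in (0:ℝ)..s, heatKernel 1 t ≤ ∫ t in (0:ℝ)..s, 2 * t :=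
      intervalIntegral.integral_mono_on hs.le ((continuous_heatKernel 1).intervalIntegrable _ _)
        (Continuous.intervalIntegrable (by fun_prop) _ _) fun t ht => heatKernel_one_le ht.1
    rw [intervalIntegral.integral_const_mul, integral_id] at h3
    have h4 : A * ∫ t in (0:ℝ)..s, heatKernel 1 t ≤ A * s * s := by
      rw [mul_assoc]; gcongr; nlinarith
    have : 1 / 40 * s ≤ A * s * s := by nlinarith
    exact le_of_mul_le_mul_right this hs
  · have hr : 0 < √s := Real.sqrt_pos.2 hs
    have hr2 : √s * √s = s := Real.mul_self_sqrt hs.le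
    have h2 := le_heatKernel_one (a := 1 / √s) hs.le (by positivity)
      (by rw [div_le_one hr]; exact Real.one_le_sqrt.2 h1)
      (by rw [div_pow, Real.sq_sqrt hs.le]; field_simp; norm_num)
    have h3 := integral_heatKernel_one_le hs.le
    have h4 : A * ∫ t in (0:ℝ)..s, heatKernel 1 t ≤ A * √s := by gcongr
    have h5 : s * (1 / √s) ^ 3 / 80 = 1 / (80 * √s) := by
      field_simp; rw [Real.sq_sqrt hs.le]
    rw [h5] at h2
    have h6 : 2 * (1 / (80 * √s)) ≤ A * √s := by linarith
    have h7 : 2 * (1 / (80 * √s)) * √s ≤ A * √s * √s := by gcongr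
    rw [mul_assoc A, hr2] at h7
    have h8 : 2 * (1 / (80 * √s)) * √s = 1 / 40 := by field_simp; norm_num
    linarith


/-! ### Phases of a single-interface solution. -/

theorem sgn_of_nonneg {x : ℝ} (h : 0 ≤ x) : sgn x = 1 := if_neg (not_lt.2 h)

theorem sgn_of_neg {x : ℝ} (h : x < 0) : sgn x = -1 := if_pos h

theorem abs_apply_sub_le (x y : LInf) (j : ℤ) : |x j - y j| ≤ ‖x - y‖ := by
  simpa using lp.norm_apply_le_norm (p := ∞) (by simp) (x - y) j

theorem abs_apply_le (x : LInf) (j : ℤ) : |x j| ≤ ‖x‖ := by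
  simpa using lp.norm_apply_le_norm (p := ∞) (by simp) x j

theorem continuous_apply_LInf (j : ℤ) : Continuous fun x : LInf => x j :=
  (LipschitzWith.of_dist_le_mul (K := 1) fun x y => by
    simpa [Real.dist_eq, dist_eq_norm] using abs_apply_sub_le x y j).continuous

/-- The values of `Φ'` along a state with interface at `k`. -/
def branch (k : ℤ) (x : ℤ → ℝ) (j : ℤ) : ℝ := if j < k then x j - 1 else x j + 1

theorem dPhi_eq_branch {k j : ℤ} {x : ℤ → ℝ} (h1 : j < k → 0 ≤ x j) (h2 : k ≤ j → x j < 0) :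
    dPhi (x j) = branch k x j := by
  unfold dPhi branch
  split_ifs with h
  · rw [sgn_of_nonneg (h1 h)]
  · rw [sgn_of_neg (h2 (not_lt.1 h))]; ring

/-- Were k < l, site k would be negative for one membership and positive for the other. -/
theorem eq_of_mem_stateSpace {k l : ℤ} {x : LInf} (hk : x ∈ stateSpace k) (hl : x ∈ stateSpace l) :
    k = l := by
  have aux : ∀ {k l : ℤ}, x ∈ stateSpace k → x ∈ stateSpace l → ¬ k < l := by
    rintro k l ⟨-, δ, hδ, h⟩ ⟨⟨δ', hδ', h'⟩, -⟩ hkl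
    linarith [(h k le_rfl).2, h' k hkl]
  rcases lt_trichotomy k l with h | h | h
  · exact absurd h (aux hk hl)
  · exact h
  · exact absurd h (aux hl hk)

namespace IsSingleInterfaceSolution

variable {u : ℝ → LInf} {T : ℤ → EReal}

theorem T_zero (h : IsSingleInterfaceSolution 1 u T) : T 0 = 0 := h.start

theorem T_nonneg (h : IsSingleInterfaceSolution 1 u T) {k : ℤ} (hk : 0 ≤ k) : 0 ≤ T k := by
  rcases hk.eq_or_lt with rfl | hk
  · rw [h.T_zero]
  · exact (h.pos k (by omega)).le

theorem coe_toReal (h : IsSingleInterfaceSolution 1 u T) {k : ℤ} (hk : 0 ≤ k) (hT : T k ≠ ⊤) :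
    ((T k).toReal : EReal) = T k :=
  EReal.coe_toReal hT (ne_bot_of_le_ne_bot (by simp) (h.T_nonneg hk))

/-- After the first infinite transition time all transition times are infinite. -/
theorem eq_top (h : IsSingleInterfaceSolution 1 u T) {k : ℤ} (hk : 1 ≤ k) (hT : T (k - 1) = ⊤) :
    T k = ⊤ := by
  by_contra hne
  -- every time before the first infinite transition time lies in an earlier interval
  have cover : ∀ m : ℤ, 0 ≤ m → T m ≠ ⊤ ∨ ∀ t : ℝ, 0 ≤ t →
      ∃ i, 1 ≤ i ∧ i ≤ m ∧ T (i - 1) ≤ (t : EReal) ∧ (t : EReal) < T i := by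
    intro m hm
    induction m, hm using Int.leInduction with
    | base => left; rw [h.T_zero]; exact EReal.zero_ne_top
    | succ m hm ih =>
      rcases ih with ih | ih
      · by_cases htop : T (m + 1) = ⊤
        · right
          intro t ht
          by_contra! hcon
          have : ∀ i : ℤ, 0 ≤ i → i ≤ m + 1 → T i ≤ (t : EReal) := by
            intro i hi
            induction i, hi using Int.leInduction with
            | base => intro _; rw [h.T_zero]; exact_mod_cast ht
            | succ i hi ih' =>
              intro hi'
              have := hcon (i + 1) (by omega) hi' (by simpa using ih' (by omega))
              exact this
          have h1 := this (m + 1) (by omega) le_rfl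
          rw [htop] at h1
          exact absurd h1 (by simp)
        · exact Or.inl htop
      · right
        intro t ht
        obtain ⟨i, h1, h2, h3⟩ := ih t ht
        exact ⟨i, h1, by omega, h3⟩
  rcases cover (k - 1) (by omega) with h1 | h1
  · exact h1 hT
  · have hTk := h.coe_toReal (by omega) hne
    obtain ⟨i, hi1, hi2, hi3, hi4⟩ := h1 (T k).toReal (EReal.toReal_nonneg (h.T_nonneg (by omega)))
    rw [hTk] at hi3 hi4
    have hlt : T k < T (k + 1) := by
      rcases h.increasing (k + 1) (by omega) with h2 | h2
      · rw [add_sub_cancel_right] at h2; exact absurd h2 hne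
      · rwa [add_sub_cancel_right] at h2
    -- A time just after `T k` lies both in an earlier interval and in the interval following `T k`,
    -- so the state would have two different interface positions.
    obtain ⟨s, hs1, hs2⟩ := EReal.lt_iff_exists_real_btwn.1 (lt_min hi4 hlt)
    have e1 := h.mem_stateSpace i (by omega) s (hi3.trans_lt hs1) (hs2.trans_le (min_le_left _ _))
    have e2 := h.mem_stateSpace (k + 1) (by omega) s (by simpa using hs1) (hs2.trans_le (min_le_right _ _))
    have := eq_of_mem_stateSpace e1 e2
    omega

theorem T_lt (h : IsSingleInterfaceSolution 1 u T) {k : ℤ} (hk : 1 ≤ k) (hT : T (k - 1) ≠ ⊤) :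
    T (k - 1) < T k := (h.increasing k hk).resolve_left hT

theorem T_mono (h : IsSingleInterfaceSolution 1 u T) {k l : ℤ} (hk : 0 ≤ k) (hkl : k ≤ l) :
    T k ≤ T l := by
  induction l, hkl using Int.leInduction with
  | base => exact le_rfl
  | succ l hl ih =>
    rcases eq_or_ne (T l) ⊤ with h1 | h1
    · rw [h.eq_top (k := l + 1) (by omega) (by simpa using h1)]; exact le_top
    · refine ih.trans (le_of_lt ?_)
      simpa using h.T_lt (k := l + 1) (by omega) (by simpa using h1)

theorem hasDerivAt (h : IsSingleInterfaceSolution 1 u T) {k : ℤ} (hk : 1 ≤ k) {t : ℝ}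
    (h1 : T (k - 1) < (t : EReal)) (h2 : (t : EReal) < T k) (j : ℤ) :
    HasDerivAt (fun s => u s j) (lap (branch k (u t)) j) t := by
  have ht : 0 < t := by
    have := (h.T_nonneg (k := k - 1) (by omega)).trans_lt h1
    exact_mod_cast this
  have hd := h.solves t ht.le (fun n hn heq => by
    rcases le_or_gt n (k - 1) with hnk | hnk
    · exact absurd (heq ▸ h.T_mono (by omega) hnk) (not_le.2 h1)
    · exact absurd (heq ▸ h.T_mono (k := k) (l := n) (by omega) (by omega)) (not_le.2 h2)) j
  have hX := h.mem_stateSpace k hk t h1 h2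
  have e : (fun i => dPhi (u t i)) = branch k (u t) := by
    ext i
    obtain ⟨⟨δ, hδ, h3⟩, δ', hδ', h4⟩ := hX
    exact dPhi_eq_branch (fun hi => hδ.le.trans (h3 i hi)) fun hi => (h4 i hi).2.trans_lt (by linarith)
  rw [e] at hd
  exact hd.hasDerivAt (Ici_mem_nhds ht)

theorem continuousOn_apply (h : IsSingleInterfaceSolution 1 u T) (j : ℤ) :
    ContinuousOn (fun t => u t j) (Ici 0) :=
  (continuous_apply_LInf j).comp_continuousOn h.continuousOn

theorem hasDerivAt_branch (h : IsSingleInterfaceSolution 1 u T) {k : ℤ} (hk : 1 ≤ k) {t : ℝ}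
    (h1 : T (k - 1) < (t : EReal)) (h2 : (t : EReal) < T k) (j : ℤ) :
    HasDerivAt (fun s => branch k (u s) j) (lap (branch k (u t)) j) t := by
  have := h.hasDerivAt hk h1 h2 j
  unfold branch at this ⊢
  split_ifs
  · exact this.sub_const 1
  · exact this.add_const 1

theorem continuousOn_branch (h : IsSingleInterfaceSolution 1 u T) (k j : ℤ) :
    ContinuousOn (fun t => branch k (u t) j) (Ici 0) := by
  have := h.continuousOn_apply j
  unfold branch
  split_ifs
  · exact this.sub continuousOn_const
  · exact this.add continuousOn_const

theorem exists_bound (h : IsSingleInterfaceSolution 1 u T) (b : ℝ) :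
    ∃ M, 0 ≤ M ∧ ∀ t ∈ Icc 0 b, ∀ k j, |branch k (u t) j| ≤ M := by
  obtain ⟨C, hC⟩ := isCompact_Icc.exists_bound_of_continuousOn (h.continuousOn.mono (Icc_subset_Ici_self : Icc 0 b ⊆ Ici 0))
  refine ⟨|C| + 1, by positivity, fun t ht k j => ?_⟩
  have h1 := (abs_apply_le (u t) j).trans ((hC t ht).trans (le_abs_self C))
  have h2 := abs_le.1 h1
  unfold branch
  split_ifs <;> exact abs_le.2 ⟨by linarith, by linarith⟩

/-- Signs on the closed intervals between two transitions. -/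
theorem sign_le (h : IsSingleInterfaceSolution 1 u T) {k : ℤ} (hk : 1 ≤ k) (hT : T (k - 1) ≠ ⊤) {t : ℝ}
    (h1 : T (k - 1) ≤ (t : EReal)) (h2 : (t : EReal) ≤ T k) (j : ℤ) :
    (j < k → 0 ≤ u t j) ∧ (k ≤ j → -2 ≤ u t j ∧ u t j ≤ 0) := by
  set S : Set ℝ := {s | T (k - 1) < (s : EReal) ∧ (s : EReal) < T k} with hS
  have hT0 := h.T_nonneg (k := k - 1) (by omega)
  have ht0 : 0 ≤ t := by exact_mod_cast hT0.trans h1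
  -- Joining t to any interior time shows that t is a limit of interior times, so weak inequalities
  -- persist by continuity at the end points.
  have hcl : t ∈ closure S := by
    have hlt := h.T_lt hk hT
    obtain ⟨s, hs1, hs2⟩ := EReal.lt_iff_exists_real_btwn.1 hlt
    have hseg : openSegment ℝ t s ⊆ S := by
      rcases lt_trichotomy s t with hst | hst | hst
      · rw [openSegment_symm, openSegment_eq_Ioo hst]
        exact fun x hx => ⟨hs1.trans (by exact_mod_cast hx.1), lt_of_lt_of_le (by exact_mod_cast hx.2) h2⟩
      · subst hst; simp [hS, hs1, hs2]
      · rw [openSegment_eq_Ioo hst]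
        exact fun x hx => ⟨h1.trans_lt (by exact_mod_cast hx.1), lt_trans (by exact_mod_cast hx.2) hs2⟩
    exact closure_mono hseg (segment_subset_closure_openSegment (left_mem_segment ℝ t s))
  have hSsub : S ⊆ Ici 0 := fun s hs => by
    have := hT0.trans hs.1.le
    exact (by exact_mod_cast this : (0 : ℝ) ≤ s)
  have hmem : u t j ∈ closure ((fun s => u s j) '' S) :=
    ((h.continuousOn_apply j t ht0).mono hSsub).mem_closure_image hcl
  constructor
  · intro hj
    have : (fun s => u s j) '' S ⊆ Ici 0 := by
      rintro _ ⟨s, hs, rfl⟩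
      obtain ⟨⟨δ, hδ, h3⟩, -⟩ := h.mem_stateSpace k hk s hs.1 hs.2
      exact hδ.le.trans (h3 j hj)
    exact closure_minimal this isClosed_Ici hmem
  · intro hj
    have : (fun s => u s j) '' S ⊆ Icc (-2) 0 := by
      rintro _ ⟨s, hs, rfl⟩
      obtain ⟨-, δ, hδ, h3⟩ := h.mem_stateSpace k hk s hs.1 hs.2
      exact ⟨by linarith [(h3 j hj).1], by linarith [(h3 j hj).2]⟩
    exact closure_minimal this isClosed_Icc hmem

/-- At a transition the sites beyond the new interface stay strictly in the negative phase. -/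
theorem neg_at_transition (h : IsSingleInterfaceSolution 1 u T) {k : ℤ} (hk : 1 ≤ k) {b : ℝ}
    (hb : T k = b) {j : ℤ} (hj : k < j) : u b j < 0 := by
  have hT : T (k - 1) ≠ ⊤ := fun h1 => by rw [h.eq_top hk h1] at hb; exact absurd hb (by simp)
  obtain ⟨s, hs1, hs2⟩ := EReal.lt_iff_exists_real_btwn.1 (h.T_lt hk hT)
  rw [hb] at hs2
  have hsb : s < b := by exact_mod_cast hs2
  have hs0 : 0 ≤ s := by exact_mod_cast (h.T_nonneg (k := k - 1) (by omega)).trans hs1.le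
  -- The integrating factor removes the diagonal term -2u_j. Both neighbours of a site beyond k are
  -- nonpositive, so the product cannot increase and stays strictly negative.
  set f : ℝ → ℝ := fun t => Real.exp (2 * t) * u t j with hf
  have hanti : AntitoneOn f (Icc s b) := by
    apply antitoneOn_of_deriv_nonpos (convex_Icc s b)
    · exact (by fun_prop : Continuous fun t => Real.exp (2 * t)).continuousOn.mul
        ((h.continuousOn_apply j).mono fun t ht => hs0.trans ht.1)
    · rw [interior_Icc]
      intro t ht
      have hd := (((hasDerivAt_id t).const_mul 2).exp).mul
        (h.hasDerivAt hk (hs1.trans (by exact_mod_cast ht.1)) (by rw [hb]; exact_mod_cast ht.2) j)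
      exact hd.differentiableAt.differentiableWithinAt
    · rw [interior_Icc]
      intro t ht
      have h1 : T (k - 1) < (t : EReal) := hs1.trans (by exact_mod_cast ht.1)
      have h2 : (t : EReal) < T k := by rw [hb]; exact_mod_cast ht.2
      have hd := (((hasDerivAt_id t).const_mul 2).exp).mul (h.hasDerivAt hk h1 h2 j)
      rw [show deriv f t = _ from hd.deriv]
      have e1 := ((h.sign_le hk hT h1.le h2.le (j + 1)).2 (by omega)).2
      have e2 := ((h.sign_le hk hT h1.le h2.le (j - 1)).2 (by omega)).2
      have e3 : lap (branch k (u t)) j = u t (j + 1) - 2 * u t j + u t (j - 1) := by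
        simp only [lap, branch]
        rw [if_neg (by omega), if_neg (by omega), if_neg (by omega)]; ring
      rw [e3]
      have := Real.exp_pos (2 * t)
      simp only [id]
      nlinarith
  have h3 := hanti ⟨le_rfl, hsb.le⟩ ⟨hsb.le, le_rfl⟩ hsb.le
  obtain ⟨-, δ, hδ, h4⟩ := h.mem_stateSpace k hk s hs1 (by rw [hb]; exact hs2)
  have h5 := (h4 j hj.le).2
  have h6 : f s < 0 := mul_neg_of_pos_of_neg (Real.exp_pos _) (by linarith)
  have h7 : f b < 0 := h3.trans_lt h6
  exact (pos_iff_neg_of_mul_neg h7).1 (Real.exp_pos _)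

/-- The phases at all times. -/
theorem sign_lt (h : IsSingleInterfaceSolution 1 u T) (h0 : u 0 ∈ stateSpace 1) {k : ℤ} (hk : 1 ≤ k) {t : ℝ}
    (h1 : T (k - 1) ≤ (t : EReal)) (h2 : (t : EReal) < T k) (j : ℤ) :
    (j < k → 0 ≤ u t j) ∧ (k ≤ j → u t j < 0) := by
  have hT : T (k - 1) ≠ ⊤ := (h1.trans_lt (EReal.coe_lt_top t)).ne
  refine ⟨(h.sign_le hk hT h1 h2.le j).1, fun hj => ?_⟩
  rcases h1.eq_or_lt with h3 | h3
  · rcases hk.eq_or_lt with h4 | h4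
    · subst h4
      rw [show T (1 - 1) = 0 from h.T_zero] at h3
      have : t = 0 := by exact_mod_cast h3.symm
      subst this
      obtain ⟨-, δ, hδ, h5⟩ := h0
      linarith [(h5 j hj).2]
    · exact h.neg_at_transition (k := k - 1) (by omega) h3 (by omega)
  · obtain ⟨-, δ, hδ, h5⟩ := h.mem_stateSpace k hk t h3 h2
    linarith [(h5 j hj).2]

theorem dPhi_eq (h : IsSingleInterfaceSolution 1 u T) (h0 : u 0 ∈ stateSpace 1) {k : ℤ} (hk : 1 ≤ k) {t : ℝ}
    (h1 : T (k - 1) ≤ (t : EReal)) (h2 : (t : EReal) < T k) (j : ℤ) :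
    dPhi (u t j) = branch k (u t) j :=
  dPhi_eq_branch (h.sign_lt h0 hk h1 h2 j).1 (h.sign_lt h0 hk h1 h2 j).2

/-- At the flip u_k = 0, so the affine formula for p_k passes from 1 to -1 while u stays continuous.
This drop is what generates the term -2g in the singular part. -/
theorem branch_succ_at_transition (h : IsSingleInterfaceSolution 1 u T) {k : ℤ} (hk : 1 ≤ k) {t : ℝ}
    (ht : T k = t) (j : ℤ) :
    branch (k + 1) (u t) j = branch k (u t) j - if j = k then 2 else 0 := by
  have h0 := (h.transition k hk t ht).1
  unfold branch
  rcases lt_trichotomy j k with hj | hj | hj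
  · rw [if_pos (by omega), if_pos hj, if_neg hj.ne, sub_zero]
  · subst hj; simp [h0]; norm_num
  · rw [if_neg (by omega), if_neg (by omega), if_neg hj.ne', sub_zero]

end IsSingleInterfaceSolution

/-! ### Barriers and separation of the transition times. -/

/-- The ramp is stationary away from its tip, so a small multiple of it is an upper barrier behind
the interface; the unit source at the tip represents the influx there. -/
theorem lap_ramp (n j : ℤ) : lap (fun j => max ((n : ℝ) - j) 0) j = if j = n then 1 else 0 := by
  simp only [lap]
  push_cast
  rcases lt_trichotomy j n with h | h | h
  · have : (j : ℝ) + 1 ≤ n := by exact_mod_cast h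
    rw [if_neg h.ne, max_eq_left (by linarith), max_eq_left (by linarith), max_eq_left (by linarith)]; ring
  · subst h
    rw [if_pos rfl, max_eq_right (by linarith), max_eq_right (by linarith), max_eq_left (by linarith)]; ring
  · have : (n : ℝ) + 1 ≤ j := by exact_mod_cast h
    rw [if_neg h.ne', max_eq_right (by linarith), max_eq_right (by linarith), max_eq_right (by linarith)]; ring

/-- The heat equation integrated in time. The point mass cancels the source of the ramp, so ramp
plus integrated kernel solves the heat equation on the whole lattice. -/
theorem lap_integral_heatKernel (j : ℤ) (t : ℝ) :
    lap (fun i => ∫ s in (0:ℝ)..t, heatKernel i s) j = heatKernel j t - if j = 0 then 1 else 0 := by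
  have h := intervalIntegral.integral_eq_sub_of_hasDerivAt (a := 0) (b := t)
    (fun s _ => hasDerivAt_heatKernel j s)
    (Continuous.intervalIntegrable (by
      unfold lap
      exact ((continuous_heatKernel _).sub ((continuous_heatKernel _).const_mul 2)).add
        (continuous_heatKernel _)) _ _)
  rw [heatKernel_zero] at h
  rw [← h]
  have hc := fun i => (continuous_heatKernel i).intervalIntegrable (μ := volume) 0 t
  unfold lap
  rw [intervalIntegral.integral_add ((hc _).sub ((hc _).const_mul 2)) (hc _),
    intervalIntegral.integral_sub (hc _) ((hc _).const_mul 2), intervalIntegral.integral_const_mul]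

namespace IsSingleInterfaceSolution

variable {u : ℝ → LInf} {T : ℤ → EReal} {α β ε : ℝ}

/-- Ahead of the interface u < 0 gives p ≤ 1. Behind it the gradient bound allows p to grow by at
most αε per site. -/
theorem initial_le (hd : IsMacroscopicData α β ε (u 0)) (hα : 0 ≤ α * ε) (j : ℤ) :
    branch 1 (u 0) j ≤ 1 + α * ε * max ((1 : ℤ) - j : ℝ) 0 := by
  have hX := hd.mem_stateSpace
  obtain ⟨⟨δ, hδ, h3⟩, δ', hδ', h4⟩ := hX
  have e : ∀ i, dPhi (u 0 i) = branch 1 (u 0) i := fun i =>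
    dPhi_eq_branch (fun hi => hδ.le.trans (h3 i hi)) fun hi => (h4 i hi).2.trans_lt (by linarith)
  have hpos : ∀ i : ℤ, 1 ≤ i → branch 1 (u 0) i ≤ 1 := fun i hi => by
    unfold branch; rw [if_neg (by omega)]; linarith [(h4 i hi).2]
  rcases le_or_gt 1 j with hj | hj
  · have : 0 ≤ max ((1 : ℤ) - j : ℝ) 0 := le_max_right _ _
    nlinarith [hpos j hj]
  · have key : ∀ n : ℕ, branch 1 (u 0) (1 - n) ≤ 1 + α * ε * n := by
      intro n
      induction n with
      | zero => simpa using hpos 1 le_rfl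
      | succ n ih =>
        have h5 := hd.grad (1 - (n + 1 : ℕ))
        rw [e, e, show (1 : ℤ) - (n + 1 : ℕ) + 1 = 1 - n by push_cast; ring] at h5
        have := (abs_le.1 h5).1
        push_cast at this ⊢
        linarith
    have := key (1 - j).toNat
    have hc : ((1 - j).toNat : ℤ) = 1 - j := Int.toNat_of_nonneg (by omega)
    have hc' : ((1 - j).toNat : ℝ) = 1 - j := by exact_mod_cast hc
    rw [hc, hc', show (1 : ℤ) - (1 - j) = j by ring] at this
    refine this.trans ?_
    push_cast
    have := le_max_left ((1 : ℝ) - j) 0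
    nlinarith

/-- One-sided bound behind the interface. -/
theorem branch_le (h : IsSingleInterfaceSolution 1 u T) (hd : IsMacroscopicData α β ε (u 0))
    (hα : 0 ≤ α * ε) {k : ℤ} (hk : 1 ≤ k) :
    T (k - 1) ≠ ⊤ → ∀ t : ℝ, T (k - 1) ≤ (t : EReal) → (t : EReal) ≤ T k → ∀ j,
    branch k (u t) j ≤ 1 + α * ε * max ((k : ℝ) - j) 0 := by
  -- one step: from the beginning of an interval to all its times
  have step : ∀ k : ℤ, 1 ≤ k → ∀ a : ℝ, T (k - 1) = a →
      (∀ j, branch k (u a) j ≤ 1 + α * ε * max ((k : ℝ) - j) 0) →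
      ∀ t : ℝ, T (k - 1) ≤ (t : EReal) → (t : EReal) ≤ T k → ∀ j,
      branch k (u t) j ≤ 1 + α * ε * max ((k : ℝ) - j) 0 := by
    intro k hk a ha hinit t h1 h2 j
    rw [ha] at h1
    have hT : T (k - 1) ≠ ⊤ := by rw [ha]; simp
    have hat : a ≤ t := by exact_mod_cast h1
    have ha0 : 0 ≤ a := by
      have := h.T_nonneg (k := k - 1) (by omega); rw [ha] at this; exact_mod_cast this
    obtain ⟨M, hM0, hM⟩ := h.exists_bound t
    have hmem : ∀ s ∈ Ioo a t, T (k - 1) < (s : EReal) ∧ (s : EReal) < T k := fun s hs =>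
      ⟨by rw [ha]; exact_mod_cast hs.1, lt_of_lt_of_le (by exact_mod_cast hs.2) h2⟩
    -- The comparison is made only behind the interface, where the ramp is linear; at all other
    -- sites the inequality p ≤ 1 follows from the phase.
    have := min_principle (a := a) (b := t) (M := M) {j | j < k}
      (fun t j => 1 + α * ε * max ((k : ℝ) - j) 0 - branch k (u t) j)
      (fun t j => -lap (branch k (u t)) j)
      (fun j => continuousOn_const.sub ((h.continuousOn_branch k j).mono fun s hs => ha0.trans hs.1))
      (fun j _ s hs => by
        have := (h.hasDerivAt_branch hk (hmem s hs).1 (hmem s hs).2 j).const_sub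
          (1 + α * ε * max ((k : ℝ) - j) 0)
        exact this)
      (fun j hj s hs => by
        have h3 := lap_ramp k j
        rw [if_neg (ne_of_lt hj)] at h3
        have h4 : lap (fun i => 1 + α * ε * max ((k : ℝ) - i) 0 - branch k (u s) i) j
            = α * ε * lap (fun i => max ((k : ℝ) - i) 0) j - lap (branch k (u s)) j := by
          unfold lap; ring
        rw [h4, h3]; linarith)
      (fun s hs j _ => by
        have h3 := (abs_le.1 (hM s ⟨ha0.trans hs.1, hs.2⟩ k j)).2
        have : 0 ≤ α * ε * max ((k : ℝ) - j) 0 := mul_nonneg hα (le_max_right _ _)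
        linarith)
      (fun s hs j hj => by
        have hj : k ≤ j := not_lt.1 hj
        have h3 := ((h.sign_le hk hT (t := s) (by rw [ha]; exact_mod_cast hs.1)
          (le_trans (by exact_mod_cast hs.2) h2) j).2 hj).2
        have : 0 ≤ α * ε * max ((k : ℝ) - j) 0 := mul_nonneg hα (le_max_right _ _)
        unfold branch
        rw [if_neg (not_lt.2 hj)]
        linarith)
      (fun j => by linarith [hinit j]) t ⟨hat, le_rfl⟩ j
    linarith
  induction k, hk using Int.leInduction with
  | base =>
    intro _
    exact step 1 le_rfl 0 (by simpa using h.T_zero) (fun j => initial_le hd hα j)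
  | succ k hk ih =>
    intro hT
    rw [add_sub_cancel_right] at hT
    have hT' : T (k - 1) ≠ ⊤ := fun h1 => hT (h.eq_top hk h1)
    have hc := h.coe_toReal (by omega) hT
    refine step (k + 1) (by omega) (T k).toReal (by rw [add_sub_cancel_right, hc]) fun j => ?_
    -- At a transition p can only drop and the ramp with tip moved to k+1 is larger, so the bound is
    -- inherited by the next interval.
    rw [h.branch_succ_at_transition hk hc.symm]
    have h1 := ih hT' (T k).toReal (by rw [hc]; exact (h.T_lt hk hT').le) (by rw [hc]) j
    have h2 : max ((k : ℝ) - j) 0 ≤ max (((k + 1 : ℤ) : ℝ) - j) 0 :=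
      max_le_max_right _ (by push_cast; linarith)
    have h3 : α * ε * max ((k : ℝ) - j) 0 ≤ α * ε * max (((k + 1 : ℤ) : ℝ) - j) 0 := by gcongr
    split_ifs <;> linarith

/-- Lower bound for the time between two transitions. -/
theorem separation (h : IsSingleInterfaceSolution 1 u T) (hd : IsMacroscopicData α β ε (u 0))
    (hα : 0 ≤ α * ε) {k : ℤ} (hk : 1 ≤ k) {a b : ℝ} (ha : T k = a) (hb : T (k + 1) = b) :
    1 / 40 ≤ α * ε * (b - a) := by
  have hT : T k ≠ ⊤ := by rw [ha]; simp
  have hT' : T (k - 1) ≠ ⊤ := fun h1 => hT (h.eq_top hk h1)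
  have hab : a < b := by
    have := h.T_lt (k := k + 1) (by omega) (by simpa using hT)
    rw [add_sub_cancel_right, ha, hb] at this
    exact_mod_cast this
  have ha0 : 0 ≤ a := by
    have := h.T_nonneg (k := k) (by omega); rw [ha] at this; exact_mod_cast this
  obtain ⟨M, hM0, hM⟩ := h.exists_bound b
  have hmem : ∀ s ∈ Ioo a b, T (k + 1 - 1) < (s : EReal) ∧ (s : EReal) < T (k + 1) := fun s hs =>
    ⟨by rw [add_sub_cancel_right, ha]; exact_mod_cast hs.1, by rw [hb]; exact_mod_cast hs.2⟩
  -- The accumulated influx through the kink of the ramp.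
  set G : ℝ → ℤ → ℝ := fun t j => ∫ s in (0:ℝ)..(t - a), heatKernel (j - k) s with hG
  have hGd : ∀ j t, HasDerivAt (fun t => G t j) (heatKernel (j - k) (t - a)) t := fun j t => by
    have h1 : HasDerivAt (fun x => ∫ s in (0:ℝ)..x, heatKernel (j - k) s) (heatKernel (j - k) (t - a)) (t - a) :=
      intervalIntegral.integral_hasDerivAt_right ((continuous_heatKernel _).intervalIntegrable _ _)
        ((continuous_heatKernel _).stronglyMeasurableAtFilter _ _) (continuous_heatKernel _).continuousAt
    have := h1.comp t ((hasDerivAt_id t).sub_const a)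
    simpa [Function.comp_def] using this
  have hGlap : ∀ j t, lap (G t) j = heatKernel (j - k) (t - a) - if j = k then 1 else 0 := fun j t => by
    have h1 := lap_comp_sub (fun i => ∫ s in (0:ℝ)..(t - a), heatKernel i s) j k
    rw [lap_integral_heatKernel] at h1
    simp only [sub_eq_zero] at h1
    exact h1
  -- The upper barrier solves the heat equation exactly: ramp with influx, minus twice the kernel
  -- emitted by the drop at site k. Since both sides solve the same linear equation, no sign
  -- information is needed and the comparison holds on the whole lattice.
  have key := min_principle (a := a) (b := b) (M := M + 2) univ
    (fun t j => 1 + α * ε * (max ((k : ℝ) - j) 0 + G t j) - 2 * heatKernel (j - k) (t - a)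
      - branch (k + 1) (u t) j)
    (fun t j => α * ε * heatKernel (j - k) (t - a) - 2 * lap (fun i => heatKernel (i - k) (t - a)) j
      - lap (branch (k + 1) (u t)) j)
    (fun j => by
      have h1 : Continuous (fun t => G t j) := continuous_iff_continuousAt.2 fun t => (hGd j t).continuousAt
      have h2 := continuous_heatKernel (j - k)
      refine ContinuousOn.sub (Continuous.continuousOn (by fun_prop)) ((h.continuousOn_branch _ j).mono fun s hs => ha0.trans hs.1))
    (fun j _ s hs => by
      have h1 := h.hasDerivAt_branch (k := k + 1) (by omega) (hmem s hs).1 (hmem s hs).2 j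
      have h2 := (hasDerivAt_heatKernel_shift j k a s).const_mul 2
      have h3 := ((hGd j s).const_add (max ((k : ℝ) - j) 0)).const_mul (α * ε)
      exact ((h3.const_add 1).sub h2).sub h1)
    (fun j _ s hs => by
      have h1 := lap_ramp k j
      have h2 := hGlap j s
      have h3 : α * ε * (lap (fun j => max ((k : ℝ) - j) 0) j + lap (G s) j) = α * ε * heatKernel (j - k) (s - a) := by
        rw [h1, h2]; ring
      rw [← h3]
      simp only [lap]
      apply le_of_eq; ring)
    (fun s hs j _ => by
      have h1 := (abs_le.1 (hM s ⟨ha0.trans hs.1, hs.2⟩ (k + 1) j)).2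
      have h2 := (abs_le.1 (abs_heatKernel_le_one (j - k) (sub_nonneg.2 hs.1))).2
      have h3 : 0 ≤ G s j := intervalIntegral.integral_nonneg (sub_nonneg.2 hs.1)
        fun x hx => heatKernel_nonneg _ hx.1
      have h4 : 0 ≤ α * ε * (max ((k : ℝ) - j) 0 + G s j) :=
        mul_nonneg hα (add_nonneg (le_max_right _ _) h3)
      linarith)
    (fun _ _ j hj => absurd (mem_univ j) hj)
    (fun j => by
      have h1 := h.branch_le hd hα hk hT' a (by rw [← ha]; exact (h.T_lt hk hT').le) (by rw [ha]) j
      have hjk : (j - k = 0) ↔ j = k := sub_eq_zero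
      have hG0 : G a j = 0 := by simp [hG]
      rw [h.branch_succ_at_transition hk ha, sub_self, heatKernel_zero, hG0, add_zero]
      simp only [hjk]
      split_ifs <;> linarith)
    b ⟨hab.le, le_rfl⟩ (k + 1)
  -- At time b the site k+1 has p = 1 on the branch before its flip, and the ramp vanishes there.
  -- The barrier thus reduces to the balance between influx and kernel at the nearest neighbour.
  have hu := (h.transition (k + 1) (by omega) b hb).1
  have hbr : branch (k + 1) (u b) (k + 1) = 1 := by simp [branch, hu]
  have hmax : max ((k : ℝ) - ((k + 1 : ℤ) : ℝ)) 0 = 0 := max_eq_right (by push_cast; linarith)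
  simp only [hbr, hmax, hG, add_sub_cancel_left, zero_add] at key
  exact le_mul_of_heatKernel_one_le (sub_pos.2 hab) hα (by linarith)

/-- Every time belongs to an interval between two transitions. -/
theorem exists_index (h : IsSingleInterfaceSolution 1 u T) (hd : IsMacroscopicData α β ε (u 0))
    (hα : 0 ≤ α * ε) {t : ℝ} (ht : 0 ≤ t) :
    ∃ n : ℤ, 0 ≤ n ∧ T n ≤ (t : EReal) ∧ (t : EReal) < T (n + 1) := by
  by_contra! hcon
  have hle : ∀ n : ℤ, 0 ≤ n → T n ≤ (t : EReal) := by
    intro n hn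
    induction n, hn using Int.leInduction with
    | base => rw [h.T_zero]; exact_mod_cast ht
    | succ n hn ih => exact hcon n hn ih
  have hne : ∀ n : ℤ, 0 ≤ n → T n ≠ ⊤ := fun n hn => ((hle n hn).trans_lt (EReal.coe_lt_top t)).ne
  -- If the time t were never passed, all transition times would be finite and at most t, although
  -- separation makes them grow at least linearly.
  have hgrow : ∀ n : ℕ, (n : ℝ) / 40 ≤ α * ε * (T (n + 1)).toReal := by
    intro n
    induction n with
    | zero =>
      simp only [Nat.cast_zero, zero_div]
      exact mul_nonneg hα (EReal.toReal_nonneg (h.T_nonneg (by omega)))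
    | succ n ih =>
      have := h.separation hd hα (k := (n : ℤ) + 1) (by omega) (h.coe_toReal (by omega) (hne _ (by omega))).symm
        (h.coe_toReal (k := (n : ℤ) + 1 + 1) (by omega) (hne _ (by omega))).symm
      push_cast
      linarith
  obtain ⟨n, hn⟩ := exists_nat_gt (40 * (α * ε * t))
  have h1 := hgrow n
  have h2 : (T (n + 1)).toReal ≤ t := by
    have := hle (n + 1) (by omega)
    rw [← h.coe_toReal (by omega) (hne _ (by omega))] at this
    exact_mod_cast this
  have h3 : α * ε * (T (n + 1)).toReal ≤ α * ε * t := by gcongr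
  linarith

end IsSingleInterfaceSolution


/-! ### Heat flow of bounded lattice data. -/

/-- The solution of the discrete heat equation with bounded initial data `f`. -/
noncomputable def heatFlow (f : ℤ → ℝ) (t : ℝ) (j : ℤ) : ℝ := ∑' k, heatKernel (j - k) t * f k

theorem summable_half_pow_natAbs (j : ℤ) : Summable fun k : ℤ => (1 / 2 : ℝ) ^ (j - k).natAbs := by
  have h : Summable fun k : ℤ => (1 / 2 : ℝ) ^ k.natAbs := by
    refine Summable.of_nat_of_neg (f := fun k : ℤ => (1 / 2 : ℝ) ^ k.natAbs) ?_ ?_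
    · simpa only [Int.natAbs_natCast] using summable_geometric_two
    · simpa only [Int.natAbs_neg, Int.natAbs_natCast] using summable_geometric_two
  exact h.comp_injective (Equiv.subLeft j).injective

theorem half_pow_natAbs_le (i j : ℤ) (h : (i - j).natAbs ≤ 1) :
    (1 / 2 : ℝ) ^ i.natAbs ≤ 2 * (1 / 2 : ℝ) ^ j.natAbs := by
  have h1 : j.natAbs ≤ i.natAbs + 1 := by omega
  have h2 : (1 / 2 : ℝ) ^ (i.natAbs + 1) ≤ (1 / 2 : ℝ) ^ j.natAbs :=
    pow_le_pow_of_le_one (by norm_num) (by norm_num) h1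
  rw [pow_succ] at h2; linarith

theorem abs_lap_heatKernel_le_geometric (j : ℤ) {t : ℝ} (ht : 0 ≤ t) :
    |lap (fun i => heatKernel i t) j| ≤ 6 * Real.exp (t / 2) * (1 / 2 : ℝ) ^ j.natAbs := by
  have h0 := heatKernel_nonneg j ht
  have h1 := heatKernel_nonneg (j + 1) ht
  have h2 := heatKernel_nonneg (j - 1) ht
  have h3 := heatKernel_le_geometric j ht
  have h4 := heatKernel_le_geometric (j + 1) ht
  have h5 := heatKernel_le_geometric (j - 1) ht
  have he := Real.exp_pos (t / 2)
  have h6 : Real.exp (t / 2) * (1 / 2 : ℝ) ^ (j + 1).natAbs ≤ Real.exp (t / 2) * (2 * (1 / 2 : ℝ) ^ j.natAbs) := by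
    gcongr; exact half_pow_natAbs_le _ _ (by omega)
  have h7 : Real.exp (t / 2) * (1 / 2 : ℝ) ^ (j - 1).natAbs ≤ Real.exp (t / 2) * (2 * (1 / 2 : ℝ) ^ j.natAbs) := by
    gcongr; exact half_pow_natAbs_le _ _ (by omega)
  have h8 : 0 ≤ Real.exp (t / 2) * (1 / 2 : ℝ) ^ j.natAbs := by positivity
  simp only [lap]
  exact abs_le.2 ⟨by linarith, by linarith⟩

variable {f : ℤ → ℝ} {M L : ℝ}

theorem summable_heatFlow (hf : ∀ k, |f k| ≤ M) (j : ℤ) {t : ℝ} (ht : 0 ≤ t) :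
    Summable fun k => heatKernel (j - k) t * f k := by
  refine Summable.of_norm_bounded ((hasSum_heatKernel_shift j ht).summable.mul_right M) fun k => ?_
  rw [Real.norm_eq_abs, abs_mul, abs_of_nonneg (heatKernel_nonneg _ ht)]
  exact mul_le_mul_of_nonneg_left (hf k) (heatKernel_nonneg _ ht)

theorem heatFlow_le_of_le (hf : ∀ k, |f k| ≤ M) {C : ℝ} (hC : ∀ k, f k ≤ C) (j : ℤ) {t : ℝ} (ht : 0 ≤ t) :
    heatFlow f t j ≤ C := by
  have h := (hasSum_heatKernel_shift j ht).mul_right C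
  rw [one_mul] at h
  exact hasSum_le (fun k => mul_le_mul_of_nonneg_left (hC k) (heatKernel_nonneg _ ht))
    (summable_heatFlow hf j ht).hasSum h

theorem heatFlow_neg (t : ℝ) (j : ℤ) : heatFlow (fun k => -f k) t j = -heatFlow f t j := by
  unfold heatFlow; simp only [mul_neg, tsum_neg]

theorem abs_heatFlow_le (hf : ∀ k, |f k| ≤ M) (j : ℤ) {t : ℝ} (ht : 0 ≤ t) : |heatFlow f t j| ≤ M := by
  have h1 := heatFlow_le_of_le hf (fun k => (abs_le.1 (hf k)).2) j ht
  have h2 := heatFlow_le_of_le (f := fun k => -f k) (M := M) (fun k => by rw [abs_neg]; exact hf k)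
    (C := M) (fun k => by linarith [(abs_le.1 (hf k)).1]) j ht
  rw [heatFlow_neg] at h2
  exact abs_le.2 ⟨by linarith, h1⟩

theorem heatFlow_zero (j : ℤ) : heatFlow f 0 j = f j := by
  unfold heatFlow
  rw [tsum_eq_single j]
  · simp [heatKernel_zero]
  · intro k hk
    rw [heatKernel_zero, if_neg (by omega), zero_mul]

theorem hasDerivAt_heatFlow (hf : ∀ k, |f k| ≤ M) (j : ℤ) {t : ℝ} (ht : 0 < t) :
    HasDerivAt (fun s => heatFlow f s j) (lap (heatFlow f t) j) t := by
  have hM : 0 ≤ M := (abs_nonneg _).trans (hf 0)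
  have h := hasDerivAt_tsum_of_isPreconnected (𝕜 := ℝ) (t := Ioo 0 (t + 1))
    (g := fun k s => heatKernel (j - k) s * f k)
    (g' := fun k s => lap (fun i => heatKernel i s) (j - k) * f k)
    (u := fun k => 6 * Real.exp ((t + 1) / 2) * (1 / 2 : ℝ) ^ (j - k).natAbs * M) (y₀ := t) (y := t)
    (((summable_half_pow_natAbs j).mul_left _).mul_right M) isOpen_Ioo isPreconnected_Ioo
    (fun k s _ => (hasDerivAt_heatKernel (j - k) s).mul_const (f k))
    (fun k s hs => by
      rw [Real.norm_eq_abs, abs_mul]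
      have h1 := abs_lap_heatKernel_le_geometric (j - k) hs.1.le
      have h2 : Real.exp (s / 2) ≤ Real.exp ((t + 1) / 2) := by
        apply Real.exp_le_exp.2; linarith [hs.2]
      have h3 := hf k
      calc _ ≤ 6 * Real.exp (s / 2) * (1 / 2 : ℝ) ^ (j - k).natAbs * M := by gcongr
        _ ≤ _ := by gcongr)
    ⟨ht, by linarith⟩ (summable_heatFlow hf j ht.le) ⟨ht, by linarith⟩
  refine HasDerivAt.congr_deriv (f := fun s => heatFlow f s j) h ?_
  have e : ∀ i, HasSum (fun k => heatKernel (i - k) t * f k) (heatFlow f t i) := fun i =>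
    (summable_heatFlow hf i ht.le).hasSum
  refine (((((e (j + 1)).sub ((e j).mul_left 2)).add (e (j - 1))).congr_fun fun k => ?_)).tsum_eq
  simp only [lap, show j + 1 - k = j - k + 1 by ring, show j - 1 - k = j - k - 1 by ring]
  ring

theorem continuousOn_heatFlow (hf : ∀ k, |f k| ≤ M) (j : ℤ) :
    ContinuousOn (fun t => heatFlow f t j) (Ici 0) := by
  have hM : 0 ≤ M := (abs_nonneg _).trans (hf 0)
  intro t ht
  have h : ContinuousOn (fun t => heatFlow f t j) (Icc 0 (t + 1)) := by
    apply continuousOn_tsum (u := fun k => Real.exp ((t + 1) / 2) * (1 / 2 : ℝ) ^ (j - k).natAbs * M)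
    · exact fun k => ((continuous_heatKernel _).mul_const _).continuousOn
    · exact ((summable_half_pow_natAbs j).mul_left _).mul_right M
    · intro k s hs
      rw [Real.norm_eq_abs, abs_mul, abs_of_nonneg (heatKernel_nonneg _ hs.1)]
      have h1 := heatKernel_le_geometric (j - k) hs.1
      have h2 : Real.exp (s / 2) ≤ Real.exp ((t + 1) / 2) := by
        apply Real.exp_le_exp.2; linarith [hs.2]
      have h3 := hf k
      calc _ ≤ Real.exp (s / 2) * (1 / 2 : ℝ) ^ (j - k).natAbs * M := by gcongr
        _ ≤ _ := by gcongr
  refine (h t ⟨ht, by linarith⟩).mono_of_mem_nhdsWithin ?_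
  rw [← Ici_inter_Iic]
  exact inter_mem_nhdsWithin _ (Iic_mem_nhds (by linarith))

theorem heatFlow_eq_tsum (t : ℝ) (j : ℤ) : heatFlow f t j = ∑' k, heatKernel k t * f (j - k) := by
  unfold heatFlow
  rw [← (Equiv.subLeft j).tsum_eq]
  simp

/-- The flow commutes with translations, so the difference is the flow of a translate of the data
minus the data, which is bounded by L|i - j|. -/
theorem abs_heatFlow_sub_le (hf : ∀ k, |f k| ≤ M) (hL : ∀ i j, |f i - f j| ≤ L * |(i : ℝ) - j|)
    (i j : ℤ) {t : ℝ} (ht : 0 ≤ t) : |heatFlow f t i - heatFlow f t j| ≤ L * |(i : ℝ) - j| := by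
  have hs : ∀ i, Summable fun k => heatKernel k t * f (i - k) := fun i =>
    summable_heatKernel_mul ht fun k => hf (i - k)
  have e : heatFlow f t i - heatFlow f t j = heatFlow (fun k => f (i - j + k) - f k) t j := by
    rw [heatFlow_eq_tsum, heatFlow_eq_tsum, heatFlow_eq_tsum, ← (hs i).tsum_sub (hs j)]
    congr 1; ext k
    rw [show i - j + (j - k) = i - k by ring]; ring
  rw [e]
  apply abs_heatFlow_le _ _ ht
  intro k
  refine (hL _ _).trans (le_of_eq ?_)
  push_cast; ring_nf

/-- The cone L|j - i|, which bounds the data seen from i, lies below the parabola L((j - i)²/(2l) +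
l/2), and adding 2τ to the square makes it a caloric barrier. The width l = √(2t) balances its two
terms at the final time. -/
theorem heatFlow_add_le (hf : ∀ k, |f k| ≤ M) (hL0 : 0 ≤ L)
    (hL : ∀ i j, |f i - f j| ≤ L * |(i : ℝ) - j|) (i : ℤ) {s t : ℝ} (hs : 0 ≤ s) (ht : 0 ≤ t) :
    heatFlow f (s + t) i ≤ heatFlow f s i + L * √(2 * t) := by
  rcases ht.eq_or_lt with rfl | ht
  · simp
  set l := √(2 * t) with hl
  have hlpos : 0 < l := Real.sqrt_pos.2 (by linarith)
  have hl2 : l * l = 2 * t := Real.mul_self_sqrt (by linarith)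
  have := min_principle (a := s) (b := s + t) (M := M + |heatFlow f s i|) univ
    (fun τ j => heatFlow f s i + L * (((j : ℝ) - i) ^ 2 + 2 * (τ - s)) / (2 * l) + L * l / 2 - heatFlow f τ j)
    (fun τ j => L * 2 / (2 * l) - lap (heatFlow f τ) j)
    (fun j => by
      refine ContinuousOn.sub (Continuous.continuousOn (by fun_prop))
        ((continuousOn_heatFlow hf j).mono fun x hx => hs.trans hx.1))
    (fun j _ τ hτ => by
      have h1 : HasDerivAt (fun τ => heatFlow f s i + L * (((j : ℝ) - i) ^ 2 + 2 * (τ - s)) / (2 * l) + L * l / 2)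
          (L * (2 * 1) / (2 * l)) τ :=
        ((((((hasDerivAt_id τ).sub_const s).const_mul 2).const_add _).const_mul L).div_const _ |>.const_add _).add_const _
      rw [mul_one] at h1
      exact h1.sub (hasDerivAt_heatFlow hf j (hs.trans_lt hτ.1)))
    (fun j _ τ hτ => by
      simp only [lap]; push_cast
      apply le_of_eq; field_simp; ring)
    (fun τ hτ j _ => by
      have h1 := (abs_le.1 (abs_heatFlow_le hf j (hs.trans hτ.1))).2
      have h2 := neg_abs_le (heatFlow f s i)
      have h3 : 0 ≤ L * (((j : ℝ) - i) ^ 2 + 2 * (τ - s)) / (2 * l) := by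
        have := sub_nonneg.2 hτ.1
        positivity
      have h4 : 0 ≤ L * l / 2 := by positivity
      linarith)
    (fun _ _ j hj => absurd (mem_univ j) hj)
    (fun j => by
      have h1 := (abs_le.1 (abs_heatFlow_sub_le hf hL j i hs)).2
      have h2 : |(j : ℝ) - i| ≤ ((j : ℝ) - i) ^ 2 / (2 * l) + l / 2 := by
        rw [← sq_abs]
        have := sq_nonneg (|(j : ℝ) - i| - l)
        rw [div_add_div _ _ (by positivity) two_ne_zero, le_div_iff₀ (by positivity)]
        nlinarith
      have h3 : L * |(j : ℝ) - i| ≤ L * (((j : ℝ) - i) ^ 2 / (2 * l) + l / 2) := by gcongr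
      have e : L * (((j : ℝ) - i) ^ 2 + 2 * (s - s)) / (2 * l) + L * l / 2 = L * (((j : ℝ) - i) ^ 2 / (2 * l) + l / 2) := by
        ring
      linarith)
    (s + t) ⟨by linarith, le_rfl⟩ i
  have e : L * (((i : ℝ) - i) ^ 2 + 2 * (s + t - s)) / (2 * l) = L * l / 2 := by
    rw [sub_self, add_sub_cancel_left, ← hl2]; field_simp; ring
  rw [e] at this
  linarith

theorem abs_heatFlow_time_sub_le (hf : ∀ k, |f k| ≤ M) (hL0 : 0 ≤ L)
    (hL : ∀ i j, |f i - f j| ≤ L * |(i : ℝ) - j|) (i : ℤ) {s t : ℝ} (hs : 0 ≤ s) (ht : 0 ≤ t) :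
    |heatFlow f t i - heatFlow f s i| ≤ L * √(2 * |t - s|) := by
  wlog hst : s ≤ t generalizing s t
  · rw [abs_sub_comm, abs_sub_comm t s]; exact this ht hs (le_of_not_ge hst)
  have h1 := heatFlow_add_le hf hL0 hL i hs (sub_nonneg.2 hst)
  have h2 := heatFlow_add_le (f := fun k => -f k) (M := M) (fun k => by rw [abs_neg]; exact hf k) hL0
    (fun i j => by rw [neg_sub_neg, abs_sub_comm]; exact hL i j) i hs (sub_nonneg.2 hst)
  rw [heatFlow_neg, heatFlow_neg] at h2
  rw [add_sub_cancel] at h1 h2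
  rw [abs_of_nonneg (sub_nonneg.2 hst)]
  exact abs_le.2 ⟨by linarith, by linarith⟩

/-! ### Uniqueness and the splitting into regular and singular part. -/

/-- Uniqueness of bounded solutions of the discrete heat equation. -/
theorem heat_unique {a b M : ℝ} (v : ℝ → ℤ → ℝ)
    (hcont : ∀ j, ContinuousOn (fun t => v t j) (Icc a b))
    (hderiv : ∀ j, ∀ t ∈ Ioo a b, HasDerivAt (fun s => v s j) (lap (v t) j) t)
    (hbd : ∀ t ∈ Icc a b, ∀ j, |v t j| ≤ M) (hinit : ∀ j, v a j = 0) :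
    ∀ t ∈ Icc a b, ∀ j, v t j = 0 := by
  intro t ht j
  apply le_antisymm
  · have := min_principle (a := a) (b := b) (M := M) univ (fun t j => -v t j) (fun t j => -lap (v t) j)
      (fun j => (hcont j).neg) (fun j _ t ht => (hderiv j t ht).neg)
      (fun j _ t _ => by simp only [lap]; linarith)
      (fun t ht j _ => by linarith [(abs_le.1 (hbd t ht j)).2])
      (fun _ _ j hj => absurd (mem_univ j) hj) (fun j => by simp [hinit j]) t ht j
    linarith
  · exact min_principle (a := a) (b := b) (M := M) univ v (fun t j => lap (v t) j)
      hcont (fun j _ t ht => hderiv j t ht) (fun j _ t _ => le_rfl)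
      (fun t ht j _ => (abs_le.1 (hbd t ht j)).1)
      (fun _ _ j hj => absurd (mem_univ j) hj) (fun j => (hinit j).ge) t ht j

theorem abs_dPhi_le (x : ℝ) : |dPhi x| ≤ |x| + 1 := by
  unfold dPhi sgn
  split_ifs
  · rw [sub_neg_eq_add]; exact (abs_add_le x 1).trans (by simp)
  · exact (abs_sub x 1).trans (by simp)

theorem abs_dPhi_apply_le (x : LInf) (j : ℤ) : |dPhi (x j)| ≤ ‖x‖ + 1 :=
  (abs_dPhi_le _).trans (by linarith [abs_apply_le x j])

theorem regularPart_eq_heatFlow (u : ℝ → LInf) (t : ℝ) (j : ℤ) :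
    regularPart u t j = heatFlow (fun k => dPhi (u 0 k)) t j := rfl

namespace IsSingleInterfaceSolution

variable {u : ℝ → LInf} {T : ℤ → EReal}

/-- On each closed interval between transitions `p` is the sum of its regular and singular part. -/
theorem branch_eq (h : IsSingleInterfaceSolution 1 u T) (h0 : u 0 ∈ stateSpace 1) {n : ℤ} (hn : 0 ≤ n) :
    T n ≠ ⊤ → ∀ t : ℝ, T n ≤ (t : EReal) → (t : EReal) ≤ T (n + 1) → ∀ j,
    branch (n + 1) (u t) j = regularPart u t j
      - 2 * ∑ k ∈ Finset.Icc 1 n, heatKernel (j - k) (t - (T k).toReal) := by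
  have step : ∀ n : ℤ, 0 ≤ n → ∀ a : ℝ, T n = a →
      (∀ j, branch (n + 1) (u a) j = regularPart u a j
        - 2 * ∑ k ∈ Finset.Icc 1 n, heatKernel (j - k) (a - (T k).toReal)) →
      ∀ t : ℝ, T n ≤ (t : EReal) → (t : EReal) ≤ T (n + 1) → ∀ j,
      branch (n + 1) (u t) j = regularPart u t j
        - 2 * ∑ k ∈ Finset.Icc 1 n, heatKernel (j - k) (t - (T k).toReal) := by
    intro n hn a ha hinit t h1 h2 j
    rw [ha] at h1
    have hat : a ≤ t := by exact_mod_cast h1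
    have ha0 : 0 ≤ a := by
      have := h.T_nonneg hn; rw [ha] at this; exact_mod_cast this
    obtain ⟨M, hM0, hM⟩ := h.exists_bound t
    have hmem : ∀ s ∈ Ioo a t, T (n + 1 - 1) < (s : EReal) ∧ (s : EReal) < T (n + 1) := fun s hs =>
      ⟨by rw [add_sub_cancel_right, ha]; exact_mod_cast hs.1, lt_of_lt_of_le (by exact_mod_cast hs.2) h2⟩
    have hTk : ∀ k ∈ Finset.Icc 1 n, (T k).toReal ≤ a := by
      intro k hk
      rw [Finset.mem_Icc] at hk
      have h3 := h.T_mono (k := k) (l := n) (by omega) hk.2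
      have h4 : T k ≠ ⊤ := (h3.trans_lt (by rw [ha]; exact EReal.coe_lt_top a)).ne
      rw [← h.coe_toReal (by omega) h4, ha] at h3
      exact_mod_cast h3
    have hq := abs_dPhi_apply_le (u 0)
    -- The difference of the two sides is a bounded solution of the heat equation that vanishes at
    -- the start of the interval, because the kernels emitted at earlier transitions are caloric
    -- there.
    have key := heat_unique (a := a) (b := t) (M := M + (‖u 0‖ + 1) + 2 * ∑ k ∈ Finset.Icc 1 n, 1)
      (fun t j => branch (n + 1) (u t) j - heatFlow (fun k => dPhi (u 0 k)) t j
        + 2 * ∑ k ∈ Finset.Icc 1 n, heatKernel (j - k) (t - (T k).toReal))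
      (fun j => by
        refine ContinuousOn.add (ContinuousOn.sub ((h.continuousOn_branch _ j).mono fun s hs => ha0.trans hs.1)
          ((continuousOn_heatFlow hq j).mono fun s hs => ha0.trans hs.1)) (Continuous.continuousOn ?_)
        refine continuous_const.mul (continuous_finsetSum _ fun k _ => ?_)
        exact (continuous_heatKernel _).comp (by fun_prop))
      (fun j s hs => by
        have e1 := h.hasDerivAt_branch (k := n + 1) (by omega) (hmem s hs).1 (hmem s hs).2 j
        have e2 := hasDerivAt_heatFlow hq j (ha0.trans_lt hs.1)
        have e3 := (HasDerivAt.fun_sum (u := Finset.Icc 1 n) (x := s)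
          (fun k _ => hasDerivAt_heatKernel_shift j k (T k).toReal s)).const_mul 2
        refine ((e1.sub e2).add e3).congr_deriv ?_
        simp only [lap, Finset.sum_add_distrib, Finset.sum_sub_distrib, ← Finset.mul_sum]
        ring)
      (fun s hs j => by
        have e1 := hM s ⟨ha0.trans hs.1, hs.2⟩ (n + 1) j
        have e2 := abs_heatFlow_le hq j (ha0.trans hs.1)
        have e3 : |2 * ∑ k ∈ Finset.Icc 1 n, heatKernel (j - k) (s - (T k).toReal)| ≤
            2 * ∑ k ∈ Finset.Icc 1 n, 1 := by
          rw [abs_mul, abs_two]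
          gcongr
          refine (Finset.abs_sum_le_sum_abs _ _).trans (Finset.sum_le_sum fun k hk => ?_)
          exact abs_heatKernel_le_one _ (sub_nonneg.2 ((hTk k hk).trans hs.1))
        refine (abs_add_le _ _).trans (add_le_add ((abs_sub _ _).trans (add_le_add e1 e2)) e3))
      (fun j => by
        have := hinit j
        rw [regularPart_eq_heatFlow] at this
        linarith)
      t ⟨hat, le_rfl⟩ j
    rw [regularPart_eq_heatFlow]
    linarith
  induction n, hn using Int.leInduction with
  | base =>
    intro _
    refine step 0 le_rfl 0 h.T_zero fun j => ?_
    rw [regularPart_eq_heatFlow, heatFlow_zero, h.dPhi_eq h0 (k := 1) le_rfl (by simpa using h.T_zero.le)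
      (by exact_mod_cast h.pos 1 le_rfl)]
    simp
  | succ n hn ih =>
    intro hT
    have hT' : T n ≠ ⊤ := fun h1 => hT (h.eq_top (by omega) (by simpa using h1))
    have hc := h.coe_toReal (k := n + 1) (by omega) hT
    refine step (n + 1) (by omega) _ hc.symm fun j => ?_
    -- The kernel added at this index has age zero and is a point mass, so twice its value is
    -- exactly the drop of p.
    rw [h.branch_succ_at_transition (by omega) hc.symm,
      ih hT' _ (by rw [hc]; exact h.T_mono hn (by omega)) hc.le,
      show Finset.Icc 1 (n + 1) = insert (n + 1) (Finset.Icc 1 n) by ext; simp; omega,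
      Finset.sum_insert (by simp), sub_self, heatKernel_zero]
    simp only [sub_eq_zero]
    split_ifs <;> ring

theorem T_le_iff (h : IsSingleInterfaceSolution 1 u T) {n k : ℤ} (hn : 0 ≤ n) (hk : 0 ≤ k) {t : ℝ}
    (h1 : T n ≤ (t : EReal)) (h2 : (t : EReal) < T (n + 1)) : T k ≤ (t : EReal) ↔ k ≤ n := by
  constructor
  · intro h3
    by_contra! h4
    exact absurd (h3.trans_lt h2) (not_lt.2 (h.T_mono (by omega) h4))
  · exact fun h3 => (h.T_mono hk h3).trans h1

theorem singularPart_eq (h : IsSingleInterfaceSolution 1 u T) {n : ℤ} (hn : 0 ≤ n) {t : ℝ}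
    (h1 : T n ≤ (t : EReal)) (h2 : (t : EReal) < T (n + 1)) (j : ℤ) :
    singularPart T t j = -2 * ∑ k ∈ Finset.Icc 1 n, heatKernel (j - k) (t - (T k).toReal) := by
  unfold singularPart
  rw [← finsum_mem_coe_finset]
  have e : {k : ℤ | 1 ≤ k ∧ T k ≤ (t : EReal)} = ((Finset.Icc 1 n : Finset ℤ) : Set ℤ) := by
    ext k
    simp only [mem_ofPred_eq, Finset.coe_Icc, mem_Icc]
    exact and_congr_right fun hk => h.T_le_iff hn (by omega) h1 h2
  rw [e]

theorem dPhi_eq_add (h : IsSingleInterfaceSolution 1 u T) (h0 : u 0 ∈ stateSpace 1) {n : ℤ} (hn : 0 ≤ n) {t : ℝ}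
    (h1 : T n ≤ (t : EReal)) (h2 : (t : EReal) < T (n + 1)) (j : ℤ) :
    dPhi (u t j) = regularPart u t j + singularPart T t j := by
  rw [h.dPhi_eq h0 (k := n + 1) (by omega) (by simpa using h1) h2, h.singularPart_eq hn h1 h2,
    h.branch_eq h0 hn (h1.trans_lt (EReal.coe_lt_top t)).ne t h1 h2.le]
  ring

end IsSingleInterfaceSolution


/-! ### The regularized kernel -/

section RegKernel

variable {d ε : ℝ}

/-- The time weight that controls the modulus of continuity of the regularized kernel. -/
noncomputable def kernelWeight (d ε τ : ℝ) : ℝ := if τ ≤ 0 then 0 else (max τ (d * ε)) ^ (-(3 / 4) : ℝ)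

theorem kernelWeight_nonneg (d ε : ℝ) (τ : ℝ) : 0 ≤ kernelWeight d ε τ := by
  unfold kernelWeight
  split_ifs with h
  · exact le_rfl
  · exact Real.rpow_nonneg (le_max_of_le_left (not_le.1 h).le) _

theorem regKernel_of_nonpos {τ : ℝ} (h : τ ≤ 0) (j : ℤ) : regKernel d ε τ j = 0 := if_pos h

theorem regKernel_of_mem {τ : ℝ} (h0 : 0 ≤ τ) (h : τ ≤ d * ε) (j : ℤ) :
    regKernel d ε τ j = τ / (d * ε) * heatKernel j (d * ε / ε ^ 2) := by
  unfold regKernel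
  split_ifs with h1
  · rw [le_antisymm h1 h0]; simp
  · rfl

theorem regKernel_of_le (hd : 0 < d) (hε : 0 < ε) {τ : ℝ} (h : d * ε ≤ τ) (j : ℤ) :
    regKernel d ε τ j = heatKernel j (τ / ε ^ 2) := by
  have hpos : 0 < d * ε := mul_pos hd hε
  rcases h.eq_or_lt with rfl | h
  · rw [regKernel_of_mem hpos.le le_rfl, div_self hpos.ne', one_mul]
  · unfold regKernel
    rw [if_neg (by linarith), if_neg (by linarith)]

/-- The regularized kernel is a multiple, with factor in `[0, 1]`, of the heat kernel. -/
theorem regKernel_eq_mul (hd : 0 < d) (hε : 0 < ε) (τ : ℝ) (hτ : 0 < τ) :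
    ∃ c, 0 ≤ c ∧ c ≤ 1 ∧ ∀ j, regKernel d ε τ j = c * heatKernel j (max τ (d * ε) / ε ^ 2) := by
  have hpos : 0 < d * ε := mul_pos hd hε
  rcases le_total τ (d * ε) with h | h
  · exact ⟨τ / (d * ε), by positivity, by rwa [div_le_one hpos], fun j => by
      rw [regKernel_of_mem hτ.le h, max_eq_right h]⟩
  · exact ⟨1, zero_le_one, le_rfl, fun j => by rw [regKernel_of_le hd hε h, max_eq_left h, one_mul]⟩

theorem regKernel_nonneg (hd : 0 < d) (hε : 0 < ε) (τ : ℝ) (j : ℤ) : 0 ≤ regKernel d ε τ j := by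
  rcases le_or_gt τ 0 with h | h
  · rw [regKernel_of_nonpos h]
  · obtain ⟨c, hc0, -, hc⟩ := regKernel_eq_mul hd hε τ h
    rw [hc]
    exact mul_nonneg hc0 (heatKernel_nonneg _ (by positivity))

theorem hasSum_regKernel (hd : 0 < d) (hε : 0 < ε) (τ : ℝ) (k : ℤ) :
    ∃ c, 0 ≤ c ∧ c ≤ 1 ∧ HasSum (fun j => regKernel d ε τ (j - k)) c := by
  rcases le_or_gt τ 0 with h | h
  · exact ⟨0, le_rfl, zero_le_one, by simp only [regKernel_of_nonpos h]; exact hasSum_zero⟩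
  · obtain ⟨c, hc0, hc1, hc⟩ := regKernel_eq_mul hd hε τ h
    refine ⟨c, hc0, hc1, ?_⟩
    simp only [hc]
    simpa using (hasSum_heatKernel_shift' k (t := max τ (d * ε) / ε ^ 2) (by positivity)).mul_left c

theorem regKernel_le_one (hd : 0 < d) (hε : 0 < ε) (τ : ℝ) (j : ℤ) : regKernel d ε τ j ≤ 1 := by
  obtain ⟨c, -, hc1, hc⟩ := hasSum_regKernel hd hε τ 0
  have := le_hasSum hc j fun i _ => regKernel_nonneg hd hε τ _
  rw [sub_zero] at this
  linarith

theorem abs_mul_regKernel_le (hd : 0 < d) (hε : 0 < ε) (τ : ℝ) (j : ℤ) :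
    |(j : ℝ)| * regKernel d ε τ j ≤ 2 := by
  rcases le_or_gt τ 0 with h | h
  · rw [regKernel_of_nonpos h]; simp
  · obtain ⟨c, hc0, hc1, hc⟩ := regKernel_eq_mul hd hε τ h
    rw [hc]
    have := abs_mul_heatKernel_le j (t := max τ (d * ε) / ε ^ 2) (by positivity)
    have h0 := heatKernel_nonneg j (t := max τ (d * ε) / ε ^ 2) (by positivity)
    have h1 : 0 ≤ |(j : ℝ)| * heatKernel j (max τ (d * ε) / ε ^ 2) := by positivity
    nlinarith

/-- The bound 1/(2√t) in macroscopic time: the parabolic scaling produces one factor ε. -/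
theorem heatKernel_div_le (hε : 0 < ε) {τ : ℝ} (hτ : 0 < τ) (j : ℤ) :
    heatKernel j (τ / ε ^ 2) ≤ ε * τ ^ (-(1 / 2) : ℝ) := by
  refine (heatKernel_le j (by positivity)).trans ?_
  rw [Real.sqrt_div hτ.le, Real.sqrt_sq hε.le, Real.rpow_neg hτ.le, ← Real.sqrt_eq_rpow]
  have : 0 < √τ := Real.sqrt_pos.2 hτ
  rw [← div_eq_mul_inv, div_le_div_iff₀ (by positivity) this]
  field_simp
  norm_num

/-- This is the bound 2/t^(3/2) at microscopic time t = max(τ, dε)/ε²; the cut-off factor is at most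
1. The weight is squared because it is the -3/4 power. -/
theorem sum_sq_grad_regKernel_le (hd : 0 < d) (hε : 0 < ε) (τ : ℝ) (k : ℤ) :
    Summable (fun j => (regKernel d ε τ (j + 1 - k) - regKernel d ε τ (j - k)) ^ 2) ∧
    ∑' j, (regKernel d ε τ (j + 1 - k) - regKernel d ε τ (j - k)) ^ 2 ≤ 2 * ε ^ 3 * kernelWeight d ε τ ^ 2 := by
  suffices h : Summable (fun j => (regKernel d ε τ (j + 1) - regKernel d ε τ j) ^ 2) ∧
      ∑' j, (regKernel d ε τ (j + 1) - regKernel d ε τ j) ^ 2 ≤ 2 * ε ^ 3 * kernelWeight d ε τ ^ 2 by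
    have e : (fun j => (regKernel d ε τ (j + 1 - k) - regKernel d ε τ (j - k)) ^ 2) =
        (fun j => (regKernel d ε τ (j + 1) - regKernel d ε τ j) ^ 2) ∘ (Equiv.subRight k) := by
      ext j; simp [show j + 1 - k = j - k + 1 by ring]
    rw [e]
    exact ⟨(Equiv.subRight k).summable_iff.2 h.1, ((Equiv.subRight k).tsum_eq
      (fun j => (regKernel d ε τ (j + 1) - regKernel d ε τ j) ^ 2)).le.trans h.2⟩
  rcases le_or_gt τ 0 with h | h
  · simp [regKernel_of_nonpos h, kernelWeight, h, summable_zero]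
  · obtain ⟨c, hc0, hc1, hc⟩ := regKernel_eq_mul hd hε τ h
    have hm : 0 < max τ (d * ε) := lt_max_of_lt_left h
    obtain ⟨h1, h2⟩ := sum_sq_grad_heatKernel_le (t := max τ (d * ε) / ε ^ 2) (by positivity)
    set m := max τ (d * ε) with hmdef
    have e : (fun j => (regKernel d ε τ (j + 1) - regKernel d ε τ j) ^ 2) = fun j =>
        c ^ 2 * (heatKernel (j + 1) (m / ε ^ 2) - heatKernel j (m / ε ^ 2)) ^ 2 := by
      ext j; rw [hc, hc]; ring
    rw [e]
    refine ⟨h1.mul_left _, ?_⟩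
    rw [tsum_mul_left]
    have h3 : 2 / (m / ε ^ 2 * √(m / ε ^ 2)) = 2 * ε ^ 3 * kernelWeight d ε τ ^ 2 := by
      have hw : kernelWeight d ε τ = m ^ (-(3 / 4) : ℝ) := by rw [kernelWeight, if_neg (not_le.2 h)]
      rw [hw, ← Real.rpow_natCast (m ^ (-(3 / 4) : ℝ)) 2, ← Real.rpow_mul hm.le, Real.sqrt_div hm.le, Real.sqrt_sq hε.le]
      rw [show (-(3 / 4) : ℝ) * ((2 : ℕ) : ℝ) = -(1 + 1 / 2) by norm_num, Real.rpow_neg hm.le, Real.rpow_add hm,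
        Real.rpow_one, ← Real.sqrt_eq_rpow]
      have : 0 < √m := Real.sqrt_pos.2 hm
      field_simp
    rw [← h3]
    have h4 : 0 ≤ ∑' j, (heatKernel (j + 1) (m / ε ^ 2) - heatKernel j (m / ε ^ 2)) ^ 2 :=
      tsum_nonneg fun j => sq_nonneg _
    have h5 : c ^ 2 ≤ 1 := by nlinarith
    nlinarith

/-- On the linear ramp the relative increment lies in [0, 1] and is therefore at most its own power
1/4, which puts the estimate into the same form as that for later times. -/
theorem abs_regKernel_sub_le_of_linear (hd : 0 < d) (hε : 0 < ε) (j : ℤ) {a b : ℝ} (ha : 0 ≤ a) (hab : a ≤ b)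
    (hb : b ≤ d * ε) :
    |regKernel d ε b j - regKernel d ε a j| ≤ ε * (b - a) ^ (1 / 4 : ℝ) * (d * ε) ^ (-(3 / 4) : ℝ) := by
  have hpos : 0 < d * ε := mul_pos hd hε
  rw [regKernel_of_mem ha (hab.trans hb), regKernel_of_mem (ha.trans hab) hb, ← sub_mul, ← sub_div,
    abs_mul, abs_of_nonneg (heatKernel_nonneg _ (by positivity)),
    abs_of_nonneg (div_nonneg (sub_nonneg.2 hab) hpos.le)]
  have hx0 : 0 ≤ (b - a) / (d * ε) := div_nonneg (sub_nonneg.2 hab) hpos.le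
  have hx1 : (b - a) / (d * ε) ≤ 1 := by rw [div_le_one hpos]; linarith
  have h1 : (b - a) / (d * ε) ≤ ((b - a) / (d * ε)) ^ (1 / 4 : ℝ) := by
    conv_lhs => rw [← Real.rpow_one ((b - a) / (d * ε))]
    exact Real.rpow_le_rpow_of_exponent_ge_of_imp hx0 hx1 (by norm_num) (fun _ h => by norm_num at h)
  calc _ ≤ ((b - a) / (d * ε)) ^ (1 / 4 : ℝ) * (ε * (d * ε) ^ (-(1 / 2) : ℝ)) := by
        gcongr; · exact heatKernel_nonneg _ (by positivity)
        · exact heatKernel_div_le hε hpos j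
    _ = _ := by
        rw [Real.div_rpow (sub_nonneg.2 hab) hpos.le, show (-(3 / 4) : ℝ) = -(1 / 2) + -(1 / 4) by norm_num,
          Real.rpow_add hpos, Real.rpow_neg hpos.le (1 / 4)]
        field_simp

theorem abs_regKernel_sub_le_of_le (hd : 0 < d) (hε : 0 < ε) (j : ℤ) {a b : ℝ} (ha : d * ε ≤ a) (hab : a ≤ b) :
    |regKernel d ε b j - regKernel d ε a j| ≤ 2 * ε * (b - a) ^ (1 / 4 : ℝ) * a ^ (-(3 / 4) : ℝ) := by
  have hpos : 0 < d * ε := mul_pos hd hε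
  have ha0 : 0 < a := hpos.trans_le ha
  rw [regKernel_of_le hd hε ha, regKernel_of_le hd hε (ha.trans hab)]
  refine (abs_heatKernel_sub_le j (a := a / ε ^ 2) (by positivity) (by gcongr)).trans (le_of_eq ?_)
  rw [← sub_div, Real.div_rpow (sub_nonneg.2 hab) (by positivity), Real.div_rpow ha0.le (by positivity),
    Real.rpow_neg (by positivity : 0 ≤ ε ^ 2)]
  have e : ((ε ^ 2) ^ (3 / 4 : ℝ)) = ε * (ε ^ 2) ^ (1 / 4 : ℝ) := by
    rw [show (3 / 4 : ℝ) = 1 / 2 + 1 / 4 by norm_num, Real.rpow_add (by positivity), ← Real.sqrt_eq_rpow,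
      Real.sqrt_sq hε.le]
  rw [e]
  have : 0 < (ε ^ 2) ^ (1 / 4 : ℝ) := by positivity
  field_simp

/-- Temporal modulus of continuity of the regularized kernel. -/
theorem abs_regKernel_sub_le (hd : 0 < d) (hε : 0 < ε) (j : ℤ) (a b : ℝ) :
    |regKernel d ε b j - regKernel d ε a j| ≤
      3 * ε * |b - a| ^ (1 / 4 : ℝ) * (kernelWeight d ε a + kernelWeight d ε b) := by
  have hpos : 0 < d * ε := mul_pos hd hε
  wlog hab : a ≤ b generalizing a b
  · rw [abs_sub_comm, abs_sub_comm b a, add_comm (kernelWeight d ε a)]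
    exact this b a (le_of_not_ge hab)
  have hWa := kernelWeight_nonneg d ε a
  have hWb := kernelWeight_nonneg d ε b
  rw [abs_of_nonneg (sub_nonneg.2 hab)]
  have hX : 0 ≤ (b - a) ^ (1 / 4 : ℝ) := Real.rpow_nonneg (sub_nonneg.2 hab) _
  have hεX : 0 ≤ ε * (b - a) ^ (1 / 4 : ℝ) := by positivity
  rcases le_or_gt b 0 with hb | hb
  · rw [regKernel_of_nonpos hb, regKernel_of_nonpos (hab.trans hb)]
    simp only [sub_self, abs_zero]; positivity
  have eb : kernelWeight d ε b = (max b (d * ε)) ^ (-(3 / 4) : ℝ) := if_neg (not_le.2 hb)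
  rcases le_or_gt a 0 with ha | ha
  · rw [regKernel_of_nonpos ha, sub_zero]
    have hba : b ^ (1 / 4 : ℝ) ≤ (b - a) ^ (1 / 4 : ℝ) := by gcongr; linarith
    rcases le_total b (d * ε) with h | h
    · have := abs_regKernel_sub_le_of_linear hd hε j le_rfl hb.le h
      rw [regKernel_of_nonpos le_rfl, sub_zero, sub_zero] at this
      rw [max_eq_right h] at eb
      rw [← eb] at this
      have h2 : ε * b ^ (1 / 4 : ℝ) * kernelWeight d ε b ≤ ε * (b - a) ^ (1 / 4 : ℝ) * kernelWeight d ε b := by gcongr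
      nlinarith [mul_nonneg hεX hWa, mul_nonneg hεX hWb]
    · rw [regKernel_of_le hd hε h, abs_of_nonneg (heatKernel_nonneg _ (by positivity))]
      rw [max_eq_left h] at eb
      have := heatKernel_div_le hε hb j
      -- Here the earlier value is zero, and a quarter power of the age is traded for a quarter
      -- power of the time increment, which is at least the age.
      rw [show (-(1 / 2) : ℝ) = 1 / 4 + -(3 / 4) by norm_num, Real.rpow_add hb, ← eb] at this
      have h2 : b ^ (1 / 4 : ℝ) * kernelWeight d ε b ≤ (b - a) ^ (1 / 4 : ℝ) * kernelWeight d ε b := by gcongr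
      nlinarith [mul_nonneg hεX hWa, mul_nonneg hεX hWb]
  have ea : kernelWeight d ε a = (max a (d * ε)) ^ (-(3 / 4) : ℝ) := if_neg (not_le.2 ha)
  rcases le_total b (d * ε) with h | h
  · have := abs_regKernel_sub_le_of_linear hd hε j ha.le hab h
    rw [max_eq_right h] at eb
    rw [← eb] at this
    nlinarith [mul_nonneg hεX hWa, mul_nonneg hεX hWb]
  -- When the switching time dε lies between a and b, the increment is split there; both parts carry
  -- the weight at a.
  rcases le_total a (d * ε) with h' | h'
  · have h1 := abs_regKernel_sub_le_of_linear hd hε j ha.le h' le_rfl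
    have h2 := abs_regKernel_sub_le_of_le hd hε j le_rfl h
    rw [max_eq_right h'] at ea
    rw [← ea] at h1 h2
    have h3 := abs_sub_le (regKernel d ε b j) (regKernel d ε (d * ε) j) (regKernel d ε a j)
    have h4 : ε * (d * ε - a) ^ (1 / 4 : ℝ) * kernelWeight d ε a ≤ ε * (b - a) ^ (1 / 4 : ℝ) * kernelWeight d ε a := by
      gcongr
    have h5 : 2 * ε * (b - d * ε) ^ (1 / 4 : ℝ) * kernelWeight d ε a ≤ 2 * ε * (b - a) ^ (1 / 4 : ℝ) * kernelWeight d ε a := by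
      gcongr
    nlinarith [mul_nonneg hεX hWa, mul_nonneg hεX hWb]
  · have h1 := abs_regKernel_sub_le_of_le hd hε j h' hab
    rw [max_eq_left h'] at ea
    rw [← ea] at h1
    nlinarith [mul_nonneg hεX hWa, mul_nonneg hεX hWb]

end RegKernel

/-! ### Superpositions of regularized kernels -/

/-- Comparison with the integral of x^(-3/4), done algebraically: for fourth roots x and y of n and
n+1, the identity y⁴ - x⁴ = 1 gives 1/y³ ≤ 4(y - x). -/
theorem sum_rpow_le (n : ℕ) : ∑ i ∈ Finset.range (n + 1), (max 1 (i : ℝ)) ^ (-(3 / 4) : ℝ) ≤ 1 + 4 * (n : ℝ) ^ (1 / 4 : ℝ) := by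
  induction n with
  | zero => simp
  | succ n ih =>
    rw [Finset.sum_range_succ]
    have hn : (0 : ℝ) ≤ n := Nat.cast_nonneg n
    rw [max_eq_right (by push_cast; linarith : (1 : ℝ) ≤ ((n + 1 : ℕ) : ℝ))]
    push_cast
    set y := ((n : ℝ) + 1) ^ (1 / 4 : ℝ) with hy
    set x := (n : ℝ) ^ (1 / 4 : ℝ) with hx
    have hy4 : y ^ 4 = n + 1 := by
      rw [hy, ← Real.rpow_natCast, ← Real.rpow_mul (by linarith)]; norm_num
    have hx4 : x ^ 4 = n := by
      rw [hx, ← Real.rpow_natCast, ← Real.rpow_mul (by linarith)]; norm_num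
    have hx0 : 0 ≤ x := Real.rpow_nonneg hn _
    have hy0 : 0 < y := by positivity
    have hxy : x ≤ y := by rw [hx, hy]; gcongr; linarith
    have e : ((n : ℝ) + 1) ^ (-(3 / 4) : ℝ) = 1 / y ^ 3 := by
      rw [hy, ← Real.rpow_natCast, ← Real.rpow_mul (by linarith), Real.rpow_neg (by linarith), one_div]; norm_num
    rw [e]
    have h1 : 1 ≤ 4 * (y - x) * y ^ 3 := by
      have h2 : y ^ 4 - x ^ 4 = (y - x) * (y ^ 3 + y ^ 2 * x + y * x ^ 2 + x ^ 3) := by ring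
      have h3 : y ^ 3 + y ^ 2 * x + y * x ^ 2 + x ^ 3 ≤ 4 * y ^ 3 := by
        have : y ^ 2 * x ≤ y ^ 2 * y := by gcongr
        have : y * x ^ 2 ≤ y * y ^ 2 := by gcongr
        have : x ^ 3 ≤ y ^ 3 := by gcongr
        nlinarith
      have h4 : (y - x) * (y ^ 3 + y ^ 2 * x + y * x ^ 2 + x ^ 3) ≤ (y - x) * (4 * y ^ 3) :=
        mul_le_mul_of_nonneg_left h3 (sub_nonneg.2 hxy)
      nlinarith
    have h5 : 1 / y ^ 3 ≤ 4 * (y - x) := by rw [div_le_iff₀ (by positivity)]; linarith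
    linarith

/-- Separated macroscopic transition times. -/
structure Separated (d ε τfin : ℝ) (F : Finset ℤ) (σ : ℤ → ℝ) : Prop where
  nonneg : ∀ k ∈ F, 0 ≤ σ k
  le : ∀ k ∈ F, σ k ≤ τfin
  sep : ∀ k ∈ F, ∀ l ∈ F, k ≤ l → 4 * d * ε * ((l : ℝ) - k) ≤ σ l - σ k

section Superposition

variable {d ε τfin : ℝ} {F : Finset ℤ} {σ : ℤ → ℝ}

/-- The bound for the sum of all weights. -/
noncomputable def weightBound (d τfin : ℝ) : ℝ := d ^ (-(3 / 4) : ℝ) * (1 + 4 * (τfin / (4 * d)) ^ (1 / 4 : ℝ))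

theorem weightBound_nonneg (hd : 0 < d) (hτ : 0 ≤ τfin) : 0 ≤ weightBound d τfin := by
  unfold weightBound; positivity

/-- Counting back from the latest transition m before τ, the age of transition k is at least 4dε(m -
k). The weights are thus dominated by (dε)^(-3/4)·max(1, m - k)^(-3/4), with at most τfin/(4dε) + 1
terms. Their sum is of order ε^(-3/4)·ε^(-1/4), and the prefactor ε makes it bounded. -/
theorem sum_kernelWeight_le (hs : Separated d ε τfin F σ) (hd : 0 < d) (hε : 0 < ε) (hε1 : ε ≤ 1)
    (hτfin : 0 ≤ τfin) (τ : ℝ) :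
    ε * ∑ k ∈ F, kernelWeight d ε (τ - σ k) ≤ weightBound d τfin := by
  classical
  have hpos : 0 < d * ε := mul_pos hd hε
  have e1 : ∑ k ∈ F, kernelWeight d ε (τ - σ k) = ∑ k ∈ F.filter (fun k => σ k < τ), kernelWeight d ε (τ - σ k) := by
    rw [Finset.sum_filter]
    refine Finset.sum_congr rfl fun k _ => ?_
    split_ifs with h
    · rfl
    · exact if_pos (by linarith)
  rw [e1]
  set A := F.filter (fun k => σ k < τ) with hA
  rcases A.eq_empty_or_nonempty with hAe | hAne
  · rw [hAe]; simpa using weightBound_nonneg hd hτfin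
  set m := A.max' hAne with hm
  have hmA : m ∈ A := A.max'_mem hAne
  have hmF := Finset.mem_filter.1 hmA
  set N : ℕ := ⌊τfin / (4 * d * ε)⌋₊ with hN
  have hk : ∀ k ∈ A, k ≤ m ∧ (m - k).toNat ≤ N ∧
      kernelWeight d ε (τ - σ k) ≤ (d * ε) ^ (-(3 / 4) : ℝ) * (max 1 (((m - k).toNat : ℕ) : ℝ)) ^ (-(3 / 4) : ℝ) := by
    intro k hkA
    have hkF := Finset.mem_filter.1 hkA
    have hkm : k ≤ m := A.le_max' k hkA
    have hsep := hs.sep k hkF.1 m hmF.1 hkm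
    have hcast : (((m - k).toNat : ℕ) : ℝ) = (m : ℝ) - k := by
      have : ((m - k).toNat : ℤ) = m - k := Int.toNat_of_nonneg (by omega)
      exact_mod_cast this
    refine ⟨hkm, ?_, ?_⟩
    · apply Nat.le_floor
      rw [hcast, le_div_iff₀ (by positivity)]
      have := hs.nonneg k hkF.1
      have := hs.le m hmF.1
      linarith
    · rw [kernelWeight, if_neg (by linarith [hkF.2]), hcast, ← Real.mul_rpow hpos.le (by positivity)]
      have hmk : (0 : ℝ) ≤ (m : ℝ) - k := by rw [← hcast]; positivity
      apply Real.rpow_le_rpow_of_nonpos (by positivity) _ (by norm_num)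
      rw [mul_max_of_nonneg _ _ hpos.le]
      apply max_le
      · rw [mul_one]; exact le_max_right _ _
      · refine le_max_of_le_left ?_
        have := hmF.2
        nlinarith [mul_nonneg hpos.le hmk]
  have h2 : ∑ k ∈ A, kernelWeight d ε (τ - σ k) ≤ (d * ε) ^ (-(3 / 4) : ℝ) *
      ∑ i ∈ Finset.range (N + 1), (max 1 (i : ℝ)) ^ (-(3 / 4) : ℝ) := by
    refine (Finset.sum_le_sum fun k hkA => (hk k hkA).2.2).trans ?_
    rw [← Finset.mul_sum]
    gcongr
    rw [← Finset.sum_image (f := fun i : ℕ => (max 1 (i : ℝ)) ^ (-(3 / 4) : ℝ)) (s := A) (g := fun k => (m - k).toNat)]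
    · apply Finset.sum_le_sum_of_subset_of_nonneg
      · intro i hi
        obtain ⟨k, hkA, rfl⟩ := Finset.mem_image.1 hi
        exact Finset.mem_range.2 (Nat.lt_succ_of_le (hk k hkA).2.1)
      · intro i _ _; positivity
    · intro k hkA l hlA hkl
      have h3 := (hk k hkA).1
      have h4 := (hk l hlA).1
      simp only at hkl
      omega
  have h3 := sum_rpow_le N
  have h4 : (N : ℝ) ^ (1 / 4 : ℝ) ≤ (τfin / (4 * d * ε)) ^ (1 / 4 : ℝ) := by
    gcongr; exact Nat.floor_le (by positivity)
  calc ε * ∑ k ∈ A, kernelWeight d ε (τ - σ k)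
      ≤ ε * ((d * ε) ^ (-(3 / 4) : ℝ) * (1 + 4 * (τfin / (4 * d * ε)) ^ (1 / 4 : ℝ))) := by
        gcongr; refine h2.trans ?_; gcongr; linarith
    _ = d ^ (-(3 / 4) : ℝ) * (ε ^ (1 / 4 : ℝ) + 4 * (τfin / (4 * d)) ^ (1 / 4 : ℝ)) := by
        have e2 : ε * ε ^ (-(3 / 4) : ℝ) = ε ^ (1 / 4 : ℝ) := by
          nth_rw 1 [← Real.rpow_one ε]
          rw [← Real.rpow_add hε]; norm_num
        have e3 : (τfin / (4 * d * ε)) ^ (1 / 4 : ℝ) = (τfin / (4 * d)) ^ (1 / 4 : ℝ) / ε ^ (1 / 4 : ℝ) := by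
          rw [← Real.div_rpow (by positivity) hε.le, div_div]
        have h5 : 0 < ε ^ (1 / 4 : ℝ) := by positivity
        rw [Real.mul_rpow hd.le hε.le, e3]
        calc _ = d ^ (-(3 / 4) : ℝ) * (ε * ε ^ (-(3 / 4) : ℝ)) * (1 + 4 * ((τfin / (4 * d)) ^ (1 / 4 : ℝ) / ε ^ (1 / 4 : ℝ))) := by ring
          _ = _ := by rw [e2]; field_simp
    _ ≤ weightBound d τfin := by
        unfold weightBound
        gcongr
        exact Real.rpow_le_one hε.le hε1 (by norm_num)

/-- The superposition of shifted and delayed regularized kernels. -/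
noncomputable def kernelSum (d ε : ℝ) (F : Finset ℤ) (σ : ℤ → ℝ) (τ : ℝ) (j : ℤ) : ℝ :=
  -2 * ∑ k ∈ F, regKernel d ε (τ - σ k) (j - k)

theorem abs_kernelSum_time_sub_le (hs : Separated d ε τfin F σ) (hd : 0 < d) (hε : 0 < ε) (hε1 : ε ≤ 1)
    (hτfin : 0 ≤ τfin) (a b : ℝ) (j : ℤ) :
    |kernelSum d ε F σ b j - kernelSum d ε F σ a j| ≤ 12 * weightBound d τfin * |b - a| ^ (1 / 4 : ℝ) := by
  have ha := sum_kernelWeight_le hs hd hε hε1 hτfin a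
  have hb := sum_kernelWeight_le hs hd hε hε1 hτfin b
  have hX : 0 ≤ |b - a| ^ (1 / 4 : ℝ) := by positivity
  calc |kernelSum d ε F σ b j - kernelSum d ε F σ a j|
      = 2 * |∑ k ∈ F, (regKernel d ε (b - σ k) (j - k) - regKernel d ε (a - σ k) (j - k))| := by
        unfold kernelSum
        rw [← mul_sub, ← Finset.sum_sub_distrib, abs_mul]; norm_num
    _ ≤ 2 * ∑ k ∈ F, 3 * ε * |b - a| ^ (1 / 4 : ℝ) * (kernelWeight d ε (a - σ k) + kernelWeight d ε (b - σ k)) := by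
        gcongr
        refine (Finset.abs_sum_le_sum_abs _ _).trans (Finset.sum_le_sum fun k _ => ?_)
        have := abs_regKernel_sub_le hd hε (j - k) (a - σ k) (b - σ k)
        rwa [sub_sub_sub_cancel_right] at this
    _ = 6 * |b - a| ^ (1 / 4 : ℝ) * (ε * ∑ k ∈ F, kernelWeight d ε (a - σ k) + ε * ∑ k ∈ F, kernelWeight d ε (b - σ k)) := by
        rw [← Finset.mul_sum, Finset.sum_add_distrib]; ring
    _ ≤ 6 * |b - a| ^ (1 / 4 : ℝ) * (weightBound d τfin + weightBound d τfin) := by gcongr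
    _ = _ := by ring

/-- The `ℓ²`-bound for the discrete gradient. -/
theorem sum_sq_grad_kernelSum_le (hs : Separated d ε τfin F σ) (hd : 0 < d) (hε : 0 < ε) (hε1 : ε ≤ 1)
    (hτfin : 0 ≤ τfin) (τ : ℝ) (s : Finset ℤ) :
    ∑ j ∈ s, (kernelSum d ε F σ τ (j + 1) - kernelSum d ε F σ τ j) ^ 2 ≤ 8 * weightBound d τfin ^ 2 * ε := by
  set W := fun k => kernelWeight d ε (τ - σ k) with hW
  set D := fun k j => regKernel d ε (τ - σ k) (j + 1 - k) - regKernel d ε (τ - σ k) (j - k) with hD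
  have hW0 : ∀ k, 0 ≤ W k := fun k => kernelWeight_nonneg _ _ _
  have hD0 : ∀ k, W k = 0 → ∀ j, D k j = 0 := by
    intro k hk j
    have : τ - σ k ≤ 0 := by
      by_contra h
      have h1 : W k = (max (τ - σ k) (d * ε)) ^ (-(3 / 4) : ℝ) := if_neg h
      have : 0 < W k := by
        rw [h1]; exact Real.rpow_pos_of_pos (lt_max_of_lt_left (not_le.1 h)) _
      linarith
    simp [hD, regKernel_of_nonpos this]
  have hw := sum_kernelWeight_le hs hd hε hε1 hτfin τ
  have hSW : 0 ≤ ∑ k ∈ F, W k := Finset.sum_nonneg fun k _ => hW0 k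
  -- Cauchy–Schwarz with the weights themselves: each squared gradient is of order W², so dividing
  -- by W leaves a second sum of weights. A vanishing weight belongs to a kernel that has not
  -- started yet, so division by zero is harmless.
  have hcs : ∀ j, (∑ k ∈ F, D k j) ^ 2 ≤ (∑ k ∈ F, W k) * ∑ k ∈ F, D k j ^ 2 / W k := by
    intro j
    apply Finset.sum_sq_le_sum_mul_sum_of_sq_le_mul F (fun k _ => hW0 k) (fun k _ => div_nonneg (sq_nonneg _) (hW0 k))
    intro k _
    rcases eq_or_ne (W k) 0 with h | h
    · rw [hD0 k h, h]; simp
    · apply le_of_eq; field_simp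
  have hin : ∀ k, ∑ j ∈ s, D k j ^ 2 / W k ≤ 2 * ε ^ 3 * W k := by
    intro k
    rcases eq_or_ne (W k) 0 with h | h
    · simp [h]
    · have hpos : 0 < W k := lt_of_le_of_ne (hW0 k) (Ne.symm h)
      rw [← Finset.sum_div, div_le_iff₀ hpos]
      obtain ⟨h1, h2⟩ := sum_sq_grad_regKernel_le hd hε (τ - σ k) k
      have h3 := h1.sum_le_tsum s fun j _ => sq_nonneg _
      calc _ ≤ _ := h3
        _ ≤ _ := h2
        _ = _ := by simp only [hW]; ring
  calc ∑ j ∈ s, (kernelSum d ε F σ τ (j + 1) - kernelSum d ε F σ τ j) ^ 2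
      = 4 * ∑ j ∈ s, (∑ k ∈ F, D k j) ^ 2 := by
        rw [Finset.mul_sum]
        refine Finset.sum_congr rfl fun j _ => ?_
        unfold kernelSum
        rw [← mul_sub, ← Finset.sum_sub_distrib, mul_pow]; norm_num [hD]
    _ ≤ 4 * ∑ j ∈ s, (∑ k ∈ F, W k) * ∑ k ∈ F, D k j ^ 2 / W k := by gcongr with j; exact hcs j
    _ = 4 * (∑ k ∈ F, W k) * ∑ k ∈ F, ∑ j ∈ s, D k j ^ 2 / W k := by
        rw [← Finset.mul_sum, Finset.sum_comm]; ring
    _ ≤ 4 * (∑ k ∈ F, W k) * ∑ k ∈ F, 2 * ε ^ 3 * W k := by gcongr with k; exact hin k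
    _ = 8 * (ε * ∑ k ∈ F, W k) ^ 2 * ε := by rw [← Finset.mul_sum]; ring
    _ ≤ 8 * weightBound d τfin ^ 2 * ε := by gcongr

/-- Telescoping and Cauchy–Schwarz; macroscopically this is 1/2-Hölder continuity in space. -/
theorem sq_sub_le_of_sum_sq_grad {ρ : ℤ → ℝ} {G : ℝ} (hρ : ∀ s : Finset ℤ, ∑ j ∈ s, (ρ (j + 1) - ρ j) ^ 2 ≤ G)
    (i j : ℤ) : (ρ i - ρ j) ^ 2 ≤ |(i : ℝ) - j| * G := by
  wlog hij : j ≤ i generalizing i j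
  · rw [← neg_sq, neg_sub, abs_sub_comm]; exact this j i (le_of_not_ge hij)
  obtain ⟨n, rfl⟩ := Int.le.dest hij
  have htel : ρ (j + n) - ρ j = ∑ m ∈ Finset.range n, (ρ (j + m + 1) - ρ (j + m)) := by
    have := Finset.sum_range_sub (fun m : ℕ => ρ (j + m)) n
    simp only [Nat.cast_add, Nat.cast_one, Nat.cast_zero, add_zero, ← add_assoc] at this
    exact this.symm
  have hcs := sq_sum_le_card_mul_sum_sq (s := Finset.range n) (f := fun m : ℕ => ρ (j + m + 1) - ρ (j + m))
  have him := hρ ((Finset.range n).map ⟨fun m : ℕ => j + m, fun a b h => by simpa using h⟩)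
  rw [Finset.sum_map] at him
  rw [htel]
  refine hcs.trans ?_
  rw [Finset.card_range]
  push_cast
  rw [add_sub_cancel_left, abs_of_nonneg (Nat.cast_nonneg n)]
  gcongr
  exact him

/-- Far from all transition sites each kernel is at most 2/L by the first-moment bound, uniformly in
time. -/
theorem abs_kernelSum_le (hd : 0 < d) (hε : 0 < ε) (τ : ℝ) (j : ℤ) (L : ℝ) (hL : 0 < L)
    (hF : ∀ k ∈ F, L ≤ |((j - k : ℤ) : ℝ)|) :
    |kernelSum d ε F σ τ j| ≤ 4 * F.card / L := by
  unfold kernelSum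
  rw [abs_mul, show |(-2 : ℝ)| = 2 by norm_num]
  have : |∑ k ∈ F, regKernel d ε (τ - σ k) (j - k)| ≤ ∑ k ∈ F, 2 / L := by
    refine (Finset.abs_sum_le_sum_abs _ _).trans (Finset.sum_le_sum fun k hk => ?_)
    rw [abs_of_nonneg (regKernel_nonneg hd hε _ _), le_div_iff₀ hL]
    have h1 := abs_mul_regKernel_le hd hε (τ - σ k) (j - k)
    have h2 := regKernel_nonneg hd hε (τ - σ k) (j - k)
    nlinarith [hF k hk]
  rw [Finset.sum_const, nsmul_eq_mul] at this
  calc _ ≤ 2 * (F.card * (2 / L)) := by gcongr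
    _ = _ := by ring

end Superposition


/-! ### Cells -/

theorem abs_mul_cell_sub_le {ε : ℝ} (hε : 0 < ε) (ξ : ℝ) : |ε * cell ε ξ - ξ| ≤ ε / 2 := by
  unfold cell
  have h1 := Int.floor_le (ξ / ε + 1 / 2)
  have h2 := Int.lt_floor_add_one (ξ / ε + 1 / 2)
  have e : ξ = ε * (ξ / ε) := by field_simp
  rw [abs_le]
  constructor
  · nlinarith
  · nlinarith

theorem cell_mono {ε : ℝ} (hε : 0 < ε) : Monotone (cell ε) := fun x y h => by
  unfold cell; gcongr

theorem mul_abs_cell_sub_le {ε : ℝ} (hε : 0 < ε) (ξ η : ℝ) :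
    ε * |(cell ε ξ : ℝ) - cell ε η| ≤ |ξ - η| + ε := by
  have h1 := abs_mul_cell_sub_le hε ξ
  have h2 := abs_mul_cell_sub_le hε η
  have e : ε * |(cell ε ξ : ℝ) - cell ε η| = |(ε * cell ε ξ - ξ) - (ε * cell ε η - η) + (ξ - η)| := by
    rw [← abs_of_pos hε, ← abs_mul, abs_of_pos hε]; congr 1; ring
  rw [e]
  have h3 := abs_add_le ((ε * cell ε ξ - ξ) - (ε * cell ε η - η)) (ξ - η)
  have h4 := abs_sub (ε * cell ε ξ - ξ) (ε * cell ε η - η)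
  linarith

theorem cell_eq_iff {ε : ℝ} (hε : 0 < ε) (ξ : ℝ) (j : ℤ) :
    cell ε ξ = j ↔ ξ ∈ Ico (ε * j - ε / 2) (ε * j + ε / 2) := by
  unfold cell
  rw [Int.floor_eq_iff, mem_Ico]
  have e : ξ = ε * (ξ / ε) := by field_simp
  constructor
  · rintro ⟨h1, h2⟩; constructor <;> nlinarith
  · rintro ⟨h1, h2⟩
    constructor
    · have : ε * j ≤ ε * (ξ / ε + 1 / 2) := by linarith
      exact le_of_mul_le_mul_left this hε
    · have : ε * (ξ / ε + 1 / 2) < ε * (j + 1) := by linarith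
      exact lt_of_mul_lt_mul_left this hε.le

theorem cell_mul {ε : ℝ} (hε : 0 < ε) (j : ℤ) : cell ε (ε * j) = j := by
  rw [cell_eq_iff hε]; constructor <;> linarith

theorem cell_zero {ε : ℝ} (hε : 0 < ε) : cell ε 0 = 0 := by simpa using cell_mul hε 0

/-- Allows α to be replaced by a positive constant. -/
theorem IsMacroscopicData.mono {α α' β ε : ℝ} {u₀ : LInf} (h : IsMacroscopicData α β ε u₀) (hε : 0 < ε)
    (hα : α ≤ α') : IsMacroscopicData α' β ε u₀ :=
  ⟨h.mem_stateSpace, h.lap_zero, fun j => (h.grad j).trans (by gcongr),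
    fun j hj => (h.lap_ne_zero j hj).trans (by gcongr)⟩

/-! ### Uniform estimates for a single-interface solution with macroscopic data -/

/-- A single-interface solution with macroscopic data, on the macroscopic time interval `[0, τfin]`. -/
structure MacroSolution (a β τfin ε : ℝ) (u : ℝ → LInf) (T : ℤ → EReal) : Prop where
  a_pos : 0 < a
  ε_pos : 0 < ε
  τfin_pos : 0 < τfin
  sol : IsSingleInterfaceSolution 1 u T
  data : IsMacroscopicData a β ε (u 0)

/-- The separation constant. -/
noncomputable def sepConst (a : ℝ) : ℝ := 1 / (160 * a)

theorem sepConst_pos {a : ℝ} (ha : 0 < a) : 0 < sepConst a := by unfold sepConst; positivity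

/-- The macroscopic transition times. -/
noncomputable def macroTime (ε : ℝ) (T : ℤ → EReal) (k : ℤ) : ℝ := ε ^ 2 * (T k).toReal

namespace MacroSolution

variable {a β τfin ε : ℝ} {u : ℝ → LInf} {T : ℤ → EReal}

theorem aε_nonneg (h : MacroSolution a β τfin ε u T) : 0 ≤ a * ε := (mul_pos h.a_pos h.ε_pos).le

theorem d_pos (h : MacroSolution a β τfin ε u T) : 0 < sepConst a := sepConst_pos h.a_pos

theorem index (h : MacroSolution a β τfin ε u T) {τ : ℝ} (hτ : 0 ≤ τ) :
    ∃ n : ℤ, 0 ≤ n ∧ T n ≤ ((τ / ε ^ 2 : ℝ) : EReal) ∧ ((τ / ε ^ 2 : ℝ) : EReal) < T (n + 1) :=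
  h.sol.exists_index h.data h.aε_nonneg (div_nonneg hτ (sq_nonneg ε))

theorem separation_succ (h : MacroSolution a β τfin ε u T) {k : ℤ} (hk : 1 ≤ k) (hT : T (k + 1) ≠ ⊤) :
    4 * sepConst a * ε ≤ macroTime ε T (k + 1) - macroTime ε T k := by
  have hT' : T k ≠ ⊤ := fun h1 => hT (h.sol.eq_top (by omega) (by simpa using h1))
  have := h.sol.separation h.data h.aε_nonneg hk (h.sol.coe_toReal (by omega) hT').symm
    (h.sol.coe_toReal (by omega) hT).symm
  have ha := h.a_pos
  have hε := h.ε_pos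
  unfold macroTime sepConst
  -- The microscopic gap 1/(40aε), multiplied by ε², equals four times `sepConst a` times ε. The
  -- factor 4 leaves room for both the switching time dε and the required gap 2dε.
  have e : 4 * (1 / (160 * a)) * ε = 1 / 40 / (a * ε) * ε ^ 2 := by field_simp; norm_num
  rw [e, ← mul_sub, mul_comm (ε ^ 2)]
  gcongr
  rw [div_le_iff₀ (by positivity)]
  linarith

theorem separation_le (h : MacroSolution a β τfin ε u T) {k l : ℤ} (hk : 1 ≤ k) (hkl : k ≤ l) :
    T l ≠ ⊤ → 4 * sepConst a * ε * ((l : ℝ) - k) ≤ macroTime ε T l - macroTime ε T k := by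
  induction l, hkl using Int.leInduction with
  | base => intro _; simp
  | succ l hl ih =>
    intro hT
    have hT' : T l ≠ ⊤ := fun h1 => hT (h.sol.eq_top (by omega) (by simpa using h1))
    have h1 := ih hT'
    have h2 := h.separation_succ (by omega) hT
    push_cast
    linarith

theorem coe_macroTime (h : MacroSolution a β τfin ε u T) {k : ℤ} (hk : 0 ≤ k) (hT : T k ≠ ⊤) :
    ((macroTime ε T k / ε ^ 2 : ℝ) : EReal) = T k := by
  have := h.ε_pos
  rw [macroTime, mul_div_cancel_left₀ _ (by positivity), h.sol.coe_toReal hk hT]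

theorem T_le_iff (h : MacroSolution a β τfin ε u T) {k : ℤ} (hk : 0 ≤ k) (hT : T k ≠ ⊤) (τ : ℝ) :
    T k ≤ ((τ / ε ^ 2 : ℝ) : EReal) ↔ macroTime ε T k ≤ τ := by
  have := h.ε_pos
  rw [← h.coe_macroTime hk hT, EReal.coe_le_coe_iff, div_le_div_iff_of_pos_right (by positivity)]

theorem lt_T_iff (h : MacroSolution a β τfin ε u T) {k : ℤ} (hk : 0 ≤ k) (hT : T k ≠ ⊤) (τ : ℝ) :
    ((τ / ε ^ 2 : ℝ) : EReal) < T k ↔ τ < macroTime ε T k := by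
  rw [← not_le, h.T_le_iff hk hT, not_le]

theorem T_lt_iff (h : MacroSolution a β τfin ε u T) {k : ℤ} (hk : 0 ≤ k) (hT : T k ≠ ⊤) (τ : ℝ) :
    T k < ((τ / ε ^ 2 : ℝ) : EReal) ↔ macroTime ε T k < τ := by
  have := h.ε_pos
  rw [← h.coe_macroTime hk hT, EReal.coe_lt_coe_iff, div_lt_div_iff_of_pos_right (by positivity)]

theorem macroTime_nonneg (h : MacroSolution a β τfin ε u T) {k : ℤ} (hk : 0 ≤ k) : 0 ≤ macroTime ε T k :=
  mul_nonneg (sq_nonneg ε) (EReal.toReal_nonneg (h.sol.T_nonneg hk))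

theorem ne_top_of_le {k : ℤ} {t : ℝ} (h1 : T k ≤ (t : EReal)) : T k ≠ ⊤ :=
  (h1.trans_lt (EReal.coe_lt_top t)).ne

theorem finite_transitions (h : MacroSolution a β τfin ε u T) : (transitions τfin ε T).Finite := by
  obtain ⟨n, hn, h1, h2⟩ := h.index h.τfin_pos.le
  exact (Finset.Icc 1 n).finite_toSet.subset fun k hk => by
    rw [Finset.coe_Icc]
    exact ⟨hk.1, (h.sol.T_le_iff hn (by linarith [hk.1]) h1 h2).1 hk.2.le⟩

/-- The finite set of transitions. -/
noncomputable def trans (h : MacroSolution a β τfin ε u T) : Finset ℤ := h.finite_transitions.toFinset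

theorem mem_trans (h : MacroSolution a β τfin ε u T) {k : ℤ} :
    k ∈ h.trans ↔ 1 ≤ k ∧ T k < ((τfin / ε ^ 2 : ℝ) : EReal) := by
  unfold trans; rw [Finite.mem_toFinset]; rfl

theorem separated (h : MacroSolution a β τfin ε u T) :
    Separated (sepConst a) ε τfin h.trans (macroTime ε T) where
  nonneg k hk := h.macroTime_nonneg (by linarith [(h.mem_trans.1 hk).1])
  le k hk := by
    have h1 := h.mem_trans.1 hk
    exact (h.T_le_iff (by linarith [h1.1]) (ne_top_of_le h1.2.le) τfin).1 h1.2.le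
  sep k hk l hl hkl := h.separation_le (h.mem_trans.1 hk).1 hkl (ne_top_of_le (h.mem_trans.1 hl).2.le)

/-- A bound for the macroscopic position of all transitions. -/
noncomputable def _root_.DiffusionLattice.posBound (a τfin : ℝ) : ℝ := 2 + τfin / (4 * sepConst a)

theorem mul_index_le (h : MacroSolution a β τfin ε u T) {k : ℤ} (hk : 1 ≤ k) (hT : T k ≠ ⊤)
    (hle : macroTime ε T k ≤ τfin) : ε * k ≤ ε + τfin / (4 * sepConst a) := by
  have hd := h.d_pos
  have h1 := h.separation_le le_rfl hk hT
  have h2 := h.macroTime_nonneg (k := 1) (by omega)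
  have h3 : ε * (k - 1) ≤ τfin / (4 * sepConst a) := by
    rw [le_div_iff₀ (by positivity)]
    push_cast at h1
    linarith
  linarith

theorem mul_card_le (h : MacroSolution a β τfin ε u T) : ε * h.trans.card ≤ ε + τfin / (4 * sepConst a) := by
  have hd := h.d_pos
  have hε := h.ε_pos
  have hτ := h.τfin_pos
  rcases h.trans.eq_empty_or_nonempty with he | hne
  · rw [he]; simp only [Finset.card_empty, Nat.cast_zero, mul_zero]; positivity
  · set m := h.trans.max' hne with hm
    have hmF := h.mem_trans.1 (h.trans.max'_mem hne)
    have hsub : h.trans ⊆ Finset.Icc 1 m := fun k hk =>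
      Finset.mem_Icc.2 ⟨(h.mem_trans.1 hk).1, h.trans.le_max' k hk⟩
    have hcard := Finset.card_le_card hsub
    rw [Int.card_Icc] at hcard
    have h1 : ((h.trans.card : ℕ) : ℝ) ≤ m := by
      have : (h.trans.card : ℤ) ≤ m := by
        have := hmF.1
        omega
      exact_mod_cast this
    have h2 := h.mul_index_le hmF.1 (ne_top_of_le hmF.2.le) (h.separated.le m (h.trans.max'_mem hne))
    refine le_trans ?_ h2
    gcongr

theorem macroR₁_eq (h : MacroSolution a β τfin ε u T) (d : ℝ) (z : ℝ × ℝ) :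
    macroR₁ τfin d ε T z = kernelSum d ε h.trans (macroTime ε T) z.1 (cell ε z.2) := by
  unfold macroR₁ kernelSum
  rw [finsum_mem_eq_finite_toFinset_sum _ h.finite_transitions]
  rfl

theorem interface_eq (h : MacroSolution a β τfin ε u T) {n : ℤ} (hn : 0 ≤ n) {τ : ℝ}
    (h1 : T n ≤ ((τ / ε ^ 2 : ℝ) : EReal)) (h2 : ((τ / ε ^ 2 : ℝ) : EReal) < T (n + 1)) :
    interface ε T τ = ε * n := by
  unfold interface
  have hset : ∀ k : ℤ, (1 ≤ k ∧ T k ≤ ((τ / ε ^ 2 : ℝ) : EReal) ∧ ((τ / ε ^ 2 : ℝ) : EReal) < T (k + 1)) ↔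
      1 ≤ k ∧ k = n := by
    intro k
    constructor
    · rintro ⟨h3, h4, h5⟩
      refine ⟨h3, ?_⟩
      have h6 := (h.sol.T_le_iff hn (by omega) h1 h2).1 h4
      have h7 := (h.sol.T_le_iff (n := k) (by omega) hn h4 h5).1 h1
      omega
    · rintro ⟨h3, rfl⟩; exact ⟨h3, h1, h2⟩
  rcases hn.eq_or_lt with rfl | hpos
  · have : {k : ℤ | 1 ≤ k ∧ T k ≤ ((τ / ε ^ 2 : ℝ) : EReal) ∧ ((τ / ε ^ 2 : ℝ) : EReal) < T (k + 1)} = ∅ := by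
      ext k; simp only [mem_ofPred_eq, hset, mem_empty_iff_false, iff_false]; omega
    rw [this]; simp
  · have : {k : ℤ | 1 ≤ k ∧ T k ≤ ((τ / ε ^ 2 : ℝ) : EReal) ∧ ((τ / ε ^ 2 : ℝ) : EReal) < T (k + 1)} = {n} := by
      ext k; simp only [mem_ofPred_eq, hset, mem_singleton_iff]; omega
    rw [this, finsum_mem_singleton]

/-- If the interface moves from site n to site m, then at least m - n - 1 complete gaps between
transitions lie inside the time interval. The uncounted site accounts for the error ε. -/
theorem interface_mono_lip (h : MacroSolution a β τfin ε u T) {τ₁ τ₂ : ℝ} (h0 : 0 ≤ τ₁) (h12 : τ₁ ≤ τ₂) :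
    interface ε T τ₁ ≤ interface ε T τ₂ ∧
      interface ε T τ₂ - interface ε T τ₁ ≤ (τ₂ - τ₁) / (4 * sepConst a) + ε := by
  have hd := h.d_pos
  have hε := h.ε_pos
  obtain ⟨n, hn, h1, h2⟩ := h.index h0
  obtain ⟨m, hm, h3, h4⟩ := h.index (h0.trans h12)
  rw [h.interface_eq hn h1 h2, h.interface_eq hm h3 h4]
  have hnm : n ≤ m := by
    rw [← h.sol.T_le_iff hm hn h3 h4]
    refine h1.trans ?_
    rw [EReal.coe_le_coe_iff]; gcongr
  have hnm' : (n : ℝ) ≤ m := by exact_mod_cast hnm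
  refine ⟨by gcongr, ?_⟩
  rcases hnm.eq_or_lt with rfl | hlt
  · rw [sub_self]
    have := sub_nonneg.2 h12
    positivity
  · have hTm := ne_top_of_le h3
    have h5 := h.separation_le (k := n + 1) (l := m) (by omega) hlt hTm
    have h6 := (h.T_le_iff hm hTm τ₂).1 h3
    have hTn : T (n + 1) ≠ ⊤ := ((h.sol.T_mono (k := n + 1) (l := m) (by omega) hlt).trans_lt (lt_top_iff_ne_top.2 hTm)).ne
    have h7 := (h.lt_T_iff (by omega) hTn τ₁).1 h2
    have h8 : ε * ((m : ℝ) - n - 1) ≤ (τ₂ - τ₁) / (4 * sepConst a) := by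
      rw [le_div_iff₀ (by positivity)]
      push_cast at h5
      linarith
    linarith

theorem abs_interface_sub_le (h : MacroSolution a β τfin ε u T) {τ₁ τ₂ : ℝ} (h1 : 0 ≤ τ₁) (h2 : 0 ≤ τ₂) :
    |interface ε T τ₂ - interface ε T τ₁| ≤ |τ₂ - τ₁| / (4 * sepConst a) + ε := by
  wlog h12 : τ₁ ≤ τ₂ generalizing τ₁ τ₂
  · rw [abs_sub_comm, abs_sub_comm τ₂]; exact this h2 h1 (le_of_not_ge h12)
  have := h.interface_mono_lip h1 h12
  rw [abs_of_nonneg (sub_nonneg.2 this.1), abs_of_nonneg (sub_nonneg.2 h12)]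
  exact this.2

theorem interface_zero (h : MacroSolution a β τfin ε u T) : interface ε T 0 = 0 := by
  have := h.interface_eq (n := 0) le_rfl (τ := 0) (by simpa using h.sol.T_zero.le)
    (by simpa using h.sol.pos 1 le_rfl)
  simpa using this

/-! #### The regular part -/

theorem initial_lipschitz (h : MacroSolution a β τfin ε u T) (i j : ℤ) :
    |dPhi (u 0 i) - dPhi (u 0 j)| ≤ a * ε * |(i : ℝ) - j| := by
  wlog hij : j ≤ i generalizing i j
  · rw [abs_sub_comm, abs_sub_comm (i : ℝ)]; exact this j i (le_of_not_ge hij)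
  obtain ⟨n, rfl⟩ := Int.le.dest hij
  clear hij
  induction n with
  | zero => simp
  | succ n ih =>
    have h1 := h.data.grad (j + n)
    have h2 := abs_sub_le (dPhi (u 0 (j + n + 1))) (dPhi (u 0 (j + n))) (dPhi (u 0 j))
    push_cast at ih h2 ⊢
    rw [add_sub_cancel_left, abs_of_nonneg (by positivity : (0 : ℝ) ≤ (n : ℝ))] at ih
    rw [add_sub_cancel_left, abs_of_nonneg (by positivity : (0 : ℝ) ≤ (n : ℝ) + 1)]
    rw [← add_assoc]
    linarith

theorem macroQ_eq (u : ℝ → LInf) (z : ℝ × ℝ) :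
    macroQ ε u z = heatFlow (fun k => dPhi (u 0 k)) (z.1 / ε ^ 2) (cell ε z.2) := rfl

theorem abs_macroQ_sub_le (h : MacroSolution a β τfin ε u T) {z w : ℝ × ℝ} (hz : 0 ≤ z.1) (hw : 0 ≤ w.1) :
    |macroQ ε u z - macroQ ε u w| ≤ a * (|z.2 - w.2| + ε) + a * √(2 * |z.1 - w.1|) := by
  have hε := h.ε_pos
  have ha := h.a_pos
  rw [macroQ_eq, macroQ_eq]
  set f := fun k => dPhi (u 0 k)
  have hf := abs_dPhi_apply_le (u 0)
  have h1 := abs_heatFlow_sub_le hf h.initial_lipschitz (cell ε z.2) (cell ε w.2) (t := z.1 / ε ^ 2) (by positivity)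
  have h2 := abs_heatFlow_time_sub_le hf h.aε_nonneg h.initial_lipschitz (cell ε w.2) (s := w.1 / ε ^ 2)
    (t := z.1 / ε ^ 2) (by positivity) (by positivity)
  have h3 := mul_abs_cell_sub_le hε z.2 w.2
  have e : a * ε * √(2 * |z.1 / ε ^ 2 - w.1 / ε ^ 2|) = a * √(2 * |z.1 - w.1|) := by
    rw [← sub_div, abs_div, abs_of_pos (by positivity : 0 < ε ^ 2), ← mul_div_assoc, Real.sqrt_div (by positivity),
      Real.sqrt_sq hε.le]
    field_simp
  rw [e] at h2
  have h4 : a * ε * |(cell ε z.2 : ℝ) - cell ε w.2| ≤ a * (|z.2 - w.2| + ε) := by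
    rw [mul_assoc]; gcongr
  have h5 := abs_sub_le (heatFlow f (z.1 / ε ^ 2) (cell ε z.2)) (heatFlow f (z.1 / ε ^ 2) (cell ε w.2))
    (heatFlow f (w.1 / ε ^ 2) (cell ε w.2))
  linarith

/-- Site 1 is in the negative phase, so p_1 lies in [-1, 1]; the gradient bound transfers this to
site 0. It anchors the regular part where no uniform bound on the data is assumed. -/
theorem abs_macroQ_zero_le (h : MacroSolution a β τfin ε u T) : |macroQ ε u (0, 0)| ≤ 1 + a * ε := by
  rw [macroQ_eq]
  simp only [zero_div, cell_zero h.ε_pos, heatFlow_zero]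
  obtain ⟨-, δ, hδ, h2⟩ := h.data.mem_stateSpace
  have h3 := h2 1 le_rfl
  have h4 : dPhi (u 0 1) = u 0 1 + 1 := by
    unfold dPhi; rw [sgn_of_neg (by linarith)]; ring
  have h5 := h.initial_lipschitz 0 1
  norm_num at h5
  have h6 := abs_le.1 h5
  rw [h4] at h6
  exact abs_le.2 ⟨by linarith, by linarith⟩

/-! #### The singular part -/

theorem abs_macroR₁_sub_le (h : MacroSolution a β τfin ε u T) (hε1 : ε ≤ 1) (z w : ℝ × ℝ) :
    |macroR₁ τfin (sepConst a) ε T z - macroR₁ τfin (sepConst a) ε T w| ≤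
      12 * weightBound (sepConst a) τfin * |z.1 - w.1| ^ (1 / 4 : ℝ) +
      √(8 * weightBound (sepConst a) τfin ^ 2 * (|z.2 - w.2| + ε)) := by
  have hε := h.ε_pos
  rw [h.macroR₁_eq, h.macroR₁_eq]
  have h1 := abs_kernelSum_time_sub_le h.separated h.d_pos hε hε1 h.τfin_pos.le w.1 z.1 (cell ε z.2)
  have h2 := sq_sub_le_of_sum_sq_grad (sum_sq_grad_kernelSum_le h.separated h.d_pos hε hε1 h.τfin_pos.le w.1)
    (cell ε z.2) (cell ε w.2)
  have h3 := mul_abs_cell_sub_le hε z.2 w.2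
  have h4 := Real.abs_le_sqrt (h2.trans (by
    calc |(cell ε z.2 : ℝ) - cell ε w.2| * (8 * weightBound (sepConst a) τfin ^ 2 * ε)
        = 8 * weightBound (sepConst a) τfin ^ 2 * (ε * |(cell ε z.2 : ℝ) - cell ε w.2|) := by ring
      _ ≤ 8 * weightBound (sepConst a) τfin ^ 2 * (|z.2 - w.2| + ε) := by gcongr))
  exact (abs_sub_le _ _ _).trans (add_le_add h1 h4)

theorem macroR₁_of_nonpos (h : MacroSolution a β τfin ε u T) (d : ℝ) {z : ℝ × ℝ} (hz : z.1 ≤ 0) :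
    macroR₁ τfin d ε T z = 0 := by
  rw [h.macroR₁_eq, kernelSum, Finset.sum_eq_zero, mul_zero]
  intro k hk
  have := h.separated.nonneg k hk
  exact regKernel_of_nonpos (by linarith) _

theorem abs_macroR₁_le_time (h : MacroSolution a β τfin ε u T) (hε1 : ε ≤ 1) {z : ℝ × ℝ} (hz : 0 ≤ z.1) :
    |macroR₁ τfin (sepConst a) ε T z| ≤ 12 * weightBound (sepConst a) τfin * z.1 ^ (1 / 4 : ℝ) := by
  have h0 := h.macroR₁_of_nonpos (sepConst a) (z := (0, z.2)) le_rfl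
  rw [h.macroR₁_eq] at h0 ⊢
  have h1 := abs_kernelSum_time_sub_le h.separated h.d_pos h.ε_pos hε1 h.τfin_pos.le 0 z.1 (cell ε z.2)
  rwa [h0, sub_zero, sub_zero, abs_of_nonneg hz] at h1

/-- All transitions up to the final time sit in a bounded macroscopic region and number O(1/ε),
while each kernel at macroscopic distance L is O(ε/L). -/
theorem abs_macroR₁_le_tail (h : MacroSolution a β τfin ε u T) (hε1 : ε ≤ 1) {z : ℝ × ℝ}
    (hz : posBound a τfin < |z.2|) :
    |macroR₁ τfin (sepConst a) ε T z| ≤ 4 * posBound a τfin / (|z.2| - posBound a τfin) := by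
  have hε := h.ε_pos
  have hpos : 0 < |z.2| - posBound a τfin := sub_pos.2 hz
  rw [h.macroR₁_eq]
  have h1 := abs_kernelSum_le (F := h.trans) (σ := macroTime ε T) h.d_pos hε z.1 (cell ε z.2)
    ((|z.2| - posBound a τfin) / ε) (by positivity) (fun k hk => by
      have hk' := h.mem_trans.1 hk
      have h2 := h.mul_index_le hk'.1 (ne_top_of_le hk'.2.le) (h.separated.le k hk)
      have h3 := abs_mul_cell_sub_le hε z.2
      rw [div_le_iff₀ hε]
      have hk0 : (0 : ℝ) ≤ ε * k := by
        have : (0 : ℝ) ≤ k := by exact_mod_cast (by omega : (0 : ℤ) ≤ k)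
        positivity
      have e : |((cell ε z.2 - k : ℤ) : ℝ)| * ε = |z.2 + (ε * cell ε z.2 - z.2) - ε * k| := by
        rw [← abs_of_pos hε, ← abs_mul, abs_of_pos hε]; push_cast; congr 1; ring
      rw [e]
      have h4 := abs_sub_abs_le_abs_sub (z.2) (ε * k - (ε * cell ε z.2 - z.2))
      have h5 := abs_sub (ε * k) (ε * cell ε z.2 - z.2)
      rw [abs_of_nonneg hk0] at h5
      have e2 : z.2 - (ε * k - (ε * cell ε z.2 - z.2)) = z.2 + (ε * cell ε z.2 - z.2) - ε * k := by ring
      rw [e2] at h4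
      unfold posBound
      linarith)
  refine h1.trans ?_
  have h2 := h.mul_card_le
  calc 4 * (h.trans.card : ℝ) / ((|z.2| - posBound a τfin) / ε)
      = 4 * (ε * h.trans.card) / (|z.2| - posBound a τfin) := by field_simp
    _ ≤ _ := by
      gcongr
      refine h2.trans ?_
      unfold posBound
      linarith

end MacroSolution

/-! ### Compactness -/

/-- A version of Arzelà–Ascoli for piecewise constant functions: for each η the oscillation bound is
required only from some index on. The limit is built from convergence on a dense sequence. -/
theorem exists_subseq_tendstoLocallyUniformly {X : Type*} [PseudoMetricSpace X] [TopologicalSpace.SeparableSpace X]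
    (f : ℕ → X → ℝ) (hbd : ∀ x, ∃ M, ∀ n, |f n x| ≤ M)
    (heq : ∀ η > 0, ∃ δ > 0, ∃ N, ∀ n ≥ N, ∀ x y, dist x y < δ → |f n x - f n y| < η) :
    ∃ φ : ℕ → ℕ, StrictMono φ ∧ ∃ F : X → ℝ, TendstoLocallyUniformly (fun n => f (φ n)) F atTop := by
  rcases isEmpty_or_nonempty X with hX | hX
  · exact ⟨id, strictMono_id, fun _ => 0, fun _ _ x => (hX.false x).elim⟩
  set D := TopologicalSpace.denseSeq X
  choose M hM using hbd
  -- The diagonal argument is replaced by compactness of the countable product of intervals that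
  -- contains all values on the dense sequence.
  obtain ⟨c, -, φ, hφ, hc⟩ := (isCompact_univ_pi fun i : ℕ => isCompact_Icc (a := -M (D i)) (b := M (D i))).tendsto_subseq
    (x := fun n i => f n (D i)) (fun n i _ => abs_le.1 (hM (D i) n))
  rw [tendsto_pi_nhds] at hc
  have hcauchy : ∀ x, CauchySeq fun n => f (φ n) x := by
    intro x
    rw [Metric.cauchySeq_iff']
    intro η hη
    obtain ⟨δ, hδ, N, hN⟩ := heq (η / 4) (by linarith)
    obtain ⟨i, hi⟩ := (TopologicalSpace.denseRange_denseSeq X).exists_dist_lt x hδ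
    obtain ⟨N', hN'⟩ := Metric.tendsto_atTop.1 (hc i) (η / 4) (by linarith)
    refine ⟨max N N', fun n hn => ?_⟩
    have h1 := hN (φ n) ((le_max_left _ _).trans (hn.trans (hφ.id_le n))) x (D i) hi
    have h2 := hN (φ (max N N')) ((le_max_left _ _).trans (hφ.id_le _)) x (D i) hi
    have h3 := hN' n ((le_max_right _ _).trans hn)
    have h4 := hN' (max N N') (le_max_right _ _)
    simp only [Real.dist_eq, Function.comp_apply] at h3 h4 ⊢
    rw [abs_lt] at *
    constructor <;> linarith
  choose F hF using fun x => cauchySeq_tendsto_of_complete (hcauchy x)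
  refine ⟨φ, hφ, F, ?_⟩
  rw [Metric.tendstoLocallyUniformly_iff]
  intro η hη x
  obtain ⟨δ, hδ, N, hN⟩ := heq (η / 4) (by linarith)
  refine ⟨Metric.ball x δ, Metric.ball_mem_nhds x hδ, ?_⟩
  obtain ⟨N', hN'⟩ := Metric.tendsto_atTop.1 (hF x) (η / 4) (by linarith)
  filter_upwards [eventually_ge_atTop (max N N')] with n hn y hy
  have h1 := hN (φ n) ((le_max_left _ _).trans (hn.trans (hφ.id_le n))) y x hy
  have h2 := hN' n ((le_max_right _ _).trans hn)
  have h3 : |F y - F x| ≤ η / 4 := by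
    refine le_of_tendsto ((hF y).sub (hF x)).abs ?_
    filter_upwards [eventually_ge_atTop N] with m hm
    exact (hN (φ m) (hm.trans (hφ.id_le m)) y x hy).le
  rw [Real.dist_eq] at h2 ⊢
  rw [abs_lt] at *
  rw [abs_le] at h3
  constructor <;> linarith [h3.1, h3.2]

theorem exists_subseq_tendstoLocallyUniformlyOn {X : Type*} [PseudoMetricSpace X] [SecondCountableTopology X]
    (s : Set X) (f : ℕ → X → ℝ) (hbd : ∀ x ∈ s, ∃ M, ∀ n, |f n x| ≤ M)
    (heq : ∀ η > 0, ∃ δ > 0, ∃ N, ∀ n ≥ N, ∀ x ∈ s, ∀ y ∈ s, dist x y < δ → |f n x - f n y| < η) :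
    ∃ φ : ℕ → ℕ, StrictMono φ ∧ ∃ F : X → ℝ, TendstoLocallyUniformlyOn (fun n => f (φ n)) F atTop s := by
  classical
  obtain ⟨φ, hφ, F, hF⟩ := exists_subseq_tendstoLocallyUniformly (X := s) (fun n x => f n x)
    (fun x => hbd x x.2) (fun η hη => by
      obtain ⟨δ, hδ, N, hN⟩ := heq η hη
      exact ⟨δ, hδ, N, fun n hn x y hxy => hN n hn x x.2 y y.2 hxy⟩)
  refine ⟨φ, hφ, fun x => if h : x ∈ s then F ⟨x, h⟩ else 0, ?_⟩
  rw [tendstoLocallyUniformlyOn_iff_tendstoLocallyUniformly_comp_coe]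
  have e : (fun x => if h : x ∈ s then F ⟨x, h⟩ else 0) ∘ ((↑) : s → X) = F := by
    funext x; simp
  rw [e]
  exact hF


/-- The moduli of the rescaled functions contain ε as a second argument; continuity at the origin in
both arguments yields asymptotic equicontinuity. -/
theorem exists_delta_of_modulus {modu : ℝ × ℝ → ℝ} (hmodu : Continuous modu) (h0 : modu (0, 0) = 0) {ε : ℕ → ℝ}
    (hε : Tendsto ε atTop (𝓝 0)) {η : ℝ} (hη : 0 < η) :
    ∃ δ > 0, ∃ N, ∀ n ≥ N, ∀ x, |x| < δ → modu (x, ε n) < η := by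
  have h1 : ∀ᶠ p in 𝓝 ((0, 0) : ℝ × ℝ), modu p < η :=
    hmodu.continuousAt.eventually_lt continuousAt_const (by rw [h0]; exact hη)
  obtain ⟨δ, hδ, h2⟩ := Metric.eventually_nhds_iff.1 h1
  obtain ⟨N, hN⟩ := Metric.tendsto_atTop.1 hε δ hδ
  refine ⟨δ, hδ, N, fun n hn x hx => h2 ?_⟩
  rw [Prod.dist_eq]
  exact max_lt (by simpa [Real.dist_eq] using hx) (hN n hn)

/-- On a large rectangle local convergence is uniform by compactness; outside it both the functions
and their limit are small. -/
theorem tendstoUniformlyOn_of_tail {f : ℕ → ℝ × ℝ → ℝ} {F : ℝ × ℝ → ℝ} {τfin : ℝ}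
    (hloc : TendstoLocallyUniformlyOn f F atTop (domain τfin))
    (htail : ∀ η > 0, ∃ X, ∀ᶠ n in atTop, ∀ z ∈ domain τfin, X ≤ |z.2| → |f n z| ≤ η) :
    TendstoUniformlyOn f F atTop (domain τfin) := by
  rw [Metric.tendstoUniformlyOn_iff]
  intro η hη
  obtain ⟨X, hX⟩ := htail (η / 3) (by linarith)
  have hFtail : ∀ z ∈ domain τfin, X ≤ |z.2| → |F z| ≤ η / 3 := fun z hz hzX =>
    le_of_tendsto (hloc.tendsto_at hz).abs (hX.mono fun n hn => hn z hz hzX)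
  have hcomp : TendstoUniformlyOn f F atTop (Icc 0 τfin ×ˢ Icc (-X) X) :=
    (tendstoLocallyUniformlyOn_iff_tendstoUniformlyOn_of_compact (isCompact_Icc.prod isCompact_Icc)).1
      (hloc.mono (prod_mono_right (subset_univ _)))
  filter_upwards [hX, Metric.tendstoUniformlyOn_iff.1 hcomp η hη] with n hn1 hn2 z hz
  rcases le_or_gt X |z.2| with h | h
  · rw [Real.dist_eq]
    have := abs_sub (F z) (f n z)
    have := hn1 z hz h
    have := hFtail z hz h
    linarith
  · exact hn2 z ⟨hz.1, abs_le.1 h.le⟩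

section Sequence

variable {a β τfin : ℝ} {ε : ℕ → ℝ} {u : ℕ → ℝ → LInf} {T : ℕ → ℤ → EReal}

theorem exists_subseq_interface (h : ∀ n, MacroSolution a β τfin (ε n) (u n) (T n)) (hε : Tendsto ε atTop (𝓝 0)) :
    ∃ φ : ℕ → ℕ, StrictMono φ ∧ ∃ ξ : ℝ → ℝ,
      TendstoUniformlyOn (fun n => interface (ε (φ n)) (T (φ n))) ξ atTop (Icc 0 τfin) := by
  obtain ⟨B, hB⟩ := hε.bddAbove_range
  have ha := (h 0).a_pos
  have hd := (h 0).d_pos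
  obtain ⟨φ, hφ, ξ, hξ⟩ := exists_subseq_tendstoLocallyUniformlyOn (Icc 0 τfin) (fun n => interface (ε n) (T n))
    (fun τ hτ => ⟨|τ| / (4 * sepConst a) + B, fun n => by
      have h1 := (h n).abs_interface_sub_le le_rfl hτ.1
      rw [(h n).interface_zero, sub_zero, sub_zero] at h1
      linarith [hB (mem_range_self n)]⟩)
    (fun η hη => by
      obtain ⟨δ, hδ, N, hN⟩ := exists_delta_of_modulus (modu := fun p => |p.1| / (4 * sepConst a) + p.2)
        (by fun_prop) (by simp) hε hη
      exact ⟨δ, hδ, N, fun n hn x hx y hy hxy =>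
        ((h n).abs_interface_sub_le hy.1 hx.1).trans_lt (hN n hn (x - y) hxy)⟩)
  exact ⟨φ, hφ, ξ, (tendstoLocallyUniformlyOn_iff_tendstoUniformlyOn_of_compact isCompact_Icc).1 hξ⟩

theorem exists_subseq_regular (h : ∀ n, MacroSolution a β τfin (ε n) (u n) (T n)) (hε : Tendsto ε atTop (𝓝 0)) :
    ∃ φ : ℕ → ℕ, StrictMono φ ∧ ∃ Q : ℝ × ℝ → ℝ,
      TendstoLocallyUniformlyOn (fun n => macroQ (ε (φ n)) (u (φ n))) Q atTop (domain τfin) := by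
  obtain ⟨B, hB⟩ := hε.bddAbove_range
  have ha := (h 0).a_pos
  refine exists_subseq_tendstoLocallyUniformlyOn (domain τfin) (fun n => macroQ (ε n) (u n))
    (fun z hz => ⟨a * (|z.2| + B) + a * √(2 * |z.1|) + (1 + a * B), fun n => ?_⟩) (fun η hη => ?_)
  · have h1 := (h n).abs_macroQ_sub_le (z := z) (w := (0, 0)) hz.1.1 le_rfl
    have h2 := (h n).abs_macroQ_zero_le
    have h3 := hB (mem_range_self n)
    simp only [sub_zero] at h1
    have h4 := abs_sub_abs_le_abs_sub (macroQ (ε n) (u n) z) (macroQ (ε n) (u n) (0, 0))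
    have h5 : a * (|z.2| + ε n) ≤ a * (|z.2| + B) := by gcongr
    have h6 : a * ε n ≤ a * B := by gcongr
    linarith
  · obtain ⟨δ, hδ, N, hN⟩ := exists_delta_of_modulus (modu := fun p => a * (|p.1| + p.2) + a * √(2 * |p.1|))
      (by fun_prop) (by simp) hε hη
    refine ⟨δ, hδ, N, fun n hn x hx y hy hxy => ((h n).abs_macroQ_sub_le hx.1.1 hy.1.1).trans_lt
      (lt_of_le_of_lt ?_ (hN n hn (dist x y) (by rwa [abs_of_nonneg dist_nonneg])))⟩
    have h1 : |x.1 - y.1| ≤ |dist x y| := by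
      rw [abs_of_nonneg dist_nonneg, Prod.dist_eq]; exact le_max_left _ _
    have h2 : |x.2 - y.2| ≤ |dist x y| := by
      rw [abs_of_nonneg dist_nonneg, Prod.dist_eq]; exact le_max_right _ _
    simp only
    gcongr

theorem eventually_le_one (hε : Tendsto ε atTop (𝓝 0)) : ∀ᶠ n in atTop, ε n ≤ 1 :=
  (hε.eventually_lt_const one_pos).mono fun _ hn => hn.le

theorem macroR₁_equicontinuous (h : ∀ n, MacroSolution a β τfin (ε n) (u n) (T n)) (hε : Tendsto ε atTop (𝓝 0))
    {η : ℝ} (hη : 0 < η) : ∃ δ > 0, ∃ N, ∀ n ≥ N, ∀ x y : ℝ × ℝ, dist x y < δ →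
      |macroR₁ τfin (sepConst a) (ε n) (T n) x - macroR₁ τfin (sepConst a) (ε n) (T n) y| < η := by
  have hW := weightBound_nonneg (h 0).d_pos (h 0).τfin_pos.le
  set W := weightBound (sepConst a) τfin
  obtain ⟨δ, hδ, N, hN⟩ := exists_delta_of_modulus
    (modu := fun p => 12 * W * |p.1| ^ (1 / 4 : ℝ) + √(8 * W ^ 2 * (|p.1| + p.2)))
    (by
      have : Continuous fun p : ℝ × ℝ => |p.1| ^ (1 / 4 : ℝ) :=
        continuous_fst.abs.rpow_const fun _ => Or.inr (by norm_num)
      fun_prop) (by simp) hε hη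
  obtain ⟨N', hN'⟩ := eventually_atTop.1 (eventually_le_one hε)
  refine ⟨δ, hδ, max N N', fun n hn x y hxy => ((h n).abs_macroR₁_sub_le (hN' n ((le_max_right _ _).trans hn)) x y).trans_lt
    (lt_of_le_of_lt ?_ (hN n ((le_max_left _ _).trans hn) (dist x y) (by rwa [abs_of_nonneg dist_nonneg])))⟩
  have h1 : |x.1 - y.1| ≤ |dist x y| := by
    rw [abs_of_nonneg dist_nonneg, Prod.dist_eq]; exact le_max_left _ _
  have h2 : |x.2 - y.2| ≤ |dist x y| := by
    rw [abs_of_nonneg dist_nonneg, Prod.dist_eq]; exact le_max_right _ _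
  simp only
  gcongr

theorem exists_subseq_singular (h : ∀ n, MacroSolution a β τfin (ε n) (u n) (T n)) (hε : Tendsto ε atTop (𝓝 0)) :
    ∃ φ : ℕ → ℕ, StrictMono φ ∧ ∃ R : ℝ × ℝ → ℝ,
      TendstoUniformlyOn (fun n => macroR₁ τfin (sepConst a) (ε (φ n)) (T (φ n))) R atTop (domain τfin) := by
  have hd := (h 0).d_pos
  have hτ := (h 0).τfin_pos
  obtain ⟨φ, hφ, R, hR⟩ := exists_subseq_tendstoLocallyUniformlyOn (domain τfin)
    (fun n => macroR₁ τfin (sepConst a) (ε n) (T n))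
    (fun z hz => by
      obtain ⟨N, hN⟩ := eventually_atTop.1 (eventually_le_one hε)
      -- The uniform bound needs ε ≤ 1, which may fail for finitely many indices; their values are
      -- simply added to the bound.
      refine ⟨12 * weightBound (sepConst a) τfin * z.1 ^ (1 / 4 : ℝ) +
        ∑ n ∈ Finset.range N, |macroR₁ τfin (sepConst a) (ε n) (T n) z|, fun n => ?_⟩
      have h0 : 0 ≤ 12 * weightBound (sepConst a) τfin * z.1 ^ (1 / 4 : ℝ) := by
        have := weightBound_nonneg hd hτ.le
        have := hz.1.1
        positivity
      have h1 : 0 ≤ ∑ n ∈ Finset.range N, |macroR₁ τfin (sepConst a) (ε n) (T n) z| :=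
        Finset.sum_nonneg fun _ _ => abs_nonneg _
      rcases le_or_gt N n with hn | hn
      · have := (h n).abs_macroR₁_le_time (hN n hn) (z := z) hz.1.1
        linarith
      · have := Finset.single_le_sum (f := fun n => |macroR₁ τfin (sepConst a) (ε n) (T n) z|)
          (fun _ _ => abs_nonneg _) (Finset.mem_range.2 hn)
        linarith)
    (fun η hη => by
      obtain ⟨δ, hδ, N, hN⟩ := macroR₁_equicontinuous h hε hη
      exact ⟨δ, hδ, N, fun n hn x _ y _ hxy => hN n hn x y hxy⟩)
  refine ⟨φ, hφ, R, tendstoUniformlyOn_of_tail hR fun η hη => ?_⟩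
  have hB : 0 < posBound a τfin := by unfold posBound; positivity
  refine ⟨posBound a τfin + 4 * posBound a τfin / η, ?_⟩
  filter_upwards [(hε.comp hφ.tendsto_atTop).eventually (Iic_mem_nhds one_pos)] with n hn z hz hzX
  have h1 : 0 < 4 * posBound a τfin / η := by positivity
  refine ((h (φ n)).abs_macroR₁_le_tail hn (by linarith)).trans ?_
  rw [div_le_iff₀ (by linarith)]
  have h2 : 4 * posBound a τfin / η ≤ |z.2| - posBound a τfin := by linarith
  rw [div_le_iff₀ hη] at h2
  linarith

theorem tendstoUniformlyOn_subseq {X : Type*} {f : ℕ → X → ℝ} {F : X → ℝ} {s : Set X} {φ : ℕ → ℕ}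
    (hφ : StrictMono φ) (h : TendstoUniformlyOn f F atTop s) : TendstoUniformlyOn (fun n => f (φ n)) F atTop s :=
  fun v hv => hφ.tendsto_atTop.eventually (h v hv)

theorem tendstoLocallyUniformlyOn_subseq {X : Type*} [TopologicalSpace X] {f : ℕ → X → ℝ} {F : X → ℝ} {s : Set X}
    {φ : ℕ → ℕ} (hφ : StrictMono φ) (h : TendstoLocallyUniformlyOn f F atTop s) :
    TendstoLocallyUniformlyOn (fun n => f (φ n)) F atTop s := fun v hv x hx =>
  let ⟨t, ht, h'⟩ := h v hv x hx
  ⟨t, ht, hφ.tendsto_atTop.eventually h'⟩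

/-- Compactness of the rescaled data. -/
theorem exists_isLimit (h : ∀ n, MacroSolution a β τfin (ε n) (u n) (T n)) (hε : Tendsto ε atTop (𝓝 0)) :
    ∃ φ : ℕ → ℕ, StrictMono φ ∧ ∃ (Q R : ℝ × ℝ → ℝ) (ξ : ℝ → ℝ),
      IsLimit τfin (sepConst a) (ε ∘ φ) (u ∘ φ) (T ∘ φ) Q R ξ := by
  obtain ⟨φ₁, hφ₁, ξ, hξ⟩ := exists_subseq_interface h hε
  obtain ⟨φ₂, hφ₂, Q, hQ⟩ := exists_subseq_regular (ε := fun n => ε (φ₁ n)) (u := fun n => u (φ₁ n))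
    (T := fun n => T (φ₁ n)) (fun n => h (φ₁ n)) (hε.comp hφ₁.tendsto_atTop)
  obtain ⟨φ₃, hφ₃, R, hR⟩ := exists_subseq_singular (ε := fun n => ε (φ₁ (φ₂ n))) (u := fun n => u (φ₁ (φ₂ n)))
    (T := fun n => T (φ₁ (φ₂ n))) (fun n => h (φ₁ (φ₂ n))) (hε.comp (hφ₁.comp hφ₂).tendsto_atTop)
  exact ⟨φ₁ ∘ φ₂ ∘ φ₃, hφ₁.comp (hφ₂.comp hφ₃), Q, R, ξ,
    tendstoUniformlyOn_subseq (hφ₂.comp hφ₃) hξ, tendstoLocallyUniformlyOn_subseq hφ₃ hQ, hR⟩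

/-! ### Estimates for the limits -/

variable {P Q R : ℝ × ℝ → ℝ} {ξ : ℝ → ℝ}

theorem abs_ξ_sub_le (h : ∀ n, MacroSolution a β τfin (ε n) (u n) (T n)) (hε : Tendsto ε atTop (𝓝 0))
    (hlim : IsLimit τfin (sepConst a) ε u T Q R ξ) {x y : ℝ} (hx : x ∈ Icc 0 τfin) (hy : y ∈ Icc 0 τfin) :
    |ξ x - ξ y| ≤ |x - y| / (4 * sepConst a) := by
  have h1 := ((hlim.interface.tendsto_at hx).sub (hlim.interface.tendsto_at hy)).abs
  have h2 : Tendsto (fun n => |x - y| / (4 * sepConst a) + ε n) atTop (𝓝 (|x - y| / (4 * sepConst a) + 0)) :=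
    hε.const_add _
  rw [add_zero] at h2
  exact le_of_tendsto_of_tendsto' h1 h2 fun n => (h n).abs_interface_sub_le hy.1 hx.1

theorem monotoneOn_ξ (h : ∀ n, MacroSolution a β τfin (ε n) (u n) (T n))
    (hlim : IsLimit τfin (sepConst a) ε u T Q R ξ) : MonotoneOn ξ (Icc 0 τfin) := fun _ hx _ hy hxy =>
  le_of_tendsto_of_tendsto' (hlim.interface.tendsto_at hx) (hlim.interface.tendsto_at hy) fun n =>
    ((h n).interface_mono_lip hx.1 hxy).1

theorem abs_Q_sub_le (h : ∀ n, MacroSolution a β τfin (ε n) (u n) (T n)) (hε : Tendsto ε atTop (𝓝 0))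
    (hlim : IsLimit τfin (sepConst a) ε u T Q R ξ) {z w : ℝ × ℝ} (hz : z ∈ domain τfin) (hw : w ∈ domain τfin) :
    |Q z - Q w| ≤ a * |z.2 - w.2| + a * √(2 * |z.1 - w.1|) := by
  have h1 := ((hlim.regular.tendsto_at hz).sub (hlim.regular.tendsto_at hw)).abs
  have h2 : Tendsto (fun n => a * (|z.2 - w.2| + ε n) + a * √(2 * |z.1 - w.1|)) atTop
      (𝓝 (a * (|z.2 - w.2| + 0) + a * √(2 * |z.1 - w.1|))) := ((hε.const_add _).const_mul a).add_const _
  rw [add_zero] at h2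
  exact le_of_tendsto_of_tendsto' h1 h2 fun n => (h n).abs_macroQ_sub_le hz.1.1 hw.1.1

theorem abs_R_sub_le (h : ∀ n, MacroSolution a β τfin (ε n) (u n) (T n)) (hε : Tendsto ε atTop (𝓝 0))
    (hlim : IsLimit τfin (sepConst a) ε u T Q R ξ) {z w : ℝ × ℝ} (hz : z ∈ domain τfin) (hw : w ∈ domain τfin) :
    |R z - R w| ≤ 12 * weightBound (sepConst a) τfin * |z.1 - w.1| ^ (1 / 4 : ℝ) +
      √(8 * weightBound (sepConst a) τfin ^ 2 * |z.2 - w.2|) := by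
  have h1 := ((hlim.singular.tendsto_at hz).sub (hlim.singular.tendsto_at hw)).abs
  have h2 : Tendsto (fun n => 12 * weightBound (sepConst a) τfin * |z.1 - w.1| ^ (1 / 4 : ℝ) +
      √(8 * weightBound (sepConst a) τfin ^ 2 * (|z.2 - w.2| + ε n))) atTop
      (𝓝 (12 * weightBound (sepConst a) τfin * |z.1 - w.1| ^ (1 / 4 : ℝ) +
      √(8 * weightBound (sepConst a) τfin ^ 2 * (|z.2 - w.2| + 0)))) :=
    (((hε.const_add _).const_mul _).sqrt).const_add _
  rw [add_zero] at h2
  refine le_of_tendsto_of_tendsto h1 h2 ?_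
  filter_upwards [eventually_le_one hε] with n hn
  exact (h n).abs_macroR₁_sub_le hn z w

theorem abs_R_le_time (h : ∀ n, MacroSolution a β τfin (ε n) (u n) (T n)) (hε : Tendsto ε atTop (𝓝 0))
    (hlim : IsLimit τfin (sepConst a) ε u T Q R ξ) {z : ℝ × ℝ} (hz : z ∈ domain τfin) :
    |R z| ≤ 12 * weightBound (sepConst a) τfin * z.1 ^ (1 / 4 : ℝ) := by
  refine le_of_tendsto (hlim.singular.tendsto_at hz).abs ?_
  filter_upwards [eventually_le_one hε] with n hn
  exact (h n).abs_macroR₁_le_time hn hz.1.1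

theorem R_zero (h : ∀ n, MacroSolution a β τfin (ε n) (u n) (T n))
    (hlim : IsLimit τfin (sepConst a) ε u T Q R ξ) (x : ℝ) : R (0, x) = 0 := by
  have hz : ((0, x) : ℝ × ℝ) ∈ domain τfin := ⟨⟨le_rfl, (h 0).τfin_pos.le⟩, mem_univ _⟩
  refine tendsto_nhds_unique (hlim.singular.tendsto_at hz) ?_
  simp only [(h _).macroR₁_of_nonpos (sepConst a) (z := (0, x)) le_rfl]
  exact tendsto_const_nhds

theorem abs_Q_le (hlim : IsLimit τfin (sepConst a) ε u T Q R ξ) {M : ℝ} (hM : ∀ n, ∀ j : ℤ, |dPhi (u n 0 j)| ≤ M)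
    {z : ℝ × ℝ} (hz : z ∈ domain τfin) : |Q z| ≤ M := by
  refine le_of_tendsto (hlim.regular.tendsto_at hz).abs (Eventually.of_forall fun n => ?_)
  rw [MacroSolution.macroQ_eq]
  exact abs_heatFlow_le (hM n) _ (div_nonneg hz.1.1 (sq_nonneg _))

theorem continuousOn_Q (h : ∀ n, MacroSolution a β τfin (ε n) (u n) (T n)) (hε : Tendsto ε atTop (𝓝 0))
    (hlim : IsLimit τfin (sepConst a) ε u T Q R ξ) : ContinuousOn Q (domain τfin) := by
  intro z hz
  rw [ContinuousWithinAt, tendsto_iff_dist_tendsto_zero]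
  have hc : Continuous fun w : ℝ × ℝ => a * |w.2 - z.2| + a * √(2 * |w.1 - z.1|) := by fun_prop
  have h0 : Tendsto (fun w : ℝ × ℝ => a * |w.2 - z.2| + a * √(2 * |w.1 - z.1|)) (𝓝[domain τfin] z) (𝓝 0) := by
    have := (hc.tendsto z).mono_left (nhdsWithin_le_nhds (s := domain τfin))
    simpa using this
  refine squeeze_zero' (Eventually.of_forall fun _ => dist_nonneg) ?_ h0
  filter_upwards [self_mem_nhdsWithin] with w hw
  exact abs_Q_sub_le h hε hlim hw hz

theorem continuousOn_R (h : ∀ n, MacroSolution a β τfin (ε n) (u n) (T n)) (hε : Tendsto ε atTop (𝓝 0))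
    (hlim : IsLimit τfin (sepConst a) ε u T Q R ξ) : ContinuousOn R (domain τfin) := by
  intro z hz
  rw [ContinuousWithinAt, tendsto_iff_dist_tendsto_zero]
  set W := weightBound (sepConst a) τfin with hW
  have hc : Continuous fun w : ℝ × ℝ => 12 * W * |w.1 - z.1| ^ (1 / 4 : ℝ) + √(8 * W ^ 2 * |w.2 - z.2|) := by
    have : Continuous fun w : ℝ × ℝ => |w.1 - z.1| ^ (1 / 4 : ℝ) :=
      (continuous_fst.sub continuous_const).abs.rpow_const fun _ => Or.inr (by norm_num)
    fun_prop
  have h0 : Tendsto (fun w : ℝ × ℝ => 12 * W * |w.1 - z.1| ^ (1 / 4 : ℝ) + √(8 * W ^ 2 * |w.2 - z.2|))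
      (𝓝[domain τfin] z) (𝓝 0) := by
    have := (hc.tendsto z).mono_left (nhdsWithin_le_nhds (s := domain τfin))
    simpa using this
  refine squeeze_zero' (Eventually.of_forall fun _ => dist_nonneg) ?_ h0
  filter_upwards [self_mem_nhdsWithin] with w hw
  exact abs_R_sub_le h hε hlim hw hz

end Sequence


/-! ### Integration of piecewise constant functions -/

theorem measurable_cell (ε : ℝ) : Measurable (cell ε) := by
  unfold cell
  exact Int.measurable_floor.comp (by fun_prop)

theorem map_cell {ε : ℝ} (hε : 0 < ε) :
    Measure.map (cell ε) volume = ENNReal.ofReal ε • Measure.count := by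
  refine Measure.ext_of_singleton fun j => ?_
  rw [Measure.map_apply (measurable_cell ε) (measurableSet_singleton j)]
  have e : cell ε ⁻¹' {j} = Ico (ε * j - ε / 2) (ε * j + ε / 2) := by
    ext ξ; exact cell_eq_iff hε ξ j
  rw [e, Real.volume_Ico]
  simp only [Measure.smul_apply, Measure.count_singleton, smul_eq_mul, mul_one]
  congr 1; ring

theorem lintegral_cell {ε : ℝ} (hε : 0 < ε) (φ : ℤ → ℝ≥0∞) :
    ∫⁻ ξ, φ (cell ε ξ) = ENNReal.ofReal ε * ∑' j, φ j := by
  rw [← lintegral_map (f := φ) (measurable_of_countable φ) (measurable_cell ε), map_cell hε,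
    lintegral_smul_measure, lintegral_count, smul_eq_mul]

theorem lintegral_cell_le {ε C : ℝ} (hε : 0 < ε) (φ : ℤ → ℝ) (hφ : ∀ s : Finset ℤ, ∑ j ∈ s, |φ j| ≤ C) :
    ∫⁻ ξ, ‖φ (cell ε ξ)‖ₑ ≤ ENNReal.ofReal (ε * C) := by
  rw [lintegral_cell hε (fun j => ‖φ j‖ₑ), ENNReal.ofReal_mul hε.le]
  gcongr
  rw [ENNReal.tsum_eq_iSup_sum]
  refine iSup_le fun s => ?_
  have : ∑ j ∈ s, ‖φ j‖ₑ = ENNReal.ofReal (∑ j ∈ s, |φ j|) := by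
    rw [ENNReal.ofReal_sum_of_nonneg fun j _ => abs_nonneg _]
    exact Finset.sum_congr rfl fun j _ => Real.enorm_eq_ofReal_abs _
  rw [this]
  exact ENNReal.ofReal_le_ofReal (hφ s)

namespace MacroSolution

variable {a β τfin ε : ℝ} {u : ℝ → LInf} {T : ℤ → EReal}

theorem macroP_eq_add (h : MacroSolution a β τfin ε u T) {z : ℝ × ℝ} (hz : 0 ≤ z.1) :
    macroP ε u z = macroQ ε u z + macroR ε T z := by
  obtain ⟨n, hn, h1, h2⟩ := h.index hz
  exact h.sol.dPhi_eq_add h.data.mem_stateSpace hn h1 h2 _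

theorem macroTime_le_of_le (h : MacroSolution a β τfin ε u T) {n k : ℤ} {τ : ℝ} (hk : 0 ≤ k) (hkn : k ≤ n)
    (h1 : T n ≤ ((τ / ε ^ 2 : ℝ) : EReal)) : T k ≠ ⊤ ∧ macroTime ε T k ≤ τ := by
  have h3 := (h.sol.T_mono hk hkn).trans h1
  exact ⟨ne_top_of_le h3, (h.T_le_iff hk (ne_top_of_le h3) τ).1 h3⟩

theorem macroR₁_eq_sum (h : MacroSolution a β τfin ε u T) (d : ℝ) {n : ℤ} (hn : 0 ≤ n) {z : ℝ × ℝ}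
    (hz : z.1 ≤ τfin) (h1 : T n ≤ ((z.1 / ε ^ 2 : ℝ) : EReal)) (h2 : ((z.1 / ε ^ 2 : ℝ) : EReal) < T (n + 1)) :
    macroR₁ τfin d ε T z =
      -2 * ∑ k ∈ Finset.Icc 1 n, regKernel d ε (z.1 - macroTime ε T k) (cell ε z.2 - k) := by
  rw [h.macroR₁_eq, kernelSum]
  congr 1
  apply Finset.sum_congr_of_eq_on_inter
  · intro k hk hk'
    obtain ⟨hk1, hk2⟩ := h.mem_trans.1 hk
    apply regKernel_of_nonpos
    rw [Finset.mem_Icc, not_and] at hk'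
    have h3 : ¬ T k ≤ ((z.1 / ε ^ 2 : ℝ) : EReal) := fun h4 =>
      hk' hk1 ((h.sol.T_le_iff hn (by omega) h1 h2).1 h4)
    rw [h.T_le_iff (by omega) (ne_top_of_le hk2.le)] at h3
    linarith
  -- A transition exactly at the final time may have occurred without being listed in `transitions`,
  -- where the inequality is strict. Its regularized kernel still has age zero and vanishes.
  · intro k hk hk'
    rw [Finset.mem_Icc] at hk
    apply regKernel_of_nonpos
    have h3 := h.macroTime_le_of_le (by omega) hk.2 h1
    have h4 : ¬ T k < ((τfin / ε ^ 2 : ℝ) : EReal) := fun h5 => hk' (h.mem_trans.2 ⟨hk.1, h5⟩)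
    rw [h.T_lt_iff (by omega) h3.1] at h4
    linarith
  · intro k _ _; rfl

theorem macroR_eq_sum (h : MacroSolution a β τfin ε u T) {n : ℤ} (hn : 0 ≤ n) {z : ℝ × ℝ}
    (h1 : T n ≤ ((z.1 / ε ^ 2 : ℝ) : EReal)) (h2 : ((z.1 / ε ^ 2 : ℝ) : EReal) < T (n + 1)) :
    macroR ε T z =
      -2 * ∑ k ∈ Finset.Icc 1 n, heatKernel (cell ε z.2 - k) ((z.1 - macroTime ε T k) / ε ^ 2) := by
  have hε := h.ε_pos
  rw [macroR, h.sol.singularPart_eq hn h1 h2]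
  congr 1
  refine Finset.sum_congr rfl fun k _ => ?_
  rw [macroTime, sub_div, mul_div_cancel_left₀ _ (by positivity)]

/-- Only the last transition contributes to the remainder. -/
theorem macroR₂_eq (h : MacroSolution a β τfin ε u T) {n : ℤ} (hn : 0 ≤ n) {z : ℝ × ℝ}
    (hz : z.1 ≤ τfin) (h1 : T n ≤ ((z.1 / ε ^ 2 : ℝ) : EReal)) (h2 : ((z.1 / ε ^ 2 : ℝ) : EReal) < T (n + 1)) :
    macroR₂ τfin (sepConst a) ε T z = if n = 0 then 0 else
      -2 * (heatKernel (cell ε z.2 - n) ((z.1 - macroTime ε T n) / ε ^ 2)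
        - regKernel (sepConst a) ε (z.1 - macroTime ε T n) (cell ε z.2 - n)) := by
  have hε := h.ε_pos
  have hd := h.d_pos
  rw [macroR₂, h.macroR_eq_sum hn h1 h2, h.macroR₁_eq_sum _ hn hz h1 h2, ← mul_sub, ← Finset.sum_sub_distrib]
  split_ifs with h0
  · subst h0; simp
  · congr 1
    rw [Finset.sum_eq_single n]
    · intro k hk hkn
      rw [Finset.mem_Icc] at hk
      have h3 := h.macroTime_le_of_le (k := n) hn le_rfl h1
      have h4 := h.separation_le hk.1 hk.2 h3.1
      have h5 : (1 : ℝ) ≤ (n : ℝ) - k := by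
        have : (1 : ℤ) ≤ n - k := by omega
        exact_mod_cast this
      -- An earlier transition is at least 4dε old, so its kernel is already fully switched on.
      rw [regKernel_of_le hd hε (by nlinarith [mul_pos hd hε]), sub_self]
    · intro h3
      exact absurd (Finset.mem_Icc.2 ⟨by omega, le_rfl⟩) h3

/-- At each time the remainder is twice the difference of two nonnegative kernels with mass at most
1. The ℓ¹ bound will produce the factor ε after integration over cells. -/
theorem exists_macroR₂_slice (h : MacroSolution a β τfin ε u T) {τ : ℝ} (hτ : τ ∈ Icc 0 τfin) :
    ∃ b : ℤ → ℝ, (∀ x, macroR₂ τfin (sepConst a) ε T (τ, x) = b (cell ε x)) ∧ (∀ j, |b j| ≤ 2) ∧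
      ∀ s : Finset ℤ, ∑ j ∈ s, |b j| ≤ 4 := by
  obtain ⟨n, hn, h1, h2⟩ := h.index hτ.1
  have hε := h.ε_pos
  have hd := h.d_pos
  rcases eq_or_ne n 0 with h0 | h0
  · refine ⟨fun _ => 0, fun x => ?_, fun j => by simp, fun s => by simp⟩
    rw [h.macroR₂_eq (z := (τ, x)) hn hτ.2 h1 h2, if_pos h0]
  · have h3 := (h.macroTime_le_of_le (k := n) hn le_rfl h1).2
    have ht : 0 ≤ (τ - macroTime ε T n) / ε ^ 2 := div_nonneg (by linarith) (by positivity)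
    refine ⟨fun j => -2 * (heatKernel (j - n) ((τ - macroTime ε T n) / ε ^ 2)
        - regKernel (sepConst a) ε (τ - macroTime ε T n) (j - n)), fun x => ?_, fun j => ?_, fun s => ?_⟩
    · rw [h.macroR₂_eq (z := (τ, x)) hn hτ.2 h1 h2, if_neg h0]
    · have e1 := heatKernel_nonneg (j - n) ht
      have e2 := (abs_le.1 (abs_heatKernel_le_one (j - n) ht)).2
      have e3 := regKernel_nonneg hd hε (τ - macroTime ε T n) (j - n)
      have e4 := regKernel_le_one hd hε (τ - macroTime ε T n) (j - n)
      exact abs_le.2 ⟨by linarith, by linarith⟩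
    · have e1 := sum_le_hasSum s (fun j _ => heatKernel_nonneg (j - n) ht) (hasSum_heatKernel_shift' n ht)
      obtain ⟨c, -, hc1, hc⟩ := hasSum_regKernel hd hε (τ - macroTime ε T n) n
      have e2 := sum_le_hasSum s (fun j _ => regKernel_nonneg hd hε _ _) hc
      calc ∑ j ∈ s, |-2 * (heatKernel (j - n) ((τ - macroTime ε T n) / ε ^ 2)
            - regKernel (sepConst a) ε (τ - macroTime ε T n) (j - n))|
          ≤ ∑ j ∈ s, 2 * (heatKernel (j - n) ((τ - macroTime ε T n) / ε ^ 2)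
            + regKernel (sepConst a) ε (τ - macroTime ε T n) (j - n)) := by
            refine Finset.sum_le_sum fun j _ => ?_
            have e1 := heatKernel_nonneg (j - n) ht
            have e3 := regKernel_nonneg hd hε (τ - macroTime ε T n) (j - n)
            exact abs_le.2 ⟨by linarith, by linarith⟩
        _ ≤ 4 := by rw [← Finset.mul_sum, Finset.sum_add_distrib]; linarith

theorem macroR₂_eq_zero (h : MacroSolution a β τfin ε u T) {τ : ℝ} (hτ : τ ∈ Icc 0 τfin)
    (hT : ∀ k : ℤ, 1 ≤ k → T k ≠ ⊤ → macroTime ε T k ≤ τ → macroTime ε T k + sepConst a * ε ≤ τ) (x : ℝ) :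
    macroR₂ τfin (sepConst a) ε T (τ, x) = 0 := by
  obtain ⟨n, hn, h1, h2⟩ := h.index hτ.1
  rw [h.macroR₂_eq (z := (τ, x)) hn hτ.2 h1 h2]
  split_ifs with h0
  · rfl
  · have h3 := h.macroTime_le_of_le (k := n) hn le_rfl h1
    have h4 := hT n (by omega) h3.1 h3.2
    rw [regKernel_of_le h.d_pos h.ε_pos (by linarith), sub_self, mul_zero]

theorem measurable_of_cell {f : ℝ → ℤ → ℝ} (hf : ∀ j, Measurable fun τ => f τ j) (ε : ℝ) :
    Measurable fun z : ℝ × ℝ => f z.1 (cell ε z.2) := by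
  have h1 : Measurable fun p : ℝ × ℤ => f p.1 p.2 := measurable_from_prod_countable_left hf
  exact h1.comp (measurable_fst.prodMk ((measurable_cell ε).comp measurable_snd))

theorem measurable_regKernel (d ε : ℝ) (j : ℤ) : Measurable fun τ => regKernel d ε τ j := by
  unfold regKernel
  refine Measurable.ite measurableSet_Iic measurable_const (Measurable.ite measurableSet_Iic (by fun_prop) ?_)
  exact (continuous_heatKernel j).measurable.comp (by fun_prop)

theorem measurableSet_domain (τfin : ℝ) : MeasurableSet (domain τfin) := measurableSet_Icc.prod MeasurableSet.univ

theorem measurable_macroR₁ (h : MacroSolution a β τfin ε u T) (d : ℝ) : Measurable (macroR₁ τfin d ε T) := by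
  have e : macroR₁ τfin d ε T = fun z => kernelSum d ε h.trans (macroTime ε T) z.1 (cell ε z.2) := by
    ext z; exact h.macroR₁_eq d z
  rw [e]
  refine measurable_of_cell (f := kernelSum d ε h.trans (macroTime ε T)) (fun j => ?_) ε
  unfold kernelSum
  exact (Finset.measurable_fun_sum _ fun k _ => (measurable_regKernel d ε _).comp (by fun_prop)).const_mul _

/-- The number of summands depends on time, so the sum is rewritten over the fixed range of indices
reached at the final time, with each term cut off before its transition. -/
theorem aestronglyMeasurable_macroR (h : MacroSolution a β τfin ε u T) :
    AEStronglyMeasurable (macroR ε T) (volume.restrict (domain τfin)) := by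
  obtain ⟨N, hN, h1, h2⟩ := h.index h.τfin_pos.le
  have hm : Measurable fun z : ℝ × ℝ => -2 * ∑ k ∈ Finset.Icc 1 N,
      if macroTime ε T k ≤ z.1 then heatKernel (cell ε z.2 - k) ((z.1 - macroTime ε T k) / ε ^ 2) else 0 := by
    refine measurable_of_cell (f := fun τ j => -2 * ∑ k ∈ Finset.Icc 1 N,
      if macroTime ε T k ≤ τ then heatKernel (j - k) ((τ - macroTime ε T k) / ε ^ 2) else 0) (fun j => ?_) ε
    refine (Finset.measurable_fun_sum _ fun k _ => ?_).const_mul _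
    refine Measurable.ite measurableSet_Ici ?_ measurable_const
    exact (continuous_heatKernel _).measurable.comp (by fun_prop)
  refine hm.aestronglyMeasurable.congr ?_
  refine (ae_restrict_iff' (measurableSet_domain τfin)).2 (Eventually.of_forall fun z hz => ?_)
  obtain ⟨n, hn, h3, h4⟩ := h.index hz.1.1
  have hnN : n ≤ N := by
    rw [← h.sol.T_le_iff hN hn h1 h2]
    refine h3.trans ?_
    have := h.ε_pos
    rw [EReal.coe_le_coe_iff]
    have := hz.1.2
    gcongr
  simp only
  rw [h.macroR_eq_sum hn h3 h4]
  congr 1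
  symm
  rw [← Finset.sum_filter]
  apply Finset.sum_congr _ fun _ _ => rfl
  ext k
  simp only [Finset.mem_filter, Finset.mem_Icc]
  constructor
  · rintro ⟨hk1, hk2⟩
    exact ⟨⟨hk1, hk2.trans hnN⟩, (h.macroTime_le_of_le (by omega) hk2 h3).2⟩
  · rintro ⟨⟨hk1, hk2⟩, hk3⟩
    have hTk := (h.macroTime_le_of_le (by omega) hk2 h1).1
    exact ⟨hk1, (h.sol.T_le_iff hn (by omega) h3 h4).1 ((h.T_le_iff (by omega) hTk _).2 hk3)⟩

theorem aestronglyMeasurable_macroR₂ (h : MacroSolution a β τfin ε u T) (d : ℝ) :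
    AEStronglyMeasurable (macroR₂ τfin d ε T) (volume.restrict (domain τfin)) :=
  h.aestronglyMeasurable_macroR.sub (h.measurable_macroR₁ d).aestronglyMeasurable

theorem lintegral_macroR₂_le (h : MacroSolution a β τfin ε u T) :
    ∫⁻ z in domain τfin, ‖macroR₂ τfin (sepConst a) ε T z‖ₑ ≤ ENNReal.ofReal (4 * τfin) * ENNReal.ofReal ε := by
  have hm := (h.aestronglyMeasurable_macroR₂ (sepConst a)).enorm
  unfold domain at hm ⊢
  rw [Measure.volume_eq_prod, ← Measure.prod_restrict, Measure.restrict_univ] at hm ⊢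
  rw [lintegral_prod _ hm]
  have hτ := h.τfin_pos
  have hε := h.ε_pos
  calc ∫⁻ τ in Icc 0 τfin, ∫⁻ x, ‖macroR₂ τfin (sepConst a) ε T (τ, x)‖ₑ
      ≤ ∫⁻ τ in Icc 0 τfin, ENNReal.ofReal (ε * 4) := by
        refine setLIntegral_mono' measurableSet_Icc fun τ hτ => ?_
        obtain ⟨b, hb1, hb2, hb3⟩ := h.exists_macroR₂_slice hτ
        simp only [hb1]
        exact lintegral_cell_le h.ε_pos b hb3
    _ = ENNReal.ofReal (4 * τfin) * ENNReal.ofReal ε := by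
        rw [setLIntegral_const, Real.volume_Icc, sub_zero, ← ENNReal.ofReal_mul (by positivity),
          ← ENNReal.ofReal_mul (by positivity)]
        congr 1; ring

/-- Interpolation between the sup bound 2 and the L¹ bound of order ε. -/
theorem eLpNorm_macroR₂_le (h : MacroSolution a β τfin ε u T) {s : ℝ≥0∞} (hs1 : 1 ≤ s) (hs : s < ⊤) :
    eLpNorm (macroR₂ τfin (sepConst a) ε T) s (volume.restrict (domain τfin)) ≤
      (2 ^ (s.toReal - 1) * (ENNReal.ofReal (4 * τfin) * ENNReal.ofReal ε)) ^ (1 / s.toReal) := by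
  have hs0 : s ≠ 0 := (one_pos.trans_le hs1).ne'
  have hsr : 1 ≤ s.toReal := by
    have := ENNReal.toReal_mono hs.ne hs1
    simpa using this
  rw [eLpNorm_eq_lintegral_rpow_enorm_toReal hs0 hs.ne]
  gcongr
  calc ∫⁻ z in domain τfin, ‖macroR₂ τfin (sepConst a) ε T z‖ₑ ^ s.toReal
      ≤ ∫⁻ z in domain τfin, 2 ^ (s.toReal - 1) * ‖macroR₂ τfin (sepConst a) ε T z‖ₑ := by
        refine setLIntegral_mono' (measurableSet_domain τfin) fun z hz => ?_
        obtain ⟨b, hb1, hb2, -⟩ := h.exists_macroR₂_slice hz.1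
        have h2 : ‖macroR₂ τfin (sepConst a) ε T z‖ₑ ≤ 2 := by
          rw [show z = (z.1, z.2) from rfl, hb1, Real.enorm_eq_ofReal_abs]
          simpa using ENNReal.ofReal_le_ofReal (hb2 (cell ε z.2))
        set x := ‖macroR₂ τfin (sepConst a) ε T z‖ₑ
        calc x ^ s.toReal = x ^ (s.toReal - 1) * x := by
              conv_lhs => rw [← sub_add_cancel s.toReal 1]
              rw [ENNReal.rpow_add_of_nonneg _ _ (by linarith) zero_le_one, ENNReal.rpow_one]
          _ ≤ _ := by gcongr
    _ = 2 ^ (s.toReal - 1) * ∫⁻ z in domain τfin, ‖macroR₂ τfin (sepConst a) ε T z‖ₑ :=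
        lintegral_const_mul'' _ (h.aestronglyMeasurable_macroR₂ _).enorm
    _ ≤ _ := by gcongr; exact h.lintegral_macroR₂_le

end MacroSolution

section Sequence

variable {a β τfin : ℝ} {ε : ℕ → ℝ} {u : ℕ → ℝ → LInf} {T : ℕ → ℤ → EReal}
variable {P Q R : ℝ × ℝ → ℝ} {ξ : ℝ → ℝ}

theorem tendsto_eLpNorm_macroR₂ (h : ∀ n, MacroSolution a β τfin (ε n) (u n) (T n)) (hε : Tendsto ε atTop (𝓝 0))
    {s : ℝ≥0∞} (hs1 : 1 ≤ s) (hs : s < ⊤) :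
    Tendsto (fun n => eLpNorm (macroR₂ τfin (sepConst a) (ε n) (T n)) s (volume.restrict (domain τfin)))
      atTop (𝓝 0) := by
  have hsr : 1 ≤ s.toReal := by
    have := ENNReal.toReal_mono hs.ne hs1
    simpa using this
  have hpos : 0 < 1 / s.toReal := by positivity
  have h1 : Tendsto (fun n => ENNReal.ofReal (ε n)) atTop (𝓝 0) := by
    have h0 := (ENNReal.continuous_ofReal.tendsto 0).comp hε
    rw [ENNReal.ofReal_zero] at h0
    exact h0
  have h2 : Tendsto (fun n => 2 ^ (s.toReal - 1) * (ENNReal.ofReal (4 * τfin) * ENNReal.ofReal (ε n))) atTop (𝓝 0) := by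
    have h3 := ENNReal.Tendsto.const_mul (a := ENNReal.ofReal (4 * τfin)) h1 (Or.inr ENNReal.ofReal_ne_top)
    have h4 := ENNReal.Tendsto.const_mul (a := (2 : ℝ≥0∞) ^ (s.toReal - 1)) h3
      (Or.inr (ENNReal.rpow_ne_top_of_nonneg (by linarith) (by simp)))
    simpa using h4
  have h5 := ((ENNReal.continuous_rpow_const (y := 1 / s.toReal)).tendsto 0).comp h2
  rw [ENNReal.zero_rpow_of_pos hpos] at h5
  exact tendsto_of_tendsto_of_tendsto_of_le_of_le tendsto_const_nhds h5 (fun _ => zero_le)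
    fun n => (h n).eLpNorm_macroR₂_le hs1 hs

theorem tendsto_eLpNorm_macroP_sub (h : ∀ n, MacroSolution a β τfin (ε n) (u n) (T n)) (hε : Tendsto ε atTop (𝓝 0))
    (hlim : IsLimit τfin (sepConst a) ε u T Q R ξ) (hP : ∀ z, P z = Q z + R z) {s : ℝ≥0∞} (hs1 : 1 ≤ s) (hs : s < ⊤)
    {K : Set (ℝ × ℝ)} (hK : K ⊆ domain τfin) (hKc : IsCompact K) :
    Tendsto (fun n => eLpNorm (fun z => macroP (ε n) (u n) z - P z) s (volume.restrict K)) atTop (𝓝 0) := by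
  have hR₂ := tendsto_eLpNorm_macroR₂ h hε hs1 hs
  have hs0 : s ≠ 0 := (one_pos.trans_le hs1).ne'
  have hV : volume K ^ (1 / s.toReal) ≠ ⊤ :=
    ENNReal.rpow_ne_top_of_nonneg (by positivity) hKc.measure_lt_top.ne
  rw [ENNReal.tendsto_nhds_zero] at hR₂ ⊢
  intro e he
  have he2 : 0 < e / 2 := ENNReal.half_pos he.ne'
  obtain ⟨η, hη, hηV⟩ : ∃ η : ℝ≥0, 0 < η ∧ (η : ℝ≥0∞) * volume K ^ (1 / s.toReal) ≤ e / 2 := by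
    rcases eq_or_ne (e / 2) ⊤ with h1 | h1
    · exact ⟨1, one_pos, by rw [h1]; exact le_top⟩
    · obtain ⟨η, hη1, hη2⟩ := ENNReal.exists_nnreal_pos_mul_lt hV he2.ne'
      exact ⟨η, hη1, hη2.le⟩
  have hQ : TendstoUniformlyOn (fun n => macroQ (ε n) (u n)) Q atTop K :=
    (tendstoLocallyUniformlyOn_iff_tendstoUniformlyOn_of_compact hKc).1 (hlim.regular.mono hK)
  have hR := hlim.singular.mono hK
  rw [Metric.tendstoUniformlyOn_iff] at hQ hR
  filter_upwards [hR₂ (e / 2) he2, hQ (η / 2) (by positivity), hR (η / 2) (by positivity)] with n hn1 hn2 hn3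
  have hbd : ∀ᵐ z ∂(volume.restrict K), ‖macroP (ε n) (u n) z - P z‖ ≤
      ‖(η : ℝ) + ‖macroR₂ τfin (sepConst a) (ε n) (T n) z‖‖ := by
    refine (ae_restrict_iff' hKc.measurableSet).2 (Eventually.of_forall fun z hz => ?_)
    have h1 := hn2 z hz
    have h2 := hn3 z hz
    rw [Real.dist_eq] at h1 h2
    rw [(h n).macroP_eq_add (hK hz).1.1, hP]
    have e1 : macroQ (ε n) (u n) z + macroR (ε n) (T n) z - (Q z + R z) =
        -(Q z - macroQ (ε n) (u n) z) - (R z - macroR₁ τfin (sepConst a) (ε n) (T n) z)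
          + macroR₂ τfin (sepConst a) (ε n) (T n) z := by unfold macroR₂; ring
    rw [e1]
    refine (norm_add_le _ _).trans ?_
    rw [Real.norm_of_nonneg (by positivity : 0 ≤ (η : ℝ) + ‖macroR₂ τfin (sepConst a) (ε n) (T n) z‖)]
    gcongr
    refine (norm_sub_le _ _).trans ?_
    rw [norm_neg, Real.norm_eq_abs, Real.norm_eq_abs]
    linarith
  have hm : AEStronglyMeasurable (macroR₂ τfin (sepConst a) (ε n) (T n)) (volume.restrict K) :=
    ((h n).aestronglyMeasurable_macroR₂ _).mono_measure (Measure.restrict_mono hK le_rfl)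
  calc eLpNorm (fun z => macroP (ε n) (u n) z - P z) s (volume.restrict K)
      ≤ eLpNorm (fun z => (η : ℝ) + ‖macroR₂ τfin (sepConst a) (ε n) (T n) z‖) s (volume.restrict K) :=
        eLpNorm_mono_ae hbd
    _ ≤ eLpNorm (fun _ => (η : ℝ)) s (volume.restrict K) +
        eLpNorm (fun z => ‖macroR₂ τfin (sepConst a) (ε n) (T n) z‖) s (volume.restrict K) :=
        eLpNorm_add_le aestronglyMeasurable_const hm.norm hs1
    _ ≤ e / 2 + e / 2 := by
        gcongr
        · rw [eLpNorm_const' _ hs0 hs.ne, Measure.restrict_apply_univ]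
          simpa using hηV
        · rw [eLpNorm_norm]
          exact (eLpNorm_mono_measure _ (Measure.restrict_mono hK le_rfl)).trans hn1
    _ = e := ENNReal.add_halves e

end Sequence


/-! ### Convolution with the Gaussian kernel -/

theorem integrable_exp_neg_abs : Integrable fun x : ℝ => Real.exp (-|x|) := by
  refine (integrable_inv_one_add_sq.const_mul 2).mono' (by fun_prop) (Eventually.of_forall fun x => ?_)
  rw [Real.norm_eq_abs, abs_of_pos (Real.exp_pos _), Real.exp_neg, ← div_eq_mul_inv, inv_eq_one_div,
    div_le_div_iff₀ (Real.exp_pos _) (by positivity)]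
  have := Real.quadratic_le_exp_of_nonneg (abs_nonneg x)
  nlinarith [sq_abs x, abs_nonneg x]

/-- The moments `x^m e^{-x²/(4τ)}` of the Gaussian. -/
noncomputable def gaussianMoment (m : ℕ) (τ x : ℝ) : ℝ := x ^ m * Real.exp (-x ^ 2 / (4 * τ))

/-- The power is absorbed by m!·e^|x|, and completing the square gives -x²/(4τ) ≤ 4τ - 2|x|. The
resulting majorant does not depend on τ ≤ τ₁, as differentiation under the integral requires. -/
theorem abs_gaussianMoment_le (m : ℕ) {τ τ₁ : ℝ} (hτ : 0 < τ) (hτ₁ : τ ≤ τ₁) (x : ℝ) :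
    |gaussianMoment m τ x| ≤ m.factorial * Real.exp (4 * τ₁) * Real.exp (-|x|) := by
  have h1 : |x| ^ m ≤ m.factorial * Real.exp |x| := by
    have := Real.pow_div_factorial_le_exp |x| (abs_nonneg x) m
    rw [div_le_iff₀ (by positivity)] at this
    linarith
  have h2 : -x ^ 2 / (4 * τ) ≤ 4 * τ₁ - 2 * |x| := by
    rw [div_le_iff₀ (by positivity)]
    nlinarith [sq_nonneg (|x| - 4 * τ), sq_abs x, mul_le_mul_of_nonneg_left hτ₁ hτ.le]
  rw [gaussianMoment, abs_mul, abs_pow, Real.abs_exp]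
  calc |x| ^ m * Real.exp (-x ^ 2 / (4 * τ)) ≤ (m.factorial * Real.exp |x|) * Real.exp (4 * τ₁ - 2 * |x|) := by
        gcongr
    _ = _ := by
        rw [mul_assoc, mul_assoc, ← Real.exp_add, ← Real.exp_add]
        ring_nf

theorem abs_gaussianMoment_sub_le (m : ℕ) {τ τ₁ x x₀ : ℝ} (hτ : 0 < τ) (hτ₁ : τ ≤ τ₁) (hx : |x - x₀| ≤ 1) (y : ℝ) :
    |gaussianMoment m τ (x - y)| ≤ m.factorial * Real.exp (4 * τ₁ + 1) * Real.exp (-|x₀ - y|) := by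
  refine (abs_gaussianMoment_le m hτ hτ₁ _).trans ?_
  rw [mul_assoc, mul_assoc, ← Real.exp_add, ← Real.exp_add]
  gcongr ?_ * Real.exp ?_
  have : |x₀ - y| ≤ |x - y| + |x - x₀| := by
    rw [abs_sub_comm x x₀, add_comm]; exact abs_sub_le _ _ _
  linarith

/-- The moments are introduced because they form a family closed under both derivatives. The
truncated index at m = 0 is harmless, its coefficient being zero. -/
theorem hasDerivAt_gaussianMoment_space (m : ℕ) (τ x : ℝ) :
    HasDerivAt (gaussianMoment m τ)
      (m * gaussianMoment (m - 1) τ x - gaussianMoment (m + 1) τ x / (2 * τ)) x := by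
  have h := (hasDerivAt_pow m x).mul ((((hasDerivAt_pow 2 x).neg).div_const (4 * τ)).exp)
  refine h.congr_deriv ?_
  simp only [gaussianMoment, Pi.neg_apply]
  ring

theorem hasDerivAt_gaussianMoment_time (m : ℕ) {τ : ℝ} (hτ : τ ≠ 0) (x : ℝ) :
    HasDerivAt (fun s => gaussianMoment m s x) (gaussianMoment (m + 2) τ x / (4 * τ ^ 2)) τ := by
  have h := (((hasDerivAt_id τ).const_mul 4).inv (by simpa using hτ)).const_mul (-x ^ 2)
  refine ((h.exp).const_mul (x ^ m)).congr_deriv ?_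
  simp only [gaussianMoment, id, div_eq_mul_inv, Pi.inv_apply]
  field_simp
  ring

noncomputable def gaussianConv (m : ℕ) (f : ℝ → ℝ) (τ x : ℝ) : ℝ := ∫ y, gaussianMoment m τ (x - y) * f y

section Conv

variable {f : ℝ → ℝ} {M : ℝ}

theorem continuous_gaussianMoment (m : ℕ) (τ : ℝ) : Continuous (gaussianMoment m τ) := by
  unfold gaussianMoment; fun_prop

theorem integrable_gaussianDominant (C M x₀ : ℝ) : Integrable fun y : ℝ => C * Real.exp (-|x₀ - y|) * M :=
  ((integrable_exp_neg_abs.comp_sub_left x₀).const_mul C).mul_const M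

theorem aestronglyMeasurable_gaussian (hf : Continuous f) (m : ℕ) (τ x : ℝ) :
    AEStronglyMeasurable (fun y => gaussianMoment m τ (x - y) * f y) :=
  (((continuous_gaussianMoment m τ).comp (continuous_const.sub continuous_id)).mul hf).aestronglyMeasurable

theorem norm_gaussian_mul_le (hM : ∀ y, |f y| ≤ M) (m : ℕ) {τ τ₁ x x₀ : ℝ} (hτ : 0 < τ) (hτ₁ : τ ≤ τ₁)
    (hx : |x - x₀| ≤ 1) (y : ℝ) :
    ‖gaussianMoment m τ (x - y) * f y‖ ≤ m.factorial * Real.exp (4 * τ₁ + 1) * Real.exp (-|x₀ - y|) * M := by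
  rw [norm_mul, Real.norm_eq_abs, Real.norm_eq_abs]
  exact mul_le_mul (abs_gaussianMoment_sub_le m hτ hτ₁ hx y) (hM y) (abs_nonneg _) (by positivity)

theorem integrable_gaussian_mul (hf : Continuous f) (hM : ∀ y, |f y| ≤ M) (m : ℕ) {τ : ℝ} (hτ : 0 < τ) (x : ℝ) :
    Integrable fun y => gaussianMoment m τ (x - y) * f y :=
  (integrable_gaussianDominant _ M x).mono' (aestronglyMeasurable_gaussian hf m τ x)
    (Eventually.of_forall fun y => norm_gaussian_mul_le hM m hτ le_rfl (by simp) y)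

theorem hasDerivAt_gaussianConv_space (hf : Continuous f) (hM : ∀ y, |f y| ≤ M) (m : ℕ) {τ : ℝ} (hτ : 0 < τ) (x : ℝ) :
    HasDerivAt (gaussianConv m f τ)
      (m * gaussianConv (m - 1) f τ x - gaussianConv (m + 1) f τ x / (2 * τ)) x := by
  have hb := (integrable_gaussianDominant ((m - 1).factorial * Real.exp (4 * τ + 1)) M x).const_mul (m : ℝ)
  have hb' := (integrable_gaussianDominant ((m + 1).factorial * Real.exp (4 * τ + 1)) M x).div_const (2 * τ)
  have key := (hasDerivAt_integral_of_dominated_loc_of_deriv_le (μ := volume) (x₀ := x) (s := Metric.ball x 1)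
    (F := fun x y => gaussianMoment m τ (x - y) * f y)
    (F' := fun x y => m * (gaussianMoment (m - 1) τ (x - y) * f y) - gaussianMoment (m + 1) τ (x - y) * f y / (2 * τ))
    (Metric.ball_mem_nhds x one_pos) (Eventually.of_forall fun x => aestronglyMeasurable_gaussian hf m τ x)
    (integrable_gaussian_mul hf hM m hτ x)
    (((aestronglyMeasurable_gaussian hf _ τ x).const_mul _).sub
      ((aestronglyMeasurable_gaussian hf _ τ x).mul_const (2 * τ)⁻¹))
    (Eventually.of_forall fun y z hz => ?_) (hb.add hb') (Eventually.of_forall fun y z _ => ?_)).2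
  · refine key.congr_deriv ?_
    rw [integral_sub ((integrable_gaussian_mul hf hM _ hτ x).const_mul _)
      ((integrable_gaussian_mul hf hM _ hτ x).div_const _), integral_const_mul, integral_div]
    rfl
  · have hz' : |z - x| ≤ 1 := (Metric.mem_ball.1 hz).le
    refine (norm_sub_le _ _).trans ?_
    rw [norm_mul, norm_div]
    have e1 : ‖(m : ℝ)‖ = m := by simp
    have e2 : ‖2 * τ‖ = 2 * τ := Real.norm_of_nonneg (by positivity)
    rw [e1, e2]
    exact add_le_add (mul_le_mul_of_nonneg_left (norm_gaussian_mul_le hM _ hτ le_rfl hz' y) (by positivity))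
      (div_le_div_of_nonneg_right (norm_gaussian_mul_le hM _ hτ le_rfl hz' y) (by positivity))
  · have h := ((hasDerivAt_gaussianMoment_space m τ (z - y)).comp z ((hasDerivAt_id z).sub_const y)).mul_const (f y)
    refine h.congr_deriv ?_
    ring

theorem hasDerivAt_gaussianConv_time (hf : Continuous f) (hM : ∀ y, |f y| ≤ M) (m : ℕ) {τ : ℝ} (hτ : 0 < τ) (x : ℝ) :
    HasDerivAt (fun s => gaussianConv m f s x) (gaussianConv (m + 2) f τ x / (4 * τ ^ 2)) τ := by
  have hb := (integrable_gaussianDominant ((m + 2).factorial * Real.exp (4 * (2 * τ) + 1)) M x).div_const (τ ^ 2)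
  have key := (hasDerivAt_integral_of_dominated_loc_of_deriv_le (μ := volume) (x₀ := τ) (s := Ioo (τ / 2) (2 * τ))
    (F := fun s y => gaussianMoment m s (x - y) * f y)
    (F' := fun s y => gaussianMoment (m + 2) s (x - y) * f y / (4 * s ^ 2))
    (Ioo_mem_nhds (by linarith) (by linarith)) (Eventually.of_forall fun s => aestronglyMeasurable_gaussian hf m s x)
    (integrable_gaussian_mul hf hM m hτ x)
    ((aestronglyMeasurable_gaussian hf _ τ x).mul_const (4 * τ ^ 2)⁻¹)
    (Eventually.of_forall fun y s hs => ?_) hb (Eventually.of_forall fun y s hs => ?_)).2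
  · refine key.congr_deriv ?_
    rw [integral_div]
    rfl
  · have hs0 : 0 < s := by linarith [hs.1]
    have e2 : ‖4 * s ^ 2‖ = 4 * s ^ 2 := Real.norm_of_nonneg (by positivity)
    rw [norm_div, e2]
    gcongr
    · exact (norm_nonneg _).trans (norm_gaussian_mul_le hM _ hτ (by linarith) (x := x) (by simp) y)
    · exact norm_gaussian_mul_le hM _ hs0 hs.2.le (by simp) y
    · nlinarith [hs.1]
  · have hs0 : s ≠ 0 := by linarith [hs.1]
    refine ((hasDerivAt_gaussianMoment_time m hs0 (x - y)).mul_const (f y)).congr_deriv ?_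
    ring

theorem continuousAt_gaussianConv (hf : Continuous f) (hM : ∀ y, |f y| ≤ M) (m : ℕ) {z : ℝ × ℝ} (hz : 0 < z.1) :
    ContinuousAt (fun w : ℝ × ℝ => gaussianConv m f w.1 w.2) z := by
  have hnhds : Ioo 0 (2 * z.1) ×ˢ Metric.ball z.2 1 ∈ 𝓝 z :=
    prod_mem_nhds (Ioo_mem_nhds hz (by linarith)) (Metric.ball_mem_nhds _ one_pos)
  refine continuousAt_of_dominated (F := fun (w : ℝ × ℝ) y => gaussianMoment m w.1 (w.2 - y) * f y)
    (Eventually.of_forall fun w => aestronglyMeasurable_gaussian hf m w.1 w.2) ?_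
    (integrable_gaussianDominant (m.factorial * Real.exp (4 * (2 * z.1) + 1)) M z.2)
    (Eventually.of_forall fun y => ?_)
  · filter_upwards [hnhds] with w hw
    exact Eventually.of_forall fun y => norm_gaussian_mul_le hM m hw.1.1 hw.1.2.le (Metric.mem_ball.1 hw.2).le y
  · unfold gaussianMoment
    have : (4 * z.1) ≠ 0 := by positivity
    fun_prop (disch := assumption)

/-- The Gaussian convolution solves the heat equation. -/
theorem isHeatSolution_of_gaussianConv {Q : ℝ × ℝ → ℝ} {τfin : ℝ} (hQ : ContinuousOn Q (domain τfin))
    (hf : Continuous f) (hM : ∀ y, |f y| ≤ M) (h0 : ∀ x, Q (0, x) = f x)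
    (h : ∀ τ ∈ Ioo 0 τfin, ∀ x, Q (τ, x) = (√(4 * Real.pi * τ))⁻¹ * gaussianConv 0 f τ x) :
    IsHeatSolution τfin f Q := by
  have hc : ContinuousOn (fun z : ℝ × ℝ => (√(4 * Real.pi * z.1))⁻¹) (Ioo 0 τfin ×ˢ univ) := by
    refine ContinuousOn.inv₀ (by fun_prop) fun z hz => ?_
    have := hz.1.1
    positivity
  have hF (m : ℕ) : ContinuousOn (fun w : ℝ × ℝ => gaussianConv m f w.1 w.2) (Ioo 0 τfin ×ˢ univ) :=
    fun z hz => (continuousAt_gaussianConv hf hM m hz.1.1).continuousWithinAt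
  have ht : ContinuousOn (fun z : ℝ × ℝ => (2 * z.1)⁻¹) (Ioo 0 τfin ×ˢ univ) := by
    refine ContinuousOn.inv₀ (by fun_prop) fun z hz => ?_
    have := hz.1.1
    positivity
  refine ⟨hQ, h0, fun z => (√(4 * Real.pi * z.1))⁻¹ * (-(gaussianConv 1 f z.1 z.2 * (2 * z.1)⁻¹)),
    fun z => (√(4 * Real.pi * z.1))⁻¹ *
      (-((gaussianConv 0 f z.1 z.2 - gaussianConv 2 f z.1 z.2 * (2 * z.1)⁻¹) * (2 * z.1)⁻¹)),
    hc.mul ((hF 1).mul ht).neg, hc.mul (((hF 0).sub ((hF 2).mul ht)).mul ht).neg, fun τ hτ x => ⟨?_, ?_, ?_⟩⟩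
  · have e : (fun y => Q (τ, y)) = fun y => (√(4 * Real.pi * τ))⁻¹ * gaussianConv 0 f τ y := funext (h τ hτ)
    rw [e]
    refine ((hasDerivAt_gaussianConv_space hf hM 0 hτ.1 x).const_mul _).congr_deriv ?_
    simp [div_eq_mul_inv]
  · change HasDerivAt (fun y => (√(4 * Real.pi * τ))⁻¹ * -(gaussianConv 1 f τ y * (2 * τ)⁻¹)) _ x
    refine (((hasDerivAt_gaussianConv_space hf hM 1 hτ.1 x).mul_const (2 * τ)⁻¹).fun_neg.const_mul _).congr_deriv ?_
    simp [div_eq_mul_inv]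
  · have e : (fun s => Q (s, x)) =ᶠ[𝓝 τ] fun s => (√(4 * Real.pi * s))⁻¹ * gaussianConv 0 f s x := by
      filter_upwards [Ioo_mem_nhds hτ.1 hτ.2] with s hs using h s hs x
    have hτ0 : τ ≠ 0 := hτ.1.ne'
    have hp : 0 < 4 * Real.pi * τ := by have := hτ.1; positivity
    have h1 := ((((hasDerivAt_id τ).const_mul (4 * Real.pi)).sqrt (by simpa using hp.ne')).inv
      (by simpa using (Real.sqrt_pos.2 hp).ne')).mul (hasDerivAt_gaussianConv_time hf hM 0 hτ.1 x)
    refine (h1.congr_of_eventuallyEq e).congr_deriv ?_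
    have hs : √(4 * Real.pi * τ) ^ 2 = 4 * Real.pi * τ := Real.sq_sqrt hp.le
    have hs0 := (Real.sqrt_pos.2 hp).ne'
    simp only [id, mul_one, Pi.inv_apply, zero_add]
    rw [hs]
    field_simp
    ring

end Conv


/-! ### Local limit theorem for the discrete heat kernel -/

theorem integrable_cell {ε : ℝ} (hε : 0 < ε) {φ : ℤ → ℝ} (hφ : Summable φ) : Integrable fun ξ => φ (cell ε ξ) := by
  refine ⟨((measurable_of_countable φ).comp (measurable_cell ε)).aestronglyMeasurable, ?_⟩
  rw [HasFiniteIntegral, lintegral_cell hε (fun j => ‖φ j‖ₑ)]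
  refine ENNReal.mul_lt_top ENNReal.ofReal_lt_top ?_
  have h := (summable_norm_iff.2 hφ)
  simp_rw [enorm_eq_nnnorm]
  exact lt_top_iff_ne_top.2 (ENNReal.tsum_coe_ne_top_iff_summable_coe.2 h)

theorem integral_cell {ε : ℝ} (hε : 0 < ε) {φ : ℤ → ℝ} (hφ : Summable φ) :
    ∫ ξ, φ (cell ε ξ) = ε * ∑' j, φ j := by
  have hm : AEStronglyMeasurable φ (Measure.map (cell ε) volume) :=
    (measurable_of_countable φ).aestronglyMeasurable
  have hi : Integrable φ (Measure.map (cell ε) volume) :=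
    (integrable_map_measure hm (measurable_cell ε).aemeasurable).2 (integrable_cell hε hφ)
  rw [← integral_map (measurable_cell ε).aemeasurable hm, integral_countable hi, ← tsum_mul_left]
  refine tsum_congr fun j => ?_
  rw [map_cell hε, measureReal_def]
  simp [hε.le]

noncomputable def gaussian (τ x : ℝ) : ℝ := (√(4 * Real.pi * τ))⁻¹ * Real.exp (-x ^ 2 / (4 * τ))

theorem gaussian_nonneg (τ x : ℝ) : 0 ≤ gaussian τ x := by unfold gaussian; positivity

theorem continuous_gaussian (τ : ℝ) : Continuous (gaussian τ) := by unfold gaussian; fun_prop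

theorem integrable_gaussian {τ : ℝ} (hτ : 0 < τ) : Integrable (gaussian τ) := by
  have h := integrable_gaussian_mul (f := fun _ => 1) (M := 1) continuous_const (by simp) 0 hτ 0
  refine (h.const_mul (√(4 * Real.pi * τ))⁻¹).congr (Eventually.of_forall fun x => ?_)
  simp [gaussian, gaussianMoment]

theorem integral_gaussian_eq_one {τ : ℝ} (hτ : 0 < τ) : ∫ x, gaussian τ x = 1 := by
  have e (x : ℝ) : gaussian τ x = (√(4 * Real.pi * τ))⁻¹ * Real.exp (-(1 / (4 * τ)) * x ^ 2) := by
    unfold gaussian; congr 2; ring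
  simp_rw [e]
  rw [integral_const_mul, integral_gaussian, show Real.pi / (1 / (4 * τ)) = 4 * Real.pi * τ by field_simp]
  exact inv_mul_cancel₀ (Real.sqrt_pos.2 (by positivity)).ne'

theorem integral_exp_mul_cos {τ : ℝ} (hτ : 0 < τ) (x : ℝ) :
    1 / (2 * Real.pi) * ∫ κ : ℝ, Real.exp (-τ * κ ^ 2) * Real.cos (x * κ) = gaussian τ x := by
  have hb : 0 < (τ : ℂ).re := by simpa using hτ
  have h := fourierIntegral_gaussian hb x
  have hi : Integrable fun κ : ℝ => Complex.exp (Complex.I * x * κ) * Complex.exp (-τ * κ ^ 2) := by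
    refine (integrable_cexp_quadratic hb (Complex.I * x) 0).congr (Eventually.of_forall fun κ => ?_)
    simp only
    rw [← Complex.exp_add]; ring_nf
  have h2 : ∫ κ : ℝ, Real.exp (-τ * κ ^ 2) * Real.cos (x * κ) =
      (∫ κ : ℝ, Complex.exp (Complex.I * x * κ) * Complex.exp (-τ * κ ^ 2)).re := by
    rw [← Complex.reCLM_apply, ← Complex.reCLM.integral_comp_comm hi]
    refine integral_congr_ae (Eventually.of_forall fun κ => ?_)
    simp only [Complex.reCLM_apply]
    rw [← Complex.exp_add, Complex.exp_re]
    have e : Complex.I * x * κ + -τ * κ ^ 2 = ((-τ * κ ^ 2 : ℝ) : ℂ) + ((x * κ : ℝ) : ℂ) * Complex.I := by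
      push_cast; ring
    rw [e, Complex.add_re, Complex.add_im, Complex.re_ofReal_mul, Complex.im_ofReal_mul, Complex.ofReal_re,
      Complex.ofReal_im, Complex.I_re, Complex.I_im, mul_zero, add_zero, zero_add, mul_one]
  rw [h2, h]
  have e1 : ((Real.pi : ℂ) / τ) ^ (1 / 2 : ℂ) = ((√(Real.pi / τ) : ℝ) : ℂ) := by
    rw [Real.sqrt_eq_rpow, Complex.ofReal_cpow (by positivity)]
    push_cast; rfl
  have e2 : -(x : ℂ) ^ 2 / (4 * τ) = ((-x ^ 2 / (4 * τ) : ℝ) : ℂ) := by push_cast; ring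
  rw [e1, e2, ← Complex.ofReal_exp, ← Complex.ofReal_mul, Complex.ofReal_re, gaussian, ← mul_assoc]
  congr 1
  have hp := Real.pi_pos
  rw [← Real.sqrt_inv, one_div, ← Real.sqrt_sq (x := (2 * Real.pi)⁻¹) (by positivity), ← Real.sqrt_mul (by positivity)]
  congr 1
  field_simp
  norm_num

theorem tendsto_two_mul_one_sub_cos (κ : ℝ) {ε : ℕ → ℝ} (h0 : ∀ n, 0 < ε n) (hε : Tendsto ε atTop (𝓝 0)) :
    Tendsto (fun n => 2 * (1 - Real.cos (ε n * κ)) / ε n ^ 2) atTop (𝓝 (κ ^ 2)) := by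
  rw [tendsto_iff_dist_tendsto_zero]
  have h1 : Tendsto (fun n => ε n ^ 2 * κ ^ 4) atTop (𝓝 (0 ^ 2 * κ ^ 4)) := (hε.pow 2).mul_const _
  rw [zero_pow two_ne_zero, zero_mul] at h1
  have h2 : ∀ᶠ n in atTop, |ε n * κ| ≤ 1 := by
    have : Tendsto (fun n => |ε n * κ|) atTop (𝓝 |0 * κ|) := (hε.mul_const κ).abs
    rw [zero_mul, abs_zero] at this
    exact (this.eventually_lt_const one_pos).mono fun _ h => h.le
  refine squeeze_zero' (Eventually.of_forall fun _ => dist_nonneg) ?_ h1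
  filter_upwards [h2] with n hn
  have hb := Real.cos_bound hn
  have hp := h0 n
  rw [Real.dist_eq]
  have e : 2 * (1 - Real.cos (ε n * κ)) / ε n ^ 2 - κ ^ 2 =
      -2 * (Real.cos (ε n * κ) - (1 - (ε n * κ) ^ 2 / 2)) / ε n ^ 2 := by field_simp; ring
  rw [e, abs_div, abs_mul, abs_of_pos (by positivity : 0 < ε n ^ 2), div_le_iff₀ (by positivity)]
  have e4 : |ε n * κ| ^ 4 = ε n ^ 4 * κ ^ 4 := by rw [Even.pow_abs (by decide), mul_pow]
  rw [e4] at hb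
  have : (0 : ℝ) ≤ ε n ^ 4 * κ ^ 4 := by positivity
  rw [show |(-2 : ℝ)| = 2 by norm_num]
  nlinarith

/-- The substitution k = εκ; the indicator turns the growing frequency window into an integral over
the whole line, ready for dominated convergence. -/
theorem heatKernel_rescaled {ε τ : ℝ} (hε : 0 < ε) (j : ℤ) :
    ε⁻¹ * heatKernel j (τ / ε ^ 2) = 1 / (2 * Real.pi) * ∫ κ : ℝ,
      (Ioc (-Real.pi / ε) (Real.pi / ε)).indicator
        (fun κ => Real.exp (-(2 * (1 - Real.cos (ε * κ)) / ε ^ 2) * τ) * Real.cos (ε * j * κ)) κ := by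
  rw [integral_indicator measurableSet_Ioc, ← intervalIntegral.integral_of_le (by
    have := Real.pi_pos
    rw [neg_div]; have : 0 < Real.pi / ε := by positivity
    linarith), heatKernel, ← mul_assoc, mul_comm ε⁻¹, mul_assoc]
  congr 1
  have h := intervalIntegral.integral_comp_mul_left (a := -Real.pi / ε) (b := Real.pi / ε)
    (fun k => Real.exp (-(2 * (1 - Real.cos k)) * (τ / ε ^ 2)) * Real.cos (j * k)) hε.ne'
  rw [mul_div_cancel₀ _ hε.ne', mul_div_cancel₀ _ hε.ne', smul_eq_mul] at h
  rw [← h]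
  refine intervalIntegral.integral_congr fun κ _ => ?_
  congr 2 <;> ring

/-- The rescaled heat kernel converges pointwise to the Gaussian. -/
theorem tendsto_heatKernel_rescaled {ε : ℕ → ℝ} (h0 : ∀ n, 0 < ε n) (hε : Tendsto ε atTop (𝓝 0)) {τ : ℝ} (hτ : 0 < τ)
    (x : ℝ) : Tendsto (fun n => (ε n)⁻¹ * heatKernel (cell (ε n) x) (τ / ε n ^ 2)) atTop (𝓝 (gaussian τ x)) := by
  have hp := Real.pi_pos
  simp_rw [fun n => heatKernel_rescaled (τ := τ) (h0 n)]
  rw [← integral_exp_mul_cos hτ]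
  refine Tendsto.const_mul _ (tendsto_integral_of_dominated_convergence
    (fun κ => Real.exp (-(4 / Real.pi ^ 2 * τ) * κ ^ 2)) (fun n => ?_) (integrable_exp_neg_mul_sq (by positivity))
    (fun n => Eventually.of_forall fun κ => ?_) (Eventually.of_forall fun κ => ?_))
  · exact (Continuous.aestronglyMeasurable (by fun_prop)).indicator measurableSet_Ioc
  · by_cases hκ : κ ∈ Ioc (-Real.pi / ε n) (Real.pi / ε n)
    · rw [indicator_of_mem hκ, norm_mul, Real.norm_eq_abs, Real.norm_eq_abs, Real.abs_exp]
      refine (mul_le_of_le_one_right (Real.exp_pos _).le (Real.abs_cos_le_one _)).trans (Real.exp_le_exp.2 ?_)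
      have hn := h0 n
      have h1 : |ε n * κ| ≤ Real.pi := by
        rw [abs_le]
        have h2 := hκ.1
        have h3 := hκ.2
        rw [div_lt_iff₀ hn] at h2
        rw [le_div_iff₀ hn] at h3
        constructor <;> linarith
      have h2 := Real.cos_le_one_sub_mul_cos_sq h1
      -- Inside the window the discrete symbol dominates a fixed multiple of κ², which gives a
      -- Gaussian majorant independent of ε.
      have h3 : 4 / Real.pi ^ 2 * κ ^ 2 ≤ 2 * (1 - Real.cos (ε n * κ)) / ε n ^ 2 := by
        rw [le_div_iff₀ (by positivity)]
        have : 4 / Real.pi ^ 2 * κ ^ 2 * ε n ^ 2 = 2 * (2 / Real.pi ^ 2 * (ε n * κ) ^ 2) := by ring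
        rw [this]; linarith
      nlinarith
    · rw [indicator_of_notMem hκ, norm_zero]
      exact (Real.exp_pos _).le
  · have hev : ∀ᶠ n in atTop, κ ∈ Ioc (-Real.pi / ε n) (Real.pi / ε n) := by
      have : Tendsto (fun n => |ε n * κ|) atTop (𝓝 |0 * κ|) := (hε.mul_const κ).abs
      rw [zero_mul, abs_zero] at this
      filter_upwards [this.eventually_lt_const hp] with n hn
      have h1 := abs_lt.1 hn
      rw [mem_Ioc, div_lt_iff₀ (h0 n), le_div_iff₀ (h0 n)]
      constructor <;> linarith
    have hcell : Tendsto (fun n => ε n * cell (ε n) x) atTop (𝓝 x) := by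
      rw [tendsto_iff_dist_tendsto_zero]
      refine squeeze_zero (fun _ => dist_nonneg) (fun n => ?_) hε
      rw [Real.dist_eq]
      have := abs_mul_cell_sub_le (h0 n) x
      have := h0 n
      linarith
    have hlim := (Real.continuous_exp.tendsto _).comp
      (((tendsto_two_mul_one_sub_cos κ h0 hε).neg).mul_const τ)
    have hlim2 := (Real.continuous_cos.tendsto _).comp (hcell.mul_const κ)
    have e : Real.exp (-τ * κ ^ 2) = Real.exp (-κ ^ 2 * τ) := by congr 1; ring
    rw [e]
    refine (hlim.mul hlim2).congr' ?_
    filter_upwards [hev] with n hn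
    rw [indicator_of_mem hn]
    rfl

/-- Pointwise convergence of probability densities implies convergence of the integrals. -/
theorem tendsto_integral_abs_sub_of_density {k : ℕ → ℝ → ℝ} {G : ℝ → ℝ} (hk0 : ∀ n x, 0 ≤ k n x)
    (hki : ∀ n, Integrable (k n)) (hk1 : ∀ n, ∫ x, k n x = 1) (hG0 : ∀ x, 0 ≤ G x) (hGi : Integrable G)
    (hG1 : ∫ x, G x = 1) (hlim : ∀ x, Tendsto (fun n => k n x) atTop (𝓝 (G x))) :
    Tendsto (fun n => ∫ x, |k n x - G x|) atTop (𝓝 0) := by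
  have h1 : Tendsto (fun n => ∫ x, max (G x - k n x) 0) atTop (𝓝 (∫ _ : ℝ, (0 : ℝ))) := by
    refine tendsto_integral_of_dominated_convergence G
      (fun n => ((hGi.sub (hki n)).sup (integrable_zero _ _ _)).aestronglyMeasurable) hGi
      (fun n => Eventually.of_forall fun x => ?_) (Eventually.of_forall fun x => ?_)
    · rw [Real.norm_of_nonneg (le_max_right _ _)]
      exact max_le (by linarith [hk0 n x]) (hG0 x)
    · have := ((hlim x).const_sub (G x)).max (tendsto_const_nhds (x := (0 : ℝ)))
      simpa using this
  -- Scheffé's trick: equal total masses make the L¹ distance twice the integral of the positive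
  -- part of G - k, and that part is dominated by G.
  have e (n : ℕ) : ∫ x, |k n x - G x| = 2 * ∫ x, max (G x - k n x) 0 := by
    have hi : Integrable fun x => 2 * max (G x - k n x) 0 :=
      ((hGi.sub (hki n)).sup (integrable_zero ℝ ℝ volume)).const_mul 2
    have : ∫ x, |k n x - G x| = ∫ x, (2 * max (G x - k n x) 0 + (k n x - G x)) :=
      integral_congr_ae (Eventually.of_forall fun x => by
        simp only
        rcases le_total (k n x) (G x) with h | h
        · rw [max_eq_left (by linarith), abs_of_nonpos (by linarith)]; ring
        · rw [max_eq_right (by linarith), abs_of_nonneg (by linarith)]; ring)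
    rw [this, integral_add (g := fun x => k n x - G x) hi ((hki n).sub hGi), integral_sub (hki n) hGi, hk1, hG1, integral_const_mul]
    ring
  simp_rw [e]
  simpa using h1.const_mul 2

theorem abs_integral_mul_sub_le {k G F F' : ℝ → ℝ} {M : ℝ} (hki : Integrable k) (hG0 : ∀ x, 0 ≤ G x) (hGi : Integrable G)
    (hF : AEStronglyMeasurable F) (hF' : AEStronglyMeasurable F') (hM : ∀ x, |F x| ≤ M) (hM' : ∀ x, |F' x| ≤ M) :
    |(∫ x, k x * F x) - ∫ x, G x * F' x| ≤ M * (∫ x, |k x - G x|) + ∫ x, G x * |F x - F' x| := by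
  have i1 : Integrable fun x => k x * F x := hki.mul_bdd hF (Eventually.of_forall hM)
  have i2 : Integrable fun x => G x * F' x := hGi.mul_bdd hF' (Eventually.of_forall hM')
  have i3 : Integrable fun x => G x * |F x - F' x| :=
    hGi.mul_bdd (c := M + M) (hF.sub hF').norm (Eventually.of_forall fun x => by
      simp only [Real.norm_eq_abs, abs_abs]
      exact (abs_sub _ _).trans (add_le_add (hM x) (hM' x)))
  have i4 : Integrable fun x => M * |k x - G x| := ((hki.sub hGi).abs).const_mul M
  rw [← integral_sub i1 i2, ← integral_const_mul, ← integral_add i4 i3]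
  refine (abs_integral_le_integral_abs).trans (integral_mono (i1.sub i2).abs (i4.add i3) fun x => ?_)
  beta_reduce
  have e : k x * F x - G x * F' x = (k x - G x) * F x + G x * (F x - F' x) := by ring
  rw [e]
  refine (abs_add_le _ _).trans (add_le_add ?_ ?_)
  · rw [abs_mul, mul_comm]
    exact mul_le_mul_of_nonneg_right (hM x) (abs_nonneg _)
  · rw [abs_mul, abs_of_nonneg (hG0 x)]


/-! ### The limit of the regular part -/

namespace MacroSolution

variable {a β τfin ε : ℝ} {u : ℝ → LInf} {T : ℤ → EReal}

noncomputable def scaledKernel (ε τ x : ℝ) : ℝ := ε⁻¹ * heatKernel (cell ε x) (τ / ε ^ 2)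

theorem scaledKernel_nonneg {ε τ : ℝ} (hε : 0 < ε) (hτ : 0 ≤ τ) (x : ℝ) : 0 ≤ scaledKernel ε τ x :=
  mul_nonneg (inv_pos.2 hε).le (heatKernel_nonneg _ (by positivity))

theorem integrable_scaledKernel {ε τ : ℝ} (hε : 0 < ε) (hτ : 0 ≤ τ) : Integrable (scaledKernel ε τ) :=
  (integrable_cell hε (summable_heatKernel (by positivity))).const_mul _

theorem integral_scaledKernel {ε τ : ℝ} (hε : 0 < ε) (hτ : 0 ≤ τ) : ∫ x, scaledKernel ε τ x = 1 := by
  unfold scaledKernel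
  rw [integral_const_mul, integral_cell hε (φ := fun j => heatKernel j (τ / ε ^ 2)) (summable_heatKernel (by positivity)),
    (hasSum_heatKernel (by positivity)).tsum_eq, mul_one, inv_mul_cancel₀ hε.ne']

theorem macroQ_zero (hε : 0 < ε) (j : ℤ) : macroQ ε u (0, ε * j) = dPhi (u 0 j) := by
  rw [macroQ_eq, zero_div, heatFlow_zero, cell_mul hε]

/-- The lattice convolution becomes an integral of cell functions; the factor 1/ε in the kernel
compensates the cell length. -/
theorem macroQ_eq_integral (hε : 0 < ε) {τ M : ℝ} (hτ : 0 ≤ τ) (hM : ∀ j, |dPhi (u 0 j)| ≤ M) (x : ℝ) :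
    macroQ ε u (τ, x) = ∫ y, scaledKernel ε τ y * dPhi (u 0 (cell ε x - cell ε y)) := by
  have ht : 0 ≤ τ / ε ^ 2 := by positivity
  have hs : Summable fun k => heatKernel k (τ / ε ^ 2) * dPhi (u 0 (cell ε x - k)) :=
    Summable.of_norm_bounded ((summable_heatKernel ht).mul_right M) fun k => by
      rw [Real.norm_eq_abs, abs_mul, abs_of_nonneg (heatKernel_nonneg _ ht)]
      exact mul_le_mul_of_nonneg_left (hM _) (heatKernel_nonneg _ ht)
  rw [macroQ_eq, heatFlow_eq_tsum]
  simp_rw [scaledKernel, mul_assoc]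
  rw [integral_const_mul, integral_cell hε hs, inv_mul_cancel_left₀ hε.ne']

/-- Comparison of the regular part with a Gaussian convolution. -/
theorem abs_macroQ_sub_gaussian_le (h : MacroSolution a β τfin ε u T) {M τ : ℝ} (hM : ∀ j, |dPhi (u 0 j)| ≤ M)
    {f : ℝ → ℝ} (hf : Continuous f) (hfM : ∀ y, |f y| ≤ M) (hτ : 0 < τ) (x : ℝ) :
    |macroQ ε u (τ, x) - ∫ y, gaussian τ y * f (x - y)| ≤
      M * (∫ y, |scaledKernel ε τ y - gaussian τ y|) +
        (2 * a * ε + ∫ y, gaussian τ y * |macroQ ε u (0, x - y) - f (x - y)|) := by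
  have hε := h.ε_pos
  have hm : Measurable fun y => dPhi (u 0 (cell ε x - cell ε y)) :=
    (measurable_of_countable fun j => dPhi (u 0 (cell ε x - j))).comp (measurable_cell ε)
  have hm' : Measurable fun y => macroQ ε u (0, x - y) :=
    (measurable_of_countable fun j => heatFlow (fun k => dPhi (u 0 k)) (0 / ε ^ 2) j).comp
      ((measurable_cell ε).comp (measurable_const.sub measurable_id))
  have hfc : Continuous fun y => f (x - y) := by fun_prop
  rw [macroQ_eq_integral hε hτ.le hM]
  refine (abs_integral_mul_sub_le (integrable_scaledKernel hε hτ.le) (gaussian_nonneg τ) (integrable_gaussian hτ)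
    hm.aestronglyMeasurable hfc.aestronglyMeasurable (fun _ => hM _)
    (fun _ => hfM _)).trans ?_
  gcongr
  have hQ0 (y : ℝ) : |macroQ ε u (0, y)| ≤ M := by
    rw [macroQ_eq, zero_div]
    exact abs_heatFlow_le hM _ le_rfl
  have hi1 : Integrable fun y => gaussian τ y * |dPhi (u 0 (cell ε x - cell ε y)) - f (x - y)| :=
    (integrable_gaussian hτ).mul_bdd (c := M + M) (hm.aestronglyMeasurable.sub hfc.aestronglyMeasurable).norm
      (Eventually.of_forall fun y => by
        rw [Real.norm_eq_abs, abs_abs]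
        exact (abs_sub _ _).trans (add_le_add (hM _) (hfM _)))
  have hi2 : Integrable fun y => gaussian τ y * |macroQ ε u (0, x - y) - f (x - y)| :=
    (integrable_gaussian hτ).mul_bdd (c := M + M) (hm'.aestronglyMeasurable.sub hfc.aestronglyMeasurable).norm
      (Eventually.of_forall fun y => by
        rw [Real.norm_eq_abs, abs_abs]
        exact (abs_sub _ _).trans (add_le_add (hQ0 _) (hfM _)))
  have hi3 : Integrable fun y => gaussian τ y * (2 * a * ε) := (integrable_gaussian hτ).mul_const _
  have e : 2 * a * ε = ∫ y, gaussian τ y * (2 * a * ε) := by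
    rw [integral_mul_const, integral_gaussian_eq_one hτ, one_mul]
  rw [e, ← integral_add hi3 hi2]
  refine integral_mono hi1 (hi3.add hi2) fun y => ?_
  beta_reduce
  rw [← mul_add]
  refine mul_le_mul_of_nonneg_left ?_ (gaussian_nonneg τ y)
  have h1 := h.abs_macroQ_sub_le (z := (0, ε * ((cell ε x - cell ε y : ℤ) : ℝ))) (w := (0, x - y)) le_rfl le_rfl
  rw [macroQ_zero hε] at h1
  have h2 := abs_mul_cell_sub_le hε x
  have h3 := abs_mul_cell_sub_le hε y
  -- The difference of two cells need not be the cell of the difference; the centres deviate by at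
  -- most ε, which costs 2aε in the Lipschitz data.
  have h4 : |ε * ((cell ε x - cell ε y : ℤ) : ℝ) - (x - y)| ≤ ε := by
    push_cast
    rw [abs_le] at h2 h3 ⊢
    constructor <;> linarith
  simp only [sub_self, abs_zero, mul_zero, Real.sqrt_zero, add_zero] at h1
  have h5 := mul_le_mul_of_nonneg_left (add_le_add_left h4 ε) h.a_pos.le
  calc |dPhi (u 0 (cell ε x - cell ε y)) - f (x - y)|
      ≤ |dPhi (u 0 (cell ε x - cell ε y)) - macroQ ε u (0, x - y)| + |macroQ ε u (0, x - y) - f (x - y)| :=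
        abs_sub_le _ _ _
    _ ≤ _ := by linarith

end MacroSolution

section Sequence

variable {a β τfin : ℝ} {ε : ℕ → ℝ} {u : ℕ → ℝ → LInf} {T : ℕ → ℤ → EReal}
variable {P Q R : ℝ × ℝ → ℝ} {ξ : ℝ → ℝ} {M : ℝ}

open MacroSolution

theorem tendsto_integral_scaledKernel_sub (h : ∀ n, MacroSolution a β τfin (ε n) (u n) (T n))
    (hε : Tendsto ε atTop (𝓝 0)) {τ : ℝ} (hτ : 0 < τ) :
    Tendsto (fun n => ∫ y, |scaledKernel (ε n) τ y - gaussian τ y|) atTop (𝓝 0) :=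
  tendsto_integral_abs_sub_of_density (fun n => scaledKernel_nonneg (h n).ε_pos hτ.le)
    (fun n => integrable_scaledKernel (h n).ε_pos hτ.le) (fun n => integral_scaledKernel (h n).ε_pos hτ.le)
    (gaussian_nonneg τ) (integrable_gaussian hτ) (integral_gaussian_eq_one hτ)
    (fun x => tendsto_heatKernel_rescaled (fun n => (h n).ε_pos) hε hτ x)

theorem continuous_Q_zero (h : ∀ n, MacroSolution a β τfin (ε n) (u n) (T n)) (hε : Tendsto ε atTop (𝓝 0))
    (hlim : IsLimit τfin (sepConst a) ε u T Q R ξ) : Continuous fun x => Q (0, x) := by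
  rw [← continuousOn_univ]
  exact (continuousOn_Q h hε hlim).comp (by fun_prop) fun x _ => ⟨⟨le_rfl, (h 0).τfin_pos.le⟩, mem_univ _⟩

/-- The kernels converge in L¹, and the data, bounded but only locally uniformly convergent, are
handled by dominated convergence against the Gaussian. -/
theorem Q_eq_gaussian (h : ∀ n, MacroSolution a β τfin (ε n) (u n) (T n)) (hε : Tendsto ε atTop (𝓝 0))
    (hlim : IsLimit τfin (sepConst a) ε u T Q R ξ) (hM : ∀ n, ∀ j : ℤ, |dPhi (u n 0 j)| ≤ M)
    {τ : ℝ} (hτ : τ ∈ Ioc 0 τfin) (x : ℝ) : Q (τ, x) = ∫ y, gaussian τ y * Q (0, x - y) := by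
  have hmem (y : ℝ) : ((0, y) : ℝ × ℝ) ∈ domain τfin := ⟨⟨le_rfl, (h 0).τfin_pos.le⟩, mem_univ _⟩
  have hf := continuous_Q_zero h hε hlim
  refine tendsto_nhds_unique (hlim.regular.tendsto_at (a := (τ, x)) ⟨⟨hτ.1.le, hτ.2⟩, mem_univ _⟩) ?_
  rw [tendsto_iff_dist_tendsto_zero]
  have h3 : Tendsto (fun n => ∫ y, gaussian τ y * |macroQ (ε n) (u n) (0, x - y) - Q (0, x - y)|) atTop
      (𝓝 (∫ _ : ℝ, (0 : ℝ))) := by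
    refine tendsto_integral_of_dominated_convergence (fun y => gaussian τ y * (M + M)) (fun n => ?_)
      ((integrable_gaussian hτ.1).mul_const _) (fun n => Eventually.of_forall fun y => ?_)
      (Eventually.of_forall fun y => ?_)
    · have hm' : Measurable fun y => macroQ (ε n) (u n) (0, x - y) :=
        (measurable_of_countable fun j => heatFlow (fun k => dPhi (u n 0 k)) (0 / ε n ^ 2) j).comp
          ((measurable_cell (ε n)).comp (measurable_const.sub measurable_id))
      have hfc : Continuous fun y => Q (0, x - y) := hf.comp (by fun_prop)
      exact (continuous_gaussian τ).aestronglyMeasurable.mul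
        (hm'.aestronglyMeasurable.sub hfc.aestronglyMeasurable).norm
    · rw [Real.norm_eq_abs, abs_mul, abs_of_nonneg (gaussian_nonneg _ _), abs_abs]
      refine mul_le_mul_of_nonneg_left ((abs_sub _ _).trans (add_le_add ?_ (abs_Q_le hlim hM (hmem _))))
        (gaussian_nonneg _ _)
      rw [macroQ_eq, zero_div]
      exact abs_heatFlow_le (hM n) _ le_rfl
    · have := (((hlim.regular.tendsto_at (hmem (x - y))).sub_const (Q (0, x - y))).abs).const_mul (gaussian τ y)
      simpa using this
  have h4 := ((tendsto_integral_scaledKernel_sub h hε hτ.1).const_mul M).add ((hε.const_mul (2 * a)).add h3)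
  simp only [integral_zero, mul_zero, add_zero] at h4
  exact squeeze_zero (fun _ => dist_nonneg) (fun n =>
    (h n).abs_macroQ_sub_gaussian_le (hM n) hf (fun y => abs_Q_le hlim hM (hmem y)) hτ.1 x) h4

theorem isHeatSolution_Q (h : ∀ n, MacroSolution a β τfin (ε n) (u n) (T n)) (hε : Tendsto ε atTop (𝓝 0))
    (hlim : IsLimit τfin (sepConst a) ε u T Q R ξ) (hP : ∀ z, P z = Q z + R z)
    (hM : ∀ n, ∀ j : ℤ, |dPhi (u n 0 j)| ≤ M) : IsHeatSolution τfin (fun x => P (0, x)) Q := by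
  have e : (fun x => P (0, x)) = fun x => Q (0, x) := funext fun x => by rw [hP, R_zero h hlim, add_zero]
  rw [e]
  refine isHeatSolution_of_gaussianConv (M := M) (continuousOn_Q h hε hlim) (continuous_Q_zero h hε hlim)
    (fun y => abs_Q_le hlim hM ⟨⟨le_rfl, (h 0).τfin_pos.le⟩, mem_univ _⟩) (fun _ => rfl) fun τ hτ x => ?_
  rw [Q_eq_gaussian h hε hlim hM ⟨hτ.1, hτ.2.le⟩, gaussianConv, ← integral_const_mul,
    ← integral_sub_left_eq_self _ volume x]
  refine integral_congr_ae (Eventually.of_forall fun y => ?_)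
  simp only [gaussian, gaussianMoment, pow_zero, one_mul, sub_sub_cancel]
  ring

/-- At time zero R vanishes and p = q. Conversely, when the data converge uniformly, the comparison
with the Gaussian convolution has an error independent of x at each fixed time. -/
theorem tendstoUniformly_macroP_zero_iff (h : ∀ n, MacroSolution a β τfin (ε n) (u n) (T n))
    (hε : Tendsto ε atTop (𝓝 0)) (hlim : IsLimit τfin (sepConst a) ε u T Q R ξ) (hP : ∀ z, P z = Q z + R z)
    (hM : ∀ n, ∀ j : ℤ, |dPhi (u n 0 j)| ≤ M) :
    TendstoUniformly (fun n x => macroP (ε n) (u n) (0, x)) (fun x => P (0, x)) atTop ↔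
      TendstoUniformlyOn (fun n => macroQ (ε n) (u n)) Q atTop (domain τfin) := by
  have hmem (y : ℝ) : ((0, y) : ℝ × ℝ) ∈ domain τfin := ⟨⟨le_rfl, (h 0).τfin_pos.le⟩, mem_univ _⟩
  have e1 : (fun x => P (0, x)) = fun x => Q (0, x) := funext fun x => by rw [hP, R_zero h hlim, add_zero]
  have e2 : (fun (n : ℕ) (x : ℝ) => macroP (ε n) (u n) (0, x)) = fun n x => macroQ (ε n) (u n) (0, x) := by
    funext n x
    rw [macroQ_eq, zero_div, heatFlow_zero, macroP, zero_div]
  have hf := continuous_Q_zero h hε hlim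
  have hfM (y : ℝ) := abs_Q_le hlim hM (hmem y)
  rw [e1, e2]
  constructor
  · intro hu
    rw [Metric.tendstoUniformly_iff] at hu
    rw [Metric.tendstoUniformlyOn_iff]
    intro η hη
    have hpt : ∀ τ ∈ Icc 0 τfin, ∀ᶠ n in atTop, ∀ x, |macroQ (ε n) (u n) (τ, x) - Q (τ, x)| < η / 2 := by
      intro τ hτ
      rcases hτ.1.eq_or_lt with rfl | h0
      · filter_upwards [hu (η / 2) (by linarith)] with n hn x
        rw [← Real.dist_eq, dist_comm]; exact hn x
      have h4 := ((tendsto_integral_scaledKernel_sub h hε h0).const_mul M).add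
        ((hε.const_mul (2 * a)))
      simp only [mul_zero, add_zero] at h4
      filter_upwards [hu (η / 8) (by linarith), h4.eventually_lt_const (show 0 < η / 4 by linarith)] with n hn hn' x
      rw [Q_eq_gaussian h hε hlim hM ⟨h0, hτ.2⟩]
      refine ((h n).abs_macroQ_sub_gaussian_le (hM n) hf hfM h0 x).trans_lt ?_
      have : ∫ y, gaussian τ y * |macroQ (ε n) (u n) (0, x - y) - Q (0, x - y)| ≤ ∫ y, gaussian τ y * (η / 8) := by
        refine integral_mono_of_nonneg (Eventually.of_forall fun y => mul_nonneg (gaussian_nonneg _ _) (abs_nonneg _))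
          ((integrable_gaussian h0).mul_const _) (Eventually.of_forall fun y => ?_)
        refine mul_le_mul_of_nonneg_left ?_ (gaussian_nonneg _ _)
        rw [← Real.dist_eq, dist_comm]; exact (hn _).le
      rw [integral_mul_const, integral_gaussian_eq_one h0, one_mul] at this
      linarith
    have key : ∀ᶠ n in atTop, ∀ τ ∈ Icc 0 τfin, ∀ x, |macroQ (ε n) (u n) (τ, x) - Q (τ, x)| < η := by
      -- Uniformity in time comes from a finite cover: the moduli of continuity in time are the same
      -- for all x, so convergence at one time spreads to a neighbourhood.
      refine (isCompact_Icc (a := 0) (b := τfin)).induction_on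
        (p := fun s => ∀ᶠ n in atTop, ∀ τ ∈ s, ∀ x, |macroQ (ε n) (u n) (τ, x) - Q (τ, x)| < η)
        (by simp) (fun s t hst ht => ht.mono fun n hn τ hτ => hn τ (hst hτ))
        (fun s t hs ht => ?_) (fun τ hτ => ?_)
      · filter_upwards [hs, ht] with n h1 h2 τ hτ
        exact hτ.elim (h1 τ) (h2 τ)
      · have hc : Tendsto (fun s => a * √(2 * |s - τ|)) (𝓝 τ) (𝓝 (a * √(2 * |τ - τ|))) :=
          Continuous.tendsto (by fun_prop) τ
        rw [sub_self, abs_zero, mul_zero, Real.sqrt_zero, mul_zero] at hc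
        have hev := hc.eventually_lt_const (show 0 < η / 8 by linarith)
        refine ⟨{s | a * √(2 * |s - τ|) < η / 8} ∩ Icc 0 τfin, inter_mem (mem_nhdsWithin_of_mem_nhds hev)
          self_mem_nhdsWithin, ?_⟩
        have hεa : Tendsto (fun n => a * ε n) atTop (𝓝 0) := by simpa using hε.const_mul a
        filter_upwards [hpt τ hτ, hεa.eventually_lt_const (show 0 < η / 8 by linarith)] with n hn hn' s hs x
        have h1 := (h n).abs_macroQ_sub_le (z := (s, x)) (w := (τ, x)) hs.2.1 hτ.1
        have h2 := abs_Q_sub_le h hε hlim (z := (s, x)) (w := (τ, x)) ⟨hs.2, mem_univ _⟩ ⟨hτ, mem_univ _⟩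
        have h3 := hn x
        have h4 : a * √(2 * |s - τ|) < η / 8 := hs.1
        simp only [sub_self, abs_zero, zero_add, mul_zero] at h1 h2
        rw [abs_lt] at h3 ⊢
        rw [abs_le] at h1 h2
        constructor <;> linarith
    filter_upwards [key] with n hn z hz
    rw [dist_comm, Real.dist_eq]
    exact hn z.1 hz.1 z.2
  · intro hu
    rw [Metric.tendstoUniformly_iff]
    rw [Metric.tendstoUniformlyOn_iff] at hu
    intro η hη
    filter_upwards [hu η hη] with n hn x
    exact hn _ (hmem x)

end Sequence


/-! ### Functions with square integrable derivative as limits of lattice functions -/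

theorem lintegral_le_of_le_liminf {X : Type*} [MeasurableSpace X] {μ : Measure X} {f : ℕ → X → ℝ≥0∞} {F : X → ℝ≥0∞}
    {C : ℝ≥0∞} (hf : ∀ n, Measurable (f n)) (hF : ∀ x, F x ≤ liminf (fun n => f n x) atTop)
    (hC : ∀ᶠ n in atTop, ∫⁻ x, f n x ∂μ ≤ C) : ∫⁻ x, F x ∂μ ≤ C :=
  calc ∫⁻ x, F x ∂μ ≤ ∫⁻ x, liminf (fun n => f n x) atTop ∂μ := lintegral_mono hF
    _ ≤ liminf (fun n => ∫⁻ x, f n x ∂μ) atTop := lintegral_liminf_le hf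
    _ ≤ liminf (fun _ : ℕ => C) atTop := liminf_le_liminf hC
    _ = C := liminf_const C

theorem sq_sub_le_card_mul {ρ : ℤ → ℝ} {i j : ℤ} (hij : i ≤ j) :
    (ρ j - ρ i) ^ 2 ≤ ((j : ℝ) - i) * ∑ m ∈ Finset.Ico i j, (ρ (m + 1) - ρ m) ^ 2 := by
  obtain ⟨n, rfl⟩ := Int.le.dest hij
  have e (φ : ℤ → ℝ) : ∑ m ∈ Finset.Ico i (i + n), φ m = ∑ m ∈ Finset.range n, φ (i + m) := by
    symm
    refine Finset.sum_bij (fun m _ => i + m) (fun m hm => ?_) (fun _ _ _ _ h => by simpa using h)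
      (fun m hm => ?_) (fun _ _ => rfl)
    · rw [Finset.mem_range] at hm; rw [Finset.mem_Ico]; omega
    · rw [Finset.mem_Ico] at hm
      exact ⟨(m - i).toNat, by rw [Finset.mem_range]; omega, by omega⟩
  have htel : ρ (i + n) - ρ i = ∑ m ∈ Finset.range n, (ρ (i + m + 1) - ρ (i + m)) := by
    have := Finset.sum_range_sub (fun m : ℕ => ρ (i + m)) n
    simp only [Nat.cast_add, Nat.cast_one, Nat.cast_zero, add_zero, ← add_assoc] at this
    exact this.symm
  have hcs := sq_sum_le_card_mul_sum_sq (s := Finset.range n) (f := fun m : ℕ => ρ (i + m + 1) - ρ (i + m))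
  rw [e, htel]
  simpa using hcs

/-- Disjoint intervals use disjoint blocks of lattice edges, and on each block Cauchy–Schwarz
applies. The extra ε in the denominator covers the rounding of the end points to cells. -/
theorem sum_sq_div_le_of_grad {ρ : ℤ → ℝ} {C ε : ℝ} (hε : 0 < ε)
    (hρ : ∀ s : Finset ℤ, ∑ j ∈ s, (ρ (j + 1) - ρ j) ^ 2 ≤ C * ε) {ι : Type*} (F : Finset ι) (a b : ι → ℝ)
    (hab : ∀ i ∈ F, a i ≤ b i) (hd : (F : Set ι).PairwiseDisjoint fun i => Ioc (a i) (b i)) :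
    ∑ i ∈ F, (ρ (cell ε (b i)) - ρ (cell ε (a i))) ^ 2 / (b i - a i + ε) ≤ C := by
  have hdisj : (F : Set ι).PairwiseDisjoint fun i => Finset.Ico (cell ε (a i)) (cell ε (b i)) := by
    intro i hi j hj hij
    have h1 := Ioc_disjoint_Ioc.1 (hd hi hj hij)
    refine Finset.disjoint_left.2 fun m hm hm' => ?_
    rw [Finset.mem_Ico] at hm hm'
    have h2 := cell_mono hε h1
    rw [(cell_mono hε).map_min, (cell_mono hε).map_max] at h2
    omega
  have h1 := hρ (F.biUnion fun i => Finset.Ico (cell ε (a i)) (cell ε (b i)))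
  rw [Finset.sum_biUnion hdisj] at h1
  have h2 : ε * ∑ i ∈ F, (ρ (cell ε (b i)) - ρ (cell ε (a i))) ^ 2 / (b i - a i + ε) ≤ C * ε := by
    rw [Finset.mul_sum]
    refine (Finset.sum_le_sum fun i hi => ?_).trans h1
    have h3 := cell_mono hε (hab i hi)
    have h4 := sq_sub_le_card_mul (ρ := ρ) h3
    have h5 := mul_abs_cell_sub_le hε (b i) (a i)
    have h6 : (0 : ℝ) ≤ (cell ε (b i) : ℝ) - cell ε (a i) := by
      rw [sub_nonneg]; exact_mod_cast h3
    rw [abs_of_nonneg h6, abs_of_nonneg (sub_nonneg.2 (hab i hi))] at h5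
    have hS : 0 ≤ ∑ m ∈ Finset.Ico (cell ε (a i)) (cell ε (b i)), (ρ (m + 1) - ρ m) ^ 2 :=
      Finset.sum_nonneg fun _ _ => sq_nonneg _
    have hp : 0 < b i - a i + ε := by linarith [hab i hi]
    rw [mul_div_assoc', div_le_iff₀ hp]
    nlinarith
  nlinarith

/-- Riesz's criterion for functions with square integrable derivative. -/
def HasSquareVariation (f : ℝ → ℝ) (C : ℝ) : Prop :=
  ∀ (F : Finset ℕ) (a b : ℕ → ℝ), (∀ i ∈ F, a i ≤ b i) →
    ((F : Set ℕ).PairwiseDisjoint fun i => Ioc (a i) (b i)) → ∑ i ∈ F, (f (b i) - f (a i)) ^ 2 / (b i - a i) ≤ C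

section GradLimit

variable {f : ℝ → ℝ} {ε : ℕ → ℝ} {ρ : ℕ → ℤ → ℝ} {C : ℝ}

theorem hasSquareVariation_of_limit (h0 : ∀ n, 0 < ε n) (hε : Tendsto ε atTop (𝓝 0))
    (hρ : ∀ᶠ n in atTop, ∀ s : Finset ℤ, ∑ j ∈ s, (ρ n (j + 1) - ρ n j) ^ 2 ≤ C * ε n)
    (hf : ∀ x, Tendsto (fun n => ρ n (cell (ε n) x)) atTop (𝓝 (f x))) : HasSquareVariation f C := by
  intro F a b hab hd
  refine le_of_tendsto (x := atTop) (f := fun n => ∑ i ∈ F, (ρ n (cell (ε n) (b i)) - ρ n (cell (ε n) (a i))) ^ 2 /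
    (b i - a i + ε n)) (tendsto_finsetSum _ fun i hi => ?_) ?_
  · rcases (hab i hi).eq_or_lt with h | h
    · simp [h]
    · have h1 : Tendsto (fun n => b i - a i + ε n) atTop (𝓝 (b i - a i + 0)) := hε.const_add _
      rw [add_zero] at h1
      exact (((hf _).sub (hf _)).pow 2).div h1 (sub_pos.2 h).ne'
  · filter_upwards [hρ] with n hn
    exact sum_sq_div_le_of_grad (h0 n) hn F a b hab hd

/-- By Cauchy–Schwarz the squared total increment is at most C times the total length. -/
theorem HasSquareVariation.absolutelyContinuous (hC : HasSquareVariation f C) (c d : ℝ) : AbsolutelyContinuousOnInterval f c d := by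
  rw [absolutelyContinuousOnInterval_iff]
  intro η hη
  have hC0 : 0 ≤ C := by simpa using hC ∅ (fun _ => 0) (fun _ => 0) (by simp) (by simp)
  refine ⟨η ^ 2 / (C + 1), by positivity, fun E hE hlen => ?_⟩
  obtain ⟨n, I⟩ := E
  have h1 := hC (Finset.range n) (fun i => min (I i).1 (I i).2) (fun i => max (I i).1 (I i).2)
    (fun i _ => min_le_max) hE.2
  have key := Finset.sum_sq_le_sum_mul_sum_of_sq_le_mul (Finset.range n)
    (r := fun i => dist (f (I i).1) (f (I i).2))
    (f := fun i => (f (max (I i).1 (I i).2) - f (min (I i).1 (I i).2)) ^ 2 / (max (I i).1 (I i).2 - min (I i).1 (I i).2))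
    (g := fun i => dist (I i).1 (I i).2)
    (fun i _ => div_nonneg (sq_nonneg _) (sub_nonneg.2 min_le_max)) (fun i _ => dist_nonneg) (fun i _ => le_of_eq (by
      rw [Real.dist_eq, Real.dist_eq, max_sub_min_eq_abs', sq_abs]
      rcases eq_or_ne (I i).1 (I i).2 with h | h
      · simp [h]
      · rw [div_mul_cancel₀ _ (abs_ne_zero.2 (sub_ne_zero.2 h))]
        rcases le_total (I i).1 (I i).2 with h' | h'
        · rw [max_eq_right h', min_eq_left h']; ring
        · rw [max_eq_left h', min_eq_right h']))
  have h2 : (∑ i ∈ Finset.range n, dist (f (I i).1) (f (I i).2)) ^ 2 < η ^ 2 := by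
    refine key.trans_lt ?_
    have hl : ∑ i ∈ Finset.range n, dist (I i).1 (I i).2 < η ^ 2 / (C + 1) := hlen
    rw [lt_div_iff₀ (by linarith)] at hl
    have hl0 : 0 ≤ ∑ i ∈ Finset.range n, dist (I i).1 (I i).2 := Finset.sum_nonneg fun _ _ => dist_nonneg
    rcases hl0.eq_or_lt with h | h
    · rw [← h, mul_zero]; positivity
    · have := mul_le_mul_of_nonneg_right h1 hl0
      nlinarith
  exact lt_of_pow_lt_pow_left₀ 2 hη.le h2

/-- The straddle lemma. -/
theorem tendsto_slope_cell {f' x : ℝ} (hf : HasDerivAt f f' x) {δ : ℕ → ℝ} (h0 : ∀ n, 0 < δ n)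
    (hδ : Tendsto δ atTop (𝓝 0)) :
    Tendsto (fun n => (f (δ n * cell (δ n) x + δ n / 2) - f (δ n * cell (δ n) x - δ n / 2)) / δ n) atTop (𝓝 f') := by
  rw [Metric.tendsto_atTop]
  intro η hη
  have h1 := (hasDerivAt_iff_isLittleO.1 hf).bound (half_pos hη)
  obtain ⟨r, hr, h2⟩ := Metric.eventually_nhds_iff.1 h1
  obtain ⟨N, hN⟩ := Metric.tendsto_atTop.1 hδ r hr
  refine ⟨N, fun n hn => ?_⟩
  have hp := h0 n
  have h3 := hN n hn
  rw [Real.dist_eq, sub_zero, abs_of_pos hp] at h3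
  have h4 := (cell_eq_iff hp x (cell (δ n) x)).1 rfl
  set c := δ n * cell (δ n) x
  have hb := h2 (y := c + δ n / 2) (by rw [Real.dist_eq, abs_lt]; constructor <;> linarith [h4.1, h4.2])
  have ha := h2 (y := c - δ n / 2) (by rw [Real.dist_eq, abs_lt]; constructor <;> linarith [h4.1, h4.2])
  rw [Real.norm_eq_abs, Real.norm_eq_abs, smul_eq_mul] at ha hb
  rw [abs_of_nonneg (a := c + δ n / 2 - x) (by linarith [h4.2])] at hb
  rw [abs_of_nonpos (a := c - δ n / 2 - x) (by linarith [h4.1])] at ha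
  rw [Real.dist_eq, show (f (c + δ n / 2) - f (c - δ n / 2)) / δ n - f' =
    ((f (c + δ n / 2) - f x - (c + δ n / 2 - x) * f') - (f (c - δ n / 2) - f x - (c - δ n / 2 - x) * f')) / δ n by
      field_simp; ring, abs_div, abs_of_pos hp, div_lt_iff₀ hp]
  refine (abs_sub _ _).trans_lt ?_
  nlinarith

/-- Fatou's lemma for difference quotients over cells of shrinking width: each of them has squared
L² norm at most C, and they converge at every point of differentiability. Elsewhere `deriv` is zero
by convention and the bound is trivial. -/
theorem HasSquareVariation.lintegral_deriv_sq_le (hC : HasSquareVariation f C) : ∫⁻ x, ‖deriv f x‖ₑ ^ (2 : ℝ) ≤ ENNReal.ofReal C := by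
  set δ : ℕ → ℝ := fun n => 1 / ((n : ℝ) + 1) with hδ
  have h0 (n : ℕ) : 0 < δ n := Nat.one_div_pos_of_nat
  have hlim : Tendsto δ atTop (𝓝 0) := tendsto_one_div_add_atTop_nhds_zero_nat
  set q : ℕ → ℤ → ℝ := fun n j => (f (δ n * j + δ n / 2) - f (δ n * j - δ n / 2)) / δ n with hq
  refine lintegral_le_of_le_liminf (f := fun n x => ‖q n (cell (δ n) x)‖ₑ ^ (2 : ℝ)) (fun n => ?_) (fun x => ?_)
    (Eventually.of_forall fun n => ?_)
  · exact (measurable_of_countable fun j => ‖q n j‖ₑ ^ (2 : ℝ)).comp (measurable_cell _)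
  · by_cases hx : DifferentiableAt ℝ f x
    · have h1 := tendsto_slope_cell hx.hasDerivAt h0 hlim
      have h2 : Tendsto (fun n => ‖q n (cell (δ n) x)‖ₑ ^ (2 : ℝ)) atTop (𝓝 (‖deriv f x‖ₑ ^ (2 : ℝ))) :=
        (ENNReal.continuous_rpow_const.tendsto _).comp ((continuous_enorm.tendsto _).comp h1)
      exact h2.liminf_eq.ge
    · rw [deriv_zero_of_not_differentiableAt hx, enorm_zero, ENNReal.zero_rpow_of_pos two_pos]
      exact zero_le
  · rw [lintegral_cell (h0 n) fun j => ‖q n j‖ₑ ^ (2 : ℝ), ENNReal.tsum_eq_iSup_sum, ENNReal.mul_iSup]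
    refine iSup_le fun s => ?_
    have e (j : ℤ) : ‖q n j‖ₑ ^ (2 : ℝ) = ENNReal.ofReal (q n j ^ 2) := by
      rw [Real.enorm_eq_ofReal_abs, ENNReal.ofReal_rpow_of_nonneg (abs_nonneg _) zero_le_two]
      congr 1
      rw [Real.rpow_two, sq_abs]
    simp_rw [e]
    rw [← ENNReal.ofReal_sum_of_nonneg fun _ _ => sq_nonneg _, ← ENNReal.ofReal_mul (h0 n).le]
    refine ENNReal.ofReal_le_ofReal ?_
    -- The criterion is stated for families indexed by ℕ, so the cells are renumbered through an
    -- encoding of ℤ; the default 0 of the decoder is never reached on the image.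
    have hinj : Function.Injective (Encodable.encode : ℤ → ℕ) := Encodable.encode_injective
    have h1 := hC (s.image Encodable.encode)
      (fun i => δ n * (((Encodable.decode (α := ℤ) i).getD 0 : ℤ) : ℝ) - δ n / 2)
      (fun i => δ n * (((Encodable.decode (α := ℤ) i).getD 0 : ℤ) : ℝ) + δ n / 2) (fun i _ => by linarith [h0 n]) (by
        intro i hi j hj hij
        rw [Finset.mem_coe, Finset.mem_image] at hi hj
        obtain ⟨k, -, rfl⟩ := hi
        obtain ⟨l, -, rfl⟩ := hj
        have hkl : k ≠ l := fun h => hij (by rw [h])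
        simp only [Function.onFun, Encodable.encodek, Option.getD_some]
        rw [Ioc_disjoint_Ioc]
        have hp := h0 n
        rcases lt_or_gt_of_ne hkl with h | h
        · have : (k : ℝ) + 1 ≤ l := by exact_mod_cast h
          refine (min_le_left _ _).trans (le_trans ?_ (le_max_right _ _))
          nlinarith
        · have : (l : ℝ) + 1 ≤ k := by exact_mod_cast h
          refine (min_le_right _ _).trans (le_trans ?_ (le_max_left _ _))
          nlinarith)
    rw [Finset.sum_image fun _ _ _ _ h => hinj h] at h1
    simp only [Encodable.encodek, Option.getD_some] at h1
    refine le_trans (le_of_eq ?_) h1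
    rw [Finset.mul_sum]
    refine Finset.sum_congr rfl fun j _ => ?_
    have hp := h0 n
    rw [show δ n * (j : ℝ) + δ n / 2 - (δ n * j - δ n / 2) = δ n by ring]
    simp only [hq]
    field_simp

end GradLimit


/-! ### Regularity of the limits -/

theorem HasSquareVariation.integral_mul_deriv {f φ : ℝ → ℝ} {C : ℝ} (hf : HasSquareVariation f C) (hφ : ContDiff ℝ ∞ φ)
    (hc : HasCompactSupport φ) : ∫ x, f x * deriv φ x = -∫ x, deriv f x * φ x := by
  obtain ⟨A, hA⟩ := hc.isCompact.isBounded.subset_closedBall 0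
  set B := |A| + 1 with hB
  have hsub : tsupport φ ⊆ Ioo (-B) B := fun x hx => by
    have h1 := hA hx
    rw [mem_closedBall_zero_iff, Real.norm_eq_abs] at h1
    rw [mem_Ioo, ← abs_lt]
    linarith [le_abs_self A]
  have hsub' : tsupport φ ⊆ Ioc (-B) B := hsub.trans Ioo_subset_Ioc_self
  have e1 : ∫ x in (-B)..B, f x * deriv φ x = ∫ x, f x * deriv φ x :=
    intervalIntegral.integral_eq_integral_of_support_subset fun x hx =>
      hsub' (support_deriv_subset (Function.mem_support.2 (right_ne_zero_of_mul (Function.mem_support.1 hx))))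
  have e2 : ∫ x in (-B)..B, deriv f x * φ x = ∫ x, deriv f x * φ x :=
    intervalIntegral.integral_eq_integral_of_support_subset fun x hx =>
      hsub' (subset_tsupport _ (Function.mem_support.2 (right_ne_zero_of_mul (Function.mem_support.1 hx))))
  obtain ⟨K, hK⟩ := ContDiff.lipschitzWith_of_hasCompactSupport hc hφ (by simp)
  have h := (hf.absolutelyContinuous (-B) B).integral_mul_deriv_eq_deriv_mul
    hK.lipschitzOnWith.absolutelyContinuousOnInterval
  have z1 : φ B = 0 := image_eq_zero_of_notMem_tsupport fun h => lt_irrefl _ (hsub h).2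
  have z2 : φ (-B) = 0 := image_eq_zero_of_notMem_tsupport fun h => lt_irrefl _ (hsub h).1
  rw [← e1, ← e2, h, z1, z2]
  ring

namespace IsTestFunction

variable {τfin : ℝ} {ψ : ℝ × ℝ → ℝ}

theorem slice_snd (hψ : IsTestFunction τfin ψ) (τ : ℝ) :
    ContDiff ℝ ∞ (fun x => ψ (τ, x)) ∧ HasCompactSupport fun x => ψ (τ, x) := by
  refine ⟨hψ.smooth.comp (contDiff_const.prodMk contDiff_id), ?_⟩
  refine HasCompactSupport.intro (hψ.compact.isCompact.image continuous_snd) fun x hx => ?_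
  exact image_eq_zero_of_notMem_tsupport fun h => hx ⟨_, h, rfl⟩

theorem slice_fst (hψ : IsTestFunction τfin ψ) (x : ℝ) :
    ContDiff ℝ ∞ (fun τ => ψ (τ, x)) ∧ HasCompactSupport fun τ => ψ (τ, x) := by
  refine ⟨hψ.smooth.comp (contDiff_id.prodMk contDiff_const), ?_⟩
  refine HasCompactSupport.intro (hψ.compact.isCompact.image continuous_fst) fun τ hτ => ?_
  exact image_eq_zero_of_notMem_tsupport fun h => hτ ⟨_, h, rfl⟩

theorem hasDerivAt_fderiv_snd (hψ : IsTestFunction τfin ψ) (τ x : ℝ) :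
    HasDerivAt (fun x => ψ (τ, x)) (fderiv ℝ ψ (τ, x) (0, 1)) x := by
  have h1 := (hψ.smooth.differentiable (by simp) (τ, x)).hasFDerivAt
  exact h1.comp_hasDerivAt x ((hasDerivAt_const x τ).prodMk (hasDerivAt_id x))

theorem hasDerivAt_fderiv_fst (hψ : IsTestFunction τfin ψ) (τ x : ℝ) :
    HasDerivAt (fun τ => ψ (τ, x)) (fderiv ℝ ψ (τ, x) (1, 0)) τ := by
  have h1 := (hψ.smooth.differentiable (by simp) (τ, x)).hasFDerivAt
  exact h1.comp_hasDerivAt τ ((hasDerivAt_id τ).prodMk (hasDerivAt_const τ x))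

theorem fderiv_apply (hψ : IsTestFunction τfin ψ) (v : ℝ × ℝ) : IsTestFunction τfin fun z => fderiv ℝ ψ z v where
  smooth := (hψ.smooth.fderiv_right (m := ∞) (by simp)).clm_apply contDiff_const
  compact := hψ.compact.fderiv_apply ℝ v
  supp := (tsupport_fderiv_apply_subset ℝ v).trans hψ.supp

theorem continuous_deriv_snd (hψ : IsTestFunction τfin ψ) :
    Continuous (fun z : ℝ × ℝ => deriv (fun x => ψ (z.1, x)) z.2) ∧
      HasCompactSupport fun z : ℝ × ℝ => deriv (fun x => ψ (z.1, x)) z.2 := by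
  have e : (fun z : ℝ × ℝ => deriv (fun x => ψ (z.1, x)) z.2) = fun z => fderiv ℝ ψ z (0, 1) :=
    funext fun z => (hψ.hasDerivAt_fderiv_snd z.1 z.2).deriv
  rw [e]
  exact ⟨(hψ.fderiv_apply _).smooth.continuous, (hψ.fderiv_apply _).compact⟩

end IsTestFunction

/-- On a bounded set the exponents 1 and 1/2 can be lowered to the smallest exponent 1/4 at the
price of powers of the diameter. -/
theorem isLocallyHolderOn_of_modulus {F : ℝ × ℝ → ℝ} {s : Set (ℝ × ℝ)} {A B E : ℝ} (hA : 0 ≤ A) (hB : 0 ≤ B) (hE : 0 ≤ E)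
    (h : ∀ z ∈ s, ∀ w ∈ s, |F z - F w| ≤ A * dist z w + B * √(dist z w) + E * dist z w ^ (1 / 4 : ℝ)) :
    IsLocallyHolderOn F s := by
  refine ⟨1 / 4, by norm_num, by norm_num [div_le_one], fun K hKs hK => ?_⟩
  obtain ⟨D, hD⟩ := Metric.isBounded_iff.1 hK.isBounded
  have hD' : ∀ z ∈ K, ∀ w ∈ K, dist z w ≤ max D 0 := fun z hz w hw => (hD hz hw).trans (le_max_left _ _)
  set D₀ := max D 0
  have hD₀ : 0 ≤ D₀ := le_max_right _ _
  refine ⟨Real.toNNReal (A * D₀ ^ (3 / 4 : ℝ) + B * D₀ ^ (1 / 4 : ℝ) + E), fun z hz w hw => ?_⟩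
  have hd : 0 ≤ dist z w := dist_nonneg
  have e1 : dist z w = dist z w ^ (3 / 4 : ℝ) * dist z w ^ (1 / 4 : ℝ) := by
    rw [← Real.rpow_add_of_nonneg hd (by norm_num) (by norm_num)]; norm_num
  have e2 : √(dist z w) = dist z w ^ (1 / 4 : ℝ) * dist z w ^ (1 / 4 : ℝ) := by
    rw [← Real.rpow_add_of_nonneg hd (by norm_num) (by norm_num), Real.sqrt_eq_rpow]; norm_num
  have h1 : dist z w ^ (3 / 4 : ℝ) ≤ D₀ ^ (3 / 4 : ℝ) := Real.rpow_le_rpow hd (hD' z hz w hw) (by norm_num)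
  have h2 : dist z w ^ (1 / 4 : ℝ) ≤ D₀ ^ (1 / 4 : ℝ) := Real.rpow_le_rpow hd (hD' z hz w hw) (by norm_num)
  have h3 : dist (F z) (F w) ≤ (A * D₀ ^ (3 / 4 : ℝ) + B * D₀ ^ (1 / 4 : ℝ) + E) * dist z w ^ (1 / 4 : ℝ) := by
    rw [Real.dist_eq]
    refine (h z (hKs hz) w (hKs hw)).trans ?_
    have hq : 0 ≤ dist z w ^ (1 / 4 : ℝ) := by positivity
    rw [add_mul, add_mul]
    have k1 : A * dist z w ≤ A * D₀ ^ (3 / 4 : ℝ) * dist z w ^ (1 / 4 : ℝ) := by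
      rw [mul_assoc]
      conv_lhs => rw [e1]
      gcongr
    have k2 : B * √(dist z w) ≤ B * D₀ ^ (1 / 4 : ℝ) * dist z w ^ (1 / 4 : ℝ) := by
      rw [mul_assoc, e2]
      gcongr
    linarith
  rw [edist_dist, edist_dist, ENNReal.ofReal_rpow_of_nonneg hd (by simp)]
  change _ ≤ ENNReal.ofReal _ * _
  rw [← ENNReal.ofReal_mul (by positivity)]
  refine ENNReal.ofReal_le_ofReal ?_
  simpa using h3

namespace MacroSolution

variable {a β τfin ε : ℝ} {u : ℝ → LInf} {T : ℤ → EReal}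

theorem lintegral_macroR₁_slice_le (h : MacroSolution a β τfin ε u T) (τ : ℝ) :
    ∫⁻ x, ‖macroR₁ τfin (sepConst a) ε T (τ, x)‖ₑ ≤ ENNReal.ofReal (2 * (ε + τfin / (4 * sepConst a))) := by
  have hε := h.ε_pos
  have hd := h.d_pos
  simp_rw [h.macroR₁_eq]
  refine (lintegral_cell_le (C := 2 * h.trans.card) hε (kernelSum (sepConst a) ε h.trans (macroTime ε T) τ)
    fun s => ?_).trans (ENNReal.ofReal_le_ofReal (by nlinarith [h.mul_card_le]))
  calc ∑ j ∈ s, |kernelSum (sepConst a) ε h.trans (macroTime ε T) τ j|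
      ≤ ∑ j ∈ s, 2 * ∑ k ∈ h.trans, regKernel (sepConst a) ε (τ - macroTime ε T k) (j - k) :=
        Finset.sum_le_sum fun j _ => by
          rw [kernelSum, abs_mul, abs_neg, abs_two,
            abs_of_nonneg (Finset.sum_nonneg fun k _ => regKernel_nonneg hd hε _ _)]
    _ = 2 * ∑ k ∈ h.trans, ∑ j ∈ s, regKernel (sepConst a) ε (τ - macroTime ε T k) (j - k) := by
        rw [← Finset.mul_sum, Finset.sum_comm]
    _ ≤ 2 * ∑ _k ∈ h.trans, (1 : ℝ) := by
        gcongr with k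
        obtain ⟨c, -, hc1, hc⟩ := hasSum_regKernel hd hε (τ - macroTime ε T k) k
        exact (sum_le_hasSum s (fun j _ => regKernel_nonneg hd hε _ _) hc).trans hc1
    _ = 2 * h.trans.card := by simp

end MacroSolution

section Sequence

variable {a β τfin : ℝ} {ε : ℕ → ℝ} {u : ℕ → ℝ → LInf} {T : ℕ → ℤ → EReal}
variable {P Q R : ℝ × ℝ → ℝ} {ξ : ℝ → ℝ} {M : ℝ}

theorem hasSquareVariation_R (h : ∀ n, MacroSolution a β τfin (ε n) (u n) (T n)) (hε : Tendsto ε atTop (𝓝 0))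
    (hlim : IsLimit τfin (sepConst a) ε u T Q R ξ) {τ : ℝ} (hτ : τ ∈ Icc 0 τfin) :
    HasSquareVariation (fun x => R (τ, x)) (8 * weightBound (sepConst a) τfin ^ 2) := by
  refine hasSquareVariation_of_limit (ε := ε) (fun n => (h n).ε_pos) hε
    (ρ := fun n => kernelSum (sepConst a) (ε n) (h n).trans (macroTime (ε n) (T n)) τ) ?_ fun x => ?_
  · filter_upwards [eventually_le_one hε] with n hn s
    exact sum_sq_grad_kernelSum_le (h n).separated (h n).d_pos (h n).ε_pos hn (h n).τfin_pos.le τ s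
  · have := hlim.singular.tendsto_at (x := (τ, x)) ⟨hτ, mem_univ _⟩
    simpa only [(h _).macroR₁_eq] using this

theorem integrable_R (h : ∀ n, MacroSolution a β τfin (ε n) (u n) (T n)) (hε : Tendsto ε atTop (𝓝 0))
    (hlim : IsLimit τfin (sepConst a) ε u T Q R ξ) : ∃ C : ℝ≥0, ∀ τ ∈ Icc 0 τfin,
    MemLp (fun x => R (τ, x)) 1 volume ∧ eLpNorm (fun x => R (τ, x)) 1 volume ≤ C := by
  refine ⟨Real.toNNReal (2 * (1 + τfin / (4 * sepConst a))), fun τ hτ => ?_⟩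
  have key : ∫⁻ x, ‖R (τ, x)‖ₑ ≤ ENNReal.ofReal (2 * (1 + τfin / (4 * sepConst a))) := by
    refine lintegral_le_of_le_liminf (f := fun n x => ‖macroR₁ τfin (sepConst a) (ε n) (T n) (τ, x)‖ₑ)
      (fun n => ?_) (fun x => ?_) ?_
    · exact (((h n).measurable_macroR₁ _).comp (measurable_const.prodMk measurable_id)).enorm
    · exact ((continuous_enorm.tendsto _).comp (hlim.singular.tendsto_at (x := (τ, x)) ⟨hτ, mem_univ _⟩)).liminf_eq.ge
    · filter_upwards [eventually_le_one hε] with n hn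
      exact ((h n).lintegral_macroR₁_slice_le τ).trans (ENNReal.ofReal_le_ofReal (by linarith))
  have hc : Continuous fun x => R (τ, x) := by
    rw [← continuousOn_univ]
    exact (continuousOn_R h hε hlim).comp (by fun_prop) fun x _ => ⟨hτ, mem_univ _⟩
  rw [← eLpNorm_one_eq_lintegral_enorm] at key
  exact ⟨⟨hc.aestronglyMeasurable, key.trans_lt ENNReal.ofReal_lt_top⟩, key⟩

/-- At each time R is absolutely continuous in space with square integrable derivative, so the
classical derivative serves as the weak one, by integrating by parts on slices and applying Fubini.
-/
theorem gradient_R (h : ∀ n, MacroSolution a β τfin (ε n) (u n) (T n)) (hε : Tendsto ε atTop (𝓝 0))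
    (hlim : IsLimit τfin (sepConst a) ε u T Q R ξ) : HasGradientInLInfLTwo τfin R := by
  have hτfin := (h 0).τfin_pos.le
  set C := 8 * weightBound (sepConst a) τfin ^ 2 with hC
  -- Freezing R outside the time interval gives a function continuous on the whole plane, whose
  -- partial derivative is then jointly measurable.
  set R' : ℝ → ℝ → ℝ := fun τ x => R (projIcc 0 τfin hτfin τ, x) with hR'
  have hR'c : Continuous R'.uncurry := by
    refine (continuousOn_R h hε hlim).comp_continuous (f := fun z : ℝ × ℝ => ((projIcc 0 τfin hτfin z.1 : ℝ), z.2))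
      (by fun_prop) fun z => ⟨(projIcc 0 τfin hτfin z.1).2, mem_univ _⟩
  have hR'e (τ : ℝ) (hτ : τ ∈ Icc 0 τfin) (x : ℝ) : R' τ x = R (τ, x) := by
    simp only [hR', projIcc_of_mem hτfin hτ]
  have hV (τ : ℝ) : HasSquareVariation (R' τ) C := hasSquareVariation_R h hε hlim (projIcc 0 τfin hτfin τ).2
  set D : ℝ × ℝ → ℝ := fun z => deriv (R' z.1) z.2 with hD
  have hDm : Measurable D := measurable_deriv_with_param hR'c
  have hDs (τ : ℝ) : ∫⁻ x, ‖D (τ, x)‖ₑ ^ (2 : ℝ) ≤ ENNReal.ofReal C := (hV τ).lintegral_deriv_sq_le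
  have hDn (τ : ℝ) : eLpNorm (fun x => D (τ, x)) 2 volume ≤ (ENNReal.ofReal C) ^ (1 / 2 : ℝ) := by
    rw [eLpNorm_eq_lintegral_rpow_enorm_toReal two_ne_zero ENNReal.ofNat_ne_top]
    simp only [ENNReal.toReal_ofNat]
    exact ENNReal.rpow_le_rpow (hDs τ) (by norm_num)
  have htop : (ENNReal.ofReal C) ^ (1 / 2 : ℝ) ≠ ⊤ := ENNReal.rpow_ne_top_of_nonneg (by norm_num) ENNReal.ofReal_ne_top
  have hDL : MemLp D 2 (volume.restrict (domain τfin)) := by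
    refine ⟨hDm.aestronglyMeasurable, ?_⟩
    rw [eLpNorm_lt_top_iff_lintegral_rpow_enorm_lt_top two_ne_zero ENNReal.ofNat_ne_top, domain, Measure.volume_eq_prod,
      setLIntegral_prod _ (by fun_prop)]
    simp only [ENNReal.toReal_ofNat, Measure.restrict_univ]
    refine (lintegral_mono fun τ => hDs τ).trans_lt ?_
    rw [setLIntegral_const, Real.volume_Icc]
    exact ENNReal.mul_lt_top ENNReal.ofReal_lt_top ENNReal.ofReal_lt_top
  refine ⟨D, hDm.aestronglyMeasurable, ⟨((ENNReal.ofReal C) ^ (1 / 2 : ℝ)).toNNReal, Eventually.of_forall fun τ => ?_⟩,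
    fun ψ hψ => ?_⟩
  · rw [ENNReal.coe_toNNReal htop]
    exact ⟨⟨(hDm.comp (measurable_const.prodMk measurable_id)).aestronglyMeasurable,
      (hDn τ).trans_lt htop.lt_top⟩, hDn τ⟩
  · have hψL : MemLp ψ 2 (volume.restrict (domain τfin)) :=
      hψ.smooth.continuous.memLp_of_hasCompactSupport hψ.compact
    have hi1 : IntegrableOn (fun z => D z * ψ z) (domain τfin) := hDL.integrable_mul hψL
    obtain ⟨hc, hs⟩ := hψ.continuous_deriv_snd
    have hi2 : IntegrableOn (fun z : ℝ × ℝ => R' z.1 z.2 * deriv (fun x => ψ (z.1, x)) z.2) (domain τfin) :=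
      (Continuous.integrable_of_hasCompactSupport (hR'c.mul hc) hs.mul_left).integrableOn
    have e1 : ∫ z in domain τfin, R z * deriv (fun x => ψ (z.1, x)) z.2 =
        ∫ z in domain τfin, R' z.1 z.2 * deriv (fun x => ψ (z.1, x)) z.2 :=
      setIntegral_congr_fun (MacroSolution.measurableSet_domain τfin) fun z hz => by
        simp only [hR'e z.1 hz.1 z.2]
    rw [e1]
    unfold domain at hi1 hi2 ⊢
    rw [Measure.volume_eq_prod] at hi1 hi2 ⊢
    rw [setIntegral_prod _ hi1, setIntegral_prod _ hi2, ← integral_neg]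
    refine integral_congr_ae (Eventually.of_forall fun τ => ?_)
    simp only [Measure.restrict_univ]
    exact (hV τ).integral_mul_deriv (hψ.slice_snd τ).1 (hψ.slice_snd τ).2

theorem limitRegularity (h : ∀ n, MacroSolution a β τfin (ε n) (u n) (T n)) (hε : Tendsto ε atTop (𝓝 0))
    (hlim : IsLimit τfin (sepConst a) ε u T Q R ξ) (hP : ∀ z, P z = Q z + R z)
    (hM : ∀ n, ∀ j : ℤ, |dPhi (u n 0 j)| ≤ M) : LimitRegularity τfin P Q R ξ := by
  have ha := (h 0).a_pos.le
  have hd := (h 0).d_pos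
  have hτfin := (h 0).τfin_pos.le
  have hW := weightBound_nonneg hd hτfin
  set W := weightBound (sepConst a) τfin with hWdef
  have hQb (z) (hz : z ∈ domain τfin) : |Q z| ≤ M := abs_Q_le hlim hM hz
  have hRb (z) (hz : z ∈ domain τfin) : |R z| ≤ 12 * W * τfin ^ (1 / 4 : ℝ) := by
    refine (abs_R_le_time h hε hlim hz).trans ?_
    have h1 := hz.1.1
    have h2 := hz.1.2
    gcongr
  have hfst (z w : ℝ × ℝ) : |z.1 - w.1| ≤ dist z w := by
    rw [Prod.dist_eq, ← Real.dist_eq]; exact le_max_left _ _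
  have hsnd (z w : ℝ × ℝ) : |z.2 - w.2| ≤ dist z w := by
    rw [Prod.dist_eq, ← Real.dist_eq]; exact le_max_right _ _
  have hQm (z) (hz : z ∈ domain τfin) (w) (hw : w ∈ domain τfin) :
      |Q z - Q w| ≤ a * dist z w + a * √2 * √(dist z w) := by
    refine (abs_Q_sub_le h hε hlim hz hw).trans ?_
    rw [mul_assoc, ← Real.sqrt_mul zero_le_two]
    have h1 := hfst z w
    have h2 := hsnd z w
    gcongr
  have hRm (z) (hz : z ∈ domain τfin) (w) (hw : w ∈ domain τfin) :
      |R z - R w| ≤ √(8 * W ^ 2) * √(dist z w) + 12 * W * dist z w ^ (1 / 4 : ℝ) := by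
    refine (abs_R_sub_le h hε hlim hz hw).trans ?_
    rw [← Real.sqrt_mul (by positivity), add_comm]
    have h1 := hfst z w
    have h2 := hsnd z w
    gcongr
  exact {
    lipschitz := ⟨Real.toNNReal (1 / (4 * sepConst a)), LipschitzOnWith.of_dist_le_mul fun x hx y hy => by
      rw [Real.coe_toNNReal _ (by positivity), Real.dist_eq, Real.dist_eq]
      refine (abs_ξ_sub_le h hε hlim hx hy).trans (le_of_eq ?_)
      ring⟩
    bounded_Q := ⟨M, hQb⟩
    bounded_R := ⟨_, hRb⟩
    bounded_P := ⟨M + 12 * W * τfin ^ (1 / 4 : ℝ), fun z hz => by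
      rw [hP]; exact (abs_add_le _ _).trans (add_le_add (hQb z hz) (hRb z hz))⟩
    holder_Q := isLocallyHolderOn_of_modulus (A := a) (B := a * √2) (E := 0) ha (by positivity) le_rfl
      fun z hz w hw => by linarith [hQm z hz w hw]
    holder_R := isLocallyHolderOn_of_modulus (A := 0) (B := √(8 * W ^ 2)) (E := 12 * W) le_rfl (by positivity)
      (by positivity) fun z hz w hw => by linarith [hRm z hz w hw]
    holder_P := isLocallyHolderOn_of_modulus (A := a) (B := a * √2 + √(8 * W ^ 2)) (E := 12 * W) ha (by positivity)
      (by positivity) fun z hz w hw => by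
        rw [hP, hP, add_sub_add_comm]
        refine (abs_add_le _ _).trans ((add_le_add (hQm z hz w hw) (hRm z hz w hw)).trans (le_of_eq ?_))
        ring
    integrable_R := integrable_R h hε hlim
    gradient_R := gradient_R h hε hlim }

end Sequence


/-! ### The distributional equation -/

theorem measurable_sgn : Measurable sgn :=
  Measurable.ite measurableSet_Iio measurable_const measurable_const

theorem abs_sgn (x : ℝ) : |sgn x| = 1 := by
  unfold sgn; split_ifs <;> simp

theorem integrableOn_domain_mul {F G φ : ℝ × ℝ → ℝ} {τfin B : ℝ} (hG : Measurable G)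
    (hFG : ∀ z ∈ domain τfin, F z = G z) (hB : ∀ z ∈ domain τfin, |F z| ≤ B) (hφ : Continuous φ)
    (hc : HasCompactSupport φ) : IntegrableOn (fun z => F z * φ z) (domain τfin) := by
  have hm : AEStronglyMeasurable F (volume.restrict (domain τfin)) :=
    hG.aestronglyMeasurable.congr ((ae_restrict_iff' (MacroSolution.measurableSet_domain τfin)).2
      (Eventually.of_forall fun z hz => (hFG z hz).symm))
  exact (hφ.integrable_of_hasCompactSupport hc).integrableOn.bdd_mul (c := B) hm
    ((ae_restrict_iff' (MacroSolution.measurableSet_domain τfin)).2 (Eventually.of_forall hB))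

/-- Translation invariance in space. With shift ±ε it moves by exactly one cell and plays the role
of summation by parts on the lattice. -/
theorem setIntegral_domain_shift (F φ : ℝ × ℝ → ℝ) (τfin s : ℝ) :
    ∫ z in domain τfin, F (z.1, z.2 + s) * φ z = ∫ z in domain τfin, F z * φ (z.1, z.2 - s) := by
  rw [← integral_indicator (MacroSolution.measurableSet_domain τfin),
    ← integral_indicator (MacroSolution.measurableSet_domain τfin),
    ← integral_add_right_eq_self ((domain τfin).indicator fun z => F z * φ (z.1, z.2 - s)) ((0, s) : ℝ × ℝ)]
  refine integral_congr_ae (Eventually.of_forall fun z => ?_)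
  by_cases hz : z ∈ domain τfin
  · have hz' : z + (0, s) ∈ domain τfin := ⟨by simpa using hz.1, mem_univ _⟩
    beta_reduce
    rw [indicator_of_mem hz, indicator_of_mem hz']
    simp only [Prod.fst_add, Prod.snd_add, add_zero, add_sub_cancel_right]
    congr 2
    ext <;> simp
  · have hz' : z + (0, s) ∉ domain τfin := fun h => hz ⟨by simpa using h.1, mem_univ _⟩
    beta_reduce
    rw [indicator_of_notMem hz, indicator_of_notMem hz']

/-- Convergence of the second difference quotients. -/
theorem abs_second_difference_le {φ φ₁ φ₂ : ℝ → ℝ} {C : ℝ} (h1 : ∀ x, HasDerivAt φ (φ₁ x) x)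
    (h2 : ∀ x, HasDerivAt φ₁ (φ₂ x) x) (hC : ∀ x y, |φ₂ x - φ₂ y| ≤ C * |x - y|) (x : ℝ) {H : ℝ} (hH : 0 ≤ H) :
    |φ (x + H) - 2 * φ x + φ (x - H) - H ^ 2 * φ₂ x| ≤ 2 * C * H ^ 3 := by
  have hp (y : ℝ) (ψ : ℝ → ℝ) (ψ' : ℝ) (h : HasDerivAt ψ ψ' (x + y)) : HasDerivAt (fun t => ψ (x + t)) ψ' y := by
    simpa [Function.comp_def] using h.comp y ((hasDerivAt_id y).const_add x)
  have hm (y : ℝ) (ψ : ℝ → ℝ) (ψ' : ℝ) (h : HasDerivAt ψ ψ' (x - y)) : HasDerivAt (fun t => ψ (x - t)) (-ψ') y := by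
    simpa [Function.comp_def] using h.comp y ((hasDerivAt_id y).const_sub x)
  have hK (y : ℝ) : HasDerivAt (fun t => φ₁ (x + t) - φ₁ (x - t) - 2 * t * φ₂ x)
      (φ₂ (x + y) + φ₂ (x - y) - 2 * φ₂ x) y := by
    refine (((hp y _ _ (h2 _)).sub (hm y _ _ (h2 _))).sub
      (((hasDerivAt_id y).const_mul 2).mul_const (φ₂ x))).congr_deriv ?_
    ring
  have hKb (y : ℝ) (hy : y ∈ Icc 0 H) : |φ₁ (x + y) - φ₁ (x - y) - 2 * y * φ₂ x| ≤ 2 * C * H ^ 2 := by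
    have hC0 : 0 ≤ C := by
      have := (abs_nonneg _).trans (hC 1 0)
      simpa using this
    have := (convex_Icc 0 H).norm_image_sub_le_of_norm_hasDerivWithin_le (C := 2 * C * H)
      (fun t _ => (hK t).hasDerivWithinAt) (fun t ht => ?_) (left_mem_Icc.2 hH) hy
    · simp only [add_zero, sub_zero, sub_self, mul_zero, zero_mul, Real.norm_eq_abs] at this
      rw [abs_of_nonneg hy.1] at this
      refine this.trans ?_
      have := mul_le_mul_of_nonneg_left hy.2 (show 0 ≤ 2 * C * H by positivity)
      linarith
    · have e : φ₂ (x + t) + φ₂ (x - t) - 2 * φ₂ x = (φ₂ (x + t) - φ₂ x) + (φ₂ (x - t) - φ₂ x) := by ring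
      rw [Real.norm_eq_abs, e]
      have a1 := hC (x + t) x
      have a2 := hC (x - t) x
      rw [show x + t - x = t by ring, abs_of_nonneg ht.1] at a1
      rw [show x - t - x = -t by ring, abs_neg, abs_of_nonneg ht.1] at a2
      have := mul_le_mul_of_nonneg_left ht.2 hC0
      exact (abs_add_le _ _).trans (by linarith)
  have hG (y : ℝ) : HasDerivAt (fun t => φ (x + t) - 2 * φ x + φ (x - t) - t ^ 2 * φ₂ x)
      (φ₁ (x + y) - φ₁ (x - y) - 2 * y * φ₂ x) y := by
    refine ((((hp y _ _ (h1 _)).sub_const (2 * φ x)).add (hm y _ _ (h1 _))).sub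
      ((hasDerivAt_pow 2 y).mul_const (φ₂ x))).congr_deriv ?_
    simp
    ring
  have := (convex_Icc 0 H).norm_image_sub_le_of_norm_hasDerivWithin_le (C := 2 * C * H ^ 2)
    (fun t _ => (hG t).hasDerivWithinAt) (fun t ht => hKb t ht) (left_mem_Icc.2 hH) (right_mem_Icc.2 hH)
  simp only [add_zero, sub_zero, Real.norm_eq_abs] at this
  rw [abs_of_nonneg hH] at this
  refine le_trans (le_of_eq ?_) (this.trans (le_of_eq (by ring)))
  congr 1; ring

/-- Convergence of integrals of products. -/
theorem tendsto_integral_mul_of_L1 {X : Type*} [MeasurableSpace X] {μ : Measure X} {f φ : X → ℝ} {F Φ : ℕ → X → ℝ}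
    {η : ℕ → ℝ} {B : ℝ} (hf : Integrable f μ) (hF : ∀ n, Integrable (F n) μ)
    (hlim : Tendsto (fun n => ∫ x, |F n x - f x| ∂μ) atTop (𝓝 0)) (hφ : AEStronglyMeasurable φ μ)
    (hΦ : ∀ n, AEStronglyMeasurable (Φ n) μ) (hB : ∀ x, |φ x| ≤ B) (hη : Tendsto η atTop (𝓝 0))
    (hΦφ : ∀ n, ∀ x, |Φ n x - φ x| ≤ η n) :
    Tendsto (fun n => ∫ x, F n x * Φ n x ∂μ) atTop (𝓝 (∫ x, f x * φ x ∂μ)) := by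
  have hΦB (n : ℕ) (x : X) : |Φ n x| ≤ B + η n := by
    have := abs_add_le (φ x) (Φ n x - φ x)
    rw [add_sub_cancel] at this
    linarith [hB x, hΦφ n x]
  have h1 : Tendsto (fun n => (B + η n) * ∫ x, |F n x - f x| ∂μ) atTop (𝓝 ((B + 0) * 0)) :=
    (hη.const_add B).mul hlim
  have h2 : Tendsto (fun n => η n * ∫ x, |f x| ∂μ) atTop (𝓝 (0 * ∫ x, |f x| ∂μ)) := hη.mul_const _
  have h3 := h1.add h2
  rw [mul_zero, zero_mul, add_zero] at h3
  rw [tendsto_iff_dist_tendsto_zero]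
  refine squeeze_zero (fun _ => dist_nonneg) (fun n => ?_) h3
  have i1 : Integrable (fun x => F n x * Φ n x) μ := (hF n).mul_bdd (hΦ n) (Eventually.of_forall (hΦB n))
  have i2 : Integrable (fun x => f x * φ x) μ := hf.mul_bdd hφ (Eventually.of_forall hB)
  have i3 : Integrable (fun x => (B + η n) * |F n x - f x|) μ := (((hF n).sub hf).abs).const_mul _
  have i4 : Integrable (fun x => η n * |f x|) μ := hf.abs.const_mul _
  rw [Real.dist_eq, ← integral_sub i1 i2, ← integral_const_mul, ← integral_const_mul, ← integral_add i3 i4]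
  refine abs_integral_le_integral_abs.trans (integral_mono (i1.sub i2).abs (i3.add i4) fun x => ?_)
  have e : F n x * Φ n x - f x * φ x = (F n x - f x) * Φ n x + f x * (Φ n x - φ x) := by ring
  beta_reduce
  rw [e]
  refine (abs_add_le _ _).trans (add_le_add ?_ ?_)
  · rw [abs_mul, mul_comm]
    exact mul_le_mul_of_nonneg_right (hΦB n x) (abs_nonneg _)
  · rw [abs_mul, mul_comm]
    exact mul_le_mul_of_nonneg_right (hΦφ n x) (abs_nonneg _)

namespace MacroSolution

variable {a β τfin ε : ℝ} {u : ℝ → LInf} {T : ℤ → EReal} {ψ : ℝ × ℝ → ℝ}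

theorem exists_abs_apply_le (h : MacroSolution a β τfin ε u T) :
    ∃ C, ∀ τ ∈ Icc 0 τfin, ∀ j, |u (τ / ε ^ 2) j| ≤ C := by
  have hε := h.ε_pos
  obtain ⟨C, hC⟩ := isCompact_Icc.exists_bound_of_continuousOn
    (h.sol.continuousOn.mono (Icc_subset_Ici_self : Icc 0 (τfin / ε ^ 2) ⊆ Ici 0))
  refine ⟨C, fun τ hτ j => (abs_apply_le _ j).trans (hC _ ⟨div_nonneg hτ.1 (by positivity), ?_⟩)⟩
  have := hτ.2
  gcongr

theorem continuous_apply_max (h : MacroSolution a β τfin ε u T) (j : ℤ) :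
    Continuous fun τ : ℝ => u (max τ 0 / ε ^ 2) j :=
  (h.sol.continuousOn_apply j).comp_continuous (by fun_prop)
    fun τ => mem_Ici.2 (div_nonneg (le_max_right _ _) (sq_nonneg _))

theorem measurable_apply_max (h : MacroSolution a β τfin ε u T) :
    Measurable fun z : ℝ × ℝ => u (max z.1 0 / ε ^ 2) (cell ε z.2) :=
  measurable_of_cell (f := fun τ j => u (max τ 0 / ε ^ 2) j) (fun j => (h.continuous_apply_max j).measurable) ε

theorem measurable_dPhi : Measurable dPhi := measurable_id.sub measurable_sgn

theorem abs_dPhi_sub_le (x : ℝ) : |dPhi x| ≤ |x| + 1 := by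
  rw [dPhi]
  exact (abs_sub _ _).trans_eq (by rw [abs_sgn])

/-- Integration by parts in time on a single lattice site. -/
theorem integral_apply_mul_deriv (h : MacroSolution a β τfin ε u T) (j : ℤ) {φ : ℝ → ℝ} (hφ : ContDiff ℝ ∞ φ)
    (h0 : φ 0 = 0) (h1 : φ τfin = 0) :
    ∫ τ in Icc 0 τfin, (u (τ / ε ^ 2) j * deriv φ τ +
      (ε ^ 2)⁻¹ * lap (fun i => dPhi (u (τ / ε ^ 2) i)) j * φ τ) = 0 := by
  have hε := h.ε_pos
  obtain ⟨C, hC⟩ := h.exists_abs_apply_le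
  have hmax {τ : ℝ} (hτ : τ ∈ Icc 0 τfin) : max τ 0 = τ := max_eq_left hτ.1
  have hI : IntegrableOn (fun τ => u (τ / ε ^ 2) j * deriv φ τ +
      (ε ^ 2)⁻¹ * lap (fun i => dPhi (u (τ / ε ^ 2) i)) j * φ τ) (Icc 0 τfin) := by
    have hd : Continuous (deriv φ) := hφ.continuous_deriv (by simp)
    refine IntegrableOn.congr_fun (f := fun τ => u (max τ 0 / ε ^ 2) j * deriv φ τ +
      (ε ^ 2)⁻¹ * lap (fun i => dPhi (u (max τ 0 / ε ^ 2) i)) j * φ τ) (.add ?_ ?_)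
      (fun τ hτ => by simp only [hmax hτ]) measurableSet_Icc
    · exact ((h.continuous_apply_max j).mul hd).continuousOn.integrableOn_Icc
    · refine Integrable.bdd_mul (c := (ε ^ 2)⁻¹ * (4 * (C + 1))) hφ.continuous.continuousOn.integrableOn_Icc ?_ ?_
      · have hm (i : ℤ) : Measurable fun τ : ℝ => dPhi (u (max τ 0 / ε ^ 2) i) :=
          measurable_dPhi.comp (h.continuous_apply_max i).measurable
        refine Measurable.aestronglyMeasurable ?_
        unfold lap
        exact (((hm _).sub ((hm _).const_mul 2)).add (hm _)).const_mul _
      · refine (ae_restrict_iff' measurableSet_Icc).2 (Eventually.of_forall fun τ hτ => ?_)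
        rw [hmax hτ, Real.norm_eq_abs, abs_mul, abs_of_nonneg (by positivity)]
        gcongr
        have hb (i : ℤ) := (abs_le.1 ((abs_dPhi_sub_le (u (τ / ε ^ 2) i)).trans
          (add_le_add_left (hC τ hτ i) 1)))
        unfold lap
        have b1 := hb (j + 1)
        have b2 := hb j
        have b3 := hb (j - 1)
        rw [abs_le]
        constructor <;> linarith [b1.1, b1.2, b2.1, b2.2, b3.1, b3.2]
  rw [integral_Icc_eq_integral_Ioc, ← intervalIntegral.integral_of_le h.τfin_pos.le]
  -- The function u is continuous in time at every site and can fail to be differentiable only at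
  -- transition times. A countable exceptional set does not affect the fundamental theorem of
  -- calculus.
  have hcount : (range fun k : ℤ => ε ^ 2 * (T k).toReal).Countable := countable_range _
  rw [integral_eq_of_hasDerivAt_off_countable_of_le (fun τ => u (τ / ε ^ 2) j * φ τ) _ h.τfin_pos.le hcount]
  · rw [h0, h1]; ring
  · refine ContinuousOn.mul ?_ hφ.continuous.continuousOn
    exact (h.continuous_apply_max j).continuousOn.congr fun τ hτ => by simp only [hmax hτ]
  · rintro τ ⟨hτ, hτ'⟩
    have ht : 0 < τ / ε ^ 2 := div_pos hτ.1 (by positivity)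
    have hd := (h.sol.solves (τ / ε ^ 2) ht.le (fun k _ hk => hτ' ⟨k, by
      beta_reduce; rw [hk, EReal.toReal_coe]; field_simp⟩) j).hasDerivAt (Ici_mem_nhds ht)
    have hd2 := HasDerivAt.comp τ hd ((hasDerivAt_id τ).div_const (ε ^ 2))
    refine (hd2.mul (hφ.differentiable (by simp) τ).hasDerivAt).congr_deriv ?_
    simp only [Function.comp_apply, id, one_div]
    ring
  · exact (intervalIntegrable_iff_integrableOn_Icc_of_le h.τfin_pos.le).2 hI

theorem cell_add_self {ε : ℝ} (hε : 0 < ε) (x : ℝ) : cell ε (x + ε) = cell ε x + 1 := by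
  unfold cell
  rw [add_div, div_self hε.ne', add_right_comm, Int.floor_add_one]

theorem cell_sub_self {ε : ℝ} (hε : 0 < ε) (x : ℝ) : cell ε (x - ε) = cell ε x - 1 := by
  have := cell_add_self hε (x - ε)
  rw [sub_add_cancel] at this
  omega

theorem macroP_eq_dPhi (h : MacroSolution a β τfin ε u T) (s : ℝ) : ∃ G : ℝ × ℝ → ℝ, Measurable G ∧
    ∀ z ∈ domain τfin, macroP ε u (z.1, z.2 + s) = G z := by
  refine ⟨fun z => dPhi (u (max z.1 0 / ε ^ 2) (cell ε (z.2 + s))),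
    measurable_dPhi.comp (h.measurable_apply_max.comp (measurable_fst.prodMk (measurable_snd.add_const s))),
    fun z hz => ?_⟩
  simp only [macroP, max_eq_left hz.1.1]

theorem sgn_eq (h : MacroSolution a β τfin ε u T) : ∃ G : ℝ × ℝ → ℝ, Measurable G ∧
    ∀ z ∈ domain τfin, sgn (u (z.1 / ε ^ 2) (cell ε z.2)) = G z := by
  refine ⟨fun z => sgn (u (max z.1 0 / ε ^ 2) (cell ε z.2)), measurable_sgn.comp h.measurable_apply_max,
    fun z hz => ?_⟩
  simp only [max_eq_left hz.1.1]

theorem exists_abs_macroP_le (h : MacroSolution a β τfin ε u T) :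
    ∃ B, ∀ z ∈ domain τfin, ∀ s, |macroP ε u (z.1, z.2 + s)| ≤ B := by
  obtain ⟨C, hC⟩ := h.exists_abs_apply_le
  exact ⟨C + 1, fun z hz s => (abs_dPhi_sub_le _).trans (add_le_add_left (hC _ hz.1 _) 1)⟩

theorem integrableOn_macroP_mul (h : MacroSolution a β τfin ε u T) (s : ℝ) {φ : ℝ × ℝ → ℝ} (hφ : Continuous φ)
    (hc : HasCompactSupport φ) : IntegrableOn (fun z => macroP ε u (z.1, z.2 + s) * φ z) (domain τfin) := by
  obtain ⟨G, hG, hFG⟩ := h.macroP_eq_dPhi s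
  obtain ⟨B, hB⟩ := h.exists_abs_macroP_le
  exact integrableOn_domain_mul (F := fun z => macroP ε u (z.1, z.2 + s)) hG hFG (fun z hz => hB z hz s) hφ hc

theorem integrableOn_sgn_mul (h : MacroSolution a β τfin ε u T) {φ : ℝ × ℝ → ℝ} (hφ : Continuous φ)
    (hc : HasCompactSupport φ) : IntegrableOn (fun z => sgn (u (z.1 / ε ^ 2) (cell ε z.2)) * φ z) (domain τfin) := by
  obtain ⟨G, hG, hFG⟩ := h.sgn_eq
  exact integrableOn_domain_mul (F := fun z => sgn (u (z.1 / ε ^ 2) (cell ε z.2))) hG hFG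
    (fun z _ => (abs_sgn _).le) hφ hc

/-- The weak formulation of the lattice equation. -/
theorem integral_macroP_add_sgn (h : MacroSolution a β τfin ε u T) (hψ : IsTestFunction τfin ψ) :
    (∫ z in domain τfin, macroP ε u z * fderiv ℝ ψ z (1, 0)) +
      (∫ z in domain τfin, sgn (u (z.1 / ε ^ 2) (cell ε z.2)) * fderiv ℝ ψ z (1, 0)) =
    -∫ z in domain τfin, macroP ε u z *
      ((ψ (z.1, z.2 + ε) - 2 * ψ z + ψ (z.1, z.2 - ε)) / ε ^ 2) := by
  have hε := h.ε_pos
  have hψ₁ := hψ.fderiv_apply (1, 0)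
  have hψc := hψ.smooth.continuous
  have hψs := hψ.compact
  have j1 := h.integrableOn_macroP_mul 0 hψ₁.smooth.continuous hψ₁.compact
  simp only [add_zero, Prod.mk.eta] at j1
  have j2 := h.integrableOn_sgn_mul hψ₁.smooth.continuous hψ₁.compact
  have k1 := h.integrableOn_macroP_mul ε hψc hψs
  have k2 := h.integrableOn_macroP_mul 0 hψc hψs
  have k3 := h.integrableOn_macroP_mul (-ε) hψc hψs
  simp only [add_zero, Prod.mk.eta] at k2
  have hshift (s : ℝ) : HasCompactSupport fun z : ℝ × ℝ => ψ (z.1, z.2 + s) := by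
    have := hψs.comp_homeomorph ((Homeomorph.refl ℝ).prodCongr (Homeomorph.addRight s))
    exact this
  have l1 := h.integrableOn_macroP_mul 0 (φ := fun z => ψ (z.1, z.2 + -ε)) (by fun_prop) (hshift _)
  have l3 := h.integrableOn_macroP_mul 0 (φ := fun z => ψ (z.1, z.2 + ε)) (by fun_prop) (hshift _)
  simp only [add_zero, Prod.mk.eta] at l1 l3
  have s1 := setIntegral_domain_shift (macroP ε u) ψ τfin ε
  have s3 := setIntegral_domain_shift (macroP ε u) ψ τfin (-ε)
  simp only [sub_neg_eq_add] at s3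
  simp only [← sub_eq_add_neg] at l1
  have m1 : IntegrableOn (fun z => macroP ε u z * ψ (z.1, z.2 - ε) - 2 * (macroP ε u z * ψ z)) (domain τfin) :=
    l1.sub (k2.const_mul 2)
  have m2 : IntegrableOn (fun z => macroP ε u (z.1, z.2 + ε) * ψ z - 2 * (macroP ε u z * ψ z)) (domain τfin) :=
    k1.sub (k2.const_mul 2)
  have hR : ∫ z in domain τfin, macroP ε u z * ((ψ (z.1, z.2 + ε) - 2 * ψ z + ψ (z.1, z.2 - ε)) / ε ^ 2) =
      (ε ^ 2)⁻¹ * ((∫ z in domain τfin, macroP ε u (z.1, z.2 + ε) * ψ z) -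
        2 * (∫ z in domain τfin, macroP ε u z * ψ z) + ∫ z in domain τfin, macroP ε u (z.1, z.2 + -ε) * ψ z) := by
    rw [s1, s3, ← integral_const_mul 2, ← integral_sub l1 (k2.const_mul 2), ← integral_add m1 l3,
      ← integral_const_mul]
    refine integral_congr_ae (Eventually.of_forall fun z => ?_)
    ring
  have m3 : IntegrableOn (fun z => macroP ε u z * fderiv ℝ ψ z (1, 0) +
      sgn (u (z.1 / ε ^ 2) (cell ε z.2)) * fderiv ℝ ψ z (1, 0)) (domain τfin) := j1.add j2
  have m4 : IntegrableOn (fun z => (ε ^ 2)⁻¹ * (macroP ε u (z.1, z.2 + ε) * ψ z - 2 * (macroP ε u z * ψ z) +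
      macroP ε u (z.1, z.2 + -ε) * ψ z)) (domain τfin) := (m2.add k3).const_mul _
  rw [hR, ← integral_const_mul 2, ← integral_sub k1 (k2.const_mul 2), ← integral_add m2 k3,
    ← integral_const_mul, ← integral_add j1 j2, eq_neg_iff_add_eq_zero,
    ← integral_add m3 m4]
  have hint := m3.add m4
  unfold IntegrableOn at hint
  unfold domain at hint ⊢
  rw [Measure.volume_eq_prod, ← Measure.prod_restrict] at hint ⊢
  refine (integral_prod_symm _ hint).trans ?_
  rw [Measure.restrict_univ]
  refine (integral_congr_ae (Eventually.of_forall fun x => ?_)).trans (integral_zero _ _)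
  have hs := hψ.slice_fst x
  have e := h.integral_apply_mul_deriv (cell ε x) (φ := fun τ => ψ (τ, x)) hs.1
    (image_eq_zero_of_notMem_tsupport fun h' => lt_irrefl _ (hψ.supp h').1.1)
    (image_eq_zero_of_notMem_tsupport fun h' => lt_irrefl _ (hψ.supp h').1.2)
  refine Eq.trans (integral_congr_ae (Eventually.of_forall fun τ => ?_)) e
  simp only [Pi.add_apply, (hψ.hasDerivAt_fderiv_fst τ x).deriv, macroP, cell_add_self hε,
    ← sub_eq_add_neg, cell_sub_self hε, lap, dPhi]
  ring

end MacroSolution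


/-! ### Passage to the limit in the weak equation. -/

/-- The interface sits at εn when exactly the sites up to n are in the positive phase, and a point
is at most ε/2 away from the centre of its cell. At distance more than ε/2 the phase is therefore
determined. -/
theorem MacroSolution.sgn_apply_of_le {a β τfin ε : ℝ} {u : ℝ → LInf} {T : ℤ → EReal}
    (h : MacroSolution a β τfin ε u T) {τ x : ℝ} (hτ : 0 ≤ τ) :
    (x + ε / 2 ≤ interface ε T τ → sgn (u (τ / ε ^ 2) (cell ε x)) = 1) ∧
      (interface ε T τ < x - ε / 2 → sgn (u (τ / ε ^ 2) (cell ε x)) = -1) := by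
  have hε := h.ε_pos
  obtain ⟨n, hn, h1, h2⟩ := h.index hτ
  rw [h.interface_eq hn h1 h2]
  have hc := abs_le.1 (abs_mul_cell_sub_le hε x)
  have hs := h.sol.sign_lt h.data.mem_stateSpace (k := n + 1) (by omega) (by simpa using h1) h2 (cell ε x)
  constructor
  · intro hx
    have : (cell ε x : ℝ) ≤ n := le_of_mul_le_mul_left (by linarith) hε
    exact sgn_of_nonneg (hs.1 (by exact_mod_cast Int.lt_add_one_iff.2 (by exact_mod_cast this)))
  · intro hx
    have : (n : ℝ) < cell ε x := lt_of_mul_lt_mul_left (by linarith) hε.le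
    exact sgn_of_neg (hs.2 (by exact_mod_cast this))

section Sequence

variable {a β τfin : ℝ} {ε : ℕ → ℝ} {u : ℕ → ℝ → LInf} {T : ℕ → ℤ → EReal}
variable {P Q R : ℝ × ℝ → ℝ} {ξ : ℝ → ℝ} {M : ℝ}

theorem continuousOn_P (h : ∀ n, MacroSolution a β τfin (ε n) (u n) (T n)) (hε : Tendsto ε atTop (𝓝 0))
    (hlim : IsLimit τfin (sepConst a) ε u T Q R ξ) (hP : ∀ z, P z = Q z + R z) : ContinuousOn P (domain τfin) :=
  ((continuousOn_Q h hε hlim).add (continuousOn_R h hε hlim)).congr fun z _ => hP z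

theorem tendsto_sgn (h : ∀ n, MacroSolution a β τfin (ε n) (u n) (T n)) (hε : Tendsto ε atTop (𝓝 0))
    (hlim : IsLimit τfin (sepConst a) ε u T Q R ξ) {z : ℝ × ℝ} (hz : z ∈ domain τfin) (hne : z.2 ≠ ξ z.1) :
    Tendsto (fun n => sgn (u n (z.1 / ε n ^ 2) (cell (ε n) z.2))) atTop (𝓝 (sgn (ξ z.1 - z.2))) := by
  have hI := hlim.interface.tendsto_at hz.1
  have hε2 : Tendsto (fun n => ε n / 2) atTop (𝓝 0) := by simpa using hε.div_const 2
  rcases lt_or_gt_of_ne hne with hlt | hgt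
  · have h1 : Tendsto (fun n => z.2 + ε n / 2) atTop (𝓝 (z.2 + 0)) := hε2.const_add _
    rw [add_zero] at h1
    rw [sgn_of_nonneg (by linarith)]
    refine tendsto_const_nhds.congr' ?_
    filter_upwards [h1.eventually_lt hI hlt] with n hn
    exact (((h n).sgn_apply_of_le hz.1.1).1 hn.le).symm
  · have h1 : Tendsto (fun n => z.2 - ε n / 2) atTop (𝓝 (z.2 - 0)) := hε2.const_sub _
    rw [sub_zero] at h1
    rw [sgn_of_neg (by linarith)]
    refine tendsto_const_nhds.congr' ?_
    filter_upwards [hI.eventually_lt h1 hgt] with n hn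
    exact (((h n).sgn_apply_of_le hz.1.1).2 hn).symm

theorem tendsto_integral_sgn_mul (h : ∀ n, MacroSolution a β τfin (ε n) (u n) (T n)) (hε : Tendsto ε atTop (𝓝 0))
    (hlim : IsLimit τfin (sepConst a) ε u T Q R ξ) {φ : ℝ × ℝ → ℝ} (hφ : Continuous φ) (hc : HasCompactSupport φ) :
    Tendsto (fun n => ∫ z in domain τfin, sgn (u n (z.1 / ε n ^ 2) (cell (ε n) z.2)) * φ z) atTop
      (𝓝 (∫ z in domain τfin, sgn (ξ z.1 - z.2) * φ z)) ∧
    IntegrableOn (fun z => sgn (ξ z.1 - z.2) * φ z) (domain τfin) := by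
  have hτfin := (h 0).τfin_pos.le
  have hd := (h 0).d_pos
  set ξ' : ℝ → ℝ := fun τ => ξ (projIcc 0 τfin hτfin τ) with hξ'
  have hξc : Continuous ξ' := by
    have : ContinuousOn ξ (Icc 0 τfin) :=
      (LipschitzOnWith.of_dist_le_mul (K := Real.toNNReal (1 / (4 * sepConst a))) fun x hx y hy => by
        rw [Real.coe_toNNReal _ (by positivity), Real.dist_eq, Real.dist_eq]
        exact (abs_ξ_sub_le h hε hlim hx hy).trans (le_of_eq (by ring))).continuousOn
    exact this.comp_continuous (by fun_prop) fun τ => (projIcc 0 τfin hτfin τ).2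
  have hξe {τ : ℝ} (hτ : τ ∈ Icc 0 τfin) : ξ' τ = ξ τ := by simp only [hξ', projIcc_of_mem hτfin hτ]
  -- The graph of a continuous function meets each vertical line in one point, so the set where the
  -- phases may fail to converge is negligible.
  have hnull : ∀ᵐ z : ℝ × ℝ, z.2 ≠ ξ' z.1 := by
    have hm : MeasurableSet {z : ℝ × ℝ | z.2 = ξ' z.1} :=
      (isClosed_eq continuous_snd (hξc.comp continuous_fst)).measurableSet
    rw [ae_iff]
    simp only [ne_eq, not_not]
    rw [Measure.volume_eq_prod, Measure.measure_prod_null hm]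
    refine Eventually.of_forall fun τ => ?_
    have : Prod.mk τ ⁻¹' {z : ℝ × ℝ | z.2 = ξ' z.1} = {ξ' τ} := by ext x; simp
    beta_reduce
    rw [this]
    simp
  refine ⟨tendsto_integral_of_dominated_convergence (fun z => |φ z|)
    (fun n => ((h n).integrableOn_sgn_mul hφ hc).aestronglyMeasurable)
    (hφ.integrable_of_hasCompactSupport hc).abs.integrableOn (fun n => Eventually.of_forall fun z => ?_) ?_, ?_⟩
  · rw [norm_mul, Real.norm_eq_abs, abs_sgn, one_mul, Real.norm_eq_abs]
  · refine (ae_restrict_iff' (MacroSolution.measurableSet_domain τfin)).2 ?_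
    filter_upwards [hnull] with z hz hzd
    rw [hξe hzd.1] at hz
    exact (tendsto_sgn h hε hlim hzd hz).mul_const _
  · refine integrableOn_domain_mul (F := fun z => sgn (ξ z.1 - z.2)) (G := fun z => sgn (ξ' z.1 - z.2)) (B := 1)
      (measurable_sgn.comp ?_) (fun z hz => by simp only [hξe hz.1]) (fun z _ => (abs_sgn _).le) hφ hc
    exact ((hξc.comp continuous_fst).sub continuous_snd).measurable

/-- The field converges only in L¹ on compact sets, so the test functions must converge uniformly
and vanish outside a common strip. -/
theorem tendsto_integral_macroP_mul (h : ∀ n, MacroSolution a β τfin (ε n) (u n) (T n)) (hε : Tendsto ε atTop (𝓝 0))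
    (hlim : IsLimit τfin (sepConst a) ε u T Q R ξ) (hP : ∀ z, P z = Q z + R z) {φ : ℝ × ℝ → ℝ} {Φ : ℕ → ℝ × ℝ → ℝ}
    {η : ℕ → ℝ} {A B : ℝ} (hφ : Continuous φ) (hB : ∀ z, |φ z| ≤ B) (hΦ : ∀ n, Continuous (Φ n))
    (hη : Tendsto η atTop (𝓝 0)) (hΦφ : ∀ n z, |Φ n z - φ z| ≤ η n) (hA : ∀ z, A < |z.2| → φ z = 0)
    (hA' : ∀ n z, A < |z.2| → Φ n z = 0) :
    Tendsto (fun n => ∫ z in domain τfin, macroP (ε n) (u n) z * Φ n z) atTop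
      (𝓝 (∫ z in domain τfin, P z * φ z)) := by
  set K : Set (ℝ × ℝ) := Icc 0 τfin ×ˢ Icc (-A) A with hK
  have hKc : IsCompact K := isCompact_Icc.prod isCompact_Icc
  have hKd : K ⊆ domain τfin := prod_mono_right (subset_univ _)
  have hKm : MeasurableSet K := hKc.measurableSet
  have hKout {z : ℝ × ℝ} (hz : z ∈ domain τfin \ K) : A < |z.2| := by
    by_contra! hcon
    exact hz.2 ⟨hz.1.1, abs_le.1 hcon⟩
  have hPK : IntegrableOn P K := ((continuousOn_P h hε hlim hP).mono hKd).integrableOn_compact hKc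
  have hFK (n : ℕ) : IntegrableOn (macroP (ε n) (u n)) K := by
    obtain ⟨G, hG, hFG⟩ := (h n).macroP_eq_dPhi 0
    obtain ⟨b, hb⟩ := (h n).exists_abs_macroP_le
    refine IntegrableOn.of_bound hKc.measure_lt_top (hG.aestronglyMeasurable.congr
      ((ae_restrict_iff' hKm).2 (Eventually.of_forall fun z hz => ?_))) b
      ((ae_restrict_iff' hKm).2 (Eventually.of_forall fun z hz => ?_))
    · simpa using (hFG z (hKd hz)).symm
    · simpa using hb z (hKd hz) 0
  have hlimK : Tendsto (fun n => ∫ z in K, |macroP (ε n) (u n) z - P z|) atTop (𝓝 0) := by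
    have h1 := tendsto_eLpNorm_macroP_sub h hε hlim hP le_rfl ENNReal.one_lt_top hKd hKc
    have h2 := (ENNReal.tendsto_toReal ENNReal.zero_ne_top).comp h1
    rw [ENNReal.toReal_zero] at h2
    refine h2.congr fun n => ?_
    simp only [Function.comp_apply]
    rw [eLpNorm_one_eq_lintegral_enorm]
    exact (integral_norm_eq_lintegral_enorm ((hFK n).sub hPK).aestronglyMeasurable).symm
  have key := tendsto_integral_mul_of_L1 hPK hFK hlimK hφ.aestronglyMeasurable (fun n => (hΦ n).aestronglyMeasurable)
    hB hη hΦφ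
  have e1 : ∫ z in domain τfin, P z * φ z = ∫ z in K, P z * φ z :=
    setIntegral_eq_of_subset_of_forall_sdiff_eq_zero (MacroSolution.measurableSet_domain τfin) hKd
      fun z hz => by rw [hA z (hKout hz), mul_zero]
  have e2 (n : ℕ) : ∫ z in domain τfin, macroP (ε n) (u n) z * Φ n z = ∫ z in K, macroP (ε n) (u n) z * Φ n z :=
    setIntegral_eq_of_subset_of_forall_sdiff_eq_zero (MacroSolution.measurableSet_domain τfin) hKd
      fun z hz => by rw [hA' n z (hKout hz), mul_zero]
  simp_rw [e1, e2]
  exact key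

theorem isDistributionalSolution_P (h : ∀ n, MacroSolution a β τfin (ε n) (u n) (T n)) (hε : Tendsto ε atTop (𝓝 0))
    (hlim : IsLimit τfin (sepConst a) ε u T Q R ξ) (hP : ∀ z, P z = Q z + R z) :
    IsDistributionalSolution τfin P ξ := by
  intro ψ hψ
  have hτ' := hψ.fderiv_apply (1, 0)
  have hψ₁ := hψ.fderiv_apply (0, 1)
  have hψ₂ := hψ₁.fderiv_apply (0, 1)
  set φt : ℝ × ℝ → ℝ := fun z => fderiv ℝ ψ z (1, 0) with hφt
  set φ₁ : ℝ × ℝ → ℝ := fun z => fderiv ℝ ψ z (0, 1) with hφ₁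
  set φ₂ : ℝ × ℝ → ℝ := fun z => fderiv ℝ φ₁ z (0, 1) with hφ₂
  have et (z : ℝ × ℝ) : deriv (fun s => ψ (s, z.2)) z.1 = φt z := (hψ.hasDerivAt_fderiv_fst z.1 z.2).deriv
  have e2 (z : ℝ × ℝ) : iteratedDeriv 2 (fun x => ψ (z.1, x)) z.2 = φ₂ z := by
    have : deriv (fun x => ψ (z.1, x)) = fun x => φ₁ (z.1, x) :=
      funext fun x => (hψ.hasDerivAt_fderiv_snd z.1 x).deriv
    rw [iteratedDeriv_succ, iteratedDeriv_one, this]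
    exact (hψ₁.hasDerivAt_fderiv_snd z.1 z.2).deriv
  simp_rw [et, e2]
  obtain ⟨A, hA⟩ := hψ.compact.isCompact.isBounded.subset_closedBall 0
  have hout {χ : ℝ × ℝ → ℝ} (hχ : tsupport χ ⊆ tsupport ψ) (z : ℝ × ℝ) (hz : A < |z.2|) : χ z = 0 := by
    refine image_eq_zero_of_notMem_tsupport fun hmem => ?_
    have h1 := hA (hχ hmem)
    rw [mem_closedBall_zero_iff] at h1
    have h2 := norm_snd_le z
    rw [Real.norm_eq_abs] at h2
    linarith
  obtain ⟨E, hE⟩ := hε.bddAbove_range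
  have hE' (n : ℕ) : ε n ≤ E := hE ⟨n, rfl⟩
  have hE0 : 0 ≤ E := (h 0).ε_pos.le.trans (hE' 0)
  obtain ⟨Bt, hBt⟩ := hτ'.compact.exists_bound_of_continuous hτ'.smooth.continuous
  obtain ⟨B₂, hB₂⟩ := hψ₂.compact.exists_bound_of_continuous hψ₂.smooth.continuous
  obtain ⟨C, hC⟩ := ContDiff.lipschitzWith_of_hasCompactSupport hψ₂.compact hψ₂.smooth (by simp)
  have hψc := hψ.smooth.continuous
  have l1 : Tendsto (fun n => ∫ z in domain τfin, macroP (ε n) (u n) z * φt z) atTop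
      (𝓝 (∫ z in domain τfin, P z * φt z)) :=
    tendsto_integral_macroP_mul h hε hlim hP (η := fun _ => 0) (A := A) hτ'.smooth.continuous hBt
      (fun _ => hτ'.smooth.continuous) tendsto_const_nhds (fun _ _ => by simp)
      (hout (tsupport_fderiv_apply_subset ℝ _)) (fun _ => hout (tsupport_fderiv_apply_subset ℝ _))
  obtain ⟨l2, i2⟩ := tendsto_integral_sgn_mul h hε hlim hτ'.smooth.continuous hτ'.compact
  have hη : Tendsto (fun n => 2 * (C : ℝ) * ε n) atTop (𝓝 0) := by simpa using hε.const_mul (2 * (C : ℝ))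
  have l3 : Tendsto (fun n => ∫ z in domain τfin, macroP (ε n) (u n) z *
      ((ψ (z.1, z.2 + ε n) - 2 * ψ z + ψ (z.1, z.2 - ε n)) / ε n ^ 2)) atTop
      (𝓝 (∫ z in domain τfin, P z * φ₂ z)) := by
    -- The difference quotient shifts the test function by up to E, hence the wider strip.
    refine tendsto_integral_macroP_mul h hε hlim hP (A := A + E) hψ₂.smooth.continuous hB₂
      (fun n => by fun_prop) hη (fun n z => ?_) (fun z hz => ?_) (fun n z hz => ?_)
    · have hp := (h n).ε_pos
      have hd := abs_second_difference_le (φ := fun x => ψ (z.1, x)) (φ₁ := fun x => φ₁ (z.1, x))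
        (φ₂ := fun x => φ₂ (z.1, x)) (C := C) (hψ.hasDerivAt_fderiv_snd z.1) (hψ₁.hasDerivAt_fderiv_snd z.1)
        (fun x y => by
          have := hC.dist_le_mul (z.1, x) (z.1, y)
          rw [Real.dist_eq] at this
          simpa [Prod.dist_eq, Real.dist_eq] using this) z.2 hp.le
      have e : (ψ (z.1, z.2 + ε n) - 2 * ψ z + ψ (z.1, z.2 - ε n)) / ε n ^ 2 - φ₂ z =
          (ψ (z.1, z.2 + ε n) - 2 * ψ (z.1, z.2) + ψ (z.1, z.2 - ε n) - ε n ^ 2 * φ₂ (z.1, z.2)) / ε n ^ 2 := by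
        field_simp
      rw [e, abs_div, abs_of_pos (by positivity : 0 < ε n ^ 2), div_le_iff₀ (by positivity)]
      exact hd.trans (le_of_eq (by ring))
    · exact hout ((tsupport_fderiv_apply_subset ℝ _).trans (tsupport_fderiv_apply_subset ℝ _)) z (by linarith)
    · have hp := (h n).ε_pos
      have hn := hE' n
      have b1 : A < |z.2 + ε n| := by
        have := abs_sub_abs_le_abs_sub z.2 (-ε n)
        rw [abs_neg, abs_of_pos hp, sub_neg_eq_add] at this
        linarith
      have b2 : A < |z.2 - ε n| := by
        have := abs_sub_abs_le_abs_sub z.2 (ε n)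
        rw [abs_of_pos hp] at this
        linarith
      rw [hout le_rfl (z.1, z.2 + ε n) b1, hout le_rfl (z.1, z.2 - ε n) b2, hout le_rfl z (by linarith)]
      simp
  have key := tendsto_nhds_unique (l1.add l2) (l3.neg.congr fun n => ((h n).integral_macroP_add_sgn hψ).symm)
  have i1 : IntegrableOn (fun z => P z * φt z) (domain τfin) := by
    have hτfin := (h 0).τfin_pos.le
    have hcont : Continuous fun z : ℝ × ℝ => P ((projIcc 0 τfin hτfin z.1 : ℝ), z.2) :=
      (continuousOn_P h hε hlim hP).comp_continuous (f := fun z : ℝ × ℝ => ((projIcc 0 τfin hτfin z.1 : ℝ), z.2))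
        (by fun_prop) fun z => ⟨(projIcc 0 τfin hτfin z.1).2, mem_univ _⟩
    refine IntegrableOn.congr_fun (f := fun z => P ((projIcc 0 τfin hτfin z.1 : ℝ), z.2) * φt z)
      ((hcont.mul hτ'.smooth.continuous).integrable_of_hasCompactSupport hτ'.compact.mul_left).integrableOn
      (fun z hz => ?_) (MacroSolution.measurableSet_domain τfin)
    simp only [projIcc_of_mem hτfin hz.1]
  simp_rw [add_mul]
  rw [integral_add i1 i2, key, neg_neg]

end Sequence


/-! ### The limit dynamics -/

namespace MacroSolution

variable {a β τfin ε : ℝ} {u : ℝ → LInf} {T : ℤ → EReal}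

theorem neg_one_le_macroP (h : MacroSolution a β τfin ε u T) {z : ℝ × ℝ} (hz : 0 ≤ z.1) : -1 ≤ macroP ε u z := by
  obtain ⟨n, hn, h1, h2⟩ := h.index hz
  have h1' : T (n + 1 - 1) ≤ ((z.1 / ε ^ 2 : ℝ) : EReal) := by simpa using h1
  have hs := h.sol.sign_le (k := n + 1) (by omega) (ne_top_of_le h1') h1' h2.le (cell ε z.2)
  rw [macroP, h.sol.dPhi_eq h.data.mem_stateSpace (k := n + 1) (by omega) h1' h2, branch]
  split_ifs with hj
  · linarith [hs.1 hj]
  · linarith [(hs.2 (not_lt.1 hj)).1]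

theorem macroP_le_one (h : MacroSolution a β τfin ε u T) {τ x : ℝ} (hτ : 0 ≤ τ)
    (hx : interface ε T τ < x - ε / 2) : macroP ε u (τ, x) ≤ 1 := by
  have hs := (h.sgn_apply_of_le hτ).2 hx
  rw [macroP, dPhi, hs]
  have : u (τ / ε ^ 2) (cell ε x) < 0 := by
    by_contra! hcon
    rw [sgn_of_nonneg hcon] at hs
    norm_num at hs
  linarith

/-- If the latest transition is younger than dε, it suffices to go back to dε before it, or to time
0. By separation all earlier transitions are then at least 3dε old. The new time is not later than
τ, so monotonicity of the interface can be used there. -/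
theorem exists_regular_time (h : MacroSolution a β τfin ε u T) {τ : ℝ} (hτ : τ ∈ Icc 0 τfin) :
    ∃ τ' ∈ Icc 0 τfin, τ' ≤ τ ∧ τ - τ' ≤ 2 * sepConst a * ε ∧ ∀ x, macroR₂ τfin (sepConst a) ε T (τ', x) = 0 := by
  have hd := h.d_pos
  have hε := h.ε_pos
  have hdε : 0 < sepConst a * ε := mul_pos hd hε
  by_cases hgood : ∀ k : ℤ, 1 ≤ k → T k ≠ ⊤ → macroTime ε T k ≤ τ → macroTime ε T k + sepConst a * ε ≤ τ
  · exact ⟨τ, hτ, le_rfl, by nlinarith, h.macroR₂_eq_zero hτ hgood⟩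
  push Not at hgood
  obtain ⟨n, hn, hnT, hnτ, hnd⟩ := hgood
  have hpos : 0 < macroTime ε T n := by
    have h1 := h.sol.pos n hn
    rw [← h.coe_macroTime (by omega) hnT] at h1
    have h2 : 0 < macroTime ε T n / ε ^ 2 := by exact_mod_cast h1
    exact (div_pos_iff_of_pos_right (by positivity)).1 h2
  have hlt : max (macroTime ε T n - sepConst a * ε) 0 < macroTime ε T n := max_lt (by linarith) hpos
  have hmem : max (macroTime ε T n - sepConst a * ε) 0 ∈ Icc 0 τfin :=
    ⟨le_max_right _ _, by linarith [hτ.2]⟩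
  refine ⟨_, hmem, by linarith, by linarith [le_max_left (macroTime ε T n - sepConst a * ε) 0],
    h.macroR₂_eq_zero hmem fun k hk hkT hkτ => ?_⟩
  have hkn : k < n := by
    by_contra! hcon
    have := h.separation_le hn hcon hkT
    have : (0 : ℝ) ≤ (k : ℝ) - n := sub_nonneg.2 (by exact_mod_cast hcon)
    nlinarith
  have h1 := h.separation_le hk hkn.le hnT
  have h2 : (1 : ℝ) ≤ (n : ℝ) - k := by
    have : (1 : ℤ) ≤ n - k := by omega
    exact_mod_cast this
  have h3 := le_max_left (macroTime ε T n - sepConst a * ε) 0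
  nlinarith

/-- At a transition the field is `1`, up to the singular contribution of the transition itself. -/
theorem macroQ_add_macroR₁_at_transition (h : MacroSolution a β τfin ε u T) {k : ℤ} (hk : 1 ≤ k) (hT : T k ≠ ⊤)
    (hle : macroTime ε T k ≤ τfin) :
    interface ε T (macroTime ε T k) = ε * k ∧
      macroQ ε u (macroTime ε T k, ε * k) + macroR₁ τfin (sepConst a) ε T (macroTime ε T k, ε * k) = 1 := by
  have hd := h.d_pos
  have hε := h.ε_pos
  have hcoe := h.coe_macroTime (by omega) hT
  have hlt : T k < T (k + 1) := by
      have := h.sol.T_lt (k := k + 1) (by omega) (by simpa using hT)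
      simpa using this
  have hT' : T (k - 1) ≠ ⊤ := fun h1 => hT (h.sol.eq_top hk h1)
  refine ⟨h.interface_eq (by omega) hcoe.ge (hcoe.trans_lt hlt), ?_⟩
  -- The splitting is used at the right end of the interval before the flip, where the affine branch
  -- gives p_k = 1 and the kernel of the flip itself is absent.
  have hb := h.sol.branch_eq h.data.mem_stateSpace (n := k - 1) (by omega) hT' (macroTime ε T k / ε ^ 2)
    (by rw [hcoe]; exact h.sol.T_mono (by omega) (by omega)) (by rw [hcoe, sub_add_cancel]) k
  rw [sub_add_cancel, branch, if_neg (lt_irrefl k), (h.sol.transition k hk _ hcoe.symm).1, zero_add] at hb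
  rw [h.macroR₁_eq_sum _ (by omega) hle hcoe.ge (hcoe.trans_lt hlt), macroQ, cell_mul hε, hb, sub_eq_add_neg, neg_mul]
  congr 2
  have hsub : Finset.Icc 1 (k - 1) ⊆ Finset.Icc 1 k := Finset.Icc_subset_Icc_right (by omega)
  rw [← Finset.sum_subset hsub]
  · congr 1
    refine Finset.sum_congr rfl fun l hl => ?_
    rw [Finset.mem_Icc] at hl
    have h1 := h.separation_le hl.1 (by omega) hT
    have h2 : (1 : ℝ) ≤ (k : ℝ) - l := by
      have : (1 : ℤ) ≤ k - l := by omega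
      exact_mod_cast this
    rw [regKernel_of_le hd hε (by nlinarith [mul_pos hd hε]), sub_div, macroTime, macroTime,
      mul_div_cancel_left₀ _ (by positivity), mul_div_cancel_left₀ _ (by positivity)]
  · intro l hl hl'
    rw [Finset.mem_Icc] at hl hl'
    obtain rfl : l = k := by omega
    rw [sub_self]
    exact regKernel_of_nonpos le_rfl _

theorem interface_eq_of_no_transition (h : MacroSolution a β τfin ε u T) {s t : ℝ} (hs : 0 ≤ s) (hst : s ≤ t)
    (hno : ∀ k : ℤ, 1 ≤ k → T k ≠ ⊤ → s < macroTime ε T k → t < macroTime ε T k) :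
    interface ε T s = interface ε T t := by
  obtain ⟨n, hn, h1, h2⟩ := h.index hs
  have h3 : T n ≤ ((t / ε ^ 2 : ℝ) : EReal) := h1.trans (by
    rw [EReal.coe_le_coe_iff]; have := h.ε_pos; gcongr)
  have h4 : ((t / ε ^ 2 : ℝ) : EReal) < T (n + 1) := by
    by_cases hT : T (n + 1) = ⊤
    · rw [hT]; exact EReal.coe_lt_top _
    · rw [h.lt_T_iff (by omega) hT] at h2 ⊢
      exact hno _ (by omega) hT h2
  rw [h.interface_eq hn h1 h2, h.interface_eq hn h3 h4]

end MacroSolution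

section Sequence

variable {a β τfin : ℝ} {ε : ℕ → ℝ} {u : ℕ → ℝ → LInf} {T : ℕ → ℤ → EReal}
variable {P Q R : ℝ × ℝ → ℝ} {ξ : ℝ → ℝ}

/-- Locally uniform convergence to a continuous limit allows evaluation along moving points, here
regular times and transition points. -/
theorem tendsto_macroQ_add_macroR₁ (h : ∀ n, MacroSolution a β τfin (ε n) (u n) (T n)) (hε : Tendsto ε atTop (𝓝 0))
    (hlim : IsLimit τfin (sepConst a) ε u T Q R ξ) (hP : ∀ z, P z = Q z + R z) {φ : ℕ → ℕ}
    (hφ : Tendsto φ atTop atTop) {z : ℕ → ℝ × ℝ} {w : ℝ × ℝ} (hz : ∀ n, z n ∈ domain τfin) (hw : w ∈ domain τfin)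
    (hzw : Tendsto z atTop (𝓝 w)) :
    Tendsto (fun n => macroQ (ε (φ n)) (u (φ n)) (z n) + macroR₁ τfin (sepConst a) (ε (φ n)) (T (φ n)) (z n)) atTop
      (𝓝 (P w)) := by
  have hzw' : Tendsto z atTop (𝓝[domain τfin] w) :=
    tendsto_nhdsWithin_iff.2 ⟨hzw, Eventually.of_forall hz⟩
  rw [hP]
  have h1 : TendstoLocallyUniformlyOn (fun n => macroQ (ε (φ n)) (u (φ n))) Q atTop (domain τfin) :=
    fun v hv x hx => let ⟨t, ht, h'⟩ := hlim.regular v hv x hx; ⟨t, ht, hφ.eventually h'⟩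
  have h2 : TendstoLocallyUniformlyOn (fun n => macroR₁ τfin (sepConst a) (ε (φ n)) (T (φ n))) R atTop (domain τfin) :=
    fun v hv x hx =>
      let ⟨t, ht, h'⟩ := hlim.singular.tendstoLocallyUniformlyOn v hv x hx; ⟨t, ht, hφ.eventually h'⟩
  exact (h1.tendsto_comp (continuousOn_Q h hε hlim w hw) hw hzw').add
    (h2.tendsto_comp (continuousOn_R h hε hlim w hw) hw hzw')

/-- At times without remainder the field equals Q_ε + R_{1,ε}, so it converges pointwise and can
carry inequalities to the limit. -/
theorem exists_tendsto_macroP (h : ∀ n, MacroSolution a β τfin (ε n) (u n) (T n)) (hε : Tendsto ε atTop (𝓝 0))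
    (hlim : IsLimit τfin (sepConst a) ε u T Q R ξ) (hP : ∀ z, P z = Q z + R z) {τ : ℝ} (hτ : τ ∈ Icc 0 τfin) :
    ∃ σ : ℕ → ℝ, (∀ n, σ n ∈ Icc 0 τfin ∧ σ n ≤ τ) ∧
      ∀ x, Tendsto (fun n => macroP (ε n) (u n) (σ n, x)) atTop (𝓝 (P (τ, x))) := by
  choose σ h1 h2 h3 h4 using fun n => (h n).exists_regular_time hτ
  refine ⟨σ, fun n => ⟨h1 n, h2 n⟩, fun x => ?_⟩
  have hσ : Tendsto σ atTop (𝓝 τ) := by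
    rw [tendsto_iff_dist_tendsto_zero]
    have h5 : Tendsto (fun n => 2 * sepConst a * ε n) atTop (𝓝 0) := by simpa using hε.const_mul (2 * sepConst a)
    refine squeeze_zero (fun _ => dist_nonneg) (fun n => ?_) h5
    rw [dist_comm, Real.dist_eq, abs_of_nonneg (sub_nonneg.2 (h2 n))]
    exact h3 n
  have key := tendsto_macroQ_add_macroR₁ h hε hlim hP tendsto_id (z := fun n => (σ n, x)) (w := (τ, x))
    (fun n => ⟨h1 n, mem_univ _⟩) ⟨hτ, mem_univ _⟩ (hσ.prodMk_nhds tendsto_const_nhds)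
  refine key.congr fun n => ?_
  have h5 := (h n).macroP_eq_add (z := (σ n, x)) (h1 n).1
  have h6 := h4 n x
  rw [macroR₂, sub_eq_zero] at h6
  rw [h5, h6]
  rfl

theorem neg_one_le_P (h : ∀ n, MacroSolution a β τfin (ε n) (u n) (T n)) (hε : Tendsto ε atTop (𝓝 0))
    (hlim : IsLimit τfin (sepConst a) ε u T Q R ξ) (hP : ∀ z, P z = Q z + R z) {τ : ℝ} (hτ : τ ∈ Icc 0 τfin) (x : ℝ) :
    -1 ≤ P (τ, x) := by
  obtain ⟨σ, h1, h2⟩ := exists_tendsto_macroP h hε hlim hP hτ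
  exact ge_of_tendsto' (h2 x) fun n => (h n).neg_one_le_macroP (h1 n).1.1

/-- Strictly ahead of the limit interface the approximate sites are in the negative phase, where p ≤
1. The interface point itself follows by continuity of P from the right. -/
theorem P_le_one (h : ∀ n, MacroSolution a β τfin (ε n) (u n) (T n)) (hε : Tendsto ε atTop (𝓝 0))
    (hlim : IsLimit τfin (sepConst a) ε u T Q R ξ) (hP : ∀ z, P z = Q z + R z) {τ : ℝ} (hτ : τ ∈ Icc 0 τfin) {x : ℝ}
    (hx : ξ τ ≤ x) : P (τ, x) ≤ 1 := by
  have hgt : ∀ y, ξ τ < y → P (τ, y) ≤ 1 := by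
    intro y hy
    obtain ⟨σ, h1, h2⟩ := exists_tendsto_macroP h hε hlim hP hτ
    refine le_of_tendsto (h2 y) ?_
    have h3 : Tendsto (fun n => y - ε n / 2) atTop (𝓝 (y - 0 / 2)) := (hε.div_const 2).const_sub _
    rw [zero_div, sub_zero] at h3
    filter_upwards [(hlim.interface.tendsto_at hτ).eventually_lt h3 hy] with n hn
    exact (h n).macroP_le_one (h1 n).1.1 ((((h n).interface_mono_lip (h1 n).1.1 (h1 n).2).1).trans_lt hn)
  have hc : Continuous fun y => P (τ, y) := by
    rw [← continuousOn_univ]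
    exact (continuousOn_P h hε hlim hP).comp (by fun_prop) fun _ _ => ⟨hτ, mem_univ _⟩
  refine le_of_tendsto ((hc.tendsto x).mono_left (nhdsWithin_le_nhds (s := Ioi x))) ?_
  filter_upwards [self_mem_nhdsWithin] with y hy
  exact hgt y (hx.trans_lt hy)

theorem continuousOn_ξ (h : ∀ n, MacroSolution a β τfin (ε n) (u n) (T n)) (hε : Tendsto ε atTop (𝓝 0))
    (hlim : IsLimit τfin (sepConst a) ε u T Q R ξ) : ContinuousOn ξ (Icc 0 τfin) := by
  have hd := (h 0).d_pos
  exact (LipschitzOnWith.of_dist_le_mul (K := Real.toNNReal (1 / (4 * sepConst a))) fun x hx y hy => by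
    rw [Real.coe_toNNReal _ (by positivity), Real.dist_eq, Real.dist_eq]
    exact (abs_ξ_sub_le h hε hlim hx hy).trans (le_of_eq (by ring))).continuousOn

/-- Away from the value `1` the interface is pinned. -/
theorem exists_no_transition (h : ∀ n, MacroSolution a β τfin (ε n) (u n) (T n)) (hε : Tendsto ε atTop (𝓝 0))
    (hlim : IsLimit τfin (sepConst a) ε u T Q R ξ) (hP : ∀ z, P z = Q z + R z) {τ : ℝ} (hτ : τ ∈ Icc 0 τfin)
    (hne : P (τ, ξ τ) ≠ 1) :
    ∃ δ > 0, ∀ᶠ n in atTop, ∀ k : ℤ, 1 ≤ k → T n k ≠ ⊤ → macroTime (ε n) (T n) k ≤ τfin →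
      δ ≤ |macroTime (ε n) (T n) k - τ| := by
  -- Otherwise there are transitions at times tending to τ along a subsequence. Their positions tend
  -- to ξ(τ), and the exact value 1 of Q_ε + R_{1,ε} at them passes to P(τ, ξ(τ)).
  by_contra! hcon
  have hex (m : ℕ) : ∃ n ≥ m, ∃ k : ℤ, 1 ≤ k ∧ T n k ≠ ⊤ ∧ macroTime (ε n) (T n) k ≤ τfin ∧
      |macroTime (ε n) (T n) k - τ| < 1 / ((m : ℝ) + 1) := by
    have h1 := hcon (1 / ((m : ℝ) + 1)) Nat.one_div_pos_of_nat
    obtain ⟨n, hn, h2⟩ := frequently_atTop.1 h1 m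
    exact ⟨n, hn, h2⟩
  choose φ hφ k hk hkT hkle hkδ using hex
  have hφ' : Tendsto φ atTop atTop := tendsto_atTop_mono hφ tendsto_id
  set σ : ℕ → ℝ := fun m => macroTime (ε (φ m)) (T (φ m)) (k m) with hσdef
  have hσmem (m : ℕ) : σ m ∈ Icc 0 τfin := ⟨(h (φ m)).macroTime_nonneg (by linarith [hk m]), hkle m⟩
  have hσ : Tendsto σ atTop (𝓝 τ) := by
    rw [tendsto_iff_dist_tendsto_zero]
    exact squeeze_zero (fun _ => dist_nonneg) (fun m => (hkδ m).le) tendsto_one_div_add_atTop_nhds_zero_nat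
  have hσ' : Tendsto σ atTop (𝓝[Icc 0 τfin] τ) := tendsto_nhdsWithin_iff.2 ⟨hσ, Eventually.of_forall hσmem⟩
  have hI : Tendsto (fun m => interface (ε (φ m)) (T (φ m)) (σ m)) atTop (𝓝 (ξ τ)) := by
    have h1 : TendstoLocallyUniformlyOn (fun m => interface (ε (φ m)) (T (φ m))) ξ atTop (Icc 0 τfin) :=
      fun v hv x hx =>
        let ⟨t, ht, h'⟩ := hlim.interface.tendstoLocallyUniformlyOn v hv x hx; ⟨t, ht, hφ'.eventually h'⟩
    exact h1.tendsto_comp (continuousOn_ξ h hε hlim τ hτ) hτ hσ'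
  have hI' : Tendsto (fun m => ε (φ m) * (k m : ℝ)) atTop (𝓝 (ξ τ)) :=
    hI.congr fun m => ((h (φ m)).macroQ_add_macroR₁_at_transition (hk m) (hkT m) (hkle m)).1
  have key := tendsto_macroQ_add_macroR₁ h hε hlim hP hφ' (z := fun m => (σ m, ε (φ m) * (k m : ℝ))) (w := (τ, ξ τ))
    (fun m => ⟨hσmem m, mem_univ _⟩) ⟨hτ, mem_univ _⟩ (hσ.prodMk_nhds hI')
  refine hne (tendsto_nhds_unique key ?_)
  refine tendsto_const_nhds.congr fun m => ?_
  exact ((h (φ m)).macroQ_add_macroR₁_at_transition (hk m) (hkT m) (hkle m)).2.symm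

theorem hasDerivWithinAt_zero_ξ (h : ∀ n, MacroSolution a β τfin (ε n) (u n) (T n)) (hε : Tendsto ε atTop (𝓝 0))
    (hlim : IsLimit τfin (sepConst a) ε u T Q R ξ) (hP : ∀ z, P z = Q z + R z) {τ : ℝ} (hτ : τ ∈ Icc 0 τfin)
    (hne : P (τ, ξ τ) ≠ 1) : HasDerivWithinAt ξ 0 (Icc 0 τfin) τ := by
  obtain ⟨δ, hδ, hev⟩ := exists_no_transition h hε hlim hP hτ hne
  -- Without transitions near τ the approximate interfaces are constant there for all large n, and
  -- so is their limit.
  have hloc : ∀ s ∈ Icc 0 τfin, |s - τ| < δ → ξ s = ξ τ := by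
    intro s hs hsτ
    refine tendsto_nhds_unique (hlim.interface.tendsto_at hs) ((hlim.interface.tendsto_at hτ).congr' ?_)
    filter_upwards [hev] with n hn
    rw [abs_lt] at hsτ
    rcases le_total s τ with hle | hle
    · refine ((h n).interface_eq_of_no_transition hs.1 hle fun k hk hkT hlt => ?_).symm
      by_contra! hcon
      have := hn k hk hkT (hcon.trans hτ.2)
      rw [abs_of_nonpos (by linarith)] at this
      linarith
    · refine (h n).interface_eq_of_no_transition hτ.1 hle fun k hk hkT hlt => ?_
      by_contra! hcon
      have := hn k hk hkT (hcon.trans hs.2)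
      rw [abs_of_nonneg (by linarith)] at this
      linarith
  refine (hasDerivWithinAt_const τ (Icc 0 τfin) (ξ τ)).congr_of_eventuallyEq ?_ rfl
  filter_upwards [self_mem_nhdsWithin, mem_nhdsWithin_of_mem_nhds (Metric.ball_mem_nhds τ hδ)] with s hs hs'
  exact hloc s hs (by rwa [Metric.mem_ball, Real.dist_eq] at hs')

theorem ae_hasDerivAt_of_monotoneOn {f : ℝ → ℝ} {b : ℝ} (hf : MonotoneOn f (Icc 0 b)) :
    ∀ᵐ τ ∂(volume.restrict (Icc 0 b)), ∃ v ≥ 0, HasDerivAt f v τ := by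
  have h0 : ∀ᵐ τ : ℝ, τ ∉ ({0, b} : Set ℝ) := measure_eq_zero_iff_ae_notMem.1 ((toFinite _).measure_zero _)
  filter_upwards [hf.ae_differentiableWithinAt measurableSet_Icc, ae_restrict_mem measurableSet_Icc,
    ae_restrict_of_ae h0] with τ hd hmem hne
  rw [mem_insert_iff, mem_singleton_iff, not_or] at hne
  have hn : Icc 0 b ∈ 𝓝 τ := Icc_mem_nhds (hmem.1.lt_of_ne' hne.1) (hmem.2.lt_of_ne hne.2)
  exact ⟨derivWithin f (Icc 0 b) τ, hf.derivWithin_nonneg, hd.hasDerivWithinAt.hasDerivAt hn⟩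

theorem limitDynamics (h : ∀ n, MacroSolution a β τfin (ε n) (u n) (T n)) (hε : Tendsto ε atTop (𝓝 0))
    (hlim : IsLimit τfin (sepConst a) ε u T Q R ξ) (hP : ∀ z, P z = Q z + R z) : LimitDynamics τfin P ξ where
  equation := isDistributionalSolution_P h hε hlim hP
  initial_P := by
    have hτfin := (h 0).τfin_pos
    set W := weightBound (sepConst a) τfin
    have hc : Tendsto (fun τ : ℝ => a * √(2 * τ) + 12 * W * |τ| ^ (1 / 4 : ℝ)) (𝓝[>] 0) (𝓝 0) := by
      have h1 : Continuous fun τ : ℝ => a * √(2 * τ) + 12 * W * |τ| ^ (1 / 4 : ℝ) := by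
        have : Continuous fun τ : ℝ => |τ| ^ (1 / 4 : ℝ) := continuous_abs.rpow_const fun _ => Or.inr (by norm_num)
        fun_prop
      have h2 := (h1.tendsto 0).mono_left (nhdsWithin_le_nhds (s := Ioi 0))
      simpa using h2
    rw [Metric.tendstoUniformly_iff]
    intro η hη
    filter_upwards [hc.eventually_lt_const hη, Ioo_mem_nhdsGT hτfin] with τ h1 h2 x
    have m0 : ((0, x) : ℝ × ℝ) ∈ domain τfin := ⟨⟨le_rfl, hτfin.le⟩, mem_univ _⟩
    have m1 : ((τ, x) : ℝ × ℝ) ∈ domain τfin := ⟨⟨h2.1.le, h2.2.le⟩, mem_univ _⟩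
    have q := abs_Q_sub_le h hε hlim m1 m0
    have r := abs_R_sub_le h hε hlim m1 m0
    simp only [sub_self, abs_zero, mul_zero, sub_zero, zero_add, Real.sqrt_zero, add_zero] at q r
    rw [abs_of_pos h2.1] at q
    rw [dist_comm, Real.dist_eq, hP, hP, add_sub_add_comm]
    exact (abs_add_le _ _).trans_lt (by linarith)
  initial_ξ := by
    have hτfin := (h 0).τfin_pos
    have h1 := continuousOn_ξ h hε hlim 0 ⟨le_rfl, hτfin.le⟩
    exact h1.tendsto.mono_left (nhdsWithin_le_of_mem (mem_of_superset (Ioo_mem_nhdsGT hτfin) Ioo_subset_Icc_self))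
  lower τ hτ x := neg_one_le_P h hε hlim hP hτ x
  upper τ hτ x hx := P_le_one h hε hlim hP hτ hx
  on_interface τ hτ := ⟨neg_one_le_P h hε hlim hP hτ _, P_le_one h hε hlim hP hτ le_rfl⟩
  monotone := monotoneOn_ξ h hlim
  speed_nonneg := ae_hasDerivAt_of_monotoneOn (monotoneOn_ξ h hlim)
  speed_zero τ hτ hne := hasDerivWithinAt_zero_ξ h hε hlim hP hτ hne

end Sequence

end DiffusionLattice

/-! ### Assembly of the theorem. -/

theorem mainTheorem2 (α β τfin : ℝ) (hτ : 0 < τfin) :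
    ∃ d > 0, ∃ εmax : ℝ, 0 < εmax ∧ εmax ≤ 1 ∧
      -- bounds for the number of and the time between phase transitions
      (∀ (ε : ℝ) (u : ℝ → LInf) (T : ℤ → EReal), 0 < ε → ε ≤ εmax →
        IsSingleInterfaceSolution 1 u T → IsMacroscopicData α β ε (u 0) →
        (transitions τfin ε T).Finite ∧
        ((transitions τfin ε T).ncard : ℝ) ≤ τfin / (2 * d * ε) ∧
        ∀ k ∈ transitions τfin ε T, T k + ((2 * d / ε : ℝ) : EReal) ≤ T (k + 1)) ∧
      ∀ (ε : ℕ → ℝ) (u : ℕ → ℝ → LInf) (T : ℕ → ℤ → EReal),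
        (∀ n, 0 < ε n) → Tendsto ε atTop (𝓝 0) →
        (∀ n, IsSingleInterfaceSolution 1 (u n) (T n)) →
        (∀ n, IsMacroscopicData α β (ε n) (u n 0)) →
        -- decomposition into regular and singular part
        (∀ n, ∀ z ∈ domain τfin,
          macroP (ε n) (u n) z = macroQ (ε n) (u n) z + macroR (ε n) (T n) z) ∧
        -- compactness
        (∃ φ : ℕ → ℕ, StrictMono φ ∧ ∃ (Q R : ℝ × ℝ → ℝ) (ξ : ℝ → ℝ),
          IsLimit τfin d (ε ∘ φ) (u ∘ φ) (T ∘ φ) Q R ξ) ∧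
        -- characterization of every limit
        ((∃ M : ℝ, ∀ n, ∀ j : ℤ, |dPhi (u n 0 j)| ≤ M) →
          ∀ (P Q R : ℝ × ℝ → ℝ) (ξ : ℝ → ℝ), IsLimit τfin d ε u T Q R ξ →
            (∀ z, P z = Q z + R z) →
            (TendstoUniformly (fun n x => macroP (ε n) (u n) (0, x)) (fun x => P (0, x)) atTop ↔
              TendstoUniformlyOn (fun n => macroQ (ε n) (u n)) Q atTop (domain τfin)) ∧
            (∀ s : ℝ≥0∞, 1 ≤ s → s < ⊤ →
              Tendsto (fun n => eLpNorm (macroR₂ τfin d (ε n) (T n)) s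
                (volume.restrict (domain τfin))) atTop (𝓝 0) ∧
              ∀ K ⊆ domain τfin, IsCompact K →
                Tendsto (fun n => eLpNorm (fun z => macroP (ε n) (u n) z - P z) s
                  (volume.restrict K)) atTop (𝓝 0)) ∧
            LimitRegularity τfin P Q R ξ ∧
            IsHeatSolution τfin (fun x => P (0, x)) Q ∧
            LimitDynamics τfin P ξ) := by
  -- Enlarging α makes it positive, so that the separation constant makes sense for every given α.
  set a := max α 1
  have hd : 0 < sepConst a := sepConst_pos (lt_of_lt_of_le one_pos (le_max_right _ _))
  have key : ∀ (ε : ℝ) (u : ℝ → LInf) (T : ℤ → EReal), 0 < ε → IsSingleInterfaceSolution 1 u T →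
      IsMacroscopicData α β ε (u 0) → MacroSolution a β τfin ε u T := fun ε u T hε hsol hdata =>
    { a_pos := lt_of_lt_of_le one_pos (le_max_right _ _)
      ε_pos := hε
      τfin_pos := hτ
      sol := hsol
      data := hdata.mono hε (le_max_left _ _) }
  -- The second bound on ε turns εK ≤ ε + τfin/(4d) into εK ≤ τfin/(2d), absorbing the contribution
  -- of the first transition.
  refine ⟨sepConst a, hd, min 1 (τfin / (4 * sepConst a)), lt_min one_pos (by positivity), min_le_left _ _, ?_, ?_⟩
  · intro ε u T hε hε' hsol hdata
    have h := key ε u T hε hsol hdata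
    refine ⟨h.finite_transitions, ?_, fun k hk => ?_⟩
    · rw [Set.ncard_eq_toFinset_card _ h.finite_transitions]
      have h1 := h.mul_card_le
      have h2 := hε'.trans (min_le_right _ _)
      rw [MacroSolution.trans] at h1
      have h3 : τfin / (2 * sepConst a * ε) = (τfin / (4 * sepConst a) + τfin / (4 * sepConst a)) / ε := by
        field_simp
        norm_num
      rw [h3, le_div_iff₀ hε]
      linarith
    · by_cases hT : T (k + 1) = ⊤
      · rw [hT]
        exact le_top
      have hk1 : 1 ≤ k := hk.1
      have hTk : T k ≠ ⊤ := ne_top_of_le_ne_top hT (h.sol.T_mono (by omega) (by omega))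
      have h1 := h.separation_succ hk1 hT
      rw [← h.sol.coe_toReal (by omega) hT, ← h.sol.coe_toReal (by omega) hTk, ← EReal.coe_add, EReal.coe_le_coe_iff]
      rw [macroTime, macroTime] at h1
      have h2 : ε * (4 * sepConst a) ≤ ε * (ε * ((T (k + 1)).toReal - (T k).toReal)) := by linarith
      have h3 := le_of_mul_le_mul_left h2 hε
      have h4 : 2 * sepConst a / ε ≤ (T (k + 1)).toReal - (T k).toReal := by
        rw [div_le_iff₀ hε]
        linarith
      linarith
  · intro ε u T hε0 hε hsol hdata
    have h := fun n => key (ε n) (u n) (T n) (hε0 n) (hsol n) (hdata n)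
    refine ⟨fun n z hz => (h n).macroP_eq_add hz.1.1, exists_isLimit h hε, ?_⟩
    rintro ⟨M, hM⟩ P Q R ξ hlim hP
    exact ⟨tendstoUniformly_macroP_zero_iff h hε hlim hP hM,
      fun s hs1 hs => ⟨tendsto_eLpNorm_macroR₂ h hε hs1 hs,
        fun K hK hKc => tendsto_eLpNorm_macroP_sub h hε hlim hP hs1 hs hK hKc⟩,
      limitRegularity h hε hlim hP hM, isHeatSolution_Q h hε hlim hP hM, limitDynamics h hε hlim hP⟩
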